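/- Let $A$ be a finite alphabet and let $X\subseteq A^{\mathbb Z}$ be a subshift (closed and shift-invariant) with language $L(X)$. A word $w\in L(X)$ is *synchronizing* if for all $u,v\in L(X)$, $uw,wv\in L(X)$ implies $uwv\in L(X)$; $X$ is *synchronizing* if it is transitive (for all $u,v\in L(X)$ there is $w\in L(X)$ with $uwv\in L(X)$) and $L(X)$ contains a synchronizing word. $\mathrm{Aut}(X)$ is the group of bijective cellular automata (bijective maps given by a local rule) $X\to X$, $\sigma$ is the shift, $C(S)$ is the centralizer of $S$ in $\mathrm{Aut}(X)$, and $k(X)\in\mathbb N\cup\{\infty,\bot\}$ is the minimal cardinality of a set $S\subseteq\mathrm{Aut}(X)$ with $C(S)=\langle\sigma\rangle$ if such a set exists, and $\bot$ otherwise. A *marker pair* of $X$ is a pair of words $\mathbf 0,\mathbf 1\in L(X)$, $p=|\mathbf 0|\ge 1$, $q=|\mathbf 1|\ge 2$, $K=\gcd(p,q)$, such that: $\mathbf 0^{\mathbb Z}\in X$; $\mathbf 0$ is synchronizing, its symbols are distinct, each but the last has a unique successor and each but the first a unique predecessor in $X$; no symbol of $\mathbf 0$ occurs in $\mathbf 1$;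 $\mathbf 0\mathbf 1^*\mathbf 0\subseteq L(X)$; $q\equiv K \pmod p$; and $K$ divides $|w|$ whenever $w,\mathbf 0w\mathbf 0\in L(X)$. Given a marker pair, put $\ell=\mathbf 0^q\mathbf 1$, $r=\mathbf 1^{p+1}$ (the gliders), and let $n>|\mathbf 1^{p+1+p/K}|$. The maps below replace all occurrences of the indicated words simultaneously and change nothing else. $P_1$ exchanges $\mathbf 0(\mathbf 0^q\mathbf 1)\mathbf 0$ and $\mathbf 0(\mathbf 1^{p+1})\mathbf 0$. $P_2$ exchanges $\mathbf 0(\mathbf 1^{p+1})\mathbf 0$ and $\mathbf 0(\mathbf 1\mathbf 0^q)\mathbf 0$. For $1\le j\le p/K$ let $u'_j=\mathbf 1\mathbf 0^q\mathbf 1^j$ and let $u'_{j,1},\dots,u'_{j,n_j}=\mathbf 1^{p+1+j}$ be an enumeration of the nonempty words $w$ with $w,\mathbf 0w\mathbf 0\in L(X)$, $|w|\le n-1$, without symbols of $\mathbf 0$, and with $|w|\equiv (j+1)K\pmod p$, where for $j=p/K$ the words $\mathbf 1$ and $\mathbf 1^{p+1}$ are left out; choose $c_j,c_{j,i}\ge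 q+1$ such that $u_j=\mathbf 0^{c_j}u'_j$ and $u_{j,i}=\mathbf 0^{c_{j,i}}u'_{j,i}$ all have the same length for fixed $j$. $P_{4,n}$ replaces cyclically $u_j\mathbf 0\to u_{j,1}\mathbf 0\to\cdots\to u_{j,n_j}\mathbf 0\to u_j\mathbf 0$ for every $j$. The *glider CA* is $G_{X,n}=P_{4,n}\circ P_2\circ P_1$. Finally $F=F_2\circ F_1$, where $F_1$ exchanges $\mathbf 0 r\mathbf 0\mathbf 0\mathbf 0\ell\mathbf 0$ and $\mathbf 0 r\mathbf 0\mathbf 0\ell\mathbf 0\mathbf 0$, and $F_2$ exchanges $\mathbf 0 r\mathbf 0\mathbf 0\ell\mathbf 0$ and $\mathbf 0\mathbf 0 r\mathbf 0\ell\mathbf 0$. **Theorem.** Let $X$ be a synchronizing subshift. 1. $k(X)\ne\bot$. 2. If $X$ is infinite, then $X$ is conjugate to a subshift that has a marker pair. 3. If $X$ is infinite and $(\mathbf 0,\mathbf 1)$ is any marker pair of $X$, then $F$ is a well-defined automorphism of $X$; for every $n>|\mathbf 1^{p+1+p/K}|$ choices of enumerations and paddings as above exist, and every such choice gives a well-defined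 automorphism $G_{X,n}$; and, for any such choices made for each $n$, $$C\bigl(\langle\{G_{X,n}\mid n>|\mathbf 1^{p+1+p/K}|\}\cup\{F\}\rangle\bigr)=\langle\sigma\rangle .$$ -/

import Mathlib

namespace SynchShift

open SymbolicDynamics.FullShift

/-! ## Words, languages, synchronizing subshifts -/

section Words

variable {A : Type*}

/-- The word `w` occurs in the configuration `x` at position `i`. -/
def OccursAt (x : ℤ → A) (w : List A) (i : ℤ) : Prop :=
  ∀ (k : ℕ) (hk : k < w.length), x (i + k) = w[k]

/-- The `n`-fold power of a word. -/
def wpow (w : List A) (n : ℕ) : List A := (List.replicate n w).flatten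

variable [TopologicalSpace A]

/-- The language of a subshift: all subwords of its configurations. -/
def language (X : Subshift A ℤ) : Set (List A) :=
  {w | ∃ x ∈ X.carrier, ∃ i : ℤ, OccursAt x w i}

def IsTransitive (X : Subshift A ℤ) : Prop :=
  ∀ u ∈ language X, ∀ v ∈ language X, ∃ w ∈ language X, u ++ w ++ v ∈ language X

/-- `w` is a synchronizing word of `X`. -/
def IsSynchronizingWord (X : Subshift A ℤ) (w : List A) : Prop :=
  w ∈ language X ∧ ∀ u ∈ language X, ∀ v ∈ language X,
    u ++ w ∈ language X → w ++ v ∈ language X → u ++ w ++ v ∈ language X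

def IsSynchronizing (X : Subshift A ℤ) : Prop :=
  IsTransitive X ∧ ∃ w, IsSynchronizingWord X w

/-- A word `w = w₁ ⋯ wₙ` is deterministic in `X`: each of `w₁, …, wₙ₋₁` has a unique successor and
each of `w₂, …, wₙ` has a unique predecessor. -/
def IsDeterministicWord (X : Subshift A ℤ) (w : List A) : Prop :=
  (∀ (i : ℕ) (hi : i + 1 < w.length), ∃! a : A, [w[i], a] ∈ language X) ∧
  (∀ (i : ℕ) (hi : i + 1 < w.length), ∃! a : A, [a, w[i + 1]] ∈ language X)

end Words

/-! ## Morphisms and the automorphism group -/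

section Morphisms

variable {A B : Type*} [TopologicalSpace A] [TopologicalSpace B]

/-- Morphisms of subshifts: maps given by a local rule with memory `m` and anticipation `a`. -/
def IsMorphism (X : Subshift A ℤ) (Y : Subshift B ℤ) (F : X.carrier → Y.carrier) : Prop :=
  ∃ (m a : ℤ) (_ : m ≤ a) (f : (Fin (a - m + 1).toNat → A) → B),
    ∀ (x : X.carrier) (i : ℤ), (F x).1 i = f (fun k => x.1 (i + m + ((k : ℕ) : ℤ)))

/-- Two subshifts are conjugate if there is a bijective morphism between them. -/
def Conjugate (X : Subshift A ℤ) (Y : Subshift B ℤ) : Prop :=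
  ∃ F : X.carrier → Y.carrier, IsMorphism X Y F ∧ Function.Bijective F

/-- The shift by `g` on `X`, as a permutation of `X`. -/
def shiftPerm (X : Subshift A ℤ) (g : ℤ) : Equiv.Perm X.carrier where
  toFun x := ⟨shift g x.1, X.mapsTo g x.2⟩
  invFun x := ⟨shift (-g) x.1, X.mapsTo (-g) x.2⟩
  left_inv x := by ext i; simp
  right_inv x := by ext i; simp

theorem IsMorphism.locality {X : Subshift A ℤ} {Y : Subshift B ℤ} {F : X.carrier → Y.carrier}
    (h : IsMorphism X Y F) : ∃ r : ℕ, ∀ (x y : X.carrier) (i j : ℤ),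
      (∀ k : ℤ, |k| ≤ r → x.1 (i + k) = y.1 (j + k)) → (F x).1 i = (F y).1 j := by
  obtain ⟨m, a, hma, f, hf⟩ := h
  refine ⟨(|m| + |a|).toNat, fun x y i j hxy => ?_⟩
  rw [hf, hf]
  congr 1
  funext k
  have hk := k.2
  have := hxy (m + (k : ℕ)) (by
    rw [Int.toNat_of_nonneg (by positivity)]
    rw [abs_le]
    have h1 := neg_abs_le m
    have h2 := le_abs_self a
    have h3 := abs_nonneg m
    have h4 := abs_nonneg a
    constructor <;> omega)
  simpa [add_assoc] using this

theorem IsMorphism.of_locality {X : Subshift A ℤ} {F : X.carrier → X.carrier} (r : ℕ)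
    (h : ∀ (x y : X.carrier) (i j : ℤ),
      (∀ k : ℤ, |k| ≤ r → x.1 (i + k) = y.1 (j + k)) → (F x).1 i = (F y).1 j) :
    IsMorphism X X F := by
  classical
  refine ⟨-r, r, by omega, fun w => if hw : ∃ (x : X.carrier) (i : ℤ),
    w = fun k : Fin ((r : ℤ) - -(r : ℤ) + 1).toNat => x.1 (i + -r + ((k : ℕ) : ℤ)) then
      (F hw.choose).1 hw.choose_spec.choose
    else w ⟨0, by omega⟩, fun x i => ?_⟩
  have hw : ∃ (y : X.carrier) (j : ℤ), (fun k : Fin ((r : ℤ) - -r + 1).toNat =>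
      x.1 (i + -r + ((k : ℕ) : ℤ))) =
      fun k : Fin ((r : ℤ) - -(r : ℤ) + 1).toNat => y.1 (j + -r + ((k : ℕ) : ℤ)) := ⟨x, i, rfl⟩
  beta_reduce
  rw [dif_pos hw]
  apply h
  intro k hk
  rw [abs_le] at hk
  have := congrFun hw.choose_spec.choose_spec ⟨(k + r).toNat, by omega⟩
  simp only [Int.toNat_of_nonneg (show 0 ≤ k + r by omega)] at this
  convert this using 2 <;> ring

theorem IsMorphism.comp_self {X : Subshift A ℤ} {F G : X.carrier → X.carrier}
    (hF : IsMorphism X X F) (hG : IsMorphism X X G) : IsMorphism X X (F ∘ G) := by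
  obtain ⟨r, hr⟩ := hF.locality
  obtain ⟨s, hs⟩ := hG.locality
  refine IsMorphism.of_locality (r + s) fun x y i j h => hr _ _ _ _ fun k hk => hs _ _ _ _ ?_
  intro l hl
  have := h (k + l) (by push_cast; exact (abs_add_le k l).trans (add_le_add hk hl))
  simpa [add_assoc] using this

theorem IsMorphism.continuous [DiscreteTopology A] {X : Subshift A ℤ} {F : X.carrier → X.carrier}
    (h : IsMorphism X X F) : Continuous F := by
  obtain ⟨m, a, _, f, hf⟩ := h
  refine Continuous.subtype_mk (f := fun x => (F x).1) (continuous_pi fun i => ?_) _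
  simp only [hf]
  refine Continuous.comp (g := f) ?_ ?_
  · exact continuous_of_discreteTopology
  · exact continuous_pi fun k => (continuous_apply _).comp continuous_subtype_val

theorem IsMorphism.perm_inv [DiscreteTopology A] [Finite A] {X : Subshift A ℤ}
    {F : Equiv.Perm X.carrier} (h : IsMorphism X X F) : IsMorphism X X (F⁻¹ : Equiv.Perm _) := by
  have hc : Continuous F := h.continuous
  have hX : CompactSpace X.carrier := isCompact_iff_compactSpace.mp X.isClosed.isCompact
  let D : ℕ → Set (X.carrier × X.carrier) := fun r =>
    {p | (∀ k : ℤ, |k| ≤ r → (F p.1).1 k = (F p.2).1 k) ∧ p.1.1 0 ≠ p.2.1 0}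
  have hcoord : ∀ k : ℤ, Continuous fun x : X.carrier => x.1 k := fun k =>
    (continuous_apply k).comp continuous_subtype_val
  have hDc : ∀ r, IsClosed (D r) := by
    intro r
    have : D r = (⋂ (k : ℤ) (_ : |k| ≤ r), {p | (F p.1).1 k = (F p.2).1 k}) ∩
        {p | p.1.1 0 ≠ p.2.1 0} := by
      ext p; simp [D]
    rw [this]
    refine IsClosed.inter (isClosed_iInter fun k => isClosed_iInter fun _ => ?_) ?_
    · exact isClosed_eq ((hcoord k).comp (hc.comp continuous_fst))
        ((hcoord k).comp (hc.comp continuous_snd))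
    · exact (isClosed_discrete {q : A × A | q.1 ≠ q.2}).preimage
        (((hcoord 0).comp continuous_fst).prodMk ((hcoord 0).comp continuous_snd))
  have hex : ∃ r, D r = ∅ := by
    by_contra! hne
    obtain ⟨p, hp⟩ := IsCompact.nonempty_iInter_of_sequence_nonempty_isCompact_isClosed D
      (fun r p hp => ⟨fun k hk => hp.1 k (hk.trans (by simp)), hp.2⟩) hne
      (hDc 0).isCompact hDc
    rw [Set.mem_iInter] at hp
    have : F p.1 = F p.2 := by
      ext k
      exact (hp k.natAbs).1 k (by simp)
    exact (hp 0).2 (by rw [F.injective this])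
  obtain ⟨r, hr⟩ := hex
  obtain ⟨s, hs⟩ := h.locality
  have hshift : ∀ (x : X.carrier) (i : ℤ), F (shiftPerm X i x) = shiftPerm X i (F x) := by
    intro x i
    ext k
    exact hs _ _ k (i + k) fun l _ => by simp [shiftPerm, add_assoc]
  refine IsMorphism.of_locality r fun x y i j hxy => ?_
  by_contra hne
  have : (shiftPerm X i (F⁻¹ x), shiftPerm X j (F⁻¹ y)) ∈ D r := by
    refine ⟨fun k hk => ?_, ?_⟩
    · have h1 : F (F⁻¹ x) = x := F.apply_symm_apply x
      have h2 : F (F⁻¹ y) = y := F.apply_symm_apply y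
      simp only [hshift, h1, h2]
      exact hxy k hk
    · simpa [shiftPerm] using hne
  rw [hr] at this
  exact this

/-- The group `Aut(X)` of all bijective cellular automata on `X`. -/
def Aut [DiscreteTopology A] [Finite A] (X : Subshift A ℤ) : Subgroup (Equiv.Perm X.carrier) where
  carrier := {F | IsMorphism X X F}
  mul_mem' hF hG := hF.comp_self hG
  one_mem' := IsMorphism.of_locality 0 fun x y i j h => by simpa using h 0 (by simp)
  inv_mem' hF := IsMorphism.perm_inv hF

/-- The shift map `σ(x)[i] = x[i+1]` as an element of `Aut(X)`. -/
def sigma [DiscreteTopology A] [Finite A] (X : Subshift A ℤ) : Aut X :=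
  ⟨shiftPerm X 1, IsMorphism.of_locality 1 fun x y i j h => by
    have := h 1 (by simp)
    simpa [shiftPerm, add_comm] using this⟩

open Classical in
/-- The invariant `k(X) ∈ ℕ ∪ {∞, ⊥}`: the least cardinality of a set `S ⊆ Aut(X)` whose centralizer
is `⟨σ⟩`, and `⊥` if there is no such set. -/
noncomputable def kInv [DiscreteTopology A] [Finite A] (X : Subshift A ℤ) : WithBot ℕ∞ :=
  if ∃ S : Set (Aut X), Subgroup.centralizer S = Subgroup.zpowers (sigma X) then
    ((sInf {c : ℕ∞ | ∃ S : Set (Aut X),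
      Subgroup.centralizer S = Subgroup.zpowers (sigma X) ∧ c = S.encard} : ℕ∞) : WithBot ℕ∞)
  else ⊥

end Morphisms

/-! ## Marker words and glider automorphisms -/

section Gliders

variable {A : Type*} [TopologicalSpace A]

/-- The pair of words `z` and `o` is a marker pair
of `X`. Here `z^ℤ ∈ X` is expressed by a point of `X` with `z` at every multiple of `|z|`. -/
structure IsMarkerPair (X : Subshift A ℤ) (z o : List A) : Prop where
  z_ne_nil : z ≠ []
  z_periodic : ∃ x ∈ X.carrier, ∀ i : ℤ, OccursAt x z (i * z.length)
  z_deterministic : IsDeterministicWord X z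
  z_synchronizing : IsSynchronizingWord X z
  z_nodup : z.Nodup
  o_mem : o ∈ language X
  two_le : 2 ≤ o.length
  disjoint : ∀ a ∈ z, a ∉ o
  z_pow_z : ∀ n : ℕ, z ++ wpow o n ++ z ∈ language X
  modEq : o.length ≡ Nat.gcd z.length o.length [MOD z.length]
  dvd : ∀ w ∈ language X, z ++ w ++ z ∈ language X → Nat.gcd z.length o.length ∣ w.length

/-- `F` replaces every occurrence of `r.1` by `r.2` (in the same position), simultaneously for all
pairs `r ∈ R`, and changes nothing else. Here `r.1` and `r.2` are words of equal length. -/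
def Replaces {X : Subshift A ℤ} (R : Set (List A × List A)) (F : X.carrier → X.carrier) : Prop :=
  ∀ x : X.carrier,
    (∀ r ∈ R, ∀ k : ℤ, OccursAt x.1 r.1 k → OccursAt (F x).1 r.2 k) ∧
    (∀ i : ℤ, (∀ r ∈ R, ∀ k : ℤ, OccursAt x.1 r.1 k → ¬ (k ≤ i ∧ i < k + r.1.length)) →
      (F x).1 i = x.1 i)

/-- Replace `u` by `v` and vice versa. -/
def swapRule (u v : List A) : Set (List A × List A) := {(u, v), (v, u)}

/-- Permute the words of the list `l` cyclically, each one being replaced by the next one. -/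
def cycleRule (l : List (List A)) : Set (List A × List A) := {r | r ∈ l.zip (l.rotate 1)}

/-- The leftbound glider `z^q o`. -/
def gliderL (z o : List A) : List A := wpow z o.length ++ o

/-- The rightbound glider `o^(p+1)`. -/
def gliderR (z o : List A) : List A := wpow o (z.length + 1)

/-- The number `p / K`, where `p = |z|` and `K = gcd(|z|, |o|)`. -/
def numClasses (z o : List A) : ℕ := z.length / Nat.gcd z.length o.length

/-- `n > gliderBound z o` is the condition on the parameter `n` of a glider automorphism. -/
def gliderBound (z o : List A) : ℕ := (wpow o (z.length + 1 + numClasses z o)).length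

/-- The swap `z (z^q o) z ↔ z (o^(p+1)) z`. -/
def ruleP1 (z o : List A) : Set (List A × List A) :=
  swapRule (z ++ (wpow z o.length ++ o) ++ z) (z ++ wpow o (z.length + 1) ++ z)

/-- The swap `z (o^(p+1)) z ↔ z (o z^q) z`. -/
def ruleP2 (z o : List A) : Set (List A × List A) :=
  swapRule (z ++ wpow o (z.length + 1) ++ z) (z ++ (o ++ wpow z o.length) ++ z)

/-- The words of class `j`: the nonempty words `w` of length at most `n - 1` with `z w z ∈ L(X)`
that contain no symbol of `z` and whose length is `(j+1)K` modulo `p`; for `j = p/K` the words `o`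
and `o^(p+1)` are left out. -/
def classWords (X : Subshift A ℤ) (z o : List A) (n j : ℕ) : Set (List A) :=
  {w | w ≠ [] ∧ w.length < n ∧ w ∈ language X ∧ (∀ a ∈ w, a ∉ z) ∧ z ++ w ++ z ∈ language X ∧
    w.length ≡ (j + 1) * Nat.gcd z.length o.length [MOD z.length] ∧
    (j = numClasses z o → w ≠ o ∧ w ≠ wpow o (z.length + 1))}

/-- The choices made in the definition of the map `P₄` with parameter `n`: for each class `j`,
`1 ≤ j ≤ p/K`, an enumeration (without repetition) of the words of the class which ends with
`o^(p+1+j)`, and the numbers of copies of `z` by which `o z^q o^j` and the words of the class are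
padded from the left to a common length. (Values at other `j` are not used.) -/
structure GliderChoice (X : Subshift A ℤ) (z o : List A) (n : ℕ) where
  enum : ℕ → List (List A)
  pad₀ : ℕ → ℕ
  pad : ℕ → List A → ℕ
  enum_nodup : ∀ j, 1 ≤ j → j ≤ numClasses z o → (enum j).Nodup
  mem_enum : ∀ j, 1 ≤ j → j ≤ numClasses z o → ∀ w, w ∈ enum j ↔ w ∈ classWords X z o n j
  enum_last : ∀ j, 1 ≤ j → j ≤ numClasses z o →
    (enum j).getLast? = some (wpow o (z.length + 1 + j))
  le_pad₀ : ∀ j, 1 ≤ j → j ≤ numClasses z o → o.length + 1 ≤ pad₀ j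
  le_pad : ∀ j, 1 ≤ j → j ≤ numClasses z o → ∀ w ∈ enum j, o.length + 1 ≤ pad j w
  length_eq : ∀ j, 1 ≤ j → j ≤ numClasses z o → ∀ w ∈ enum j,
    (wpow z (pad j w) ++ w).length =
      (wpow z (pad₀ j) ++ (o ++ wpow z o.length ++ wpow o j)).length

/-- The list `u_j z, u_{j,1} z, …, u_{j,n_j} z` of padded words of class `j`. -/
def GliderChoice.padded {X : Subshift A ℤ} {z o : List A} {n : ℕ} (c : GliderChoice X z o n)
    (j : ℕ) : List (List A) :=
  (wpow z (c.pad₀ j) ++ (o ++ wpow z o.length ++ wpow o j) ++ z) ::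
    (c.enum j).map fun w => wpow z (c.pad j w) ++ w ++ z

/-- The rule of `P₄`: for each class, its padded words are permuted cyclically. -/
def GliderChoice.ruleP4 {X : Subshift A ℤ} {z o : List A} {n : ℕ} (c : GliderChoice X z o n) :
    Set (List A × List A) :=
  {r | ∃ j, 1 ≤ j ∧ j ≤ numClasses z o ∧ r ∈ cycleRule (c.padded j)}

/-- `G` is the glider automorphism `P₄ ∘ P₂ ∘ P₁` with parameter `n`, with the choices `c`. -/
def IsGliderCA [DiscreteTopology A] [Finite A] {X : Subshift A ℤ} {z o : List A} {n : ℕ}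
    (c : GliderChoice X z o n) (G : Aut X) : Prop :=
  ∃ P1 P2 P4 : Aut X, Replaces (ruleP1 z o) P1.1 ∧ Replaces (ruleP2 z o) P2.1 ∧
    Replaces c.ruleP4 P4.1 ∧ G = P4 * P2 * P1

/-- The swap `z r z z z l z ↔ z r z z l z z`, where `l` and `r` are the two gliders. -/
def ruleF1 (z o : List A) : Set (List A × List A) :=
  swapRule (z ++ gliderR z o ++ z ++ z ++ z ++ gliderL z o ++ z)
    (z ++ gliderR z o ++ z ++ z ++ gliderL z o ++ z ++ z)

/-- The swap `z r z z l z ↔ z z r z l z`, where `l` and `r` are the two gliders. -/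
def ruleF2 (z o : List A) : Set (List A × List A) :=
  swapRule (z ++ gliderR z o ++ z ++ z ++ gliderL z o ++ z)
    (z ++ z ++ gliderR z o ++ z ++ gliderL z o ++ z)

/-- `F` is the automorphism `F₂ ∘ F₁`. -/
def IsCollisionCA [DiscreteTopology A] [Finite A] {X : Subshift A ℤ} (z o : List A)
    (F : Aut X) : Prop :=
  ∃ F1 F2 : Aut X, Replaces (ruleF1 z o) F1.1 ∧ Replaces (ruleF2 z o) F2.1 ∧ F = F2 * F1

end Gliders

end SynchShift

/-! Write `p = |z|` and `q = |o|`. Powers of the shift centralize everything, so the heart of the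
matter is that an automorphism `f` which commutes with all glider automorphisms `G n` and with the
collision map `F` is a power of the shift (`mem_zpowers_of_central`).

A replacement rule between words `z u z` that overlap only in copies of `z` at their ends defines an
automorphism, because points may be cut and glued at the synchronizing word `z`
(`RuleOK.existsUnique`). Its effect is followed on points with zero tails, that is, points which far
out on both sides are powers of `z`. Such a point is encoded by a finite list of pairs (number of
copies of `z`, gap word), see `Form` and `Valid`; these points are dense by transitivity
(`exists_form_agree`).

Under `G n` a gap `o` after more than `q` copies of `z` is a glider that moves `qp` symbols to the
left, and `o^(p+1)` is a glider that moves `qp` symbols to the right, when they do not interfere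
with anything. Every other gap shorter than `n` runs through the finite cycle of its class and then
splits off a leftbound glider. The number of gliders contained in a list is conserved, and induction
on it shows that each list of short gaps evolves into a fleet of leftbound gliders followed by a
fleet of rightbound ones (`diffuses`, `exists_fleets`). Consequently a point with zero tails on
which every `G n` acts as one of the two glider shifts is itself a fleet (`leftFleet_of_shift`,
`rightFleet_of_shift`).

Let `f` commute with all these maps. It sends `z^ℤ` to a shift of itself (`exists_occursAt_image`),
so after composition with a shift it fixes `z^ℤ` and sends a single glider to a fleet with the same
direction. The map `F` affects two approaching fleets only at a few critical distances. Comparing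
when `F` moves a pair of gliders and when it moves the image of the pair shows that `f` maps both
single gliders to themselves, up to one common shift (`exists_shift_gliders`). After a second
correction `f` fixes both gliders. Since `F` alters gaps inside fleets by one copy of `z` while `G
n` alters distances between fleets, `f` fixes all fleets (`fixesList_collide`, `fixesList_fleets`),
then by evolution all points with zero tails, then everything (`eq_one_of_fixes`).

An infinite synchronizing subshift contains a periodic point `y` at whose long prefix points can be
glued. Marking the occurrences of such a prefix by fresh symbols is a conjugacy; the marks form `z`,
and `o` comes from a shortest suitable return to the prefix that leaves the orbit of `y`
(`exists_markerPair`). The center of the automorphism group is transported by the conjugacy, and a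
finite transitive subshift is a single orbit, so the center is always `⟨σ⟩` and the whole group
witnesses `k(X) ≠ ⊥`. -/

namespace SynchShift

open SymbolicDynamics.FullShift

/-! ### Words, powers and gaps in configurations -/

section Basic

variable {A : Type*}

theorem occursAt_nil (x : ℤ → A) (i : ℤ) : OccursAt x [] i := fun k hk => by simp at hk

theorem OccursAt.apply {x : ℤ → A} {w : List A} {i m : ℤ} (h : OccursAt x w i) (h1 : i ≤ m)
    (h2 : m < i + w.length) : x m = w[(m - i).toNat]'(by omega) := by
  rw [← h (m - i).toNat (by omega)]
  congr 1
  omega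

theorem OccursAt.mem {x : ℤ → A} {w : List A} {i m : ℤ} (h : OccursAt x w i) (h1 : i ≤ m)
    (h2 : m < i + w.length) : x m ∈ w := by
  rw [h.apply h1 h2]; exact List.getElem_mem _

theorem occursAt_append {x : ℤ → A} {u v : List A} {i : ℤ} :
    OccursAt x (u ++ v) i ↔ OccursAt x u i ∧ OccursAt x v (i + u.length) := by
  constructor
  · intro h
    refine ⟨fun k hk => ?_, fun k hk => ?_⟩
    · rw [h k (by simp; omega), List.getElem_append_left hk]
    · have := h (u.length + k) (by simp; omega)
      rw [List.getElem_append_right (by omega)] at this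
      push_cast at this
      rw [← add_assoc] at this
      simpa using this
  · rintro ⟨h1, h2⟩ k hk
    by_cases h : k < u.length
    · rw [h1 k h, List.getElem_append_left h]
    · rw [List.getElem_append_right (by omega), ← h2 _ (by simp at hk; omega)]
      congr 1; omega

theorem OccursAt.congr {x y : ℤ → A} {w : List A} {i : ℤ} (h : OccursAt x w i)
    (hxy : ∀ m, i ≤ m → m < i + w.length → y m = x m) : OccursAt y w i := fun k hk => by
  rw [hxy _ (by omega) (by omega), h k hk]

theorem OccursAt.agree {x y : ℤ → A} {w : List A} {i m : ℤ} (h : OccursAt x w i)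
    (h' : OccursAt y w i) (h1 : i ≤ m) (h2 : m < i + w.length) : x m = y m := by
  rw [h.apply h1 h2, h'.apply h1 h2]

theorem OccursAt.word_eq {x : ℤ → A} {u v : List A} {i : ℤ} (h : OccursAt x u i)
    (h' : OccursAt x v i) (hl : u.length = v.length) : u = v :=
  List.ext_getElem hl fun k hk hk' => by rw [← h k hk, ← h' k hk']

theorem occursAt_shift {x : ℤ → A} {w : List A} {i j : ℤ} :
    OccursAt (shift j x) w i ↔ OccursAt x w (j + i) := by
  simp [OccursAt, add_assoc]

/-- The word of length `n` that occurs in `x` at `i`. -/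
def factor (x : ℤ → A) (i : ℤ) (n : ℕ) : List A := List.ofFn fun k : Fin n => x (i + (k : ℕ))

@[simp] theorem length_factor (x : ℤ → A) (i : ℤ) (n : ℕ) : (factor x i n).length = n := by
  simp [factor]

theorem occursAt_factor (x : ℤ → A) (i : ℤ) (n : ℕ) : OccursAt x (factor x i n) i := fun k hk => by
  simp [factor]

theorem occursAt_factor_iff {x y : ℤ → A} {i j : ℤ} {n : ℕ} :
    OccursAt y (factor x i n) j ↔ ∀ k : ℕ, k < n → y (j + k) = x (i + k) := by
  simp [OccursAt, factor]

theorem mem_factor {x : ℤ → A} {i : ℤ} {n : ℕ} {a : A} :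
    a ∈ factor x i n ↔ ∃ m, i ≤ m ∧ m < i + n ∧ x m = a := by
  simp only [factor, List.mem_ofFn]
  constructor
  · rintro ⟨k, hk⟩; exact ⟨i + (k : ℕ), by omega, by omega, hk⟩
  · rintro ⟨m, h1, h2, rfl⟩
    exact ⟨⟨(m - i).toNat, by omega⟩, by dsimp only; congr 1; omega⟩

@[simp] theorem wpow_zero (w : List A) : wpow w 0 = [] := rfl

theorem wpow_succ (w : List A) (n : ℕ) : wpow w (n + 1) = w ++ wpow w n := by
  simp [wpow, List.replicate_succ]

@[simp] theorem wpow_one (w : List A) : wpow w 1 = w := by simp [wpow]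

theorem wpow_add (w : List A) (m n : ℕ) : wpow w (m + n) = wpow w m ++ wpow w n := by
  simp [wpow, ← List.flatten_append]

theorem wpow_succ' (w : List A) (n : ℕ) : wpow w (n + 1) = wpow w n ++ w := by
  rw [wpow_add, wpow_one]

@[simp] theorem length_wpow (w : List A) (n : ℕ) : (wpow w n).length = n * w.length := by
  simp [wpow]

theorem mem_of_mem_wpow {w : List A} {n : ℕ} {a : A} (h : a ∈ wpow w n) : a ∈ w := by
  simp only [wpow, List.mem_flatten, List.mem_replicate] at h
  obtain ⟨l, ⟨_, rfl⟩, h⟩ := h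
  exact h

theorem occursAt_wpow_iff {x : ℤ → A} {w : List A} {n : ℕ} {i : ℤ} :
    OccursAt x (wpow w n) i ↔ ∀ t : ℕ, t < n → OccursAt x w (i + t * w.length) := by
  induction n generalizing i with
  | zero => simp [occursAt_nil]
  | succ n ih =>
    rw [wpow_succ', occursAt_append, ih]
    constructor
    · rintro ⟨h1, h2⟩ t ht
      rcases Nat.lt_succ_iff_lt_or_eq.mp ht with h | rfl
      · exact h1 t h
      · simpa using h2
    · intro h
      exact ⟨fun t ht => h t (by omega), by simpa using h n (by omega)⟩

/-- The configuration which agrees with `x` to the left of `i` and with `y` from `i` on. -/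
def glue (i : ℤ) (x y : ℤ → A) : ℤ → A := fun m => if m < i then x m else y m

theorem glue_left {i m : ℤ} {x y : ℤ → A} (h : m < i) : glue i x y m = x m := if_pos h

theorem glue_right {i m : ℤ} {x y : ℤ → A} (h : i ≤ m) : glue i x y m = y m := if_neg (by omega)

/-- `z^c g z` occurs in `x` at `k`, where `g` is a nonempty word without symbols of `z`. -/
def GapAt (z : List A) (x : ℤ → A) (k : ℤ) (c : ℕ) (g : List A) : Prop :=
  0 < c ∧ OccursAt x (wpow z c) k ∧ OccursAt x g (k + c * z.length) ∧
    OccursAt x z (k + c * z.length + g.length) ∧ g ≠ [] ∧ ∀ a ∈ g, a ∉ z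

/-- A gap has no symbols of `z`, so it can neither begin inside the run of copies of `z` of the
other one nor extend over the copy of `z` behind it. Hence two such blocks with a common position
have the same gap, though perhaps different numbers of copies before it. -/
theorem GapAt.unique {z : List A} (hp : 0 < z.length) {x : ℤ → A} {k i m : ℤ} {c a : ℕ}
    {g w : List A} (h : GapAt z x k c g) (h' : GapAt z x i a w)
    (h1 : k ≤ m) (h2 : m < k + c * z.length + g.length)
    (h3 : i ≤ m) (h4 : m < i + a * z.length + w.length) :
    k + c * z.length = i + a * z.length ∧ g = w := by
  have key : ∀ (k i : ℤ) (c a : ℕ) (g w : List A), GapAt z x k c g → GapAt z x i a w →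
      k ≤ m → m < k + c * z.length + g.length → i ≤ m → m < i + a * z.length + w.length →
      k + c * z.length ≤ i + a * z.length ∧
        (k + c * z.length = i + a * z.length → g.length ≤ w.length) := by
    clear h h' h1 h2 h3 h4
    intro k i c a g w h h' h1 h2 h3 h4
    obtain ⟨a0, a1, a2, a3, a4, a5⟩ := h
    obtain ⟨b0, b1, b2, b3, b4, b5⟩ := h'
    have hg := List.length_pos_iff.2 a4
    have hw := List.length_pos_iff.2 b4
    constructor
    · by_contra! hlt
      by_cases hk : k ≤ i + a * z.length
      · exact b5 _ (b2.mem le_rfl (by omega))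
          (mem_of_mem_wpow (a1.mem hk (by rw [length_wpow]; push_cast; omega)))
      · have e1 : x k ∈ w := b2.mem (by omega) (by omega)
        have e2 : x k ∈ z := by
          exact mem_of_mem_wpow (a1.mem le_rfl (by
            rw [length_wpow]; have := Nat.mul_pos a0 hp; omega))
        exact b5 _ e1 e2
    · intro e
      by_contra! hlt
      refine a5 (x (i + a * z.length + w.length)) (a2.mem (by omega) (by omega)) ?_
      exact b3.mem le_rfl (by omega)
  have A1 := key k i c a g w h h' h1 h2 h3 h4
  have A2 := key i k a c w g h' h h3 h4 h1 h2
  have e : k + c * z.length = i + a * z.length := le_antisymm A1.1 A2.1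
  refine ⟨e, ?_⟩
  have hl : g.length = w.length := le_antisymm (A1.2 e) (A2.2 e.symm)
  exact OccursAt.word_eq h.2.2.1 (by rw [e]; exact h'.2.2.1) hl

end Basic

/-! ### Gluing at synchronizing words; markers -/

section Lang

variable {A : Type*} [TopologicalSpace A] {X : Subshift A ℤ}

theorem shift_mem {x : ℤ → A} (hx : x ∈ X.carrier) (j : ℤ) : shift j x ∈ X.carrier := X.mapsTo j hx

theorem mem_language_of {x : ℤ → A} {w : List A} {i : ℤ} (hx : x ∈ X.carrier) (h : OccursAt x w i) :
    w ∈ language X := ⟨x, hx, i, h⟩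

theorem exists_occursAt {w : List A} (h : w ∈ language X) (j : ℤ) :
    ∃ x ∈ X.carrier, OccursAt x w j := by
  obtain ⟨x, hx, i, h⟩ := h
  refine ⟨shift (i - j) x, shift_mem hx _, ?_⟩
  rw [occursAt_shift]; simpa using h

theorem language_factor {u v w : List A} (h : u ++ v ++ w ∈ language X) : v ∈ language X := by
  obtain ⟨x, hx, i, h⟩ := h
  rw [occursAt_append, occursAt_append] at h
  exact ⟨x, hx, _, h.1.2⟩

/-- Agreement on growing windows is convergence in the product topology, and `X` is closed. -/
theorem mem_carrier_of_approx {y : ℤ → A}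
    (h : ∀ N : ℕ, ∃ x ∈ X.carrier, ∀ m : ℤ, |m| ≤ N → x m = y m) : y ∈ X.carrier := by
  choose x hx hxy using h
  refine X.isClosed.mem_of_tendsto (b := Filter.atTop) (f := x) ?_ (Filter.Eventually.of_forall hx)
  rw [tendsto_pi_nhds]
  intro m
  refine tendsto_const_nhds.congr' ?_
  filter_upwards [Filter.eventually_ge_atTop m.natAbs] with N hN
  exact (hxy N m (by rw [Int.abs_eq_natAbs]; omega)).symm

theorem mem_carrier_of_factors {y : ℤ → A} (i₀ : ℤ) (d : ℕ)
    (h : ∀ N : ℕ, factor y (i₀ - N) (N + d + N) ∈ language X) : y ∈ X.carrier := by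
  refine mem_carrier_of_approx fun N => ?_
  obtain ⟨x, hx, hx'⟩ := exists_occursAt (h (N + i₀.natAbs + 1)) (i₀ - (N + i₀.natAbs + 1 : ℕ))
  refine ⟨x, hx, fun m hm => ?_⟩
  rw [abs_le] at hm
  refine hx'.agree (occursAt_factor _ _ _) ?_ ?_
  · omega
  · rw [length_factor]; omega

/-- Each window around the seam has the form `u z v` with `u z` from `x` and `z v` from `y`, so
synchronization puts it into the language; closedness does the rest. -/
theorem glue_mem {z : List A} (hz : IsSynchronizingWord X z) {x y : ℤ → A} {i : ℤ}
    (hx : x ∈ X.carrier) (hy : y ∈ X.carrier) (hxi : OccursAt x z i) (hyi : OccursAt y z i) :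
    glue (i + z.length) x y ∈ X.carrier := by
  refine mem_carrier_of_factors i z.length fun N => ?_
  have h1 : OccursAt x (factor x (i - N) N ++ z) (i - N) := by
    rw [occursAt_append]
    exact ⟨occursAt_factor _ _ _, by simpa using hxi⟩
  have h2 : OccursAt y (z ++ factor y (i + z.length) N) i := by
    rw [occursAt_append]
    exact ⟨hyi, occursAt_factor _ _ _⟩
  have h3 := hz.2 _ (mem_language_of hx (occursAt_factor x (i - N) N)) _
    (mem_language_of hy (occursAt_factor y (i + z.length) N)) (mem_language_of hx h1)
    (mem_language_of hy h2)
  convert h3 using 1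
  refine OccursAt.word_eq (occursAt_factor _ _ _) (i := i - N) (x := glue (i + z.length) x y) ?_
    (by simp; omega)
  rw [occursAt_append]
  refine ⟨h1.congr fun m _ hm => ?_, ?_⟩
  · rw [glue_left]
    simp at hm; omega
  · have : (i - N + ((factor x (i - N) N ++ z).length : ℤ)) = i + z.length := by simp; ring
    rw [this]
    exact (occursAt_factor _ _ _).congr fun m hm _ => glue_right hm

/-- A synchronizing word with distinct symbols which is deterministic and defines a point of
period `|z|`. -/
structure IsMarker (X : Subshift A ℤ) (z : List A) : Prop where
  ne_nil : z ≠ []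
  periodic : ∃ x ∈ X.carrier, ∀ i : ℤ, OccursAt x z (i * z.length)
  deterministic : IsDeterministicWord X z
  sync : IsSynchronizingWord X z
  nodup : z.Nodup

theorem IsMarkerPair.isMarker {z o : List A} (h : IsMarkerPair X z o) : IsMarker X z :=
  ⟨h.z_ne_nil, h.z_periodic, h.z_deterministic, h.z_synchronizing, h.z_nodup⟩


namespace IsMarker

variable {z : List A}

theorem length_pos (hz : IsMarker X z) : 0 < z.length := List.length_pos_iff.2 hz.ne_nil

/-- Unique successors and predecessors let a single symbol of `z` spread to the whole word around
it. -/
theorem occursAt_of_apply (hz : IsMarker X z) {x : ℤ → A} (hx : x ∈ X.carrier) {m : ℤ} {k : ℕ}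
    (hk : k < z.length) (h : x m = z[k]) : OccursAt x z (m - k) := by
  have pair (i : ℤ) : [x i, x (i + 1)] ∈ language X := by
    refine ⟨x, hx, i, fun k hk => ?_⟩
    match k, hk with
    | 0, _ => simp
    | 1, _ => simp
  have up (d : ℕ) (hd : k + d < z.length) : x (m + d) = z[k + d] := by
    induction d with
    | zero => simpa using h
    | succ d ih =>
      have ih := ih (by omega)
      obtain ⟨a, ha, hu⟩ := hz.deterministic.1 (k + d) (by omega)
      have h1 := hu (x (m + d + 1)) (by rw [← ih]; exact pair _)
      have h2 := hu (z[k + d + 1]) (by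
        obtain ⟨y, hy, i, hi⟩ := hz.sync.1
        refine ⟨y, hy, i + (k + d : ℕ), fun t ht => ?_⟩
        match t, ht with
        | 0, _ => simpa using hi (k + d) (by omega)
        | 1, _ => simpa [add_assoc] using hi (k + d + 1) (by omega))
      push_cast
      rw [← add_assoc, h1, ← h2]
      rfl
  have down (d : ℕ) (hd : d ≤ k) : x (m - d) = z[k - d] := by
    induction d with
    | zero => simpa using h
    | succ d ih =>
      have ih := ih (by omega)
      obtain ⟨a, ha, hu⟩ := hz.deterministic.2 (k - (d + 1)) (by omega)
      have e : k - (d + 1) + 1 = k - d := by omega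
      have h1 := hu (x (m - (d + 1 : ℕ))) (by
        simp only [e]
        rw [← ih]
        convert pair (m - (d + 1 : ℕ)) using 4
        push_cast; ring)
      have h2 := hu (z[k - (d + 1)]) (by
        obtain ⟨y, hy, i, hi⟩ := hz.sync.1
        refine ⟨y, hy, i + (k - (d + 1) : ℕ), fun t ht => ?_⟩
        match t, ht with
        | 0, _ => simpa using hi (k - (d + 1)) (by omega)
        | 1, _ => simpa [add_assoc] using hi (k - (d + 1) + 1) (by omega))
      rw [h1, ← h2]
  intro t ht
  rcases le_total t k with h' | h'
  · have := down (k - t) (by omega)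
    rw [Nat.cast_sub h'] at this
    convert this using 2
    · ring
    · omega
  · have := up (t - k) (by omega)
    rw [Nat.cast_sub h'] at this
    convert this using 2
    · ring
    · omega

theorem exists_occursAt_of_mem (hz : IsMarker X z) {x : ℤ → A} (hx : x ∈ X.carrier) {m : ℤ}
    (h : x m ∈ z) : ∃ i, OccursAt x z i ∧ i ≤ m ∧ m < i + z.length := by
  obtain ⟨k, hk, h⟩ := List.mem_iff_getElem.1 h
  exact ⟨m - k, hz.occursAt_of_apply hx hk h.symm, by omega, by omega⟩

/-- The symbols of `z` are distinct, so a symbol tells its index in `z`. -/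
theorem occursAt_unique (hz : IsMarker X z) {x : ℤ → A} {i j m : ℤ} (hi : OccursAt x z i)
    (hj : OccursAt x z j) (h1 : i ≤ m) (h2 : m < i + z.length) (h3 : j ≤ m)
    (h4 : m < j + z.length) : i = j := by
  have e := (hi.apply h1 h2).symm.trans (hj.apply h3 h4)
  have := (hz.nodup.getElem_inj_iff).1 e
  omega

theorem occursAt_next (hz : IsMarker X z) {x : ℤ → A} (hx : x ∈ X.carrier) {i : ℤ}
    (hi : OccursAt x z i) (h : x (i + z.length) ∈ z) : OccursAt x z (i + z.length) := by
  obtain ⟨j, hj, h1, h2⟩ := hz.exists_occursAt_of_mem hx h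
  have hp := hz.length_pos
  by_cases hlt : j < i + z.length
  · have := hz.occursAt_unique hi hj (m := j) (by omega) (by omega) le_rfl (by omega)
    omega
  · rwa [show i + z.length = j by omega]

theorem occursAt_sep (hz : IsMarker X z) {x : ℤ → A} {i j : ℤ} (hi : OccursAt x z i)
    (hj : OccursAt x z j) : i = j ∨ i + z.length ≤ j ∨ j + z.length ≤ i := by
  have hp := hz.length_pos
  by_contra! h
  rcases le_total i j with h' | h'
  · exact h.1 (hz.occursAt_unique hi hj h' (by omega) le_rfl (by omega))
  · exact h.1 (hz.occursAt_unique hi hj le_rfl (by omega) h' (by omega))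

end IsMarker

end Lang

/-! ### Simultaneous word replacement as an automorphism -/

section Rules

variable {A : Type*} [TopologicalSpace A] {X : Subshift A ℤ}

theorem Replaces.eq {R : Set (List A × List A)} (hlen : ∀ r ∈ R, r.1.length = r.2.length)
    {F G : X.carrier → X.carrier} (hF : Replaces R F) (hG : Replaces R G) : F = G := by
  funext x
  ext i
  by_cases h : ∀ r ∈ R, ∀ k : ℤ, OccursAt x.1 r.1 k → ¬ (k ≤ i ∧ i < k + r.1.length)
  · rw [(hF x).2 i h, (hG x).2 i h]
  · push Not at h
    obtain ⟨r, hr, k, hk, h1, h2⟩ := h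
    exact ((hF x).1 r hr k hk).agree ((hG x).1 r hr k hk) h1 (by rw [← hlen r hr]; exact h2)

/-- A set of replacement rules between words of the form `z u z` whose occurrences overlap at most
in a common word `z` at their ends, and which permutes its set of words. -/
structure RuleOK (X : Subshift A ℤ) (z : List A) (R : Set (List A × List A)) : Prop where
  bounded : ∃ M : ℕ, ∀ r ∈ R, r.1.length ≤ M
  length_eq : ∀ r ∈ R, r.1.length = r.2.length
  shape : ∀ r ∈ R, ∃ u, r.1 = z ++ u ++ z
  mem_language : ∀ r ∈ R, r.1 ∈ language X
  functional : ∀ u v w, (u, v) ∈ R → (u, w) ∈ R → v = w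
  injective : ∀ u v w, (u, w) ∈ R → (v, w) ∈ R → u = v
  exists_next : ∀ r ∈ R, ∃ w, (r.2, w) ∈ R
  exists_prev : ∀ r ∈ R, ∃ w, (w, r.1) ∈ R
  overlap : ∀ x ∈ X.carrier, ∀ r ∈ R, ∀ s ∈ R, ∀ k l, OccursAt x r.1 k → OccursAt x s.1 l →
    k = l ∧ r.1 = s.1 ∨ k + r.1.length ≤ l + z.length ∨ l + s.1.length ≤ k + z.length

namespace RuleOK

variable {z : List A} {R : Set (List A × List A)}

/-- The inverse rules. -/
theorem symm (h : RuleOK X z R) : RuleOK X z (Prod.swap '' R) where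
  bounded := by
    obtain ⟨M, hM⟩ := h.bounded
    refine ⟨M, ?_⟩
    rintro _ ⟨r, hr, rfl⟩
    exact (h.length_eq r hr).symm.trans_le (hM r hr)
  length_eq := by
    rintro _ ⟨r, hr, rfl⟩
    exact (h.length_eq r hr).symm
  shape := by
    rintro _ ⟨r, hr, rfl⟩
    obtain ⟨w, hw⟩ := h.exists_next r hr
    exact h.shape (r.2, w) hw
  mem_language := by
    rintro _ ⟨r, hr, rfl⟩
    obtain ⟨w, hw⟩ := h.exists_next r hr
    exact h.mem_language (r.2, w) hw
  functional := by
    rintro u v w ⟨⟨a, b⟩, hr, e⟩ ⟨⟨c, d⟩, hs, e'⟩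
    simp only [Prod.swap_prod_mk, Prod.mk.injEq] at e e'
    obtain ⟨rfl, rfl⟩ := e
    obtain ⟨rfl, rfl⟩ := e'
    exact h.injective _ _ _ hr hs
  injective := by
    rintro u v w ⟨⟨a, b⟩, hr, e⟩ ⟨⟨c, d⟩, hs, e'⟩
    simp only [Prod.swap_prod_mk, Prod.mk.injEq] at e e'
    obtain ⟨rfl, rfl⟩ := e
    obtain ⟨rfl, rfl⟩ := e'
    exact h.functional _ _ _ hr hs
  exists_next := by
    rintro _ ⟨r, hr, rfl⟩
    obtain ⟨w, hw⟩ := h.exists_prev r hr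
    exact ⟨w, _, hw, rfl⟩
  exists_prev := by
    rintro _ ⟨r, hr, rfl⟩
    obtain ⟨w, hw⟩ := h.exists_next r hr
    exact ⟨w, _, hw, rfl⟩
  overlap := by
    rintro x hx _ ⟨r, hr, rfl⟩ _ ⟨s, hs, rfl⟩ k l
    obtain ⟨v, hv⟩ := h.exists_next r hr
    obtain ⟨w, hw⟩ := h.exists_next s hs
    exact h.overlap x hx _ hv _ hw k l

/-- `r` is a rule in `R` whose left side occurs in `x` at `k`, with `k ≤ i < k + |r.1|`. -/
def Covers (R : Set (List A × List A)) (x : ℤ → A) (i : ℤ) (rk : (List A × List A) × ℤ) : Prop :=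
  rk.1 ∈ R ∧ OccursAt x rk.1.1 rk.2 ∧ rk.2 ≤ i ∧ i < rk.2 + rk.1.1.length

open Classical in
/-- Replace simultaneously the words of `x` according to the rules in `R`, at the positions
in `S`. -/
noncomputable def replaceOn (R : Set (List A × List A)) (S : Set ℤ) (x : ℤ → A) : ℤ → A := fun i =>
  if h : ∃ rk, Covers R x i rk ∧ rk.2 ∈ S then
    if h' : (i - h.choose.2).toNat < h.choose.1.2.length then
      h.choose.1.2[(i - h.choose.2).toNat]
    else x i
  else x i

theorem replaceOn_of_not {A : Type*} {R : Set (List A × List A)} (S : Set ℤ) {x : ℤ → A} {i : ℤ}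
    (h : ∀ r ∈ R, ∀ k ∈ S, OccursAt x r.1 k → ¬ (k ≤ i ∧ i < k + r.1.length)) :
    replaceOn R S x i = x i := by
  unfold replaceOn
  rw [dif_neg]
  rintro ⟨rk, h1, h2⟩
  exact h rk.1 h1.1 rk.2 h2 h1.2.1 h1.2.2

theorem shape_right (h : RuleOK X z R) {r : List A × List A} (hr : r ∈ R) :
    ∃ u, r.2 = z ++ u ++ z := by
  obtain ⟨w, hw⟩ := h.exists_next r hr
  exact h.shape _ hw

theorem right_mem_language (h : RuleOK X z R) {r : List A × List A} (hr : r ∈ R) :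
    r.2 ∈ language X := by
  obtain ⟨w, hw⟩ := h.exists_next r hr
  exact h.mem_language _ hw

theorem occursAt_ends (h : RuleOK X z R) {r : List A × List A} (hr : r ∈ R) {x : ℤ → A} {k : ℤ}
    (hk : OccursAt x r.1 k) : 2 * z.length ≤ r.1.length ∧ OccursAt x z k ∧
      OccursAt x z (k + r.1.length - z.length) := by
  obtain ⟨u, hu⟩ := h.shape r hr
  rw [hu] at hk ⊢
  rw [occursAt_append, occursAt_append] at hk
  refine ⟨by simp; omega, hk.1.1, ?_⟩
  convert hk.2 using 1
  simp; ring

theorem occursAt_ends_right (h : RuleOK X z R) {r : List A × List A} (hr : r ∈ R) {x : ℤ → A}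
    {k : ℤ} (hk : OccursAt x r.2 k) : OccursAt x z k ∧ OccursAt x z (k + r.1.length - z.length) := by
  obtain ⟨u, hu⟩ := h.shape_right hr
  rw [h.length_eq r hr]
  rw [hu] at hk ⊢
  rw [occursAt_append, occursAt_append] at hk
  refine ⟨hk.1.1, ?_⟩
  convert hk.2 using 1
  simp; ring

/-- Two occurrences that cover the same position are equal or share only a copy of `z` at their
ends, and both right sides carry that same copy. So the arbitrary choice made in `replaceOn` is
harmless. -/
theorem occursAt_replaceOn (hz : IsMarker X z) (h : RuleOK X z R) (S : Set ℤ) {x : ℤ → A}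
    (hx : x ∈ X.carrier) {r : List A × List A} (hr : r ∈ R) {k : ℤ} (hk : OccursAt x r.1 k)
    (hkS : k ∈ S) : OccursAt (replaceOn R S x) r.2 k := by
  intro t ht
  have hl := h.length_eq r hr
  have hex : ∃ rk, Covers R x (k + t) rk ∧ rk.2 ∈ S := ⟨(r, k), ⟨hr, hk, by simp, by simp; omega⟩, hkS⟩
  unfold replaceOn
  rw [dif_pos hex]
  obtain ⟨⟨c1, c2, c3, c4⟩, c5⟩ := hex.choose_spec
  set s := hex.choose.1
  set l := hex.choose.2
  have hl' := h.length_eq s c1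
  rw [dif_pos (by omega)]
  have hp := hz.length_pos
  have E1 := h.occursAt_ends hr hk
  have E2 := h.occursAt_ends c1 c2
  have key : ∀ (r s : List A × List A) (k l m : ℤ) (hr : r ∈ R) (hs : s ∈ R) (_ : OccursAt x r.1 k)
      (_ : OccursAt x s.1 l) (_ : k ≤ m) (_ : m < k + r.1.length) (_ : l ≤ m)
      (_ : m < l + s.1.length) (_ : k + r.1.length ≤ l + z.length),
      r.2[(m - k).toNat]'(by have := h.length_eq r hr; omega) =
        s.2[(m - l).toNat]'(by have := h.length_eq s hs; omega) := by
    intro r s k l m hr hs hk hl h1 h2 h3 h4 h5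
    have E1 := h.occursAt_ends hr hk
    have E2 := h.occursAt_ends hs hl
    have e := hz.occursAt_unique E1.2.2 E2.2.1 (m := m) (by omega) (by omega) (by omega) (by omega)
    obtain ⟨u, hu⟩ := h.shape_right hr
    obtain ⟨v, hv⟩ := h.shape_right hs
    have l1 := h.length_eq r hr
    have l2 := h.length_eq s hs
    rw [hu] at l1
    simp only [List.length_append] at l1
    rw [List.getElem_of_eq hu, List.getElem_of_eq (hv.trans (List.append_assoc _ _ _)),
      List.getElem_append_right (by simp; omega), List.getElem_append_left (by omega)]
    congr 1
    simp
    omega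
  rcases h.overlap x hx r hr s c1 k l hk c2 with ⟨e1, e2⟩ | h' | h'
  · have e3 : r = s := Prod.ext e2 (h.functional _ _ _ hr (by rw [e2]; exact c1))
    simp only [← e3, ← e1]
    congr 1
    omega
  · rw [← key r s k l (k + t) hr c1 hk c2 (by omega) (by omega) c3 c4 h']
    congr 1
    omega
  · rw [key s r l k (k + t) c1 hr c2 hk c3 c4 (by omega) (by omega) h']
    congr 1
    omega

/-- Replacing one further word amounts to two gluings: into a point containing the new word at the
copy of `z` where it begins, and back at the copy where it ends. -/
theorem replaceOn_mem_of_finite (hz : IsMarker X z) (h : RuleOK X z R) {x : ℤ → A}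
    (hx : x ∈ X.carrier) (S : Finset ℤ) : replaceOn R (S : Set ℤ) x ∈ X.carrier := by
  induction S using Finset.induction_on with
  | empty =>
    convert hx using 1
    funext i
    exact replaceOn_of_not _ (by simp)
  | insert k S hkS ih =>
    by_cases hex : ∃ r ∈ R, OccursAt x r.1 k
    swap
    · push Not at hex
      convert ih using 1
      funext i
      by_cases hc : ∃ rk, Covers R x i rk ∧ rk.2 ∈ (S : Set ℤ)
      · obtain ⟨⟨r, l⟩, ⟨c1, c2, c3, c4⟩, c5⟩ := hc
        have hl := h.length_eq r c1
        exact (h.occursAt_replaceOn hz _ hx c1 c2 (by simp; right; exact c5)).agree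
          (h.occursAt_replaceOn hz _ hx c1 c2 c5) c3 (by rw [← hl]; exact c4)
      · rw [replaceOn_of_not, replaceOn_of_not]
        · exact fun r hr l hl ho hh => hc ⟨(r, l), ⟨hr, ho, hh.1, hh.2⟩, hl⟩
        · intro r hr l hl ho hh
          simp only [Finset.coe_insert, Set.mem_insert_iff] at hl
          rcases hl with rfl | hl
          · exact hex r hr ho
          · exact hc ⟨(r, l), ⟨hr, ho, hh.1, hh.2⟩, hl⟩
    · obtain ⟨r, hr, hk⟩ := hex
      have hlr := h.length_eq r hr
      have E := h.occursAt_ends hr hk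
      have hp := hz.length_pos
      set y := replaceOn R (S : Set ℤ) x with hy
      -- The replacements already made meet this word only in its end copies of `z`, which they
      -- reproduce; so the word is still present in `y`.
      have hyx : ∀ i, k ≤ i → i < k + r.1.length → y i = x i := by
        intro i h1 h2
        by_cases hc : ∃ rk, Covers R x i rk ∧ rk.2 ∈ (S : Set ℤ)
        · obtain ⟨⟨s, l⟩, ⟨c1, c2, c3, c4⟩, c5⟩ := hc
          have E2 := h.occursAt_ends c1 c2
          have hls := h.length_eq s c1
          have O := h.occursAt_replaceOn hz S hx c1 c2 c5
          have O := h.occursAt_ends_right c1 O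
          dsimp only at c2 c3 c4 E2 O
          rcases h.overlap x hx r hr s c1 k l hk c2 with ⟨rfl, -⟩ | h' | h'
          · exact absurd c5 (by simpa using hkS)
          · exact O.1.agree E2.2.1 (by omega) (by omega)
          · exact O.2.agree E2.2.2 (by omega) (by omega)
        · exact replaceOn_of_not _ fun r hr l hl ho hh => hc ⟨(r, l), ⟨hr, ho, hh.1, hh.2⟩, hl⟩
      have hyk : OccursAt y r.1 k := hk.congr hyx
      have Ey := h.occursAt_ends hr hyk
      obtain ⟨v, hv, hvk⟩ := exists_occursAt (h.right_mem_language hr) k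
      have Ev := h.occursAt_ends_right hr hvk
      have G1 := glue_mem hz.sync ih hv Ey.2.1 Ev.1
      have G2 := glue_mem hz.sync G1 ih (i := k + r.1.length - z.length)
        (Ev.2.congr fun m h1 h2 => glue_right (by omega)) Ey.2.2
      convert G2 using 1
      funext i
      by_cases h1 : k ≤ i ∧ i < k + r.1.length
      · refine Eq.trans (b := v i) ?_ ?_
        · exact (h.occursAt_replaceOn hz _ hx hr hk (by simp)).agree hvk h1.1 (by omega)
        · rw [glue_left (by omega)]
          by_cases h2 : k + z.length ≤ i
          · rw [glue_right h2]
          · rw [glue_left (by omega)]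
            exact Ev.1.agree Ey.2.1 h1.1 (by omega)
      · refine Eq.trans (b := y i) ?_ ?_
        · by_cases hc : ∃ rk, Covers R x i rk ∧ rk.2 ∈ (S : Set ℤ)
          · obtain ⟨⟨s, l⟩, ⟨c1, c2, c3, c4⟩, c5⟩ := hc
            have hls := h.length_eq s c1
            exact (h.occursAt_replaceOn hz _ hx c1 c2 (by simp; right; exact c5)).agree
              (h.occursAt_replaceOn hz _ hx c1 c2 c5) c3 (by rw [← hls]; exact c4)
          · rw [hy, replaceOn_of_not, replaceOn_of_not]
            · exact fun r hr l hl ho hh => hc ⟨(r, l), ⟨hr, ho, hh.1, hh.2⟩, hl⟩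
            · intro s hs l hl ho hh
              simp only [Finset.coe_insert, Set.mem_insert_iff] at hl
              rcases hl with rfl | hl
              · rcases h.overlap x hx r hr s hs l l hk ho with ⟨-, e⟩ | h' | h'
                · rw [← e] at hh; exact h1 hh
                · omega
                · have := h.occursAt_ends hs ho
                  omega
              · exact hc ⟨(s, l), ⟨hs, ho, hh.1, hh.2⟩, hl⟩
        · by_cases h2 : i < k
          · rw [glue_left (by omega), glue_left (by omega)]
          · rw [glue_right (by omega)]

/-- The words have bounded length, so on a window only finitely many positions matter, and the full
replacement is a limit of finite ones. -/
theorem replaceOn_mem (hz : IsMarker X z) (h : RuleOK X z R) {x : ℤ → A}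
    (hx : x ∈ X.carrier) : replaceOn R Set.univ x ∈ X.carrier := by
  obtain ⟨M, hM⟩ := h.bounded
  refine mem_carrier_of_approx fun N =>
    ⟨_, h.replaceOn_mem_of_finite hz hx (Finset.Icc (-(N + M : ℤ)) (N + M)), fun m hm => ?_⟩
  rw [abs_le] at hm
  by_cases hc : ∃ rk, Covers R x m rk
  · obtain ⟨⟨r, l⟩, ⟨c1, c2, c3, c4⟩⟩ := hc
    have hl := h.length_eq r c1
    have := hM r c1
    dsimp only at c3 c4
    exact (h.occursAt_replaceOn hz _ hx c1 c2 (by simp; omega)).agree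
      (h.occursAt_replaceOn hz _ hx c1 c2 trivial) c3 (by rw [← hl]; exact c4)
  · rw [replaceOn_of_not, replaceOn_of_not]
    · exact fun r hr l hl ho hh => hc ⟨(r, l), ⟨hr, ho, hh.1, hh.2⟩⟩
    · exact fun r hr l hl ho hh => hc ⟨(r, l), ⟨hr, ho, hh.1, hh.2⟩⟩

/-- The rules permute their words, so a word of the system that occurs in the image must have been
put there by its own rule. Otherwise all replaced words meet it only in copies of `z`; then it was
already present in `x` and would have been replaced itself. -/
theorem replaceOn_symm (hz : IsMarker X z) (h : RuleOK X z R) {x : ℤ → A}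
    (hx : x ∈ X.carrier) :
    replaceOn (Prod.swap '' R) Set.univ (replaceOn R Set.univ x) = x := by
  set y := replaceOn R Set.univ x with hy
  have hyX : y ∈ X.carrier := h.replaceOn_mem hz hx
  have hp := hz.length_pos
  funext i
  by_cases hc : ∃ rk, Covers (Prod.swap '' R) y i rk
  · obtain ⟨⟨_, l⟩, ⟨⟨r, hr, rfl⟩, c2, c3, c4⟩⟩ := hc
    dsimp only [Prod.fst_swap] at c2 c3 c4
    have hl := h.length_eq r hr
    obtain ⟨w, hw⟩ := h.exists_next r hr
    have Ey := h.occursAt_ends hw c2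
    suffices hx' : OccursAt x r.1 l by
      have := h.symm.occursAt_replaceOn hz Set.univ hyX (r := r.swap) ⟨r, hr, rfl⟩ c2 trivial
      exact this.agree hx' c3 (by simp [hl]; exact c4)
    by_contra hne
    have hsep : ∀ s ∈ R, ∀ k, OccursAt x s.1 k → l + r.1.length ≤ k + z.length ∨
        k + s.1.length ≤ l + z.length := by
      intro s hs k hk
      obtain ⟨v, hv⟩ := h.exists_next s hs
      have hls := h.length_eq s hs
      have hsy := h.occursAt_replaceOn hz Set.univ hx hs hk trivial
      rcases h.overlap y hyX _ hw _ hv l k c2 hsy with ⟨rfl, e⟩ | h' | h'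
      · have : r = s := Prod.ext (h.injective _ _ r.2 hr (by
          dsimp only at e; rw [e]; exact hs)) e
        subst this
        exact absurd hk hne
      · left; dsimp only at h'; omega
      · right; dsimp only at h'; omega
    have hyx : ∀ m, l ≤ m → m < l + r.2.length → x m = y m := by
      intro m h1 h2
      by_cases hc : ∃ rk, Covers R x m rk
      · obtain ⟨⟨s, k⟩, ⟨c1, c2, c3, c4⟩⟩ := hc
        have E1 := h.occursAt_ends c1 c2
        have E2 := h.occursAt_ends_right c1 (h.occursAt_replaceOn hz Set.univ hx c1 c2 trivial)
        dsimp only at c3 c4 E1 E2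
        rcases hsep s c1 k c2 with h' | h'
        · exact E1.2.1.agree E2.1 c3 (by omega)
        · exact E1.2.2.agree E2.2 (by omega) (by omega)
      · exact (replaceOn_of_not _ fun r hr l hl ho hh => hc ⟨(r, l), ⟨hr, ho, hh.1, hh.2⟩⟩).symm
    -- Now `r.2` occurs in `x` too and is replaced by `w`; hence `r.2 = w`, and injectivity of the
    -- rules gives `r.1 = r.2`, against `hne`.
    have hxl := c2.congr hyx
    have O := h.occursAt_replaceOn hz Set.univ hx hw hxl trivial
    have e : r.2 = w := c2.word_eq O (by have := h.length_eq _ hw; exact this)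
    have : r = (r.2, w) := Prod.ext (h.injective _ _ w (by
      have : (r.1, r.2) ∈ R := hr
      rwa [← e]) hw) e
    exact hne (by rw [this]; exact hxl)
  · rw [replaceOn_of_not, hy, replaceOn_of_not]
    · intro r hr l hl ho hh
      have hlr := h.length_eq r hr
      exact hc ⟨(r.swap, l), ⟨r, hr, rfl⟩, h.occursAt_replaceOn hz Set.univ hx hr ho trivial,
        hh.1, by dsimp; rw [← hlr]; exact hh.2⟩
    · exact fun r hr l hl ho hh => hc ⟨(r, l), ⟨hr, ho, hh.1, hh.2⟩⟩

theorem symm_symm_image {A : Type*} (R : Set (List A × List A)) : Prod.swap '' (Prod.swap '' R) = R := by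
  rw [← Set.image_comp]; simp

/-- The inverse is the replacement by the reversed rules, and the bound on the lengths of the words
gives locality. -/
theorem existsUnique [DiscreteTopology A] [Finite A] (hz : IsMarker X z) (h : RuleOK X z R) :
    ∃! F : Aut X, Replaces R F.1 := by
  let F : Equiv.Perm X.carrier :=
    { toFun := fun x => ⟨replaceOn R Set.univ x.1, h.replaceOn_mem hz x.2⟩
      invFun := fun x => ⟨replaceOn (Prod.swap '' R) Set.univ x.1, h.symm.replaceOn_mem hz x.2⟩
      left_inv := fun x => Subtype.ext (h.replaceOn_symm hz x.2)
      right_inv := fun x => Subtype.ext (by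
        have := h.symm.replaceOn_symm hz x.2
        rwa [symm_symm_image] at this) }
  have hF : Replaces R F := fun x =>
    ⟨fun r hr k hk => h.occursAt_replaceOn hz _ x.2 hr hk trivial,
      fun i hi => replaceOn_of_not _ fun r hr k _ hk => hi r hr k hk⟩
  have hloc : IsMorphism X X F := by
    obtain ⟨M, hM⟩ := h.bounded
    refine IsMorphism.of_locality M fun x y i j hxy => ?_
    by_cases hc : ∃ rk, Covers R x.1 i rk
    · obtain ⟨⟨r, k⟩, ⟨c1, c2, c3, c4⟩⟩ := hc
      dsimp only at c2 c3 c4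
      have hl := h.length_eq r c1
      have hm := hM r c1
      have hy : OccursAt y.1 r.1 (k + (j - i)) := by
        intro t ht
        rw [← c2 t ht]
        have := hxy (k + t - i) (by rw [abs_le]; omega)
        rw [show i + (k + t - i) = k + t by ring, show j + (k + t - i) = k + (j - i) + t by ring]
          at this
        exact this.symm
      rw [((hF x).1 r c1 k c2).apply c3 (by omega),
        ((hF y).1 r c1 _ hy).apply (m := j) (by omega) (by omega)]
      congr 1
      omega
    · have hcy : ¬ ∃ rk, Covers R y.1 j rk := by
        rintro ⟨⟨r, k⟩, ⟨c1, c2, c3, c4⟩⟩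
        dsimp only at c2 c3 c4
        have hm := hM r c1
        refine hc ⟨(r, k - j + i), c1, ?_, by dsimp; omega, by dsimp; omega⟩
        intro t ht
        dsimp only at ht ⊢
        rw [← c2 t ht]
        have := hxy (k + t - j) (by rw [abs_le]; omega)
        rw [show i + (k + t - j) = k - j + i + t by ring, show j + (k + t - j) = k + t by ring]
          at this
        exact this
      rw [(hF x).2 i fun r hr l ho hh => hc ⟨(r, l), ⟨hr, ho, hh.1, hh.2⟩⟩,
        (hF y).2 j fun r hr l ho hh => hcy ⟨(r, l), ⟨hr, ho, hh.1, hh.2⟩⟩]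
      simpa using hxy 0 (by simp)
  refine ⟨⟨F, hloc⟩, hF, fun F' hF' => ?_⟩
  exact Subtype.ext (Equiv.coe_fn_injective (Replaces.eq h.length_eq hF' hF))

end RuleOK
end Rules

/-! ### Points with zero tails encoded by lists -/

section Forms

variable {A : Type*}

/-- The word `z^a₁ w₁ z^a₂ w₂ ⋯` of the list `[(a₁, w₁), (a₂, w₂), …]`. -/
def flat (z : List A) (l : List (ℕ × List A)) : List A :=
  (l.map fun e => wpow z e.1 ++ e.2).flatten

@[simp] theorem flat_nil (z : List A) : flat z [] = [] := rfl

@[simp] theorem flat_cons (z : List A) (e : ℕ × List A) (l : List (ℕ × List A)) :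
    flat z (e :: l) = wpow z e.1 ++ e.2 ++ flat z l := rfl

@[simp] theorem flat_append (z : List A) (l l' : List (ℕ × List A)) :
    flat z (l ++ l') = flat z l ++ flat z l' := by
  simp [flat]

/-- To the left of `s`, the configuration `x` is a power of `z`. -/
def LTail (z : List A) (x : ℤ → A) (s : ℤ) : Prop := ∀ t : ℕ, OccursAt x z (s - (t + 1) * z.length)

/-- From `e` on, the configuration `x` is a power of `z`. -/
def RTail (z : List A) (x : ℤ → A) (e : ℤ) : Prop := ∀ t : ℕ, OccursAt x z (e + t * z.length)

/-- From `s` on, the configuration `x` is `z^a₁ w₁ z^a₂ w₂ ⋯ z^∞`. -/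
def RForm (z : List A) (x : ℤ → A) (s : ℤ) (l : List (ℕ × List A)) : Prop :=
  OccursAt x (flat z l) s ∧ RTail z x (s + (flat z l).length)

/-- The configuration `x` is `^∞z.z^a₁ w₁ z^a₂ w₂ ⋯ z^∞`, where the dot is at position `s`. -/
def Form (z : List A) (x : ℤ → A) (s : ℤ) (l : List (ℕ × List A)) : Prop :=
  LTail z x s ∧ RForm z x s l

/-- Insert `k` copies of `z` at the beginning. -/
def addHead (k : ℕ) : List (ℕ × List A) → List (ℕ × List A)
  | [] => []
  | (a, w) :: t => (a + k, w) :: t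

@[simp] theorem addHead_nil (k : ℕ) : addHead k ([] : List (ℕ × List A)) = [] := rfl
@[simp] theorem addHead_cons (k a : ℕ) (w : List A) (t : List (ℕ × List A)) :
    addHead k ((a, w) :: t) = (a + k, w) :: t := rfl

@[simp] theorem addHead_zero (l : List (ℕ × List A)) : addHead 0 l = l := by
  cases l <;> rfl

theorem addHead_addHead (k j : ℕ) (l : List (ℕ × List A)) :
    addHead k (addHead j l) = addHead (j + k) l := by
  rcases l with - | ⟨⟨a, w⟩, t⟩ <;> simp [add_assoc]

theorem addHead_append (k : ℕ) {l : List (ℕ × List A)} (hl : l ≠ []) (l' : List (ℕ × List A)) :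
    addHead k (l ++ l') = addHead k l ++ l' := by
  rcases l with - | ⟨⟨a, w⟩, t⟩ <;> simp at *

variable {z : List A} {x y : ℤ → A} {s : ℤ}

theorem RTail.occursAt_of {e : ℤ} (h : RTail z x e) {i : ℤ} (t : ℕ) (hi : i = e + t * z.length) :
    OccursAt x z i := hi ▸ h t

theorem LTail.occursAt_of {e : ℤ} (h : LTail z x e) {i : ℤ} (t : ℕ)
    (hi : i + (t + 1) * z.length = e) : OccursAt x z i := by
  have := h t
  rwa [← hi, add_sub_cancel_right] at this

theorem RTail.add {e : ℤ} (h : RTail z x e) (k : ℕ) : RTail z x (e + k * z.length) := fun t =>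
  h.occursAt_of (t + k) (by push_cast; ring)

theorem LTail.sub {e : ℤ} (h : LTail z x e) (k : ℕ) : LTail z x (e - k * z.length) := fun t =>
  h.occursAt_of (t + k) (by push_cast; ring)

theorem rForm_nil : RForm z x s [] ↔ RTail z x s := by
  simp [RForm, occursAt_nil]

theorem rForm_append {l l' : List (ℕ × List A)} : RForm z x s (l ++ l') ↔
    OccursAt x (flat z l) s ∧ RForm z x (s + (flat z l).length) l' := by
  simp only [RForm, flat_append, occursAt_append, List.length_append, Nat.cast_add, and_assoc,
    add_assoc]

theorem rForm_cons {a : ℕ} {w : List A} {t : List (ℕ × List A)} : RForm z x s ((a, w) :: t) ↔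
    OccursAt x (wpow z a) s ∧ OccursAt x w (s + a * z.length) ∧
      RForm z x (s + a * z.length + w.length) t := by
  rw [show (a, w) :: t = [(a, w)] ++ t from rfl, rForm_append]
  simp [occursAt_append, and_assoc, add_assoc]

theorem rForm_pad {a k : ℕ} {w : List A} {t : List (ℕ × List A)} :
    RForm z x s ((a + k, w) :: t) ↔
      OccursAt x (wpow z k) s ∧ RForm z x (s + k * z.length) ((a, w) :: t) := by
  rw [rForm_cons, rForm_cons, add_comm a k, wpow_add, occursAt_append]
  simp only [length_wpow, Nat.cast_mul, Nat.cast_add, and_assoc, add_mul, add_assoc]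

theorem RForm.congr {l : List (ℕ × List A)} (h : RForm z x s l) (hxy : ∀ m, s ≤ m → y m = x m) :
    RForm z y s l :=
  ⟨h.1.congr fun m hm _ => hxy m hm, fun t => (h.2 t).congr fun m hm _ => hxy m (by
    have : 0 ≤ (t : ℤ) * z.length := by positivity
    omega)⟩

theorem LTail.congr (h : LTail z x s) (hxy : ∀ m, m < s → y m = x m) : LTail z y s := fun t =>
  (h t).congr fun m _ hm => hxy m (by
    have : 0 ≤ (t : ℤ) * z.length := by positivity
    rw [add_mul] at hm
    omega)

theorem RTail.agree (hp : 0 < z.length) (h : RTail z x s) (h' : RTail z y s) {m : ℤ}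
    (hm : s ≤ m) : x m = y m := by
  have e := Int.emod_add_mul_ediv (m - s) z.length
  have h1 := Int.emod_nonneg (m - s) (b := z.length) (by omega)
  have h2 := Int.emod_lt_of_pos (m - s) (b := z.length) (by omega)
  have h3 : 0 ≤ (m - s) / z.length := Int.ediv_nonneg (by omega) (by omega)
  have e' : (((m - s) / z.length).toNat : ℤ) * z.length = z.length * ((m - s) / z.length) := by
    rw [Int.toNat_of_nonneg h3, mul_comm]
  exact (h _).agree (h' ((m - s) / z.length).toNat) (by omega) (by omega)

theorem LTail.agree (hp : 0 < z.length) (h : LTail z x s) (h' : LTail z y s) {m : ℤ}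
    (hm : m < s) : x m = y m := by
  have e := Int.emod_add_mul_ediv (s - 1 - m) z.length
  have h1 := Int.emod_nonneg (s - 1 - m) (b := z.length) (by omega)
  have h2 := Int.emod_lt_of_pos (s - 1 - m) (b := z.length) (by omega)
  have h3 : 0 ≤ (s - 1 - m) / z.length := Int.ediv_nonneg (by omega) (by omega)
  have e' : (((s - 1 - m) / z.length).toNat : ℤ) * z.length = z.length * ((s - 1 - m) / z.length) := by
    rw [Int.toNat_of_nonneg h3, mul_comm]
  refine (h _).agree (h' ((s - 1 - m) / z.length).toNat) ?_ ?_
  · rw [add_mul]; omega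
  · rw [add_mul]; omega

theorem RForm.agree (hp : 0 < z.length) {l : List (ℕ × List A)} (h : RForm z x s l)
    (h' : RForm z y s l) {m : ℤ} (hm : s ≤ m) : x m = y m := by
  by_cases hlt : m < s + (flat z l).length
  · exact h.1.agree h'.1 hm hlt
  · exact RTail.agree hp h.2 h'.2 (by omega)

theorem Form.ext (hp : 0 < z.length) {l : List (ℕ × List A)} (h : Form z x s l)
    (h' : Form z y s l) : x = y := by
  funext m
  by_cases hm : s ≤ m
  · exact h.2.agree hp h'.2 hm
  · exact LTail.agree hp h.1 h'.1 (by omega)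

/-- The reference position may be moved over copies of `z` in the left tail, so the first exponent
can be made as large as needed. -/
theorem Form.pad {l : List (ℕ × List A)} (h : Form z x s l) (k : ℕ) :
    Form z x (s - k * z.length) (addHead k l) := by
  have hw : OccursAt x (wpow z k) (s - k * z.length) := by
    rw [occursAt_wpow_iff]
    intro t ht
    refine h.1.occursAt_of (k - 1 - t) ?_
    have : ((k - 1 - t : ℕ) : ℤ) = k - 1 - t := by omega
    rw [this]; ring
  refine ⟨h.1.sub k, ?_⟩
  rcases l with - | ⟨⟨a, w⟩, t⟩
  · rw [addHead_nil, rForm_nil]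
    intro t
    by_cases ht : t < k
    · exact (occursAt_wpow_iff.1 hw) t ht
    · refine RTail.occursAt_of (rForm_nil.1 h.2) (t - k) ?_
      rw [Nat.cast_sub (by omega)]; ring
  · rw [addHead_cons, rForm_pad]
    exact ⟨hw, by simpa using h.2⟩

theorem form_shift {l : List (ℕ × List A)} {j : ℤ} :
    Form z (shift j x) s l ↔ Form z x (s + j) l := by
  unfold Form LTail RForm RTail
  simp only [occursAt_shift]
  have e1 : ∀ t : ℤ, j + (s - (t + 1) * z.length) = s + j - (t + 1) * z.length := fun t => by ring
  have e2 : ∀ t : ℤ, j + (s + (flat z l).length + t * z.length) =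
    s + j + (flat z l).length + t * z.length := fun t => by ring
  simp only [e1, e2, add_comm j s]

theorem RTail.not_gapAt (hp : 0 < z.length) (h : RTail z x s) {a : ℕ} {w : List A} :
    ¬ GapAt z x s a w := by
  intro hg
  have h1 := h a
  obtain ⟨b0, b1, b2, b3, b4, b5⟩ := hg
  have := List.length_pos_iff.2 b4
  exact b5 _ (b2.mem le_rfl (by omega)) (h1.mem le_rfl (by omega))

end Forms

/-! ### Existence, uniqueness and density of the encoded points -/

section Valid

variable {A : Type*} [TopologicalSpace A] {X : Subshift A ℤ} {z : List A} {x y : ℤ → A} {s : ℤ}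

/-- `w` is a nonempty word without symbols of `z` such that `z w z` is in the language. -/
def IsGap (X : Subshift A ℤ) (z w : List A) : Prop :=
  w ≠ [] ∧ (∀ a ∈ w, a ∉ z) ∧ z ++ w ++ z ∈ language X

/-- The exponents are positive and the words are gaps. -/
def Valid (X : Subshift A ℤ) (z : List A) (l : List (ℕ × List A)) : Prop :=
  ∀ e ∈ l, 0 < e.1 ∧ IsGap X z e.2

@[simp] theorem valid_nil : Valid X z [] := by simp [Valid]

@[simp] theorem valid_cons {e : ℕ × List A} {l : List (ℕ × List A)} :
    Valid X z (e :: l) ↔ (0 < e.1 ∧ IsGap X z e.2) ∧ Valid X z l := by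
  simp [Valid]

@[simp] theorem valid_append {l l' : List (ℕ × List A)} :
    Valid X z (l ++ l') ↔ Valid X z l ∧ Valid X z l' := by
  simp only [Valid, List.mem_append]
  exact ⟨fun h => ⟨fun e he => h e (Or.inl he), fun e he => h e (Or.inr he)⟩,
    fun h e he => he.elim (h.1 e) (h.2 e)⟩

theorem Valid.addHead {l : List (ℕ × List A)} (h : Valid X z l) (k : ℕ) :
    Valid X z (addHead k l) := by
  rcases l with - | ⟨⟨a, w⟩, t⟩
  · simp
  · simp only [addHead_cons, valid_cons] at h ⊢
    exact ⟨⟨by omega, h.1.2⟩, h.2⟩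

theorem RForm.occursAt_head {l : List (ℕ × List A)} (hl : Valid X z l) (h : RForm z x s l) :
    OccursAt x z s := by
  rcases l with - | ⟨⟨a, w⟩, t⟩
  · simpa using (rForm_nil.1 h) 0
  · have := (occursAt_wpow_iff.1 (rForm_cons.1 h).1) 0 (valid_cons.1 hl).1.1
    simpa using this

theorem RForm.gapAt {a : ℕ} {w : List A} {t : List (ℕ × List A)} (hl : Valid X z ((a, w) :: t))
    (h : RForm z x s ((a, w) :: t)) : GapAt z x s a w := by
  rw [rForm_cons] at h
  rw [valid_cons] at hl
  exact ⟨hl.1.1, h.1, h.2.1, h.2.2.occursAt_head hl.2, hl.1.2.1, hl.1.2.2.1⟩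

/-- The first gap to the right of `s`, and with it the number of copies of `z` before it, is visible
in `x`; the entries are recovered one by one. -/
theorem RForm.unique (hp : 0 < z.length) {l l' : List (ℕ × List A)} (hl : Valid X z l)
    (hl' : Valid X z l') (h : RForm z x s l) (h' : RForm z x s l') : l = l' := by
  induction l generalizing s l' with
  | nil =>
    rcases l' with - | ⟨⟨a, w⟩, t⟩
    · rfl
    · exact absurd (h'.gapAt hl') ((rForm_nil.1 h).not_gapAt hp)
  | cons e l ih =>
    obtain ⟨a, w⟩ := e
    rcases l' with - | ⟨⟨b, v⟩, t⟩
    · exact absurd (h.gapAt hl) ((rForm_nil.1 h').not_gapAt hp)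
    · have g := h.gapAt hl
      have g' := h'.gapAt hl'
      have hw := List.length_pos_iff.2 g.2.2.2.2.1
      have hv := List.length_pos_iff.2 g'.2.2.2.2.1
      have h1 : 0 ≤ (a : ℤ) * z.length := by positivity
      have h2 : 0 ≤ (b : ℤ) * z.length := by positivity
      obtain ⟨e, rfl⟩ := g.unique hp g' (m := s) le_rfl (by omega) le_rfl (by omega)
      have : a = b := by
        have : (a : ℤ) * z.length = b * z.length := by omega
        have := mul_right_cancel₀ (by omega : (z.length : ℤ) ≠ 0) this
        omega
      subst this
      rw [ih (valid_cons.1 hl).2 (valid_cons.1 hl').2 (rForm_cons.1 h).2.2 (rForm_cons.1 h').2.2]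

theorem IsMarker.exists_periodic (hz : IsMarker X z) (s : ℤ) :
    ∃ x ∈ X.carrier, ∀ t : ℤ, OccursAt x z (s + t * z.length) := by
  obtain ⟨x, hx, h⟩ := hz.periodic
  refine ⟨shift (-s) x, shift_mem hx _, fun t => ?_⟩
  rw [occursAt_shift]
  simpa using h t

/-- Built from the right end: each gap comes from a point containing `z w z`, and the pieces are
glued at copies of `z`. Gaps and exponents can therefore be prescribed independently. -/
theorem exists_rForm (hz : IsMarker X z) {l : List (ℕ × List A)} (hl : Valid X z l) (s : ℤ) :
    ∃ x ∈ X.carrier, Form z x s l := by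
  induction l generalizing s with
  | nil =>
    obtain ⟨x, hx, h⟩ := hz.exists_periodic s
    refine ⟨x, hx, fun t => ?_, rForm_nil.2 fun t => h t⟩
    convert h (-(t + 1)) using 1
    ring
  | cons e l ih =>
    obtain ⟨a, w⟩ := e
    rw [valid_cons] at hl
    obtain ⟨x, hx, h⟩ := hz.exists_periodic s
    obtain ⟨y, hy, h'⟩ := ih hl.2 (s + a * z.length + w.length)
    obtain ⟨v, hv, hv'⟩ := exists_occursAt hl.1.2.2.2 (s + (a - 1) * z.length)
    rw [occursAt_append, occursAt_append] at hv'
    have e1 : s + (a - 1) * z.length + z.length = s + a * z.length := by ring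
    have e2 : s + (a - 1) * z.length + ((z ++ w).length : ℕ) = s + a * z.length + w.length := by
      simp; ring
    rw [e1, e2] at hv'
    have hp := hz.length_pos
    have g1 := glue_mem hz.sync hx hv (h (a - 1)) hv'.1.1
    rw [e1] at g1
    have g2 := glue_mem hz.sync g1 hy (i := s + a * z.length + w.length)
      (hv'.2.congr fun m h1 h2 => glue_right (by omega)) (h'.2.occursAt_head hl.2)
    have hap : 0 ≤ (a : ℤ) * z.length := by positivity
    have hyz := h'.2.occursAt_head hl.2
    have left : ∀ m, m < s + a * z.length → glue (s + a * z.length + w.length + z.length)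
        (glue (s + a * z.length) x v) y m = x m := fun m hm => by
      rw [glue_left (by omega), glue_left (by omega)]
    refine ⟨_, g2, ?_, rForm_cons.2 ⟨?_, ?_, ?_⟩⟩
    · refine LTail.congr (x := x) (fun t => ?_) fun m hm => left m (by omega)
      convert h (-(t + 1)) using 1
      ring
    · refine OccursAt.congr (x := x) ?_ fun m _ hm => left m ?_
      · rw [occursAt_wpow_iff]
        exact fun t _ => h t
      · rw [length_wpow] at hm
        exact_mod_cast hm
    · refine hv'.1.2.congr fun m h1 h2 => ?_
      dsimp only at h2
      rw [glue_left (by omega), glue_right (by omega)]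
    · refine h'.2.congr fun m hm => ?_
      by_cases h3 : m < s + a * z.length + w.length + z.length
      · rw [glue_left h3, glue_right (by omega)]
        exact hv'.2.agree hyz hm h3
      · rw [glue_right (by omega)]

theorem flat_mem_language (hz : IsMarker X z) {l : List (ℕ × List A)} (hl : Valid X z l) (k : ℕ) :
    flat z l ++ wpow z k ∈ language X := by
  obtain ⟨x, hx, h⟩ := exists_rForm hz hl 0
  refine mem_language_of hx (i := 0) (occursAt_append.2 ⟨h.2.1, ?_⟩)
  rw [occursAt_wpow_iff]
  exact fun t _ => h.2.2 t

/-- Induction on the distance to the periodic tail: remove either one copy of `z` or one copy of `z`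
with the gap behind it. -/
theorem exists_rForm_of_rTail (hz : IsMarker X z) (hx : x ∈ X.carrier) (d : ℕ) (s : ℤ)
    (hs : OccursAt x z s) (h : RTail z x (s + d)) :
    ∃ l, Valid X z l ∧ RForm z x s l := by
  have hp := hz.length_pos
  induction d using Nat.strong_induction_on generalizing s with
  | _ d ih =>
    rcases Nat.eq_zero_or_pos d with rfl | hd
    · exact ⟨[], valid_nil, rForm_nil.2 (by simpa using h)⟩
    have h0 : OccursAt x z (s + d) := by simpa using h 0
    by_cases hm : x (s + z.length) ∈ z
    · have h1 := hz.occursAt_next hx hs hm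
      have hle : z.length ≤ d := by
        rcases hz.occursAt_sep hs h0 with h | h | h <;> omega
      obtain ⟨l, hl, hl'⟩ := ih (d - z.length) (by omega) (s + z.length) h1 (by
        convert h using 1; omega)
      rcases l with - | ⟨⟨a, w⟩, t⟩
      · refine ⟨[], valid_nil, rForm_nil.2 fun t => ?_⟩
        rcases t with - | t
        · simpa using hs
        · exact (rForm_nil.1 hl').occursAt_of t (by push_cast; ring)
      · refine ⟨(a + 1, w) :: t, ?_, ?_⟩
        · exact hl.addHead 1
        · rw [rForm_pad]
          exact ⟨by simpa using hs, by simpa using hl'⟩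
    · have hle : s + z.length < s + d := by
        rcases hz.occursAt_sep hs h0 with h' | h' | h'
        · omega
        · rcases h'.eq_or_lt with h' | h'
          · refine absurd (h0.mem (m := s + z.length) (by omega) (by omega)) hm
          · exact h'
        · omega
      have hex : ∃ k : ℕ, x (s + z.length + k) ∈ z :=
        ⟨d - z.length, h0.mem (by omega) (by omega)⟩
      classical
      -- The gap ends where a symbol of `z` appears again. That symbol begins a copy of `z`, as an
      -- earlier beginning would lie in the gap or overlap the copy at `s`.
      let k := Nat.find hex
      have hk : x (s + z.length + k) ∈ z := Nat.find_spec hex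
      have hk' : ∀ j < k, x (s + z.length + j) ∉ z := fun j hj => Nat.find_min hex hj
      have hk0 : 0 < k := by
        by_contra! h0
        apply hm
        convert hk using 2
        omega
      have hkd : k ≤ d - z.length := Nat.find_min' hex (h0.mem (by omega) (by omega))
      have hzk : OccursAt x z (s + z.length + k) := by
        obtain ⟨i, hi, h1, h2⟩ := hz.exists_occursAt_of_mem hx hk
        rcases h1.eq_or_lt with rfl | h1
        · exact hi
        · exfalso
          by_cases h3 : s + z.length ≤ i
          · refine hk' (i - s - z.length).toNat (by omega) ?_
            rw [show s + z.length + ((i - s - z.length).toNat : ℤ) = i by omega]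
            exact hi.mem le_rfl (by omega)
          · have := hz.occursAt_unique hs hi (m := max i s)
            have h5 := this (by omega) (by omega) (by omega) (by omega)
            omega
      obtain ⟨l, hl, hl'⟩ := ih (d - z.length - k) (by omega) _ hzk (by convert h using 1; omega)
      refine ⟨(1, factor x (s + z.length) k) :: l, valid_cons.2 ⟨⟨one_pos, ?_, ?_, ?_⟩, hl⟩, ?_⟩
      · rw [← List.length_pos_iff, length_factor]; exact hk0
      · intro a ha
        obtain ⟨m, h1, h2, rfl⟩ := mem_factor.1 ha
        convert hk' (m - s - z.length).toNat (by omega) using 3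
        omega
      · refine mem_language_of hx (i := s) ?_
        rw [occursAt_append, occursAt_append]
        refine ⟨⟨hs, occursAt_factor _ _ _⟩, ?_⟩
        convert hzk using 1
        simp [add_assoc]
      · rw [rForm_cons]
        refine ⟨by simpa using hs, by simpa using occursAt_factor _ _ _, by simpa using hl'⟩

/-- Transitivity embeds the window between two copies of `z`, and gluing with `z^ℤ` at these two
copies makes the tails periodic. -/
theorem exists_form_agree (hz : IsMarker X z) (ht : IsTransitive X) (hx : x ∈ X.carrier) (i : ℤ)
    (n : ℕ) : ∃ y ∈ X.carrier, (∃ s l, Valid X z l ∧ Form z y s l) ∧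
      ∀ m, i ≤ m → m < i + n → y m = x m := by
  have hu : factor x i n ∈ language X := mem_language_of hx (occursAt_factor x i n)
  obtain ⟨u, _, h1⟩ := ht z hz.sync.1 _ hu
  obtain ⟨v, _, h2⟩ := ht _ h1 z hz.sync.1
  obtain ⟨w, hw, h⟩ := exists_occursAt h2 (i - u.length - z.length)
  simp only [occursAt_append] at h
  obtain ⟨⟨⟨⟨a1, a2⟩, a3⟩, a4⟩, a5⟩ := h
  simp only [List.length_append, Nat.cast_add, length_factor] at a2 a3 a4 a5
  set s := i - u.length - z.length with hs
  set e := s + (z.length + u.length + n + v.length) with he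
  have a5 : OccursAt w z e := a5
  obtain ⟨x0, hx0, h0⟩ := hz.exists_periodic s
  obtain ⟨x1, hx1, h1⟩ := hz.exists_periodic e
  have hp := hz.length_pos
  have g1 := glue_mem hz.sync hx0 hw (i := s) (by simpa using h0 0) a1
  have g2 := glue_mem hz.sync g1 hx1 (i := e)
    (a5.congr fun m h1 h2 => glue_right (by omega)) (by simpa using h1 0)
  have hl : LTail z (glue (e + z.length) (glue (s + z.length) x0 w) x1) s := by
    refine LTail.congr (x := x0) (fun t => ?_) fun m hm => ?_
    · convert h0 (-(t + 1)) using 1; ring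
    · rw [glue_left (by omega), glue_left (by omega)]
  have hr : RTail z (glue (e + z.length) (glue (s + z.length) x0 w) x1) e := by
    have : RForm z x1 e [] := rForm_nil.2 fun t => h1 t
    refine rForm_nil.1 (this.congr fun m hm => ?_)
    by_cases h3 : m < e + z.length
    · rw [glue_left h3, glue_right (by omega)]
      exact a5.agree (by simpa using h1 0) hm h3
    · rw [glue_right (by omega)]
  have hzs : OccursAt (glue (e + z.length) (glue (s + z.length) x0 w) x1) z s := by
    refine OccursAt.congr (x := x0) (by simpa using h0 0) fun m h1 h2 => ?_
    rw [glue_left (by omega), glue_left (by omega)]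
  obtain ⟨l, hl1, hl2⟩ := exists_rForm_of_rTail hz g2 (z.length + u.length + n + v.length) s hzs
    (by exact_mod_cast hr)
  refine ⟨_, g2, ⟨s, l, hl1, hl, hl2⟩, fun m h1 h2 => ?_⟩
  rw [glue_left (by omega), glue_right (by omega)]
  rw [show s + (z.length + u.length : ℤ) = i by omega] at a3
  exact a3.agree (occursAt_factor x i n) h1 (by simpa using h2)

end Valid

/-! ### Relative positions of gaps -/

section Gaps

variable {A : Type*} {z : List A} {x : ℤ → A}

theorem gapAt_of_occursAt {k : ℤ} {c : ℕ} {g : List A}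
    (h : OccursAt x (wpow z c ++ g ++ z) k) (hc : 0 < c) (hg : g ≠ []) (hgz : ∀ a ∈ g, a ∉ z) :
    GapAt z x k c g := by
  rw [occursAt_append, occursAt_append] at h
  refine ⟨hc, h.1.1, by simpa using h.1.2, ?_, hg, hgz⟩
  simpa [add_assoc] using h.2

theorem GapAt.occursAt {k : ℤ} {c : ℕ} {g : List A} (h : GapAt z x k c g) :
    OccursAt x (wpow z c ++ g ++ z) k := by
  rw [occursAt_append, occursAt_append]
  exact ⟨⟨h.2.1, by simpa using h.2.2.1⟩, by simpa [add_assoc] using h.2.2.2.1⟩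

theorem GapAt.length_pos {k : ℤ} {c : ℕ} {g : List A} (h : GapAt z x k c g) : 0 < g.length :=
  List.length_pos_iff.2 h.2.2.2.2.1

theorem GapAt.sep (hp : 0 < z.length) {k i : ℤ} {c a : ℕ} {g w : List A} (h : GapAt z x k c g)
    (h' : GapAt z x i a w) :
    k + c * z.length = i + a * z.length ∧ g = w ∨ k + c * z.length + g.length ≤ i ∨
      i + a * z.length + w.length ≤ k := by
  by_contra! hne
  have h1 : 0 ≤ (a : ℤ) * z.length := by positivity
  have h2 : 0 ≤ (c : ℤ) * z.length := by positivity
  have h3 := h.length_pos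
  have h4 := h'.length_pos
  obtain ⟨e1, e2⟩ := h.unique hp h' (m := max k i) (by omega) (by omega) (by omega) (by omega)
  exact hne.1 e1 e2

theorem GapAt.sep_le (hp : 0 < z.length) {k i : ℤ} {c a : ℕ} {g w : List A} (h : GapAt z x k c g)
    (h' : GapAt z x i a w) (hki : k ≤ i) :
    k + c * z.length = i + a * z.length ∧ g = w ∨ k + c * z.length + g.length ≤ i := by
  have h1 : 0 ≤ (a : ℤ) * z.length := by positivity
  have h4 := h'.length_pos
  rcases h.sep hp h' with h | h | h
  · exact Or.inl h
  · exact Or.inr h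
  · omega

/-- A run of copies of `z` which begins before the first gap after `i` ends before that gap. -/
theorem GapAt.run_le {k i : ℤ} {n a : ℕ} {w : List A}
    (h' : GapAt z x i a w) (h : OccursAt x (wpow z n) k) (hki : k ≤ i) :
    k + n * z.length ≤ i + a * z.length := by
  by_contra! hlt
  have h1 : 0 ≤ (a : ℤ) * z.length := by positivity
  have := h'.length_pos
  exact h'.2.2.2.2.2 _ (h'.2.2.1.mem le_rfl (by omega)) (mem_of_mem_wpow
    (h.mem (m := i + a * z.length) (by omega) (by simpa using hlt)))

theorem GapAt.eq_of_pos (hp : 0 < z.length) {k i : ℤ} {c a : ℕ} {g w : List A}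
    (h : GapAt z x k c g) (h' : GapAt z x i a w) (e : k + c * z.length = i + a * z.length) :
    g = w := by
  have h1 : 0 ≤ (a : ℤ) * z.length := by positivity
  have h2 : 0 ≤ (c : ℤ) * z.length := by positivity
  have h3 := h.length_pos
  have h4 := h'.length_pos
  rcases h.sep hp h' with h | h | h
  · exact h.2
  · omega
  · omega

end Gaps

/-! ### Rules that exchange two words -/

section Swap

variable {A : Type*} [TopologicalSpace A] {X : Subshift A ℤ} {z : List A}

/-- By symmetry it suffices to compare an occurrence with one that does not start before it. -/
theorem overlap_of_le {R : Set (List A × List A)}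
    (H : ∀ x ∈ X.carrier, ∀ r ∈ R, ∀ s ∈ R, ∀ k l : ℤ, k ≤ l → OccursAt x r.1 k →
      OccursAt x s.1 l → k = l ∧ r.1 = s.1 ∨ k + r.1.length ≤ l + z.length) :
    ∀ x ∈ X.carrier, ∀ r ∈ R, ∀ s ∈ R, ∀ k l, OccursAt x r.1 k → OccursAt x s.1 l →
      k = l ∧ r.1 = s.1 ∨ k + r.1.length ≤ l + z.length ∨ l + s.1.length ≤ k + z.length := by
  intro x hx r hr s hs k l hk hl
  rcases le_total k l with h | h
  · rcases H x hx r hr s hs k l h hk hl with h | h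
    · exact Or.inl h
    · exact Or.inr (Or.inl h)
  · rcases H x hx s hs r hr l k h hl hk with h | h
    · exact Or.inl ⟨h.1.symm, h.2.symm⟩
    · exact Or.inr (Or.inr h)

theorem mem_swapRule {A : Type*} {u v : List A} {r : List A × List A} :
    r ∈ swapRule u v ↔ r = (u, v) ∨ r = (v, u) := by
  simp [swapRule]

theorem ruleOK_swap {u v : List A} (hl : u.length = v.length) (hu : ∃ w, u = z ++ w ++ z)
    (hv : ∃ w, v = z ++ w ++ z) (huX : u ∈ language X) (hvX : v ∈ language X)
    (H : ∀ x ∈ X.carrier, ∀ r, r = u ∨ r = v → ∀ s, s = u ∨ s = v → ∀ k l : ℤ, k ≤ l →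
      OccursAt x r k → OccursAt x s l → k = l ∧ r = s ∨ k + r.length ≤ l + z.length) :
    RuleOK X z (swapRule u v) where
  bounded := ⟨u.length, by simp [mem_swapRule, hl]⟩
  length_eq := by simp [mem_swapRule, hl]
  shape := by
    intro r hr
    rcases mem_swapRule.1 hr with rfl | rfl
    exacts [hu, hv]
  mem_language := by
    intro r hr
    rcases mem_swapRule.1 hr with rfl | rfl
    exacts [huX, hvX]
  functional := by
    intro a b c h1 h2
    simp only [mem_swapRule, Prod.mk.injEq] at h1 h2
    rcases h1 with ⟨rfl, rfl⟩ | ⟨rfl, rfl⟩ <;> rcases h2 with ⟨h, rfl⟩ | ⟨h, rfl⟩ <;> simp [h]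
  injective := by
    intro a b c h1 h2
    simp only [mem_swapRule, Prod.mk.injEq] at h1 h2
    rcases h1 with ⟨rfl, rfl⟩ | ⟨rfl, rfl⟩ <;> rcases h2 with ⟨rfl, h⟩ | ⟨rfl, h⟩ <;> simp [h]
  exists_next := by
    intro r hr
    rcases mem_swapRule.1 hr with rfl | rfl
    exacts [⟨u, mem_swapRule.2 (Or.inr rfl)⟩, ⟨v, mem_swapRule.2 (Or.inl rfl)⟩]
  exists_prev := by
    intro r hr
    rcases mem_swapRule.1 hr with rfl | rfl
    exacts [⟨v, mem_swapRule.2 (Or.inr rfl)⟩, ⟨u, mem_swapRule.2 (Or.inl rfl)⟩]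
  overlap := overlap_of_le fun x hx r hr s hs k l hkl => by
    refine H x hx r.1 ?_ s.1 ?_ k l hkl
    · rcases mem_swapRule.1 hr with rfl | rfl <;> simp
    · rcases mem_swapRule.1 hs with rfl | rfl <;> simp

end Swap

/-! ### The rules of the first two glider maps and of the collision map -/

section Pair

variable {A : Type*} [TopologicalSpace A] {X : Subshift A ℤ} {z o : List A}

namespace IsMarkerPair

theorem length_pos (h : IsMarkerPair X z o) : 0 < z.length := h.isMarker.length_pos

theorem isGap_wpow (h : IsMarkerPair X z o) {n : ℕ} (hn : 0 < n) : IsGap X z (wpow o n) := by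
  refine ⟨?_, fun a ha ha' => h.disjoint a ha' (mem_of_mem_wpow ha), h.z_pow_z n⟩
  have := h.two_le
  rw [← List.length_pos_iff, length_wpow]
  positivity

theorem isGap_o (h : IsMarkerPair X z o) : IsGap X z o := by
  simpa using h.isGap_wpow one_pos

theorem isGap_r (h : IsMarkerPair X z o) : IsGap X z (wpow o (z.length + 1)) :=
  h.isGap_wpow (Nat.succ_pos _)

theorem wpow_o_injective (h : IsMarkerPair X z o) {m n : ℕ} (e : wpow o m = wpow o n) : m = n := by
  have := congrArg List.length e
  rw [length_wpow, length_wpow] at this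
  have h2 := h.two_le
  exact Nat.eq_of_mul_eq_mul_right (by omega) this

theorem wpow_ne_o (h : IsMarkerPair X z o) {n : ℕ} (hn : n ≠ 1) : wpow o n ≠ o := by
  intro e
  exact hn (h.wpow_o_injective (e.trans (wpow_one o).symm))

theorem o_ne_r (h : IsMarkerPair X z o) : o ≠ wpow o (z.length + 1) := by
  have := h.length_pos
  exact (h.wpow_ne_o (by omega)).symm

/-- The lengths agree since `|z^q o| = qp + q = |o^(p+1)|`. Each word ends with its only gap and one
copy of `z`, and the gap tells which of the two words it is. -/
theorem ruleOK_P1 (h : IsMarkerPair X z o) : RuleOK X z (ruleP1 z o) := by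
  have hp := h.length_pos
  have e1 : z ++ (wpow z o.length ++ o) ++ z = wpow z (o.length + 1) ++ o ++ z := by
    simp [wpow_succ]
  have e2 : z ++ wpow o (z.length + 1) ++ z = wpow z 1 ++ wpow o (z.length + 1) ++ z := by simp
  refine ruleOK_swap (by simp; ring) ⟨_, rfl⟩ ⟨_, rfl⟩ ?_ h.isGap_r.2.2 ?_
  · rw [e1]
    have := flat_mem_language h.isMarker (l := [(o.length + 1, o)]) (by simp [h.isGap_o]) 1
    simpa using this
  intro x hx r hr s hs k l hkl hk hl
  have key : ∀ r, (r = z ++ (wpow z o.length ++ o) ++ z ∨ r = z ++ wpow o (z.length + 1) ++ z) →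
      ∀ k, OccursAt x r k → ∃ c g, r = wpow z c ++ g ++ z ∧ GapAt z x k c g ∧
        (c = o.length + 1 ∧ g = o ∨ c = 1 ∧ g = wpow o (z.length + 1)) := by
    rintro r (rfl | rfl) k hk
    · rw [e1] at hk ⊢
      exact ⟨_, _, rfl, gapAt_of_occursAt hk (by omega) h.isGap_o.1 h.isGap_o.2.1, Or.inl ⟨rfl, rfl⟩⟩
    · rw [e2] at hk ⊢
      exact ⟨_, _, rfl, gapAt_of_occursAt hk (by omega) h.isGap_r.1 h.isGap_r.2.1, Or.inr ⟨rfl, rfl⟩⟩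
  obtain ⟨c, g, rfl, h1, h2⟩ := key r hr k hk
  obtain ⟨d, f, rfl, h3, h4⟩ := key s hs l hl
  rcases h1.sep_le hp h3 hkl with ⟨h5, rfl⟩ | h5
  · left
    have : c = d := by
      have := h.o_ne_r
      rcases h2 with ⟨rfl, e⟩ | ⟨rfl, e⟩ <;> rcases h4 with ⟨rfl, e'⟩ | ⟨rfl, e'⟩
      · rfl
      · exact absurd (e.symm.trans e') this
      · exact absurd (e'.symm.trans e) this
      · rfl
    subst this
    exact ⟨by omega, rfl⟩
  · right
    simp only [List.length_append, length_wpow, Nat.cast_add, Nat.cast_mul]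
    omega

/-- These words begin with one copy of `z` and their only gap. The run of copies behind it cannot
pass the gap of a later occurrence, which itself needs just one copy, so at most one copy is shared.
-/
theorem ruleOK_P2 (h : IsMarkerPair X z o) : RuleOK X z (ruleP2 z o) := by
  have hp := h.length_pos
  have e2 : z ++ (o ++ wpow z o.length) ++ z = wpow z 1 ++ o ++ wpow z (o.length + 1) := by
    simp [wpow_succ']
  have e1 : z ++ wpow o (z.length + 1) ++ z = wpow z 1 ++ wpow o (z.length + 1) ++ wpow z 1 := by
    simp
  refine ruleOK_swap (by simp; ring) ⟨_, rfl⟩ ⟨_, rfl⟩ h.isGap_r.2.2 ?_ ?_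
  · rw [e2]
    have := flat_mem_language h.isMarker (l := [(1, o)]) (by simp [h.isGap_o]) (o.length + 1)
    simpa using this
  intro x hx r hr s hs k l hkl hk hl
  have key : ∀ r, (r = z ++ wpow o (z.length + 1) ++ z ∨ r = z ++ (o ++ wpow z o.length) ++ z) →
      ∀ k, OccursAt x r k → ∃ c g, r = wpow z 1 ++ g ++ wpow z c ∧ GapAt z x k 1 g ∧
        OccursAt x (wpow z c) (k + 1 * z.length + g.length) ∧
        (c = o.length + 1 ∧ g = o ∨ c = 1 ∧ g = wpow o (z.length + 1)) := by
    rintro r (rfl | rfl) k hk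
    · rw [e1] at hk ⊢
      refine ⟨_, _, rfl, gapAt_of_occursAt (by simpa using hk) (by omega) h.isGap_r.1 h.isGap_r.2.1,
        ?_, Or.inr ⟨rfl, rfl⟩⟩
      convert (occursAt_append.1 hk).2 using 1
      simp [add_assoc]
    · rw [e2] at hk ⊢
      refine ⟨_, _, rfl, gapAt_of_occursAt ?_ (by omega) h.isGap_o.1 h.isGap_o.2.1,
        ?_, Or.inl ⟨rfl, rfl⟩⟩
      · rw [wpow_succ z o.length, ← List.append_assoc] at hk
        exact (occursAt_append.1 hk).1
      convert (occursAt_append.1 hk).2 using 1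
      simp [add_assoc]
  obtain ⟨c, g, rfl, h1, hrun, h2⟩ := key r hr k hk
  obtain ⟨d, f, rfl, h3, -, h4⟩ := key s hs l hl
  rcases h1.sep_le hp h3 hkl with ⟨h5, rfl⟩ | h5
  · left
    have : c = d := by
      have := h.o_ne_r
      rcases h2 with ⟨rfl, e⟩ | ⟨rfl, e⟩ <;> rcases h4 with ⟨rfl, e'⟩ | ⟨rfl, e'⟩
      · rfl
      · exact absurd (e.symm.trans e') this
      · exact absurd (e'.symm.trans e) this
      · rfl
    subst this
    exact ⟨by omega, rfl⟩
  · right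
    have := h3.run_le hrun (by push_cast at h5; exact h5)
    simp only [List.length_append, length_wpow, Nat.cast_add, Nat.cast_mul]
    push_cast at this ⊢
    omega

/-- The word `z^c r z^d o z^e`. -/
def _root_.SynchShift.doubleWord {A : Type*} (z o : List A) (c d e : ℕ) : List A :=
  wpow z c ++ wpow o (z.length + 1) ++ wpow z d ++ o ++ wpow z e

theorem gapAt_doubleWord (h : IsMarkerPair X z o) {x : ℤ → A} {c d e : ℕ} {k : ℤ} (hc : 0 < c)
    (hd : 0 < d) (he : 0 < e) (hk : OccursAt x (doubleWord z o c d e) k) :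
    GapAt z x k c (wpow o (z.length + 1)) ∧
    GapAt z x (k + c * z.length + (wpow o (z.length + 1)).length) d o ∧
    OccursAt x (wpow z e)
      (k + c * z.length + (wpow o (z.length + 1)).length + d * z.length + o.length) := by
  unfold doubleWord at hk
  have hdz : OccursAt x (wpow z d) (k + c * z.length + (wpow o (z.length + 1)).length) := by
    have := (occursAt_append.1 (occursAt_append.1 (occursAt_append.1 hk).1).1).2
    convert this using 1
    simp [add_assoc]
  have hez : OccursAt x (wpow z e)
      (k + c * z.length + (wpow o (z.length + 1)).length + d * z.length + o.length) := by
    convert (occursAt_append.1 hk).2 using 1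
    simp [add_assoc]
  have z1 : OccursAt x z (k + c * z.length + (wpow o (z.length + 1)).length) := by
    simpa using (occursAt_wpow_iff.1 hdz) 0 hd
  have z2 : OccursAt x z
      (k + c * z.length + (wpow o (z.length + 1)).length + d * z.length + o.length) := by
    simpa using (occursAt_wpow_iff.1 hez) 0 he
  simp only [occursAt_append] at hk
  refine ⟨⟨hc, hk.1.1.1.1, by simpa using hk.1.1.1.2, z1, h.isGap_r.1, h.isGap_r.2.1⟩,
    ⟨hd, hdz, ?_, z2, h.isGap_o.1, h.isGap_o.2.1⟩, hez⟩
  convert hk.1.2 using 1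
  simp [add_assoc]

theorem length_doubleWord {A : Type*} (z o : List A) (c d e : ℕ) :
    ((doubleWord z o c d e).length : ℤ) = c * z.length + (wpow o (z.length + 1)).length +
      d * z.length + o.length + e * z.length := by
  simp [doubleWord]
  ring

/-- If the gaps `r` of both words coincide, so do the gaps `o` that follow, and `hdd` makes the
exponents equal. The gap `o` of the first cannot be the gap `r` of the second; otherwise the second
gap `r` lies behind the first word's `o`, and `hce` leaves room for only one common copy of `z`. -/
theorem overlap_doubleWord (h : IsMarkerPair X z o) {x : ℤ → A} {c d e c' d' e' : ℕ} {k l : ℤ}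
    (hc : 0 < c) (hd : 0 < d) (he : 0 < e) (hc' : 0 < c') (hd' : 0 < d') (he' : 0 < e')
    (hk : OccursAt x (doubleWord z o c d e) k) (hl : OccursAt x (doubleWord z o c' d' e') l)
    (hkl : k ≤ l) (hdd : d = d' → c = c' ∧ e = e') (hce : c' = 1 ∨ e = 1) :
    k = l ∧ doubleWord z o c d e = doubleWord z o c' d' e' ∨
      k + (doubleWord z o c d e).length ≤ l + z.length := by
  have hp := h.length_pos
  obtain ⟨g1, g2, run⟩ := h.gapAt_doubleWord hc hd he hk
  obtain ⟨g1', g2', -⟩ := h.gapAt_doubleWord hc' hd' he' hl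
  rw [length_doubleWord]
  rcases g1.sep_le hp g1' hkl with ⟨e1, -⟩ | h1
  · left
    rw [← e1] at g2'
    have h1 : 0 ≤ (d : ℤ) * z.length := by positivity
    have h2 : 0 ≤ (d' : ℤ) * z.length := by positivity
    have h3 := g2.length_pos
    rcases g2.sep_le hp g2' le_rfl with ⟨e2, -⟩ | h4
    · have : (d : ℤ) * z.length = d' * z.length := by omega
      have := mul_right_cancel₀ (by omega : (z.length : ℤ) ≠ 0) this
      obtain ⟨rfl, rfl⟩ := hdd (by omega)
      obtain rfl : d = d' := by omega
      exact ⟨by omega, rfl⟩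
    · omega
  · right
    rcases g2.sep_le hp g1' h1 with ⟨-, e2⟩ | h2
    · exact absurd e2 h.o_ne_r
    · rcases hce with rfl | rfl
      · have := g1'.run_le run h2
        push_cast at this
        omega
      · push_cast
        omega

theorem doubleWord_mem (h : IsMarkerPair X z o) {c d : ℕ} (e : ℕ) (hc : 0 < c)
    (hd : 0 < d) : doubleWord z o c d e ∈ language X := by
  have := flat_mem_language h.isMarker (l := [(c, wpow o (z.length + 1)), (d, o)])
    (by simp [h.isGap_o, h.isGap_r, hc, hd]) e
  simpa [doubleWord] using this

theorem doubleWord_shape {A : Type*} {z o : List A} {c d e : ℕ} (hc : 0 < c) (he : 0 < e) :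
    ∃ w, doubleWord z o c d e = z ++ w ++ z := by
  obtain ⟨c, rfl⟩ : ∃ c', c = c' + 1 := ⟨c - 1, by omega⟩
  obtain ⟨e, rfl⟩ : ∃ e', e = e' + 1 := ⟨e - 1, by omega⟩
  refine ⟨wpow z c ++ wpow o (z.length + 1) ++ wpow z d ++ o ++ wpow z e, ?_⟩
  simp [doubleWord, wpow_succ z c, wpow_succ' z e]

theorem ruleOK_double (h : IsMarkerPair X z o) {c d e c' d' e' : ℕ} (hc : 0 < c) (hd : 0 < d)
    (he : 0 < e) (hc' : 0 < c') (hd' : 0 < d') (he' : 0 < e') (hsum : c + d + e = c' + d' + e')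
    (_hdd : d ≠ d') (hce : c = 1 ∧ c' = 1 ∨ e = 1 ∧ e' = 1) :
    RuleOK X z (swapRule (doubleWord z o c d e) (doubleWord z o c' d' e')) := by
  refine ruleOK_swap ?_ (doubleWord_shape hc he) (doubleWord_shape hc' he')
    (h.doubleWord_mem e hc hd) (h.doubleWord_mem e' hc' hd') ?_
  · have : ((c + d + e : ℕ) : ℤ) * z.length = ((c' + d' + e' : ℕ) : ℤ) * z.length := by rw [hsum]
    have h1 := length_doubleWord z o c d e
    have h2 := length_doubleWord z o c' d' e'
    push_cast [add_mul] at this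
    omega
  · rintro x hx r hr s hs k l hkl hk hl
    rcases hr with rfl | rfl <;> rcases hs with rfl | rfl
    · exact h.overlap_doubleWord hc hd he hc hd he hk hl hkl (by simp) (by omega)
    · exact h.overlap_doubleWord hc hd he hc' hd' he' hk hl hkl (by omega) (by omega)
    · exact h.overlap_doubleWord hc' hd' he' hc hd he hk hl hkl (by omega) (by omega)
    · exact h.overlap_doubleWord hc' hd' he' hc' hd' he' hk hl hkl (by simp) (by omega)

/-- The `q` copies of `z` belonging to the leftbound glider are absorbed into the middle exponent;
so the critical distances are `q + 3`, `q + 2` and, for `ruleF2`, `q + 1`. -/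
theorem ruleF1_eq {A : Type*} (z o : List A) : ruleF1 z o = swapRule
    (doubleWord z o 1 (o.length + 3) 1) (doubleWord z o 1 (o.length + 2) 2) := by
  simp [ruleF1, doubleWord, gliderL, gliderR, wpow_succ, add_comm o.length, wpow_add]

theorem ruleF2_eq {A : Type*} (z o : List A) : ruleF2 z o = swapRule
    (doubleWord z o 1 (o.length + 2) 1) (doubleWord z o 2 (o.length + 1) 1) := by
  simp [ruleF2, doubleWord, gliderL, gliderR, wpow_succ, add_comm o.length, wpow_add]

theorem ruleOK_F1 (h : IsMarkerPair X z o) : RuleOK X z (ruleF1 z o) := by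
  rw [ruleF1_eq]
  apply h.ruleOK_double <;> omega

theorem ruleOK_F2 (h : IsMarkerPair X z o) : RuleOK X z (ruleF2 z o) := by
  rw [ruleF2_eq]
  apply h.ruleOK_double <;> omega

theorem existsUnique_collisionCA [DiscreteTopology A] [Finite A] (h : IsMarkerPair X z o) :
    ∃! F : Aut X, IsCollisionCA z o F := by
  obtain ⟨F1, h1, u1⟩ := h.ruleOK_F1.existsUnique h.isMarker
  obtain ⟨F2, h2, u2⟩ := h.ruleOK_F2.existsUnique h.isMarker
  refine ⟨F2 * F1, ⟨F1, F2, h1, h2, rfl⟩, ?_⟩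
  rintro _ ⟨F1', F2', h1', h2', rfl⟩
  rw [u1 F1' h1', u2 F2' h2']

/-! ### The rule of `P₄` -/

theorem gcd_pos (h : IsMarkerPair X z o) : 0 < Nat.gcd z.length o.length :=
  Nat.gcd_pos_of_pos_left _ h.length_pos

theorem numClasses_mul {A : Type*} (z o : List A) :
    numClasses z o * Nat.gcd z.length o.length = z.length :=
  Nat.div_mul_cancel (Nat.gcd_dvd_left _ _)

theorem numClasses_pos (h : IsMarkerPair X z o) : 0 < numClasses z o :=
  Nat.div_pos (Nat.le_of_dvd h.length_pos (Nat.gcd_dvd_left _ _)) h.gcd_pos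

theorem numClasses_le {A : Type*} (z o : List A) : numClasses z o ≤ z.length := Nat.div_le_self _ _

/-- After division by `K` the class is a residue modulo `p/K`, and `1, …, p/K` represent each
residue once. -/
theorem class_unique (h : IsMarkerPair X z o) {w : List A} {n j i : ℕ} (hj : 1 ≤ j)
    (hj' : j ≤ numClasses z o) (hi : 1 ≤ i) (hi' : i ≤ numClasses z o)
    (h1 : w ∈ classWords X z o n j) (h2 : w ∈ classWords X z o n i) : j = i := by
  have e := h1.2.2.2.2.2.1.symm.trans h2.2.2.2.2.2.1
  rw [← numClasses_mul z o, show Nat.gcd (numClasses z o * Nat.gcd z.length o.length) o.length =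
    Nat.gcd z.length o.length by rw [numClasses_mul]] at e
  have e := (Nat.ModEq.mul_right_cancel' h.gcd_pos.ne' e).add_right_cancel'
  rcases hj'.eq_or_lt with rfl | hj'
  · rcases hi'.eq_or_lt with rfl | hi'
    · rfl
    · have := e
      rw [Nat.ModEq, Nat.mod_self, Nat.mod_eq_of_lt hi'] at this
      omega
  · rcases hi'.eq_or_lt with rfl | hi'
    · rw [Nat.ModEq, Nat.mod_self, Nat.mod_eq_of_lt hj'] at e
      omega
    · exact e.eq_of_lt_of_lt hj' hi'

/-- Both lengths are `K` modulo `p`, which is possible only in class `j = p/K`, and there these two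
words are left out. -/
theorem o_notMem_class (h : IsMarkerPair X z o) {n j : ℕ} (hj : 1 ≤ j)
    (hj' : j ≤ numClasses z o) {w : List A} (hw : w = o ∨ w = wpow o (z.length + 1)) :
    w ∉ classWords X z o n j := by
  intro hc
  have e := hc.2.2.2.2.2.1
  have e2 : w.length ≡ 1 * Nat.gcd z.length o.length [MOD z.length] := by
    rw [one_mul]
    rcases hw with rfl | rfl
    · exact h.modEq
    · rw [length_wpow, add_mul, one_mul]
      simpa using (Nat.modEq_zero_iff_dvd.2 (Dvd.intro o.length rfl)).add h.modEq
  have e := e2.symm.trans e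
  rw [← numClasses_mul z o, show Nat.gcd (numClasses z o * Nat.gcd z.length o.length) o.length =
    Nat.gcd z.length o.length by rw [numClasses_mul]] at e
  have e := Nat.ModEq.mul_right_cancel' h.gcd_pos.ne' e
  have e : 0 + 1 ≡ j + 1 [MOD numClasses z o] := by simpa using e
  have e := e.add_right_cancel'
  have := Nat.le_of_dvd hj ((Nat.modEq_zero_iff_dvd).1 e.symm)
  have := hc.2.2.2.2.2.2 (by omega)
  tauto

theorem isGap_of_class {w : List A} {n j : ℕ} (hw : w ∈ classWords X z o n j) : IsGap X z w :=
  ⟨hw.1, hw.2.2.2.1, hw.2.2.2.2.1⟩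

end IsMarkerPair
end Pair

section CycleRule

theorem mem_cycleRule {A : Type*} {l : List (List A)} {r : List A × List A} :
    r ∈ cycleRule l ↔ ∃ (i : ℕ) (hi : i < l.length),
      r = (l[i], l[(i + 1) % l.length]'(Nat.mod_lt _ (by omega))) := by
  simp only [cycleRule, Set.mem_ofPred_eq, List.mem_iff_getElem, List.getElem_zip,
    List.getElem_rotate, List.length_zip, List.length_rotate, min_self]
  exact ⟨fun ⟨i, hi, h⟩ => ⟨i, hi, h.symm⟩, fun ⟨i, hi, h⟩ => ⟨i, hi, h.symm⟩⟩

theorem add_one_mod_inj {n i j : ℕ} (hi : i < n) (hj : j < n) (h : (i + 1) % n = (j + 1) % n) :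
    i = j :=
  (Nat.ModEq.add_right_cancel' 1 h : i ≡ j [MOD n]).eq_of_lt_of_lt hi hj

end CycleRule

/-! ### Existence of enumerations and paddings; the rule of `P₄` -/

section Choice

variable {A : Type*} [TopologicalSpace A] {X : Subshift A ℤ} {z o : List A} {n : ℕ}

namespace IsMarkerPair

/-- The bound on `n` makes the word short enough, and its length is `(j+1)q`, hence `(j+1)K`, modulo
`p`. -/
theorem pow_mem_class (h : IsMarkerPair X z o) (hn : gliderBound z o < n) {j : ℕ} (hj : 1 ≤ j)
    (hj' : j ≤ numClasses z o) : wpow o (z.length + 1 + j) ∈ classWords X z o n j := by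
  have hg := h.isGap_wpow (n := z.length + 1 + j) (by omega)
  refine ⟨hg.1, ?_, language_factor hg.2.2, hg.2.1, hg.2.2, ?_, fun _ => ⟨h.wpow_ne_o ?_, ?_⟩⟩
  · refine lt_of_le_of_lt ?_ hn
    rw [gliderBound, length_wpow, length_wpow]
    exact Nat.mul_le_mul_right _ (by omega)
  · rw [length_wpow, add_assoc, add_mul]
    have := ((Nat.modEq_zero_iff_dvd (a := z.length * o.length)).2 (Dvd.intro o.length rfl)).add
      (h.modEq.mul_left (1 + j))
    simpa [add_comm] using this
  · omega
  · intro e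
    have := h.wpow_o_injective e
    omega

theorem exists_gliderChoice [Finite A] (h : IsMarkerPair X z o) (hn : gliderBound z o < n) :
    Nonempty (GliderChoice X z o n) := by
  classical
  have hfin : ∀ j, (classWords X z o n j).Finite := fun j =>
    (List.finite_length_lt A n).subset fun w hw => hw.2.1
  let last : ℕ → List A := fun j => wpow o (z.length + 1 + j)
  let enum : ℕ → List (List A) := fun j => ((hfin j).toFinset.erase (last j)).toList ++ [last j]
  have hlast : ∀ j, 1 ≤ j → j ≤ numClasses z o → last j ∈ classWords X z o n j := fun j hj hj' =>
    h.pow_mem_class hn hj hj'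
  have hmem : ∀ j, 1 ≤ j → j ≤ numClasses z o → ∀ w, w ∈ enum j ↔ w ∈ classWords X z o n j := by
    intro j hj hj' w
    have := hlast j hj hj'
    by_cases e : w = last j
    · simp [enum, e, this]
    · simp [enum, e]
  let U : ℕ → ℕ := fun j => (o ++ wpow z o.length ++ wpow o j).length
  -- The `n` additional copies of `z` leave room for at least `q + 1` copies before every word of
  -- the class, since such a word is shorter than `n ≤ np`.
  refine ⟨{ enum := enum, pad₀ := fun j => o.length + 1 + n,
            pad := fun j w => (((o.length + 1 + n) * z.length + U j) - w.length) / z.length,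
            enum_nodup := ?_, mem_enum := hmem, enum_last := ?_, le_pad₀ := ?_, le_pad := ?_,
            length_eq := ?_ }⟩
  · intro j hj hj'
    simp only [enum]
    rw [List.nodup_append]
    refine ⟨Finset.nodup_toList _, List.nodup_singleton _, ?_⟩
    rintro a ha b hb rfl
    simp only [List.mem_singleton] at hb
    subst hb
    simp at ha
  · intro j _ _
    simp [enum, last]
  · intro j _ _
    omega
  · intro j hj hj' w hw
    have hw := (hmem j hj hj' w).1 hw
    rw [Nat.le_div_iff_mul_le h.length_pos]
    have h1 := hw.2.1
    have : n ≤ n * z.length := Nat.le_mul_of_pos_right n h.length_pos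
    rw [add_mul (o.length + 1)]
    omega
  · intro j hj hj' w hw
    have hw := (hmem j hj hj' w).1 hw
    have h1 := hw.2.1
    have h2 : n ≤ n * z.length := Nat.le_mul_of_pos_right n h.length_pos
    have hle : w.length ≤ (o.length + 1 + n) * z.length + U j := by
      rw [add_mul (o.length + 1)]; omega
    -- Both `o z^q o^j` and `w` have length `(j+1)K` modulo `p`, so their difference can be filled
    -- by copies of `z`.
    have hU : (o.length + 1 + n) * z.length + U j ≡ w.length [MOD z.length] := by
      refine Nat.ModEq.trans ?_ hw.2.2.2.2.2.1.symm
      have e : (o.length + 1 + n) * z.length + U j =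
          z.length * (o.length + 1 + n + o.length) + (j + 1) * o.length := by
        simp [U]; ring
      rw [e]
      simpa using ((Nat.modEq_zero_iff_dvd (a := z.length * (o.length + 1 + n + o.length))).2
        (Dvd.intro _ rfl)).add (h.modEq.mul_left (j + 1))
    have hd : z.length ∣ (o.length + 1 + n) * z.length + U j - w.length :=
      (Nat.modEq_iff_dvd' hle).1 hU.symm
    have := Nat.div_mul_cancel hd
    rw [List.length_append, length_wpow, this, List.length_append, length_wpow]
    exact Nat.sub_add_cancel hle

end IsMarkerPair

namespace GliderChoice

variable (c : GliderChoice X z o n)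

/-- The word `u_j z`. -/
def first (j : ℕ) : List A := wpow z (c.pad₀ j) ++ (o ++ wpow z o.length ++ wpow o j) ++ z

/-- The padded word `z^c w z` of class `j`. -/
def padWord (j : ℕ) (w : List A) : List A := wpow z (c.pad j w) ++ w ++ z

theorem mem_padded {j : ℕ} {u : List A} :
    u ∈ c.padded j ↔ u = c.first j ∨ ∃ w ∈ c.enum j, u = c.padWord j w := by
  simp only [padded, List.mem_cons, List.mem_map, first, padWord]
  exact or_congr Iff.rfl ⟨fun ⟨w, hw, e⟩ => ⟨w, hw, e.symm⟩, fun ⟨w, hw, e⟩ => ⟨w, hw, e.symm⟩⟩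

variable {c}

theorem isGap (c : GliderChoice X z o n) {j : ℕ} (hj : 1 ≤ j) (hj' : j ≤ numClasses z o)
    {w : List A} (hw : w ∈ c.enum j) : IsGap X z w :=
  IsMarkerPair.isGap_of_class ((c.mem_enum j hj hj' w).1 hw)

theorem gapAt_padWord (c : GliderChoice X z o n) {j : ℕ} (hj : 1 ≤ j) (hj' : j ≤ numClasses z o)
    {w : List A} (hw : w ∈ c.enum j) {x : ℤ → A} {k : ℤ} :
    OccursAt x (c.padWord j w) k ↔ GapAt z x k (c.pad j w) w := by
  have hg := c.isGap hj hj' hw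
  have := c.le_pad j hj hj' w hw
  exact ⟨fun h => gapAt_of_occursAt h (by omega) hg.1 hg.2.1, fun h => h.occursAt⟩

theorem gapAt_first (h : IsMarkerPair X z o) (c : GliderChoice X z o n) {j : ℕ} (hj : 1 ≤ j)
    (hj' : j ≤ numClasses z o) {x : ℤ → A} {k : ℤ} :
    OccursAt x (c.first j) k ↔ GapAt z x k (c.pad₀ j) o ∧
      GapAt z x (k + c.pad₀ j * z.length + o.length) o.length (wpow o j) := by
  have hg := h.isGap_wpow (n := j) (by omega)
  have h2 := h.two_le
  have := c.le_pad₀ j hj hj'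
  obtain ⟨q, hq⟩ : ∃ q, o.length = q + 1 := ⟨o.length - 1, by omega⟩
  constructor
  · intro hk
    have e : c.first j = (wpow z (c.pad₀ j) ++ o) ++ (wpow z o.length ++ wpow o j ++ z) := by
      simp [first]
    have e' : c.first j = (wpow z (c.pad₀ j) ++ o ++ z) ++ (wpow z q ++ wpow o j ++ z) := by
      simp [first, hq, wpow_succ]
    have h1 := hk
    rw [e, occursAt_append] at h1
    rw [e', occursAt_append] at hk
    refine ⟨gapAt_of_occursAt hk.1 (by omega) h.isGap_o.1 h.isGap_o.2.1,
      gapAt_of_occursAt ?_ (by omega) hg.1 hg.2.1⟩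
    convert h1.2 using 1
    simp [add_assoc]
  · rintro ⟨h1, h2⟩
    have e : c.first j = (wpow z (c.pad₀ j) ++ o) ++ (wpow z o.length ++ wpow o j ++ z) := by
      simp [first]
    rw [e, occursAt_append]
    refine ⟨(occursAt_append.1 h1.occursAt).1, ?_⟩
    convert h2.occursAt using 1
    simp [add_assoc]

theorem length_padWord (c : GliderChoice X z o n) {j : ℕ} (hj : 1 ≤ j) (hj' : j ≤ numClasses z o)
    {w : List A} (hw : w ∈ c.enum j) : (c.padWord j w).length = (c.first j).length := by
  have := c.length_eq j hj hj' w hw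
  simp only [padWord, first, List.length_append] at this ⊢
  omega

theorem length_of_mem_padded (c : GliderChoice X z o n) {j : ℕ} (hj : 1 ≤ j)
    (hj' : j ≤ numClasses z o) {u : List A} (hu : u ∈ c.padded j) :
    u.length = (c.first j).length := by
  rcases c.mem_padded.1 hu with rfl | ⟨w, hw, rfl⟩
  · rfl
  · exact c.length_padWord hj hj' hw

theorem mem_language_of_padded (h : IsMarkerPair X z o) (c : GliderChoice X z o n) {j : ℕ}
    (hj : 1 ≤ j) (hj' : j ≤ numClasses z o) {u : List A} (hu : u ∈ c.padded j) :
    u ∈ language X := by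
  rcases c.mem_padded.1 hu with rfl | ⟨w, hw, rfl⟩
  · have h1 := c.le_pad₀ j hj hj'
    have h2 := h.two_le
    have := flat_mem_language h.isMarker (l := [(c.pad₀ j, o), (o.length, wpow o j)])
      (by simp [h.isGap_o, h.isGap_wpow (n := j) (by omega)]; omega) 1
    simpa [first] using this
  · have h1 := c.le_pad j hj hj' w hw
    have := flat_mem_language h.isMarker (l := [(c.pad j w, w)])
      (by simp [c.isGap hj hj' hw]; omega) 1
    simpa [padWord] using this

/-- The padding by at least `q + 1` copies matters here: the inner gap `o^j` of `u_j z` is preceded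
by only `q` copies, so it cannot be the first gap of another rule word starting inside. Since `o`
belongs to no class, the first gap separates `u_j z` from the other words; among the `u_j z`
themselves the inner gap gives `j`. -/
theorem overlap_padded (h : IsMarkerPair X z o) (c : GliderChoice X z o n) {j i : ℕ} (hj : 1 ≤ j)
    (hj' : j ≤ numClasses z o) (hi : 1 ≤ i) (hi' : i ≤ numClasses z o) {u v : List A}
    (hu : u ∈ c.padded j) (hv : v ∈ c.padded i) {x : ℤ → A} {k l : ℤ} (hkl : k ≤ l)
    (hk : OccursAt x u k) (hl : OccursAt x v l) :
    k = l ∧ u = v ∧ j = i ∨ k + u.length ≤ l + z.length := by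
  have hp := h.length_pos
  rcases c.mem_padded.1 hu with rfl | ⟨w, hw, rfl⟩
  · obtain ⟨g1, g2⟩ := (c.gapAt_first h hj hj').1 hk
    have len : ((c.first j).length : ℤ) = c.pad₀ j * z.length + o.length + o.length * z.length +
        (wpow o j).length + z.length := by simp [first]; ring
    rw [len]
    rcases c.mem_padded.1 hv with rfl | ⟨w', hw', rfl⟩
    · obtain ⟨g1', g2'⟩ := (c.gapAt_first h hi hi').1 hl
      rcases g1.sep_le hp g1' hkl with ⟨e, -⟩ | h1
      · left
        rw [← e] at g2'
        have e2 := h.wpow_o_injective (g2.eq_of_pos hp g2' rfl)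
        subst e2
        exact ⟨by omega, rfl, rfl⟩
      · have := c.le_pad₀ i hi hi'
        have : ((o.length + 1 : ℕ) : ℤ) * z.length ≤ c.pad₀ i * z.length := by
          gcongr
        rcases g2.sep_le hp g1' h1 with ⟨e, -⟩ | h2
        · push_cast [add_mul] at this; omega
        · right; omega
    · have g1' := (c.gapAt_padWord hi hi' hw').1 hl
      rcases g1.sep_le hp g1' hkl with ⟨e, e'⟩ | h1
      · exact absurd ((c.mem_enum i hi hi' w').1 hw') (h.o_notMem_class hi hi' (Or.inl e'.symm))
      · have := c.le_pad i hi hi' w' hw'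
        have : ((o.length + 1 : ℕ) : ℤ) * z.length ≤ c.pad i w' * z.length := by
          gcongr
        rcases g2.sep_le hp g1' h1 with ⟨e, -⟩ | h2
        · push_cast [add_mul] at this; omega
        · right; omega
  · have g1 := (c.gapAt_padWord hj hj' hw).1 hk
    have len : ((c.padWord j w).length : ℤ) = c.pad j w * z.length + w.length + z.length := by
      simp [padWord]; ring
    rw [len]
    rcases c.mem_padded.1 hv with rfl | ⟨w', hw', rfl⟩
    · obtain ⟨g1', g2'⟩ := (c.gapAt_first h hi hi').1 hl
      rcases g1.sep_le hp g1' hkl with ⟨e, e'⟩ | h1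
      · exact absurd ((c.mem_enum j hj hj' w).1 hw) (h.o_notMem_class hj hj' (Or.inl e'))
      · right; omega
    · have g1' := (c.gapAt_padWord hi hi' hw').1 hl
      rcases g1.sep_le hp g1' hkl with ⟨e, rfl⟩ | h1
      · left
        obtain rfl := h.class_unique hj hj' hi hi' ((c.mem_enum j hj hj' w).1 hw)
          ((c.mem_enum i hi hi' w).1 hw')
        exact ⟨by omega, rfl, rfl⟩
      · right; omega

theorem class_eq_of_mem_padded (h : IsMarkerPair X z o) (c : GliderChoice X z o n) {j i : ℕ}
    (hj : 1 ≤ j) (hj' : j ≤ numClasses z o) (hi : 1 ≤ i) (hi' : i ≤ numClasses z o) {u : List A}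
    (hu : u ∈ c.padded j) (hv : u ∈ c.padded i) : j = i := by
  obtain ⟨x, hx, hk⟩ := exists_occursAt (c.mem_language_of_padded h hj hj' hu) 0
  have hp := h.length_pos
  have : z.length < u.length := by
    rcases c.mem_padded.1 hu with rfl | ⟨w, hw, rfl⟩
    · have := List.length_pos_iff.2 h.isGap_o.1
      simp [first]; omega
    · have := List.length_pos_iff.2 (c.isGap hj hj' hw).1
      simp [padWord]; omega
  rcases c.overlap_padded h hj hj' hi hi' hu hv le_rfl hk hk with h' | h'
  · exact h'.2.2
  · omega

theorem nodup_padded (h : IsMarkerPair X z o) (c : GliderChoice X z o n) {j : ℕ} (hj : 1 ≤ j)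
    (hj' : j ≤ numClasses z o) : (c.padded j).Nodup := by
  have hp := h.length_pos
  have key : ∀ u ∈ c.padded j, ∃ x k, OccursAt x u k := fun u hu => by
    obtain ⟨x, hx, hk⟩ := exists_occursAt (c.mem_language_of_padded h hj hj' hu) 0
    exact ⟨x, 0, hk⟩
  rw [padded, List.nodup_cons]
  constructor
  · intro hm
    obtain ⟨w, hw, e⟩ := List.mem_map.1 hm
    obtain ⟨x, k, hk⟩ := key (c.first j) (c.mem_padded.2 (Or.inl rfl))
    have g1 := ((c.gapAt_first h hj hj').1 hk).1
    have hk' : OccursAt x (c.padWord j w) k := by rw [padWord, e]; exact hk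
    have g2 := (c.gapAt_padWord hj hj' hw).1 hk'
    have h1 := g1.length_pos
    have h2 := g2.length_pos
    rcases g1.sep_le hp g2 le_rfl with ⟨-, e'⟩ | h'
    · exact h.o_notMem_class hj hj' (Or.inl e'.symm) ((c.mem_enum j hj hj' w).1 hw)
    · have h3 : 0 ≤ (c.pad₀ j : ℤ) * z.length := by positivity
      omega
  · refine (List.nodup_map_iff_inj_on (c.enum_nodup j hj hj')).2 fun w hw w' hw' e => ?_
    obtain ⟨x, k, hk⟩ := key (c.padWord j w) (c.mem_padded.2 (Or.inr ⟨w, hw, rfl⟩))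
    have hk' : OccursAt x (c.padWord j w') k := by rw [padWord, ← e]; exact hk
    have g1 := (c.gapAt_padWord hj hj' hw).1 hk
    have g2 := (c.gapAt_padWord hj hj' hw').1 hk'
    have h1 := g1.length_pos
    rcases g1.sep_le hp g2 le_rfl with ⟨-, e'⟩ | h'
    · exact e'
    · have h3 : 0 ≤ (c.pad j w : ℤ) * z.length := by positivity
      omega

theorem ruleOK (h : IsMarkerPair X z o) (c : GliderChoice X z o n) : RuleOK X z c.ruleP4 where
  bounded := by
    refine ⟨(Finset.range (numClasses z o + 1)).sup fun j => (c.first j).length, ?_⟩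
    rintro r ⟨j, hj, hj', hr⟩
    obtain ⟨i, hi, rfl⟩ := mem_cycleRule.1 hr
    rw [c.length_of_mem_padded hj hj' (List.getElem_mem hi)]
    exact Finset.le_sup (f := fun j => (c.first j).length) (Finset.mem_range.2 (by omega))
  length_eq := by
    rintro r ⟨j, hj, hj', hr⟩
    obtain ⟨i, hi, rfl⟩ := mem_cycleRule.1 hr
    rw [c.length_of_mem_padded hj hj' (List.getElem_mem _),
      c.length_of_mem_padded hj hj' (List.getElem_mem _)]
  shape := by
    rintro r ⟨j, hj, hj', hr⟩
    obtain ⟨i, hi, rfl⟩ := mem_cycleRule.1 hr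
    rcases c.mem_padded.1 (List.getElem_mem hi) with e | ⟨w, hw, e⟩
    · obtain ⟨k, hk⟩ := Nat.exists_eq_add_of_le (c.le_pad₀ j hj hj')
      refine ⟨wpow z (o.length + k) ++ (o ++ wpow z o.length ++ wpow o j), ?_⟩
      dsimp only
      rw [e, first, hk, add_right_comm, wpow_succ]
      simp
    · obtain ⟨k, hk⟩ := Nat.exists_eq_add_of_le (c.le_pad j hj hj' w hw)
      refine ⟨wpow z (o.length + k) ++ w, ?_⟩
      dsimp only
      rw [e, padWord, hk, add_right_comm, wpow_succ]
      simp
  mem_language := by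
    rintro r ⟨j, hj, hj', hr⟩
    obtain ⟨i, hi, rfl⟩ := mem_cycleRule.1 hr
    exact c.mem_language_of_padded h hj hj' (List.getElem_mem hi)
  functional := by
    rintro u v w ⟨j, hj, hj', hr⟩ ⟨k, hk, hk', hs⟩
    obtain ⟨i, hi, e1⟩ := mem_cycleRule.1 hr
    obtain ⟨l, hl, e2⟩ := mem_cycleRule.1 hs
    rw [Prod.mk.injEq] at e1 e2
    obtain rfl := c.class_eq_of_mem_padded h hj hj' hk hk' (u := u)
      (by rw [e1.1]; exact List.getElem_mem _) (by rw [e2.1]; exact List.getElem_mem _)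
    have := (c.nodup_padded h hj hj').getElem_inj_iff.1 (e1.1.symm.trans e2.1)
    subst this
    exact e1.2.trans e2.2.symm
  injective := by
    rintro u v w ⟨j, hj, hj', hr⟩ ⟨k, hk, hk', hs⟩
    obtain ⟨i, hi, e1⟩ := mem_cycleRule.1 hr
    obtain ⟨l, hl, e2⟩ := mem_cycleRule.1 hs
    rw [Prod.mk.injEq] at e1 e2
    obtain rfl := c.class_eq_of_mem_padded h hj hj' hk hk' (u := w)
      (by rw [e1.2]; exact List.getElem_mem _) (by rw [e2.2]; exact List.getElem_mem _)
    have := (c.nodup_padded h hj hj').getElem_inj_iff.1 (e1.2.symm.trans e2.2)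
    obtain rfl := add_one_mod_inj hi hl this
    exact e1.1.trans e2.1.symm
  exists_next := by
    rintro r ⟨j, hj, hj', hr⟩
    obtain ⟨i, hi, rfl⟩ := mem_cycleRule.1 hr
    exact ⟨_, j, hj, hj', mem_cycleRule.2 ⟨(i + 1) % (c.padded j).length,
      Nat.mod_lt _ (by omega), rfl⟩⟩
  exists_prev := by
    rintro r ⟨j, hj, hj', hr⟩
    obtain ⟨i, hi, rfl⟩ := mem_cycleRule.1 hr
    refine ⟨(c.padded j)[(i + ((c.padded j).length - 1)) % (c.padded j).length]'
      (Nat.mod_lt _ (by omega)), j, hj, hj', mem_cycleRule.2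
        ⟨(i + ((c.padded j).length - 1)) % (c.padded j).length, Nat.mod_lt _ (by omega), ?_⟩⟩
    simp only [Nat.mod_add_mod, Prod.mk.injEq, true_and]
    congr 1
    rw [add_assoc, Nat.sub_add_cancel (by omega), Nat.add_mod_right, Nat.mod_eq_of_lt hi]
  overlap := overlap_of_le fun x hx r hr s hs k l hkl hk hl => by
    obtain ⟨j, hj, hj', hr⟩ := hr
    obtain ⟨j', hj1, hj1', hs⟩ := hs
    obtain ⟨i, hi, rfl⟩ := mem_cycleRule.1 hr
    obtain ⟨i', hi', rfl⟩ := mem_cycleRule.1 hs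
    rcases c.overlap_padded h hj hj' hj1 hj1' (List.getElem_mem hi) (List.getElem_mem hi') hkl
      hk hl with h1 | h1
    · exact Or.inl ⟨h1.1, h1.2.1⟩
    · exact Or.inr h1

theorem existsUnique_gliderCA [DiscreteTopology A] [Finite A] (h : IsMarkerPair X z o)
    (c : GliderChoice X z o n) : ∃! G : Aut X, IsGliderCA c G := by
  obtain ⟨P1, h1, u1⟩ := h.ruleOK_P1.existsUnique h.isMarker
  obtain ⟨P2, h2, u2⟩ := h.ruleOK_P2.existsUnique h.isMarker
  obtain ⟨P4, h4, u4⟩ := (c.ruleOK h).existsUnique h.isMarker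
  refine ⟨P4 * P2 * P1, ⟨P1, P2, P4, h1, h2, h4, rfl⟩, ?_⟩
  rintro _ ⟨P1', P2', P4', h1', h2', h4', rfl⟩
  rw [u1 P1' h1', u2 P2' h2', u4 P4' h4']

end GliderChoice
end Choice

/-! ### Positions at which a replacement can be computed separately -/

section Cut

variable {A : Type*} [TopologicalSpace A] {X : Subshift A ℤ} {z : List A}
  {R : Set (List A × List A)}

/-- `z` occurs in `x` at `i`, and no occurrence of a word of `R` straddles it. -/
def Cut (z : List A) (R : Set (List A × List A)) (x : ℤ → A) (i : ℤ) : Prop :=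
  OccursAt x z i ∧ ∀ r ∈ R, ∀ k : ℤ, OccursAt x r.1 k → i ≤ k ∨ k + r.1.length ≤ i + z.length

/-- Every word of `R` starts with at most `C` copies of `z`, followed by a gap. -/
def FirstGap (z : List A) (R : Set (List A × List A)) (C : ℕ) : Prop :=
  ∀ r ∈ R, ∀ (x : ℤ → A) (k : ℤ), OccursAt x r.1 k →
    ∃ c g, c ≤ C ∧ c * z.length + g.length + z.length ≤ r.1.length ∧ GapAt z x k c g

theorem RTail.mem {A : Type*} {z : List A} (hp : 0 < z.length) {x : ℤ → A} {s m : ℤ} (h : RTail z x s) (hm : s ≤ m) :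
    x m ∈ z := by
  have e := Int.emod_add_mul_ediv (m - s) z.length
  have h1 := Int.emod_nonneg (m - s) (b := z.length) (by omega)
  have h2 := Int.emod_lt_of_pos (m - s) (b := z.length) (by omega)
  have h3 : 0 ≤ (m - s) / z.length := Int.ediv_nonneg (by omega) (by omega)
  have e' : (((m - s) / z.length).toNat : ℤ) * z.length = z.length * ((m - s) / z.length) := by
    rw [Int.toNat_of_nonneg h3, mul_comm]
  exact (h ((m - s) / z.length).toNat).mem (by omega) (by omega)

theorem LTail.mem {A : Type*} {z : List A} (hp : 0 < z.length) {x : ℤ → A} {s m : ℤ} (h : LTail z x s) (hm : m < s) :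
    x m ∈ z := by
  have e := Int.emod_add_mul_ediv (s - 1 - m) z.length
  have h1 := Int.emod_nonneg (s - 1 - m) (b := z.length) (by omega)
  have h2 := Int.emod_lt_of_pos (s - 1 - m) (b := z.length) (by omega)
  have h3 : 0 ≤ (s - 1 - m) / z.length := Int.ediv_nonneg (by omega) (by omega)
  have e' : (((s - 1 - m) / z.length).toNat : ℤ) * z.length =
      z.length * ((s - 1 - m) / z.length) := by
    rw [Int.toNat_of_nonneg h3, mul_comm]
  refine (h ((s - 1 - m) / z.length).toNat).mem ?_ ?_
  · rw [add_mul]; omega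
  · rw [add_mul]; omega

theorem GapAt.apply_notMem {A : Type*} {z : List A} {x : ℤ → A} {k : ℤ} {c : ℕ} {g : List A} (h : GapAt z x k c g) :
    x (k + c * z.length) ∉ z :=
  h.2.2.2.2.2 _ (h.2.2.1.mem le_rfl (by have := h.length_pos; omega))

namespace RuleOK

variable {F : X.carrier → X.carrier} {x : X.carrier}

theorem cut_left (h : RuleOK X z R) {r : List A × List A} (hr : r ∈ R) {k : ℤ}
    (hk : OccursAt x.1 r.1 k) : Cut z R x.1 k := by
  refine ⟨(h.occursAt_ends hr hk).2.1, fun s hs l hl => ?_⟩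
  have := (h.occursAt_ends hr hk).1
  rcases h.overlap x.1 x.2 r hr s hs k l hk hl with h | h | h
  · exact Or.inl h.1.le
  · left; omega
  · exact Or.inr h

theorem cut_right (h : RuleOK X z R) {r : List A × List A} (hr : r ∈ R) {k : ℤ}
    (hk : OccursAt x.1 r.1 k) : Cut z R x.1 (k + r.1.length - z.length) := by
  refine ⟨(h.occursAt_ends hr hk).2.2, fun s hs l hl => ?_⟩
  have := (h.occursAt_ends hr hk).1
  rcases h.overlap x.1 x.2 r hr s hs k l hk hl with h | h | h
  · right; rw [← h.2]; omega
  · left; omega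
  · right; omega

/-- An occurrence that enters the stretch from outside reaches only into the copies of `z` at the
two cuts, and the rule reproduces these. -/
theorem inert (h : RuleOK X z R) (hF : Replaces R F) {i e : ℤ} (hi : Cut z R x.1 i)
    (he : Cut z R x.1 e)
    (hno : ∀ r ∈ R, ∀ k, OccursAt x.1 r.1 k → i ≤ k → k + r.1.length ≤ e + z.length → False) {m : ℤ}
    (h1 : i ≤ m) (h2 : m < e + z.length) : (F x).1 m = x.1 m := by
  by_cases hc : ∀ r ∈ R, ∀ k : ℤ, OccursAt x.1 r.1 k → ¬ (k ≤ m ∧ m < k + r.1.length)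
  · exact (hF x).2 m hc
  · push Not at hc
    obtain ⟨r, hr, k, hk, h3, h4⟩ := hc
    have E := h.occursAt_ends hr hk
    have E' := h.occursAt_ends_right hr ((hF x).1 r hr k hk)
    rcases hi.2 r hr k hk with h5 | h5
    · rcases he.2 r hr k hk with h6 | h6
      · exact E'.1.agree E.2.1 h3 (by omega)
      · exact (hno r hr k hk h5 h6).elim
    · exact E'.2.agree E.2.2 (by omega) (by omega)

theorem rTail_image (hz : IsMarker X z) (h : RuleOK X z R) (hF : Replaces R F) {C : ℕ}
    (hC : FirstGap z R C) {s : ℤ} (hs : Cut z R x.1 s) (ht : RTail z x.1 s) : RTail z (F x).1 s := by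
  have hp := hz.length_pos
  refine rForm_nil.1 ((rForm_nil.2 ht).congr fun m hm => ?_)
  by_cases hc : ∀ r ∈ R, ∀ k : ℤ, OccursAt x.1 r.1 k → ¬ (k ≤ m ∧ m < k + r.1.length)
  · exact (hF x).2 m hc
  · push Not at hc
    obtain ⟨r, hr, k, hk, h3, h4⟩ := hc
    have E := h.occursAt_ends hr hk
    have E' := h.occursAt_ends_right hr ((hF x).1 r hr k hk)
    rcases hs.2 r hr k hk with h5 | h5
    · obtain ⟨c, g, -, hlen, hg⟩ := hC r hr _ k hk
      have : 0 ≤ (c : ℤ) * z.length := by positivity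
      exact (hg.apply_notMem (ht.mem hp (by omega))).elim
    · exact E'.2.agree E.2.2 (by omega) (by omega)

theorem lTail_image (hz : IsMarker X z) (h : RuleOK X z R) (hF : Replaces R F) {C : ℕ}
    (hC : FirstGap z R C) {s : ℤ} (hs : Cut z R x.1 s) (ht : LTail z x.1 s) : LTail z (F x).1 s := by
  have hp := hz.length_pos
  refine ht.congr fun m hm => (hF x).2 m fun r hr k hk hkm => ?_
  have E := h.occursAt_ends hr hk
  rcases hs.2 r hr k hk with h5 | h5
  · omega
  · obtain ⟨c, g, -, hlen, hg⟩ := hC r hr _ k hk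
    have h1 : 0 ≤ (c : ℤ) * z.length := by positivity
    have h7 : ((c * z.length + g.length + z.length : ℕ) : ℤ) ≤ r.1.length := by exact_mod_cast hlen
    have := hg.length_pos
    push_cast at h7
    exact hg.apply_notMem (ht.mem hp (by omega))

/-- Every rule word contains a gap after at most `C` copies of `z`. If the first gap of the list has
at least `C` copies before it, no rule word can reach it from the left of `s`. -/
theorem cut_head (hz : IsMarker X z) {C : ℕ} (hC : FirstGap z R C) {s : ℤ}
    {l : List (ℕ × List A)} (hl : Valid X z l) (hh : ∀ e ∈ l.head?, C ≤ e.1)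
    (hf : Form z x.1 s l) : Cut z R x.1 s := by
  have hp := hz.length_pos
  refine ⟨hf.2.occursAt_head hl, fun r hr k hk => ?_⟩
  by_contra! hlt
  obtain ⟨c, g, hcC, hlen, hg⟩ := hC r hr _ k hk
  have h1 : 0 ≤ (c : ℤ) * z.length := by positivity
  by_cases h2 : k + c * z.length < s
  · exact hg.apply_notMem (hf.1.mem hp h2)
  rcases l with - | ⟨⟨a, w⟩, t⟩
  · exact hg.apply_notMem ((rForm_nil.1 hf.2).mem hp (by omega))
  · have hw := hf.2.gapAt hl
    have h4 := hg.length_pos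
    rcases hg.sep_le hp hw hlt.1.le with ⟨e, -⟩ | h3
    · have : (c : ℤ) * z.length ≤ a * z.length := by
        have := hh (a, w) (by simp)
        gcongr
        omega
      omega
    · omega

end RuleOK
end Cut

/-! ### The action of `P₁` on lists -/

section P1

variable {A : Type*} [TopologicalSpace A] {X : Subshift A ℤ} {z o : List A}

open Classical in
/-- The action of `P₁` on an entry. -/
noncomputable def p1 (z o : List A) (e : ℕ × List A) : ℕ × List A :=
  if e.2 = wpow o (z.length + 1) then (e.1 + o.length, o)
  else if e.2 = o ∧ o.length + 1 ≤ e.1 then (e.1 - o.length, wpow o (z.length + 1)) else e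

theorem Form.unpad {A : Type*} {z : List A} {x : ℤ → A} {s : ℤ} {a k : ℕ} {w : List A}
    {t : List (ℕ × List A)} (h : Form z x s ((a + k, w) :: t)) :
    Form z x (s + k * z.length) ((a, w) :: t) := by
  obtain ⟨h1, h2⟩ := rForm_pad.1 h.2
  refine ⟨fun n => ?_, h2⟩
  by_cases hn : n < k
  · have := (occursAt_wpow_iff.1 h1) (k - 1 - n) (by omega)
    convert this using 1
    have : ((k - 1 - n : ℕ) : ℤ) = k - 1 - n := by omega
    rw [this]; ring
  · refine h.1.occursAt_of (n - k) ?_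
    have : ((n - k : ℕ) : ℤ) = n - k := by omega
    rw [this]; ring

namespace IsMarkerPair

theorem p1_r {A : Type*} (z o : List A) (a : ℕ) : p1 z o (a, wpow o (z.length + 1)) = (a + o.length, o) := by
  simp [p1]

theorem p1_o (h : IsMarkerPair X z o) {a : ℕ} (ha : o.length + 1 ≤ a) :
    p1 z o (a, o) = (a - o.length, wpow o (z.length + 1)) := by
  simp [p1, h.o_ne_r, ha]

theorem p1_of_ne {A : Type*} {z o : List A} {a : ℕ} {w : List A} (h1 : w ≠ wpow o (z.length + 1))
    (h2 : w = o → a < o.length + 1) : p1 z o (a, w) = (a, w) := by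
  unfold p1
  rw [if_neg h1, if_neg]
  rintro ⟨e, h3⟩
  have := h2 e
  omega

theorem p1_cases (h : IsMarkerPair X z o) (a : ℕ) (w : List A) :
    (w = wpow o (z.length + 1) ∧ p1 z o (a, w) = (a + o.length, o)) ∨
    (w = o ∧ o.length + 1 ≤ a ∧ p1 z o (a, w) = (a - o.length, wpow o (z.length + 1))) ∨
    (w ≠ wpow o (z.length + 1) ∧ (w = o → a < o.length + 1) ∧ p1 z o (a, w) = (a, w)) := by
  by_cases h1 : w = wpow o (z.length + 1)
  · subst h1; exact Or.inl ⟨rfl, p1_r z o a⟩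
  · by_cases h2 : w = o ∧ o.length + 1 ≤ a
    · obtain ⟨rfl, h2⟩ := h2
      exact Or.inr (Or.inl ⟨rfl, h2, h.p1_o h2⟩)
    · have h3 : w = o → a < o.length + 1 := fun e => by
        by_contra! h4
        exact h2 ⟨e, h4⟩
      exact Or.inr (Or.inr ⟨h1, h3, p1_of_ne h1 h3⟩)

theorem mem_ruleP1 {A : Type*} {z o : List A} {r : List A × List A} (hr : r ∈ ruleP1 z o) :
    (r.1 = wpow z (o.length + 1) ++ o ++ z ∧ r.2 = wpow z 1 ++ wpow o (z.length + 1) ++ z) ∨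
    (r.1 = wpow z 1 ++ wpow o (z.length + 1) ++ z ∧ r.2 = wpow z (o.length + 1) ++ o ++ z) := by
  have e1 : z ++ (wpow z o.length ++ o) ++ z = wpow z (o.length + 1) ++ o ++ z := by
    simp [wpow_succ]
  have e2 : z ++ wpow o (z.length + 1) ++ z = wpow z 1 ++ wpow o (z.length + 1) ++ z := by simp
  rcases mem_swapRule.1 hr with rfl | rfl
  · exact Or.inl ⟨e1, e2⟩
  · exact Or.inr ⟨e2, e1⟩

theorem ruleP1_mem {A : Type*} (z o : List A) :
    (wpow z (o.length + 1) ++ o ++ z, wpow z 1 ++ wpow o (z.length + 1) ++ z) ∈ ruleP1 z o ∧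
    (wpow z 1 ++ wpow o (z.length + 1) ++ z, wpow z (o.length + 1) ++ o ++ z) ∈ ruleP1 z o := by
  have e1 : z ++ (wpow z o.length ++ o) ++ z = wpow z (o.length + 1) ++ o ++ z := by
    simp [wpow_succ]
  have e2 : z ++ wpow o (z.length + 1) ++ z = wpow z 1 ++ wpow o (z.length + 1) ++ z := by simp
  rw [← e1, ← e2]
  exact ⟨mem_swapRule.2 (Or.inl rfl), mem_swapRule.2 (Or.inr rfl)⟩

/-- The words of `P₁` as padded gaps. -/
theorem ruleP1_gap (h : IsMarkerPair X z o) {r : List A × List A} (hr : r ∈ ruleP1 z o)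
    {x : ℤ → A} {k : ℤ} (hk : OccursAt x r.1 k) : ∃ c g, GapAt z x k c g ∧
      r.1.length = c * z.length + g.length + z.length ∧
      (c = o.length + 1 ∧ g = o ∨ c = 1 ∧ g = wpow o (z.length + 1)) := by
  rcases mem_ruleP1 hr with ⟨e, -⟩ | ⟨e, -⟩
  · rw [e] at hk ⊢
    exact ⟨_, _, gapAt_of_occursAt hk (by omega) h.isGap_o.1 h.isGap_o.2.1, by simp; ring,
      Or.inl ⟨rfl, rfl⟩⟩
  · rw [e] at hk ⊢
    exact ⟨_, _, gapAt_of_occursAt hk (by omega) h.isGap_r.1 h.isGap_r.2.1, by simp; ring,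
      Or.inr ⟨rfl, rfl⟩⟩

theorem firstGap_P1 (h : IsMarkerPair X z o) : FirstGap z (ruleP1 z o) (o.length + 1) := by
  intro r hr x k hk
  obtain ⟨c, g, h1, h2, h3⟩ := h.ruleP1_gap hr hk
  exact ⟨c, g, by omega, h2.ge, h1⟩

/-- A rule word consists of a gap, copies of `z` before it and one copy behind it. So `P₁` acts on
the entries independently, and the copy of `z` behind a gap is again a cut from which the induction
continues. -/
theorem rForm_P1 (h : IsMarkerPair X z o) {F : X.carrier → X.carrier}
    (hF : Replaces (ruleP1 z o) F) {x : X.carrier} {s : ℤ} {l : List (ℕ × List A)}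
    (hl : Valid X z l) (hs : Cut z (ruleP1 z o) x.1 s) (hf : RForm z x.1 s l) :
    RForm z (F x).1 s (l.map (p1 z o)) := by
  have hp := h.length_pos
  have hz := h.isMarker
  have hOK := h.ruleOK_P1
  induction l generalizing s with
  | nil => exact rForm_nil.2 (hOK.rTail_image hz hF h.firstGap_P1 hs (rForm_nil.1 hf))
  | cons e t ih =>
    obtain ⟨a, w⟩ := e
    have hg := hf.gapAt hl
    have hl' := (valid_cons.1 hl).2
    obtain ⟨f1, f2, f3⟩ := rForm_cons.1 hf
    have ha0 : 0 ≤ (a : ℤ) * z.length := by positivity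
    have hw0 := hg.length_pos
    set s1 := s + a * z.length + w.length with hs1
    have hcut : Cut z (ruleP1 z o) x.1 s1 := by
      refine ⟨f3.occursAt_head hl', fun r hr k hk => ?_⟩
      by_contra! hlt
      obtain ⟨c, g, h1, h2, h3⟩ := h.ruleP1_gap hr hk
      have h2' : (r.1.length : ℤ) = c * z.length + g.length + z.length := by exact_mod_cast h2
      rcases hs.2 r hr k hk with h4 | h4
      · rcases hg.sep_le hp h1 h4 with ⟨e, rfl⟩ | h5 <;> omega
      · omega
    have IH := ih hl' hcut f3
    have hin : ∀ r ∈ ruleP1 z o, ∀ k, OccursAt x.1 r.1 k → s ≤ k → k + r.1.length ≤ s1 + z.length →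
        ∃ c : ℕ, c ≤ a ∧ k + c * z.length = s + a * z.length ∧
          k + r.1.length = s1 + z.length ∧
          (c = o.length + 1 ∧ w = o ∨ c = 1 ∧ w = wpow o (z.length + 1)) := by
      intro r hr k hk h4 h5
      obtain ⟨c, g, h1, h2, h3⟩ := h.ruleP1_gap hr hk
      have h2' : (r.1.length : ℤ) = c * z.length + g.length + z.length := by exact_mod_cast h2
      have := h1.length_pos
      rcases hg.sep_le hp h1 h4 with ⟨e, rfl⟩ | h6
      · refine ⟨c, ?_, e.symm, by omega, h3⟩
        have : (c : ℤ) * z.length ≤ a * z.length := by omega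
        have := le_of_mul_le_mul_right this (by omega)
        exact_mod_cast this
      · have : 0 ≤ (c : ℤ) * z.length := by positivity
        omega
    -- A replacement at the first gap: `c` of its copies of `z` belong to the rule word, the other
    -- `a - c` are inert.
    have main : ∀ (c c' : ℕ) (w' : List A), c ≤ a → 0 < c → 0 < c' →
        (wpow z c ++ w ++ z, wpow z c' ++ w' ++ z) ∈ ruleP1 z o →
        RForm z (F x).1 s ((a - c + c', w') :: t.map (p1 z o)) := by
      intro c c' w' hca hc hc' hr
      obtain ⟨b, rfl⟩ := Nat.exists_eq_add_of_le' hca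
      have hlen := hOK.length_eq _ hr
      simp only [List.length_append, length_wpow] at hlen
      have hlen' : (c : ℤ) * z.length + w.length = c' * z.length + w'.length := by
        exact_mod_cast (by omega : c * z.length + w.length = c' * z.length + w'.length)
      have hrun := f1
      rw [wpow_add, occursAt_append, length_wpow] at hrun
      have hk : OccursAt x.1 (wpow z c ++ w ++ z) (s + b * z.length) := by
        rw [occursAt_append, occursAt_append]
        refine ⟨⟨by exact_mod_cast hrun.2, ?_⟩, ?_⟩
        · convert f2 using 1; push_cast; simp; ring
        · convert f3.occursAt_head hl' using 1; rw [hs1]; push_cast; simp; ring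
      have hy := (hF x).1 _ hr _ hk
      have hcl := hOK.cut_left hr hk
      have hbp : 0 ≤ (b : ℤ) * z.length := by positivity
      have hcp : (z.length : ℤ) ≤ c * z.length := by
        have : (1 : ℤ) * z.length ≤ c * z.length := by gcongr; omega
        omega
      have hbc : ((b + c : ℕ) : ℤ) * z.length = b * z.length + c * z.length := by push_cast; ring
      have hinert := fun m => hOK.inert hF hs hcl (m := m) fun r hr k hk h4 h5 => by
        obtain ⟨c2, h6, h7, h8, -⟩ := hin r hr k hk h4 (by omega)
        omega
      rw [rForm_cons, Nat.add_sub_cancel, wpow_add, occursAt_append]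
      rw [occursAt_append, occursAt_append] at hy
      simp only [List.length_append, length_wpow] at hy ⊢
      push_cast at hy ⊢
      refine ⟨⟨hrun.1.congr fun m h1 h2 => hinert m h1 (by rw [length_wpow] at h2; push_cast at h2; omega),
        hy.1.1⟩, ?_, ?_⟩
      · convert hy.1.2 using 1; ring
      · convert IH using 1
        rw [hs1, hbc, add_mul]; omega
    rw [List.map_cons]
    rcases h.p1_cases a w with ⟨rfl, e⟩ | ⟨rfl, h1, e⟩ | ⟨h1, h2, e⟩
    · rw [e]
      have := main 1 (o.length + 1) o (valid_cons.1 hl).1.1 one_pos (by omega) (ruleP1_mem z o).2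
      have ha := (valid_cons.1 hl).1.1
      dsimp only at ha
      rwa [show a - 1 + (o.length + 1) = a + o.length by omega] at this
    · rw [e]
      have := main (w.length + 1) 1 _ h1 (by omega) one_pos (ruleP1_mem z w).1
      rwa [show a - (w.length + 1) + 1 = a - w.length by omega] at this
    · rw [e]
      have hinert := fun m => hOK.inert hF hs hcut (m := m) fun r hr k hk h4 h5 => by
        obtain ⟨c2, h6, h7, h8, h9⟩ := hin r hr k hk h4 h5
        rcases h9 with ⟨rfl, h9⟩ | ⟨rfl, h9⟩
        · have := h2 h9; omega
        · exact h1 h9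
      refine rForm_cons.2 ⟨f1.congr fun m h1 h2 => hinert m h1 ?_,
        f2.congr fun m h1 h2 => hinert m (by omega) (by omega), IH⟩
      rw [length_wpow] at h2; push_cast at h2; omega

/-- With at least `q + 1` copies at the head, a word replaced at the first gap does not begin left
of `s`. -/
theorem form_P1 (h : IsMarkerPair X z o) {F : X.carrier → X.carrier}
    (hF : Replaces (ruleP1 z o) F) {x : X.carrier} {s : ℤ} {l : List (ℕ × List A)}
    (hl : Valid X z l) (hh : ∀ e ∈ l.head?, o.length + 1 ≤ e.1) (hf : Form z x.1 s l) :
    Form z (F x).1 s (l.map (p1 z o)) := by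
  have hc := RuleOK.cut_head h.isMarker h.firstGap_P1 hl hh hf
  exact ⟨h.ruleOK_P1.lTail_image h.isMarker hF h.firstGap_P1 hc hf.1, h.rForm_P1 hF hl hc hf.2⟩

end IsMarkerPair
end P1

/-! ### The action of `P₂` on lists -/

section P2

variable {A : Type*} [TopologicalSpace A] {X : Subshift A ℤ} {z o : List A}

open Classical in
/-- The word which replaces `w` under `P₂`, given the number of copies of `z` after `w` (`none` if
this number is infinite). -/
noncomputable def newWord (z o w : List A) (b : Option ℕ) : List A :=
  if w = wpow o (z.length + 1) then o
  else if w = o ∧ ∀ n ∈ b, o.length + 1 ≤ n then wpow o (z.length + 1) else w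

open Classical in
/-- The change in the number of copies of `z` after `w` under `P₂`. -/
noncomputable def carry (z o w : List A) (b : Option ℕ) : ℤ :=
  if w = wpow o (z.length + 1) then o.length
  else if w = o ∧ ∀ n ∈ b, o.length + 1 ≤ n then -o.length else 0

/-- The action of `P₂` on lists, where `c` is added to the first exponent. -/
noncomputable def p2 (z o : List A) : ℤ → List (ℕ × List A) → List (ℕ × List A)
  | _, [] => []
  | c, (a, w) :: t => ((a + c).toNat, newWord z o w (t.head?.map Prod.fst)) ::
      p2 z o (carry z o w (t.head?.map Prod.fst)) t

namespace IsMarkerPair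

theorem newWord_cases (h : IsMarkerPair X z o) (w : List A) (b : Option ℕ) :
    (w = wpow o (z.length + 1) ∧ newWord z o w b = o ∧ carry z o w b = o.length) ∨
    (w = o ∧ (∀ n ∈ b, o.length + 1 ≤ n) ∧ newWord z o w b = wpow o (z.length + 1) ∧
      carry z o w b = -o.length) ∨
    (w ≠ wpow o (z.length + 1) ∧ (w = o → ∃ n ∈ b, n < o.length + 1) ∧ newWord z o w b = w ∧
      carry z o w b = 0) := by
  have := h.o_ne_r
  unfold newWord carry
  by_cases h1 : w = wpow o (z.length + 1)
  · left; simp [h1]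
  · by_cases h2 : w = o ∧ ∀ n ∈ b, o.length + 1 ≤ n
    · right; left
      rw [if_neg h1, if_neg h1, if_pos h2, if_pos h2]
      exact ⟨h2.1, h2.2, rfl, rfl⟩
    · right; right
      rw [if_neg h1, if_neg h1, if_neg h2, if_neg h2]
      refine ⟨h1, fun e => ?_, rfl, rfl⟩
      by_contra! h3
      exact h2 ⟨e, h3⟩

theorem mem_ruleP2 {A : Type*} {z o : List A} {r : List A × List A} (hr : r ∈ ruleP2 z o) :
    (r.1 = wpow z 1 ++ wpow o (z.length + 1) ++ wpow z 1 ∧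
      r.2 = wpow z 1 ++ o ++ wpow z (o.length + 1)) ∨
    (r.1 = wpow z 1 ++ o ++ wpow z (o.length + 1) ∧
      r.2 = wpow z 1 ++ wpow o (z.length + 1) ++ wpow z 1) := by
  have e2 : z ++ (o ++ wpow z o.length) ++ z = wpow z 1 ++ o ++ wpow z (o.length + 1) := by
    simp [wpow_succ']
  have e1 : z ++ wpow o (z.length + 1) ++ z = wpow z 1 ++ wpow o (z.length + 1) ++ wpow z 1 := by
    simp
  rcases mem_swapRule.1 hr with rfl | rfl
  · exact Or.inl ⟨e1, e2⟩
  · exact Or.inr ⟨e2, e1⟩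

theorem ruleP2_mem {A : Type*} (z o : List A) :
    (wpow z 1 ++ wpow o (z.length + 1) ++ wpow z 1, wpow z 1 ++ o ++ wpow z (o.length + 1)) ∈
      ruleP2 z o ∧
    (wpow z 1 ++ o ++ wpow z (o.length + 1), wpow z 1 ++ wpow o (z.length + 1) ++ wpow z 1) ∈
      ruleP2 z o := by
  have e2 : z ++ (o ++ wpow z o.length) ++ z = wpow z 1 ++ o ++ wpow z (o.length + 1) := by
    simp [wpow_succ']
  have e1 : z ++ wpow o (z.length + 1) ++ z = wpow z 1 ++ wpow o (z.length + 1) ++ wpow z 1 := by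
    simp
  rw [← e1, ← e2]
  exact ⟨mem_swapRule.2 (Or.inl rfl), mem_swapRule.2 (Or.inr rfl)⟩

/-- The words of `P₂` as gaps followed by copies of `z`. -/
theorem ruleP2_gap (h : IsMarkerPair X z o) {r : List A × List A} (hr : r ∈ ruleP2 z o)
    {x : ℤ → A} {k : ℤ} (hk : OccursAt x r.1 k) : ∃ (d : ℕ) (g : List A), GapAt z x k 1 g ∧
      (r.1.length : ℤ) = z.length + g.length + d * z.length ∧ 0 < d ∧
      OccursAt x (wpow z d) (k + z.length + g.length) ∧
      (d = o.length + 1 ∧ g = o ∨ d = 1 ∧ g = wpow o (z.length + 1)) := by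
  have key : ∀ d g, OccursAt x (wpow z 1 ++ g ++ wpow z d) k → 0 < d → IsGap X z g →
      GapAt z x k 1 g ∧ OccursAt x (wpow z d) (k + z.length + g.length) := by
    intro d g hk hd hg
    rw [occursAt_append] at hk
    have h2 : OccursAt x (wpow z d) (k + z.length + g.length) := by
      convert hk.2 using 1; simp [add_assoc]
    have h3 : OccursAt x z (k + z.length + g.length) := by
      simpa using (occursAt_wpow_iff.1 h2) 0 hd
    refine ⟨gapAt_of_occursAt (occursAt_append.2 ⟨hk.1, ?_⟩) one_pos hg.1 hg.2.1, h2⟩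
    convert h3 using 1; simp [add_assoc]
  rcases mem_ruleP2 hr with ⟨e, -⟩ | ⟨e, -⟩
  · rw [e] at hk ⊢
    obtain ⟨h1, h2⟩ := key _ _ hk one_pos h.isGap_r
    exact ⟨_, _, h1, by simp; ring, one_pos, h2, Or.inr ⟨rfl, rfl⟩⟩
  · rw [e] at hk ⊢
    obtain ⟨h1, h2⟩ := key _ _ hk (by omega) h.isGap_o
    exact ⟨_, _, h1, by simp; ring, by omega, h2, Or.inl ⟨rfl, rfl⟩⟩

theorem firstGap_P2 (h : IsMarkerPair X z o) : FirstGap z (ruleP2 z o) 1 := by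
  intro r hr x k hk
  obtain ⟨d, g, h1, h2, h3, h4⟩ := h.ruleP2_gap hr hk
  refine ⟨1, g, le_rfl, ?_, h1⟩
  have : (1 : ℤ) * z.length ≤ d * z.length := by gcongr; omega
  have : ((1 * z.length + g.length + z.length : ℕ) : ℤ) ≤ r.1.length := by push_cast; omega
  exact_mod_cast this

/-- A point with a word `w` between copies of `z`, the copies after it being a run of length `b`
ending at `e`, if `b` is not `none`. -/
theorem rForm_P2 (h : IsMarkerPair X z o) {F : X.carrier → X.carrier}
    (hF : Replaces (ruleP2 z o) F) {x : X.carrier} {k : ℤ} {w : List A} {t : List (ℕ × List A)}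
    (hl : Valid X z ((1, w) :: t)) (hs : Cut z (ruleP2 z o) x.1 k)
    (hf : RForm z x.1 k ((1, w) :: t)) :
    RForm z (F x).1 k (p2 z o 0 ((1, w) :: t)) := by
  have hp := h.length_pos
  have hz := h.isMarker
  have hOK := h.ruleOK_P2
  -- A rule word uses only one copy of `z` before its gap, so the first exponent is normalized to
  -- `1`; the other copies between two gaps are at the disposal of the left gap.
  induction t generalizing k w with
  | nil =>
    have hg := hf.gapAt hl
    have hg0 := hg.length_pos
    obtain ⟨f1, f2, f3⟩ := rForm_cons.1 hf
    have f3 := rForm_nil.1 f3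
    push_cast [one_mul] at f1 f2 f3
    have hin : ∀ r ∈ ruleP2 z o, ∀ i, OccursAt x.1 r.1 i → k ≤ i →
        i = k ∧ ∃ d : ℕ, (r.1.length : ℤ) = z.length + w.length + d * z.length ∧
        (d = o.length + 1 ∧ w = o ∨ d = 1 ∧ w = wpow o (z.length + 1)) := by
      intro r hr i hi h4
      obtain ⟨d, g, h1, h2, h3, h5, h6⟩ := h.ruleP2_gap hr hi
      rcases hg.sep_le hp h1 h4 with ⟨e, rfl⟩ | h7
      · exact ⟨by omega, d, h2, h6⟩
      · exact (h1.apply_notMem (f3.mem hp (by push_cast at h7 ⊢; omega))).elim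
    have main : ∀ (d d' : ℕ) (w' : List A), 0 < d' →
        (wpow z 1 ++ w ++ wpow z d, wpow z 1 ++ w' ++ wpow z d') ∈ ruleP2 z o →
        RForm z (F x).1 k [(1, w')] := by
      intro d d' w' hd' hr
      have hlen := hOK.length_eq _ hr
      simp only [List.length_append, length_wpow] at hlen
      have hlen : (w.length + d * z.length : ℤ) = w'.length + d' * z.length := by
        exact_mod_cast (by omega : w.length + d * z.length = w'.length + d' * z.length)
      have hk : OccursAt x.1 (wpow z 1 ++ w ++ wpow z d) k := by
        rw [occursAt_append, occursAt_append]
        refine ⟨⟨f1, by simpa using f2⟩, ?_⟩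
        rw [occursAt_wpow_iff]
        intro n _
        convert f3 n using 1; simp [add_assoc]
      have hy := (hF x).1 _ hr _ hk
      have hcr := hOK.cut_right hr hk
      have hd0 : d ≠ 0 := by
        rintro rfl
        have := (hOK.shape _ hr)
        obtain ⟨d, g, h1, h2, h3, h5, h6⟩ := h.ruleP2_gap hr hk
        have h7 := hg.eq_of_pos hp h1 rfl
        subst h7
        simp only [List.length_append, length_wpow] at h2
        push_cast at h2
        have : (1 : ℤ) * z.length ≤ d * z.length := by gcongr; omega
        omega
      obtain ⟨d, rfl⟩ := Nat.exists_eq_succ_of_ne_zero hd0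
      have e1 : k + ((wpow z 1 ++ w ++ wpow z (d + 1)).length : ℕ) - z.length =
          k + z.length + w.length + d * z.length := by simp; ring
      dsimp only [Nat.succ_eq_add_one] at hcr
      rw [e1] at hcr
      have hR := hOK.rTail_image hz hF h.firstGap_P2 hcr (f3.add d)
      rw [occursAt_append, occursAt_append] at hy
      simp only [List.length_append, length_wpow] at hy
      push_cast [one_mul] at hy
      refine rForm_cons.2 ⟨hy.1.1, by simpa using hy.1.2, rForm_nil.2 fun n => ?_⟩
      push_cast [one_mul]
      by_cases hn : n < d'
      · convert (occursAt_wpow_iff.1 hy.2) n hn using 1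
        ring
      · refine hR.occursAt_of (n + 1 - d') ?_
        have : ((n + 1 - d' : ℕ) : ℤ) = n + 1 - d' := by omega
        rw [this]
        push_cast [Nat.succ_eq_add_one, add_mul] at hlen
        rw [sub_mul, add_mul]
        omega
    simp only [p2, List.head?_nil, Option.map_none, add_zero, Int.toNat_natCast]
    rcases h.newWord_cases w none with ⟨rfl, e, -⟩ | ⟨rfl, -, e, -⟩ | ⟨h1, h2, e, -⟩
    · rw [e]; exact main _ _ _ (by omega) (ruleP2_mem z o).1
    · rw [e]; exact main _ _ _ one_pos (ruleP2_mem z w).2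
    · rw [e]
      have hno : ∀ r ∈ ruleP2 z o, ∀ i, OccursAt x.1 r.1 i → k ≤ i → False := by
        intro r hr i hi h4
        obtain ⟨-, d, -, h6 | h6⟩ := hin r hr i hi h4
        · obtain ⟨n, hn, -⟩ := h2 h6.2
          simp at hn
        · exact h1 h6.2
      have hcut : Cut z (ruleP2 z o) x.1 (k + z.length + w.length) := by
        refine ⟨by simpa using f3 0, fun r hr i hi => ?_⟩
        rcases hs.2 r hr i hi with h4 | h4
        · exact (hno r hr i hi h4).elim
        · right; omega
      have hinert := fun m => hOK.inert hF hs hcut (m := m) fun r hr k hk h4 h5 => hno r hr k hk h4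
      refine rForm_cons.2 ⟨f1.congr fun m h1 h2 => hinert m h1 ?_,
        OccursAt.congr (x := x.1) (by simpa using f2) fun m h1 h2 => hinert m (by push_cast at h1; omega) (by push_cast at h2; omega),
        rForm_nil.2 ?_⟩
      · rw [length_wpow] at h2; push_cast at h2; omega
      · have := hOK.rTail_image hz hF h.firstGap_P2 hcut f3
        simpa using this
  | cons e t ih =>
    obtain ⟨b, v⟩ := e
    have hl' := (valid_cons.1 hl).2
    have hb := (valid_cons.1 hl').1.1
    dsimp only at hb
    have hg := hf.gapAt hl
    have hg0 := hg.length_pos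
    obtain ⟨f1, f2, f3⟩ := rForm_cons.1 hf
    push_cast [one_mul] at f1 f2 f3
    have hg2 := f3.gapAt hl'
    set s1 := k + z.length + w.length with hs1
    obtain ⟨b, rfl⟩ : ∃ b', b = b' + 1 := ⟨b - 1, by omega⟩
    have f4 := rForm_pad.1 (by rw [add_comm] at f3; exact f3 : RForm z x.1 s1 ((1 + b, v) :: t))
    set k2 := s1 + b * z.length with hk2
    have hb0 : 0 ≤ (b : ℤ) * z.length := by positivity
    have hg2' : (b + 1 : ℕ) * (z.length : ℤ) = b * z.length + z.length := by push_cast; ring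
    have hl2 : Valid X z ((1, v) :: t) := by
      rw [valid_cons] at hl' ⊢
      exact ⟨⟨one_pos, hl'.1.2⟩, hl'.2⟩
    -- The last copy of `z` before the next gap is a cut: a run belonging to the rule word at the
    -- first gap ends there at the latest.
    have hcut : Cut z (ruleP2 z o) x.1 k2 := by
      refine ⟨f4.2.occursAt_head hl2, fun r hr i hi => ?_⟩
      by_contra! hlt
      obtain ⟨d, g, h1, h2, h3, h5, h6⟩ := h.ruleP2_gap hr hi
      have := h1.length_pos
      rcases hs.2 r hr i hi with h4 | h4
      · rcases hg.sep_le hp h1 h4 with ⟨e, rfl⟩ | h7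
        · have := hg2.run_le h5 (by omega)
          omega
        · rcases hg2.sep_le hp h1 (by push_cast at h7; omega) with ⟨e, rfl⟩ | h8
          · push_cast at e; rw [add_mul] at e; omega
          · push_cast at h8; rw [add_mul] at h8; omega
      · omega
    have IH := ih hl2 hcut f4.2
    have hin : ∀ r ∈ ruleP2 z o, ∀ i, OccursAt x.1 r.1 i → k ≤ i → i < k2 →
        i = k ∧ ∃ d : ℕ, (r.1.length : ℤ) = z.length + w.length + d * z.length ∧ d ≤ b + 1 ∧
        (d = o.length + 1 ∧ w = o ∨ d = 1 ∧ w = wpow o (z.length + 1)) := by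
      intro r hr i hi h4 hik
      obtain ⟨d, g, h1, h2, h3, h5, h6⟩ := h.ruleP2_gap hr hi
      rcases hg.sep_le hp h1 h4 with ⟨e, rfl⟩ | h7
      · have hik : i = k := by omega
        subst hik
        have := hg2.run_le h5 (by omega)
        have : (d : ℤ) * z.length ≤ (b + 1 : ℕ) * z.length := by omega
        have := le_of_mul_le_mul_right this (by omega)
        exact ⟨rfl, d, h2, by exact_mod_cast this, h6⟩
      · have := h1.length_pos
        rcases hg2.sep_le hp h1 (by push_cast at h7; omega) with ⟨e, rfl⟩ | h8
        · push_cast at e; rw [add_mul] at e; omega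
        · push_cast at h8; rw [add_mul] at h8; omega
    -- The replacement changes the run behind the first gap from `b + 1` to `b' + 1` copies, while
    -- the position `k2` of its last copy stays the same.
    have main : ∀ (d d' : ℕ) (w' : List A), 0 < d → 0 < d' → d ≤ b + 1 →
        (wpow z 1 ++ w ++ wpow z d, wpow z 1 ++ w' ++ wpow z d') ∈ ruleP2 z o → ∀ b' : ℕ,
        b' + d = b + d' →
        ∀ v' t', RForm z (F x).1 k2 ((1, v') :: t') →
        RForm z (F x).1 k ((1, w') :: (1 + b', v') :: t') := by
      intro d d' w' hd hd' hdb hr b' hb' v' t' hT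
      have hlen := hOK.length_eq _ hr
      simp only [List.length_append, length_wpow] at hlen
      have hlen : (w.length + d * z.length : ℤ) = w'.length + d' * z.length := by
        exact_mod_cast (by omega : w.length + d * z.length = w'.length + d' * z.length)
      have f5 := (rForm_cons.1 f3).1
      obtain ⟨m, hm⟩ := Nat.exists_eq_add_of_le hdb
      have hk : OccursAt x.1 (wpow z 1 ++ w ++ wpow z d) k := by
        rw [occursAt_append, occursAt_append]
        refine ⟨⟨f1, by simpa using f2⟩, ?_⟩
        rw [hm, wpow_add, occursAt_append] at f5
        convert f5.1 using 1; simp [hs1, add_assoc]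
      have hy := (hF x).1 _ hr _ hk
      have hcr := hOK.cut_right hr hk
      obtain ⟨d, rfl⟩ := Nat.exists_eq_add_of_le' hd
      obtain ⟨d', rfl⟩ := Nat.exists_eq_add_of_le' hd'
      have e1 : k + ((wpow z 1 ++ w ++ wpow z (d + 1)).length : ℕ) - z.length =
          s1 + d * z.length := by simp [hs1]; ring
      dsimp only at hcr
      rw [e1] at hcr
      have hbm : b = d + m := by omega
      have hbm' : (b : ℤ) * z.length = d * z.length + m * z.length := by rw [hbm]; push_cast; ring
      have hinert := fun m => hOK.inert hF hcr hcut (m := m) fun r hr i hi h4 h5 => by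
        have E := (hOK.occursAt_ends hr hi).1
        have : 0 ≤ (d : ℤ) * z.length := by positivity
        obtain ⟨h6, -⟩ := hin r hr i hi (by omega) (by omega)
        omega
      have f6 : OccursAt (F x).1 (wpow z m) (s1 + d * z.length) := by
        rw [hm, add_assoc, add_comm 1 m, wpow_add, occursAt_append, length_wpow, wpow_succ', occursAt_append] at f5
        have f5 := f5.2.1
        push_cast at f5
        refine f5.congr fun j h1 h2 => hinert j h1 ?_
        rw [length_wpow] at h2; push_cast at h2; omega
      rw [occursAt_append, occursAt_append] at hy
      simp only [List.length_append, length_wpow] at hy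
      push_cast [one_mul] at hy
      have hb2 : b' = d' + m := by omega
      refine rForm_cons.2 ⟨hy.1.1, by simpa using hy.1.2, ?_⟩
      rw [hb2]
      refine rForm_pad.2 ⟨?_, ?_⟩
      · rw [wpow_add, occursAt_append]
        have hyz := hy.2
        rw [wpow_succ', occursAt_append] at hyz
        refine ⟨by convert hyz.1 using 1; push_cast; ring, ?_⟩
        convert f6 using 1
        rw [hs1, length_wpow]
        push_cast [add_mul] at hlen ⊢
        omega
      · convert hT using 1
        rw [hk2, hs1, hbm']
        push_cast [add_mul] at hlen ⊢
        omega
    have hp2 : p2 z o 0 ((1, w) :: (b + 1, v) :: t) =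
        (1, newWord z o w (some (b + 1))) ::
          ((1 + (b + carry z o w (some (b + 1)))).toNat, newWord z o v (t.head?.map Prod.fst)) ::
          p2 z o (carry z o v (t.head?.map Prod.fst)) t := by
      simp only [p2, List.head?_cons, Option.map_some, add_zero, Int.toNat_natCast]
      congr 4
      push_cast; ring
    have hp2' : p2 z o 0 ((1, v) :: t) = (1, newWord z o v (t.head?.map Prod.fst)) ::
          p2 z o (carry z o v (t.head?.map Prod.fst)) t := by
      simp only [p2, add_zero, Int.toNat_natCast]
    rw [hp2'] at IH
    rw [hp2]
    rcases h.newWord_cases w (some (b + 1)) with ⟨rfl, e, e'⟩ | ⟨rfl, h1, e, e'⟩ | ⟨h1, h2, e, e'⟩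
    · rw [e, e']
      have := main 1 _ o one_pos (by omega) (by omega) (ruleP2_mem z o).1 (b + o.length) (by omega) _ _ IH
      convert this using 4
      omega
    · rw [e, e']
      have h1 := h1 _ rfl
      have := main _ _ _ (by omega) one_pos h1 (ruleP2_mem z w).2 (b - w.length) (by omega) _ _ IH
      convert this using 4
      omega
    · rw [e, e']
      have hinert := fun m => hOK.inert hF hs hcut (m := m) fun r hr i hi h4 h5 => by
        have E := (hOK.occursAt_ends hr hi).1
        obtain ⟨-, d, -, h7, h6 | h6⟩ := hin r hr i hi h4 (by omega)
        · obtain ⟨n, hn, h8⟩ := h2 h6.2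
          simp at hn
          omega
        · exact h1 h6.2
      refine rForm_cons.2 ⟨f1.congr fun m h1 h2 => hinert m h1 ?_,
        OccursAt.congr (x := x.1) (by simpa using f2) fun m h1 h2 => hinert m (by push_cast at h1; omega) (by push_cast at h2; omega),
        ?_⟩
      · rw [length_wpow] at h2; push_cast at h2; omega
      · rw [show (1 + (b + 0 : ℤ)).toNat = 1 + b by omega]
        have e1 : k + ((1 : ℕ) : ℤ) * z.length + w.length = s1 := by push_cast; rw [hs1]; ring
        rw [e1]
        refine rForm_pad.2 ⟨f4.1.congr fun m h1 h2 => hinert m (by omega) ?_, IH⟩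
        rw [length_wpow] at h2; push_cast at h2; omega

theorem addHead_p2 {A : Type*} (z o : List A) (k a : ℕ) (w : List A) (t : List (ℕ × List A)) :
    addHead k (p2 z o 0 ((a, w) :: t)) = p2 z o k ((a, w) :: t) := by
  simp only [p2, addHead_cons, add_zero, Int.toNat_natCast, List.cons.injEq, Prod.mk.injEq, and_true]
  omega

/-- The extra `k` moves the reference position to the left; with `k = q` leftbound gliders will be
at rest. -/
theorem form_P2 (h : IsMarkerPair X z o) {F : X.carrier → X.carrier}
    (hF : Replaces (ruleP2 z o) F) {x : X.carrier} {s : ℤ} {l : List (ℕ × List A)}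
    (hl : Valid X z l) (hf : Form z x.1 s l) (k : ℕ) :
    Form z (F x).1 (s - k * z.length) (p2 z o k l) := by
  rcases l with - | ⟨⟨a, w⟩, t⟩
  · have hc := RuleOK.cut_head h.isMarker h.firstGap_P2 hl (by simp) hf
    refine Form.pad (l := []) ⟨h.ruleOK_P2.lTail_image h.isMarker hF h.firstGap_P2 hc hf.1, ?_⟩ k
    exact rForm_nil.2 (h.ruleOK_P2.rTail_image h.isMarker hF h.firstGap_P2 hc (rForm_nil.1 hf.2))
  · have ha := (valid_cons.1 hl).1.1
    dsimp only at ha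
    obtain ⟨a, rfl⟩ := Nat.exists_eq_add_of_le ha
    have hf' := hf.unpad
    have hl' : Valid X z ((1, w) :: t) := by
      rw [valid_cons] at hl ⊢
      exact ⟨⟨one_pos, hl.1.2⟩, hl.2⟩
    have hc := RuleOK.cut_head h.isMarker h.firstGap_P2 hl' (by simp) hf'
    have hform : Form z (F x).1 _ _ := ⟨h.ruleOK_P2.lTail_image h.isMarker hF h.firstGap_P2 hc hf'.1,
      h.rForm_P2 hF hl' hc hf'.2⟩
    have := hform.pad (a + k)
    rw [addHead_p2] at this
    convert this using 1
    · push_cast; ring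
    · simp only [p2]
      congr 3
      push_cast; ring

end IsMarkerPair
end P2

/-! ### The action of `P₄` on lists and the combined step -/

section P4

variable {A : Type*} [TopologicalSpace A] {X : Subshift A ℤ} {z o : List A} {n : ℕ}

theorem flat_addHead {A : Type*} (z : List A) (b : ℕ) {l : List (ℕ × List A)} (hl : l ≠ []) :
    flat z (addHead b l) = wpow z b ++ flat z l := by
  rcases l with - | ⟨⟨a, w⟩, t⟩
  · simp at hl
  · simp [add_comm a b, wpow_add]

/-- Replacing the beginning of a list, the replaced word being preceded by further copies of `z`. -/
theorem RuleOK.rForm_replace {R : Set (List A × List A)} (hOK : RuleOK X z R)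
    {F : X.carrier → X.carrier} (hF : Replaces R F) {x : X.carrier} {s : ℤ}
    (hs : Cut z R x.1 s) {r : List A × List A} (hr : r ∈ R) {E E' t : List (ℕ × List A)}
    {b : ℕ} (hE : E ≠ []) (hE' : E' ≠ []) (e1 : r.1 = flat z E ++ z) (e2 : r.2 = flat z E' ++ z)
    (hf : RForm z x.1 s (addHead b E ++ t))
    (hz : OccursAt x.1 z (s + (flat z (addHead b E)).length))
    (hno : ∀ r ∈ R, ∀ k, OccursAt x.1 r.1 k → s ≤ k →
      k + r.1.length ≤ s + b * z.length + z.length → False) :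
    Cut z R x.1 (s + (flat z (addHead b E)).length) ∧
      ∀ t', RForm z (F x).1 (s + (flat z (addHead b E)).length) t' →
        RForm z (F x).1 s (addHead b E' ++ t') := by
  rw [flat_addHead z b hE, List.length_append, length_wpow] at hz ⊢
  rw [rForm_append, flat_addHead z b hE, occursAt_append, length_wpow] at hf
  have hlen := hOK.length_eq _ hr
  rw [e1, e2, List.length_append, List.length_append] at hlen
  push_cast at hz hf ⊢
  have hk : OccursAt x.1 r.1 (s + b * z.length) := by
    rw [e1, occursAt_append]
    exact ⟨hf.1.2, by simpa [add_assoc] using hz⟩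
  have hcl := hOK.cut_left hr hk
  have hcr := hOK.cut_right hr hk
  have hy := (hF x).1 r hr _ hk
  rw [e2, occursAt_append] at hy
  have e3 : s + (b * z.length + (flat z E).length : ℤ) =
      s + b * z.length + r.1.length - z.length := by
    rw [e1, List.length_append]; push_cast; ring
  refine ⟨by rw [e3]; exact hcr, fun t' ht => ?_⟩
  rw [rForm_append, flat_addHead z b hE', occursAt_append, length_wpow, List.length_append,
    length_wpow]
  push_cast
  refine ⟨⟨hf.1.1.congr fun m h1 h2 => hOK.inert hF hs hcl hno h1 ?_, hy.1⟩, ?_⟩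
  · rw [length_wpow] at h2; push_cast at h2; omega
  · convert ht using 1
    omega

/-- The action of `P₄` on lists. -/
inductive Step4 (c : GliderChoice X z o n) : List (ℕ × List A) → List (ℕ × List A) → Prop
  | nil : Step4 c [] []
  | inert {a : ℕ} {w : List A} {t t' : List (ℕ × List A)} :
      (∀ j, 1 ≤ j → j ≤ numClasses z o → w ∈ c.enum j → a < c.pad j w) →
      (∀ j, 1 ≤ j → j ≤ numClasses z o → w = o → (o.length, wpow o j) ∈ t.head? → a < c.pad₀ j) →
      Step4 c t t' → Step4 c ((a, w) :: t) ((a, w) :: t')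
  | cycle {j i a : ℕ} {t t' : List (ℕ × List A)} : 1 ≤ j → j ≤ numClasses z o →
      ∀ hi : i + 1 < (c.enum j).length, c.pad j (c.enum j)[i] ≤ a → Step4 c t t' →
      Step4 c ((a, (c.enum j)[i]) :: t)
        ((a - c.pad j (c.enum j)[i] + c.pad j (c.enum j)[i + 1], (c.enum j)[i + 1]) :: t')
  | split {j a : ℕ} {t t' : List (ℕ × List A)} : 1 ≤ j → j ≤ numClasses z o →
      c.pad j (wpow o (z.length + 1 + j)) ≤ a → Step4 c t t' →
      Step4 c ((a, wpow o (z.length + 1 + j)) :: t)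
        ((a - c.pad j (wpow o (z.length + 1 + j)) + c.pad₀ j, o) :: (o.length, wpow o j) :: t')
  | merge {j a : ℕ} {t t' : List (ℕ × List A)} : 1 ≤ j → j ≤ numClasses z o →
      ∀ hi : 0 < (c.enum j).length, c.pad₀ j ≤ a → Step4 c t t' →
      Step4 c ((a, o) :: (o.length, wpow o j) :: t)
        ((a - c.pad₀ j + c.pad j (c.enum j)[0], (c.enum j)[0]) :: t')

namespace GliderChoice

theorem enum_ne_nil (c : GliderChoice X z o n) {j : ℕ} (hj : 1 ≤ j) (hj' : j ≤ numClasses z o) :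
    0 < (c.enum j).length := by
  have := c.enum_last j hj hj'
  rw [List.length_pos_iff]
  intro e
  simp [e] at this

theorem enum_getElem_last (c : GliderChoice X z o n) {j i : ℕ} (hj : 1 ≤ j)
    (hj' : j ≤ numClasses z o) (hi : i + 1 = (c.enum j).length) :
    (c.enum j)[i] = wpow o (z.length + 1 + j) := by
  have := c.enum_last j hj hj'
  rw [List.getLast?_eq_getElem?, List.getElem?_eq_some_iff] at this
  obtain ⟨h1, h2⟩ := this
  rw [← h2]
  congr 1
  omega

theorem rule_cycle (c : GliderChoice X z o n) {j i : ℕ} (hj : 1 ≤ j) (hj' : j ≤ numClasses z o)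
    (hi : i + 1 < (c.enum j).length) :
    (c.padWord j (c.enum j)[i], c.padWord j (c.enum j)[i + 1]) ∈ c.ruleP4 := by
  refine ⟨j, hj, hj', mem_cycleRule.2 ⟨i + 1, by simp [padded]; omega, ?_⟩⟩
  simp only [padded, List.length_cons, List.length_map, padWord]
  simp [Nat.mod_eq_of_lt (show i + 1 + 1 < (c.enum j).length + 1 by omega)]

theorem rule_split (c : GliderChoice X z o n) {j : ℕ} (hj : 1 ≤ j) (hj' : j ≤ numClasses z o) :
    (c.padWord j (wpow o (z.length + 1 + j)), c.first j) ∈ c.ruleP4 := by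
  have h0 := c.enum_ne_nil hj hj'
  have h1 := c.enum_getElem_last (i := (c.enum j).length - 1) hj hj' (by omega)
  refine ⟨j, hj, hj', mem_cycleRule.2 ⟨(c.enum j).length, by simp [padded], ?_⟩⟩
  simp [padded, first, padWord, List.getElem_cons, h0.ne', h1]

theorem rule_merge (c : GliderChoice X z o n) {j : ℕ} (hj : 1 ≤ j) (hj' : j ≤ numClasses z o)
    (hi : 0 < (c.enum j).length) :
    (c.first j, c.padWord j (c.enum j)[0]) ∈ c.ruleP4 := by
  refine ⟨j, hj, hj', mem_cycleRule.2 ⟨0, by simp [padded], ?_⟩⟩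
  simp only [padded, List.length_cons, List.length_map, padWord, first]
  simp [Nat.mod_eq_of_lt (show 0 + 1 < (c.enum j).length + 1 by omega)]

/-- The words of `P₄` as padded gaps. -/
theorem rule_gap (h : IsMarkerPair X z o) (c : GliderChoice X z o n) {r : List A × List A}
    (hr : r ∈ c.ruleP4) {x : ℤ → A} {k : ℤ} (hk : OccursAt x r.1 k) :
    ∃ j, 1 ≤ j ∧ j ≤ numClasses z o ∧ ((GapAt z x k (c.pad₀ j) o ∧
        GapAt z x (k + c.pad₀ j * z.length + o.length) o.length (wpow o j) ∧
        (r.1.length : ℤ) = c.pad₀ j * z.length + o.length + o.length * z.length +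
          (wpow o j).length + z.length) ∨
      ∃ w ∈ c.enum j, GapAt z x k (c.pad j w) w ∧
        (r.1.length : ℤ) = c.pad j w * z.length + w.length + z.length) := by
  obtain ⟨j, hj, hj', hr⟩ := hr
  refine ⟨j, hj, hj', ?_⟩
  obtain ⟨i, hi, rfl⟩ := mem_cycleRule.1 hr
  rcases c.mem_padded.1 (List.getElem_mem hi) with e | ⟨w, hw, e⟩
  · left
    dsimp only at hk ⊢
    rw [e] at hk ⊢
    obtain ⟨g1, g2⟩ := (c.gapAt_first h hj hj').1 hk
    exact ⟨g1, g2, by simp [first]; ring⟩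
  · right
    dsimp only at hk ⊢
    rw [e] at hk ⊢
    exact ⟨w, hw, (c.gapAt_padWord hj hj' hw).1 hk, by simp [padWord]; ring⟩

theorem exists_firstGap (h : IsMarkerPair X z o) (c : GliderChoice X z o n) :
    ∃ C, FirstGap z c.ruleP4 C := by
  have hp := h.length_pos
  obtain ⟨C, hC⟩ := (c.ruleOK h).bounded
  refine ⟨C, fun r hr x k hk => ?_⟩
  have hb := hC r hr
  have key : ∀ a g, GapAt z x k a g → (a * z.length + g.length + z.length : ℤ) ≤ r.1.length →
      ∃ a g, a ≤ C ∧ a * z.length + g.length + z.length ≤ r.1.length ∧ GapAt z x k a g := by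
    intro a g hg hle
    refine ⟨a, g, ?_, by exact_mod_cast hle, hg⟩
    have h1 : a * 1 ≤ a * z.length := Nat.mul_le_mul_left _ hp
    have h2 : a * z.length + g.length + z.length ≤ r.1.length := by exact_mod_cast hle
    omega
  obtain ⟨j, hj, hj', ⟨g1, g2, e⟩ | ⟨w, hw, g, e⟩⟩ := c.rule_gap h hr hk
  · refine key _ _ g1 ?_
    have : 0 ≤ (o.length : ℤ) * z.length := by positivity
    omega
  · exact key _ _ g (by omega)

/-- The list is scanned from the left: at the first gap a padded word is replaced if there are
enough copies of `z`, and the scan goes on behind it. -/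
theorem rForm_P4 (h : IsMarkerPair X z o) (c : GliderChoice X z o n) {F : X.carrier → X.carrier}
    (hF : Replaces c.ruleP4 F) {x : X.carrier} {s : ℤ} {l : List (ℕ × List A)}
    (hl : Valid X z l) (hs : Cut z c.ruleP4 x.1 s) (hf : RForm z x.1 s l) :
    ∃ l', Step4 c l l' ∧ RForm z (F x).1 s l' := by
  have hp := h.length_pos
  have hz := h.isMarker
  have hOK := c.ruleOK h
  obtain ⟨C, hC⟩ := c.exists_firstGap h
  -- Strong induction is needed since a merge consumes two entries.
  induction hN : l.length using Nat.strong_induction_on generalizing s l with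
  | _ N ih =>
    rcases l with - | ⟨⟨a, w⟩, t⟩
    · exact ⟨[], .nil, rForm_nil.2 (hOK.rTail_image hz hF hC hs (rForm_nil.1 hf))⟩
    have hg := hf.gapAt hl
    have hl' := (valid_cons.1 hl).2
    have hw0 := hg.length_pos
    obtain ⟨f1, f2, f3⟩ := rForm_cons.1 hf
    have hsecond : ∀ j, GapAt z x.1 (s + a * z.length + w.length) o.length (wpow o j) →
        (o.length, wpow o j) ∈ t.head? := by
      intro j hj
      rcases t with - | ⟨⟨b, v⟩, t⟩
      · exact absurd hj ((rForm_nil.1 f3).not_gapAt hp)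
      · obtain ⟨e1, rfl⟩ := (f3.gapAt hl').unique hp hj (m := s + a * z.length + w.length) le_rfl
          (by
            have := (f3.gapAt hl').length_pos
            have : 0 ≤ (b : ℤ) * z.length := by positivity
            omega) le_rfl (by
            have := hj.length_pos
            have : 0 ≤ (o.length : ℤ) * z.length := by positivity
            omega)
        have : b = o.length := by
          have : (b : ℤ) * z.length = o.length * z.length := by omega
          exact_mod_cast mul_right_cancel₀ (by omega) this
        simp [this]
    -- A rule word that starts before the end of the first gap has this gap as its own first gap.
    have hin : ∀ r ∈ c.ruleP4, ∀ k, OccursAt x.1 r.1 k → s ≤ k →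
        k < s + a * z.length + w.length →
        ∃ j, 1 ≤ j ∧ j ≤ numClasses z o ∧ ((w = o ∧ (o.length, wpow o j) ∈ t.head? ∧
          k + c.pad₀ j * z.length = s + a * z.length ∧
          s + a * z.length + z.length < k + r.1.length) ∨
          (w ∈ c.enum j ∧ k + c.pad j w * z.length = s + a * z.length ∧
          s + a * z.length + z.length < k + r.1.length)) := by
      intro r hr k hk h1 h2
      obtain ⟨j, hj, hj', ⟨g1, g2, e⟩ | ⟨w', hw', g, e⟩⟩ := c.rule_gap h hr hk
      · rcases hg.sep_le hp g1 h1 with ⟨e1, rfl⟩ | h3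
        · refine ⟨j, hj, hj', Or.inl ⟨rfl, hsecond j ?_, e1.symm, ?_⟩⟩
          · rw [e1]; exact g2
          · have : 0 ≤ (w.length : ℤ) * z.length := by positivity
            omega
        · omega
      · rcases hg.sep_le hp g h1 with ⟨e1, rfl⟩ | h3
        · exact ⟨j, hj, hj', Or.inr ⟨hw', e1.symm, by omega⟩⟩
        · omega
    have hin' : ∀ b : ℕ, b ≤ a → ∀ r ∈ c.ruleP4, ∀ k, OccursAt x.1 r.1 k → s ≤ k →
        k + r.1.length ≤ s + b * z.length + z.length → False := by
      intro b hb r hr k hk h1 h2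
      have hba : (b : ℤ) * z.length ≤ a * z.length := by gcongr
      have := (hOK.occursAt_ends hr hk).1
      obtain ⟨j, -, -, ⟨-, -, -, h3⟩ | ⟨-, -, h3⟩⟩ := hin r hr k hk h1 (by omega) <;> omega
    have single : ∀ (c' : ℕ) (E' : List (ℕ × List A)), c' ≤ a → E' ≠ [] →
        (wpow z c' ++ w ++ z, flat z E' ++ z) ∈ c.ruleP4 →
        ∃ t', Step4 c t t' ∧ RForm z (F x).1 s (addHead (a - c') E' ++ t') := by
      intro c' E' hc' hE' hr
      obtain ⟨b, rfl⟩ := Nat.exists_eq_add_of_le hc'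
      rw [Nat.add_sub_cancel_left]
      have e : s + ((flat z (addHead b [(c', w)])).length : ℤ) =
          s + (c' + b : ℕ) * z.length + w.length := by simp [add_assoc]
      obtain ⟨hcut, H⟩ := hOK.rForm_replace hF hs hr (E := [(c', w)]) (t := t) (b := b) (by simp)
        hE' (by simp) rfl (by simpa using hf) (by rw [e]; exact f3.occursAt_head hl')
        (hin' b (by omega))
      rw [e] at hcut H
      obtain ⟨t', ht, ht'⟩ := ih t.length (by simp at hN; omega) hl' hcut f3 rfl
      exact ⟨t', ht, H t' ht'⟩
    by_cases H1 : ∃ j, 1 ≤ j ∧ j ≤ numClasses z o ∧ w ∈ c.enum j ∧ c.pad j w ≤ a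
    · obtain ⟨j, hj, hj', hw, ha⟩ := H1
      obtain ⟨i, hi, rfl⟩ := List.mem_iff_getElem.1 hw
      by_cases hi' : i + 1 < (c.enum j).length
      · obtain ⟨t', ht, ht'⟩ := single _ [(c.pad j (c.enum j)[i + 1], (c.enum j)[i + 1])] ha
          (by simp) (by simpa [padWord] using c.rule_cycle hj hj' hi')
        refine ⟨_, .cycle hj hj' hi' ha ht, ?_⟩
        simpa [add_comm] using ht'
      · have e := c.enum_getElem_last hj hj' (show i + 1 = (c.enum j).length by omega)
        rw [e] at ha single ⊢
        obtain ⟨t', ht, ht'⟩ := single _ [(c.pad₀ j, o), (o.length, wpow o j)] ha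
          (by simp) (by simpa [padWord, first] using c.rule_split hj hj')
        refine ⟨_, .split hj hj' ha ht, ?_⟩
        simpa [add_comm] using ht'
    by_cases H2 : ∃ j, 1 ≤ j ∧ j ≤ numClasses z o ∧ w = o ∧ (o.length, wpow o j) ∈ t.head? ∧
        c.pad₀ j ≤ a
    · obtain ⟨j, hj, hj', rfl, ht, ha⟩ := H2
      rcases t with - | ⟨e, t⟩
      · simp at ht
      simp only [List.head?_cons, Option.mem_def, Option.some.injEq] at ht
      subst ht
      have hi := c.enum_ne_nil hj hj'
      have hl2 := (valid_cons.1 hl').2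
      have f4 := (rForm_cons.1 f3).2.2
      obtain ⟨b, rfl⟩ := Nat.exists_eq_add_of_le ha
      have e : s + ((flat z (addHead b [(c.pad₀ j, w), (w.length, wpow w j)])).length : ℤ) =
          s + (c.pad₀ j + b : ℕ) * z.length + w.length + w.length * z.length +
            (wpow w j).length := by simp [add_assoc]
      obtain ⟨hcut, H⟩ := hOK.rForm_replace hF hs (c.rule_merge hj hj' hi)
        (E := [(c.pad₀ j, w), (w.length, wpow w j)])
        (E' := [(c.pad j (c.enum j)[0], (c.enum j)[0])]) (t := t) (b := b) (by simp)
        (by simp) (by simp [first]) (by simp [padWord]) (by simpa using hf)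
        (by rw [e]; exact f4.occursAt_head hl2) (hin' b (by omega))
      rw [e] at hcut H
      obtain ⟨t', ht, ht'⟩ := ih t.length (by simp at hN; omega) hl2 hcut f4 rfl
      refine ⟨_, .merge hj hj' hi ha ht, ?_⟩
      simpa [add_comm] using H t' ht'
    push Not at H1 H2
    have hno : ∀ r ∈ c.ruleP4, ∀ k, OccursAt x.1 r.1 k → s ≤ k →
        k < s + a * z.length + w.length → False := by
      intro r hr k hk h1 h2
      obtain ⟨j, hj, hj', ⟨h3, h4, h5, -⟩ | ⟨h3, h5, -⟩⟩ := hin r hr k hk h1 h2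
      · have : (a : ℤ) * z.length < c.pad₀ j * z.length := by
          gcongr; exact H2 j hj hj' h3 h4
        omega
      · have : (a : ℤ) * z.length < c.pad j w * z.length := by
          gcongr; exact H1 j hj hj' h3
        omega
    have hcut : Cut z c.ruleP4 x.1 (s + a * z.length + w.length) := by
      refine ⟨f3.occursAt_head hl', fun r hr k hk => ?_⟩
      by_contra! hlt
      rcases hs.2 r hr k hk with h4 | h4
      · exact hno r hr k hk h4 hlt.1
      · have : 0 ≤ (a : ℤ) * z.length := by positivity
        omega
    obtain ⟨t', ht, ht'⟩ := ih t.length (by simp at hN; omega) hl' hcut f3 rfl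
    refine ⟨_, .inert H1 H2 ht, ?_⟩
    have hinert := fun m => hOK.inert hF hs hcut (m := m) fun r hr k hk h4 h5 => by
      have := (hOK.occursAt_ends hr hk).1
      exact hno r hr k hk h4 (by omega)
    refine rForm_cons.2 ⟨f1.congr fun m h1 h2 => hinert m h1 ?_,
      f2.congr fun m h1 h2 => hinert m ?_ (by omega), ht'⟩
    · rw [length_wpow] at h2; push_cast at h2; omega
    · have : 0 ≤ (a : ℤ) * z.length := by positivity
      omega

end GliderChoice

/-- The action of a glider automorphism on lists, in the frame moving with the leftbound gliders. -/
def Step (c : GliderChoice X z o n) (l l' : List (ℕ × List A)) : Prop :=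
  Step4 c (p2 z o o.length (l.map (p1 z o))) l'

namespace GliderChoice

theorem Step4.valid (h : IsMarkerPair X z o) {c : GliderChoice X z o n} {l l' : List (ℕ × List A)}
    (hl : Valid X z l) (hs : Step4 c l l') : Valid X z l' := by
  have h2 := h.two_le
  induction hs with
  | nil => simp
  | inert _ _ _ ih =>
    rw [valid_cons] at hl ⊢
    exact ⟨hl.1, ih hl.2⟩
  | cycle hj hj' hi ha _ ih =>
    rw [valid_cons] at hl ⊢
    have := c.le_pad _ hj hj' _ (List.getElem_mem hi)
    exact ⟨⟨by dsimp only; omega, c.isGap hj hj' (List.getElem_mem hi)⟩, ih hl.2⟩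
  | @split j _ _ _ hj hj' ha _ ih =>
    rw [valid_cons] at hl
    rw [valid_cons, valid_cons]
    have := c.le_pad₀ _ hj hj'
    exact ⟨⟨by dsimp only; omega, h.isGap_o⟩, ⟨by dsimp only; omega, h.isGap_wpow (by omega)⟩,
      ih hl.2⟩
  | merge hj hj' hi ha _ ih =>
    rw [valid_cons, valid_cons] at hl
    rw [valid_cons]
    have := c.le_pad _ hj hj' _ (List.getElem_mem hi)
    exact ⟨⟨by dsimp only; omega, c.isGap hj hj' (List.getElem_mem hi)⟩, ih hl.2.2⟩

end GliderChoice

namespace IsMarkerPair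

theorem valid_p1 (h : IsMarkerPair X z o) {l : List (ℕ × List A)} (hl : Valid X z l) :
    Valid X z (l.map (p1 z o)) := by
  induction l with
  | nil => simp
  | cons e t ih =>
    obtain ⟨a, w⟩ := e
    rw [valid_cons] at hl
    rw [List.map_cons, valid_cons]
    refine ⟨?_, ih hl.2⟩
    have := hl.1.1
    dsimp only at this
    rcases h.p1_cases a w with ⟨rfl, e⟩ | ⟨rfl, h1, e⟩ | ⟨h1, h2, e⟩ <;> rw [e]
    · exact ⟨by dsimp only; omega, h.isGap_o⟩
    · exact ⟨by dsimp only; omega, h.isGap_r⟩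
    · exact hl.1

theorem valid_p2 (h : IsMarkerPair X z o) {l : List (ℕ × List A)} (hl : Valid X z l) (k : ℤ)
    (hk : ∀ e ∈ l.head?, 0 < e.1 + k) : Valid X z (p2 z o k l) := by
  induction l generalizing k with
  | nil => simp [p2]
  | cons e t ih =>
    obtain ⟨a, w⟩ := e
    rw [valid_cons] at hl
    rw [p2, valid_cons]
    have hk := hk _ rfl
    dsimp only at hk
    refine ⟨⟨by dsimp only; omega, ?_⟩, ih hl.2 _ fun e he => ?_⟩
    · rcases h.newWord_cases w (t.head?.map Prod.fst) with
        ⟨rfl, e, -⟩ | ⟨rfl, h1, e, -⟩ | ⟨h1, h2, e, -⟩ <;> rw [e]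
      · exact h.isGap_o
      · exact h.isGap_r
      · exact hl.1.2
    · have := (hl.2 e (by
        rcases t with - | ⟨e', t⟩
        · simp at he
        · simp at he; simp [he])).1
      rcases h.newWord_cases w (t.head?.map Prod.fst) with
        ⟨rfl, -, e'⟩ | ⟨rfl, h1, -, e'⟩ | ⟨h1, h2, -, e'⟩ <;> rw [e']
      · omega
      · rw [Option.mem_def] at he
        have := h1 e.1 (by simp [he])
        omega
      · omega

theorem valid_step (h : IsMarkerPair X z o) {c : GliderChoice X z o n} {l l' : List (ℕ × List A)}
    (hl : Valid X z l) (hs : Step c l l') : Valid X z l' :=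
  GliderChoice.Step4.valid h (h.valid_p2 (h.valid_p1 hl) _ fun e he => by
    have hl' := h.valid_p1 hl
    have := (hl' e (List.mem_of_mem_head? he)).1
    omega) hs

/-- With at least `C` copies of `z` at the head, the reference position is a cut for each of the
three maps. The frame moves by `qp` to the left in each step. -/
theorem exists_form_step [DiscreteTopology A] [Finite A] (h : IsMarkerPair X z o)
    {c : GliderChoice X z o n} {G : Aut X}
    (hG : IsGliderCA c G) : ∃ C, ∀ (x : X.carrier) (s : ℤ) (l : List (ℕ × List A)), Valid X z l →
      (∀ e ∈ l.head?, C ≤ e.1) → Form z x.1 s l →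
      ∃ l', Step c l l' ∧ Form z (G.1 x).1 (s - o.length * z.length) l' := by
  obtain ⟨P1, P2, P4, h1, h2, h4, rfl⟩ := hG
  obtain ⟨C, hC⟩ := c.exists_firstGap h
  refine ⟨C + o.length + 1, fun x s l hl hh hf => ?_⟩
  have f1 := h.form_P1 h1 hl (fun e he => by have := hh e he; omega) hf
  have f2 := h.form_P2 h2 (h.valid_p1 hl) f1 o.length
  have hl2 := h.valid_p2 (h.valid_p1 hl) o.length fun e he => by
    have := ((h.valid_p1 hl) e (List.mem_of_mem_head? he)).1
    omega
  have hcut := RuleOK.cut_head h.isMarker hC hl2 (fun e he => ?_) f2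
  · obtain ⟨l', hs, f4⟩ := c.rForm_P4 h h4 hl2 hcut f2.2
    exact ⟨l', hs, (c.ruleOK h).lTail_image h.isMarker h4 hC hcut f2.1, f4⟩
  · rcases l with - | ⟨⟨a, w⟩, t⟩
    · simp [p2] at he
    · have := hh _ rfl
      dsimp only at this
      rw [List.map_cons] at he
      rcases h.p1_cases a w with ⟨rfl, e⟩ | ⟨rfl, h1, e⟩ | ⟨h1, h2, e⟩ <;> rw [e] at he <;>
        simp [p2] at he <;> rw [← he] <;> dsimp only <;> omega

end IsMarkerPair
end P4

/-! ### Motion of gliders -/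

section Fleets

/-- A list of leftbound gliders. -/
def LeftFleet {A : Type*} (o : List A) (l : List (ℕ × List A)) : Prop :=
  ∀ e ∈ l, o.length + 1 ≤ e.1 ∧ e.2 = o

/-- A list of rightbound gliders. -/
def RightFleet {A : Type*} (z o : List A) (l : List (ℕ × List A)) : Prop :=
  ∀ e ∈ l, 0 < e.1 ∧ e.2 = wpow o (z.length + 1)

@[simp] theorem leftFleet_nil {A : Type*} (o : List A) : LeftFleet o [] := by simp [LeftFleet]

@[simp] theorem leftFleet_cons {A : Type*} {o : List A} {e : ℕ × List A} {l : List (ℕ × List A)} :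
    LeftFleet o (e :: l) ↔ (o.length + 1 ≤ e.1 ∧ e.2 = o) ∧ LeftFleet o l := by
  simp [LeftFleet]

@[simp] theorem leftFleet_append {A : Type*} {o : List A} {l l' : List (ℕ × List A)} :
    LeftFleet o (l ++ l') ↔ LeftFleet o l ∧ LeftFleet o l' := by
  simp only [LeftFleet, List.mem_append, or_imp, forall_and]
  tauto

@[simp] theorem rightFleet_nil {A : Type*} (z o : List A) : RightFleet z o [] := by
  simp [RightFleet]

@[simp] theorem rightFleet_cons {A : Type*} {z o : List A} {e : ℕ × List A}
    {l : List (ℕ × List A)} : RightFleet z o (e :: l) ↔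
      (0 < e.1 ∧ e.2 = wpow o (z.length + 1)) ∧ RightFleet z o l := by
  simp [RightFleet]

@[simp] theorem rightFleet_append {A : Type*} {z o : List A} {l l' : List (ℕ × List A)} :
    RightFleet z o (l ++ l') ↔ RightFleet z o l ∧ RightFleet z o l' := by
  simp only [RightFleet, List.mem_append, or_imp, forall_and]
  tauto

theorem LeftFleet.addHead {A : Type*} {o : List A} {l : List (ℕ × List A)} (h : LeftFleet o l)
    (k : ℕ) : LeftFleet o (addHead k l) := by
  rcases l with - | ⟨⟨a, w⟩, t⟩
  · simp
  · simp only [leftFleet_cons, addHead_cons] at h ⊢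
    exact ⟨⟨by omega, h.1.2⟩, h.2⟩

theorem RightFleet.addHead {A : Type*} {z o : List A} {l : List (ℕ × List A)}
    (h : RightFleet z o l) (k : ℕ) : RightFleet z o (addHead k l) := by
  rcases l with - | ⟨⟨a, w⟩, t⟩
  · simp
  · simp only [rightFleet_cons, addHead_cons] at h ⊢
    exact ⟨⟨by omega, h.1.2⟩, h.2⟩

variable {A : Type*} [TopologicalSpace A] {X : Subshift A ℤ} {z o : List A} {n : ℕ}

theorem IsMarkerPair.valid_leftFleet (h : IsMarkerPair X z o) {l : List (ℕ × List A)}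
    (hl : LeftFleet o l) : Valid X z l := fun e he => by
  obtain ⟨h1, h2⟩ := hl e he
  exact ⟨by omega, h2 ▸ h.isGap_o⟩

theorem IsMarkerPair.valid_rightFleet (h : IsMarkerPair X z o) {l : List (ℕ × List A)}
    (hl : RightFleet z o l) : Valid X z l := fun e he => by
  obtain ⟨h1, h2⟩ := hl e he
  exact ⟨h1, h2 ▸ h.isGap_r⟩

namespace Step4

variable {c : GliderChoice X z o n} {a : ℕ} {w : List A} {t l : List (ℕ × List A)}

theorem cons_cases (hs : Step4 c ((a, w) :: t) l) :
    (∃ t', Step4 c t t' ∧ l = (a, w) :: t' ∧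
      (∀ j, 1 ≤ j → j ≤ numClasses z o → w ∈ c.enum j → a < c.pad j w)) ∨
    (∃ j i t', 1 ≤ j ∧ j ≤ numClasses z o ∧ ∃ hi : i + 1 < (c.enum j).length,
      w = (c.enum j)[i] ∧ c.pad j w ≤ a ∧ Step4 c t t' ∧
      l = (a - c.pad j w + c.pad j (c.enum j)[i + 1], (c.enum j)[i + 1]) :: t') ∨
    (∃ j t', 1 ≤ j ∧ j ≤ numClasses z o ∧ w = wpow o (z.length + 1 + j) ∧ w ∈ c.enum j ∧
      c.pad j w ≤ a ∧ Step4 c t t' ∧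
      l = (a - c.pad j w + c.pad₀ j, o) :: (o.length, wpow o j) :: t') ∨
    (∃ j t₁ t', 1 ≤ j ∧ j ≤ numClasses z o ∧ ∃ hi : 0 < (c.enum j).length, w = o ∧
      t = (o.length, wpow o j) :: t₁ ∧ c.pad₀ j ≤ a ∧ Step4 c t₁ t' ∧
      l = (a - c.pad₀ j + c.pad j (c.enum j)[0], (c.enum j)[0]) :: t') := by
  generalize hm : (a, w) :: t = m at hs
  cases hs with
  | nil => simp at hm
  | inert h1 h2 h3 =>
    simp only [List.cons.injEq, Prod.mk.injEq] at hm
    obtain ⟨⟨rfl, rfl⟩, rfl⟩ := hm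
    exact Or.inl ⟨_, h3, rfl, h1⟩
  | cycle hj hj' hi ha h3 =>
    simp only [List.cons.injEq, Prod.mk.injEq] at hm
    obtain ⟨⟨rfl, rfl⟩, rfl⟩ := hm
    exact Or.inr (Or.inl ⟨_, _, _, hj, hj', hi, rfl, ha, h3, rfl⟩)
  | split hj hj' ha h3 =>
    simp only [List.cons.injEq, Prod.mk.injEq] at hm
    obtain ⟨⟨rfl, rfl⟩, rfl⟩ := hm
    exact Or.inr (Or.inr (Or.inl ⟨_, _, hj, hj', rfl,
      List.mem_of_getLast? (c.enum_last _ hj hj'), ha, h3, rfl⟩))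
  | merge hj hj' hi ha h3 =>
    simp only [List.cons.injEq, Prod.mk.injEq] at hm
    obtain ⟨⟨rfl, rfl⟩, rfl⟩ := hm
    exact Or.inr (Or.inr (Or.inr ⟨_, _, _, hj, hj', hi, rfl, rfl, ha, h3, rfl⟩))

theorem nil_eq (hs : Step4 c [] l) : l = [] := by
  cases hs; rfl

theorem o_notMem (h : IsMarkerPair X z o) (c : GliderChoice X z o n) {j : ℕ} (hj : 1 ≤ j)
    (hj' : j ≤ numClasses z o) (hw : w = o ∨ w = wpow o (z.length + 1)) : w ∉ c.enum j :=
  fun hm => h.o_notMem_class hj hj' hw ((c.mem_enum j hj hj' w).1 hm)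

/-- `P₄` does not change gliders. -/
theorem r_cons (h : IsMarkerPair X z o) (hw : w = wpow o (z.length + 1))
    (hs : Step4 c ((a, w) :: t) l) : ∃ t', Step4 c t t' ∧ l = (a, w) :: t' := by
  rcases hs.cons_cases with ⟨t', h1, h2, -⟩ | ⟨j, i, t', hj, hj', hi, e, -⟩ |
    ⟨j, t', hj, hj', -, e, -⟩ | ⟨j, t1, t', hj, hj', hi, e, -⟩
  · exact ⟨t', h1, h2⟩
  · exact absurd (e ▸ List.getElem_mem _) (o_notMem h c hj hj' (Or.inr hw))
  · exact absurd e (o_notMem h c hj hj' (Or.inr hw))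
  · exact absurd (e.symm.trans hw) h.o_ne_r

theorem o_cons (h : IsMarkerPair X z o) (hw : w = o) (hs : Step4 c ((a, w) :: t) l) :
    (∃ t', Step4 c t t' ∧ l = (a, w) :: t') ∨
    ∃ j t₁ t', 1 ≤ j ∧ j ≤ numClasses z o ∧ ∃ hi : 0 < (c.enum j).length,
      t = (o.length, wpow o j) :: t₁ ∧ c.pad₀ j ≤ a ∧ Step4 c t₁ t' ∧
      l = (a - c.pad₀ j + c.pad j (c.enum j)[0], (c.enum j)[0]) :: t' := by
  rcases hs.cons_cases with ⟨t', h1, h2, -⟩ | ⟨j, i, t', hj, hj', hi, e, -⟩ |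
    ⟨j, t', hj, hj', -, e, -⟩ | ⟨j, t1, t', hj, hj', hi, -, e⟩
  · exact Or.inl ⟨t', h1, h2⟩
  · exact absurd (e ▸ List.getElem_mem _) (o_notMem h c hj hj' (Or.inl hw))
  · exact absurd e (o_notMem h c hj hj' (Or.inl hw))
  · exact Or.inr ⟨_, _, _, hj, hj', hi, e⟩

theorem rightFleet_append (h : IsMarkerPair X z o) {R : List (ℕ × List A)}
    (hR : RightFleet z o R) (hs : Step4 c (R ++ t) l) : ∃ t', Step4 c t t' ∧ l = R ++ t' := by
  induction R generalizing l with
  | nil => exact ⟨l, hs, rfl⟩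
  | cons e R ih =>
    obtain ⟨a, w⟩ := e
    rw [rightFleet_cons] at hR
    obtain ⟨l', h1, rfl⟩ := r_cons h hR.1.2 hs
    obtain ⟨t', h2, rfl⟩ := ih hR.2 h1
    exact ⟨t', h2, rfl⟩

end Step4

namespace IsMarkerPair

variable {c : GliderChoice X z o n}

/-- `P₁` turns the leftbound glider into `o^(p+1)` and `P₂` turns this back into `o`, now `q` copies
of `z` further to the left; these copies are handed to the next entry. -/
theorem p2_map_cons_o (h : IsMarkerPair X z o) {a : ℕ} {k : ℤ} (ha : o.length + 1 ≤ a)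
    (l : List (ℕ × List A)) : p2 z o k (((a, o) :: l).map (p1 z o)) =
      ((a - o.length + k : ℤ).toNat, o) :: p2 z o o.length (l.map (p1 z o)) := by
  rw [List.map_cons, h.p1_o ha, p2]
  have h1 := h.newWord_cases (wpow o (z.length + 1)) ((l.map (p1 z o)).head?.map Prod.fst)
  rcases h1 with ⟨-, e, e'⟩ | ⟨e, -⟩ | ⟨e, -⟩
  · rw [e, e']
    congr 3
    omega
  · exact absurd e.symm h.o_ne_r
  · exact absurd rfl e

/-- In the moving frame a leftbound glider in front is at rest and does not influence the rest of
the list. -/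
theorem step_cons_o (h : IsMarkerPair X z o) {a : ℕ} (ha : o.length + 1 ≤ a)
    {l l' : List (ℕ × List A)} (hl : Valid X z l) (hs : Step c ((a, o) :: l) l') :
    ∃ m, Step c l m ∧ l' = (a, o) :: m := by
  rw [Step, h.p2_map_cons_o ha] at hs
  rw [show (a - o.length + o.length : ℤ).toNat = a by omega] at hs
  rcases hs.o_cons h rfl with h1 | ⟨j, t1, t', hj, hj', hi, e, -⟩
  · exact h1
  -- A merge needs exactly `q` copies before the next gap, but the carry adds `q` to a positive
  -- exponent.
  · exfalso
    rcases l with - | ⟨⟨b, v⟩, l⟩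
    · simp [p2] at e
    · have := (h.valid_p1 hl) (p1 z o (b, v)) (by simp)
      rw [List.map_cons] at e
      rcases hp : p1 z o (b, v) with ⟨b', v'⟩
      rw [hp] at e this
      simp only [p2, List.cons.injEq, Prod.mk.injEq] at e
      have := this.1
      dsimp only at this
      omega

theorem step_leftFleet_append (h : IsMarkerPair X z o) {L : List (ℕ × List A)}
    (hL : LeftFleet o L) {l l' : List (ℕ × List A)} (hl : Valid X z l)
    (hs : Step c (L ++ l) l') : ∃ m, Step c l m ∧ l' = L ++ m := by
  induction L generalizing l' with
  | nil => exact ⟨l', hs, rfl⟩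
  | cons e L ih =>
    obtain ⟨a, w⟩ := e
    rw [leftFleet_cons] at hL
    obtain ⟨⟨ha, rfl⟩, hL⟩ := hL
    obtain ⟨m, h1, rfl⟩ := h.step_cons_o ha (valid_append.2 ⟨h.valid_leftFleet hL, hl⟩) hs
    obtain ⟨m, h2, rfl⟩ := ih hL h1
    exact ⟨m, h2, rfl⟩

/-- `P₁` turns the rightbound glider into `o` at the right end of its place, and `P₂` turns this
back into `o^(p+1)` at the expense of `q` copies behind it, if more than `q` are there. -/
theorem p2_map_cons_r (h : IsMarkerPair X z o) {l : List (ℕ × List A)}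
    (hl : ∀ e ∈ (l.map (p1 z o)).head?, o.length + 1 ≤ e.1) (a : ℕ) (k : ℤ) :
    p2 z o k (((a, wpow o (z.length + 1)) :: l).map (p1 z o)) =
      ((a + k + o.length).toNat, wpow o (z.length + 1)) :: p2 z o (-o.length) (l.map (p1 z o)) := by
  rw [List.map_cons, p1_r, p2]
  rcases h.newWord_cases o ((l.map (p1 z o)).head?.map Prod.fst) with
    ⟨e, -⟩ | ⟨-, -, e, e'⟩ | ⟨-, e, -⟩
  · exact absurd e h.o_ne_r
  · rw [e, e']
    congr 3
    push_cast; ring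
  · obtain ⟨m, hm, hm'⟩ := e rfl
    rw [Option.mem_def, Option.map_eq_some_iff] at hm
    obtain ⟨e, he, rfl⟩ := hm
    have := hl e he
    omega

theorem le_head_map_p1_append {A : Type*} {z o : List A} {R l : List (ℕ × List A)}
    (hR : RightFleet z o R) (hl : ∀ e ∈ (l.map (p1 z o)).head?, o.length + 1 ≤ e.1) :
    ∀ e ∈ ((R ++ l).map (p1 z o)).head?, o.length + 1 ≤ e.1 := by
  rcases R with - | ⟨⟨a, w⟩, R⟩
  · exact hl
  · rw [rightFleet_cons] at hR
    obtain ⟨⟨ha, rfl⟩, -⟩ := hR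
    dsimp only at ha
    intro e he
    rw [List.cons_append, List.map_cons, p1_r, List.head?_cons, Option.mem_def,
      Option.some.injEq] at he
    subst he
    dsimp only
    omega

/-- Rightbound gliders, followed by a list which does not interfere. -/
theorem p2_map_rightFleet_append (h : IsMarkerPair X z o) {R l : List (ℕ × List A)}
    (hR : RightFleet z o R) (hl : ∀ e ∈ (l.map (p1 z o)).head?, o.length + 1 ≤ e.1) :
    p2 z o (-o.length) ((R ++ l).map (p1 z o)) = R ++ p2 z o (-o.length) (l.map (p1 z o)) := by
  induction R with
  | nil => rfl
  | cons e R ih =>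
    obtain ⟨a, w⟩ := e
    rw [rightFleet_cons] at hR
    obtain ⟨⟨ha, rfl⟩, hR⟩ := hR
    rw [List.cons_append, h.p2_map_cons_r (le_head_map_p1_append hR hl), ih hR, List.cons_append]
    congr 3
    omega

/-- The gain of `2q` copies at the head is the motion of the gliders plus that of the frame. -/
theorem step_rightFleet_append (h : IsMarkerPair X z o) {R l l' : List (ℕ × List A)}
    (hR : RightFleet z o R) (hR' : R ≠ [])
    (hl : ∀ e ∈ (l.map (p1 z o)).head?, o.length + 1 ≤ e.1) (hs : Step c (R ++ l) l') :
    ∃ m, Step4 c (p2 z o (-o.length) (l.map (p1 z o))) m ∧ l' = addHead (2 * o.length) R ++ m := by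
  rcases R with - | ⟨⟨a, w⟩, R⟩
  · exact absurd rfl hR'
  obtain ⟨⟨ha, rfl⟩, hR2⟩ := rightFleet_cons.1 hR
  rw [Step, List.cons_append, h.p2_map_cons_r (le_head_map_p1_append hR2 hl),
    h.p2_map_rightFleet_append hR2 hl] at hs
  have := hR.addHead (2 * o.length)
  rw [show (a + o.length + o.length : ℤ).toNat = a + 2 * o.length by omega] at hs
  exact Step4.rightFleet_append h this hs

theorem step_rightFleet (h : IsMarkerPair X z o) {R l' : List (ℕ × List A)}
    (hR : RightFleet z o R) (hs : Step c R l') : l' = addHead (2 * o.length) R := by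
  rcases eq_or_ne R [] with rfl | hR'
  · exact hs.nil_eq
  · obtain ⟨m, h1, rfl⟩ := h.step_rightFleet_append (l := []) hR hR' (by simp) (by simpa using hs)
    simp [h1.nil_eq]

/-- Leftbound gliders rest and rightbound ones advance by `2q` copies of `z`, so this much is lost
from `m`; a positive distance remains. -/
theorem step_approach (h : IsMarkerPair X z o) {R L l' : List (ℕ × List A)}
    (hR : RightFleet z o R) (hR' : R ≠ []) (hL : LeftFleet o L) {m : ℕ}
    (hm : 2 * o.length + 1 ≤ m) (hs : Step c (R ++ (m, o) :: L) l') :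
    l' = addHead (2 * o.length) R ++ (m - 2 * o.length, o) :: L := by
  obtain ⟨l1, h1, rfl⟩ := h.step_rightFleet_append hR hR' (by
    rw [List.map_cons, h.p1_o (by omega)]
    simp
    omega) hs
  rw [h.p2_map_cons_o (by omega)] at h1
  have e : p2 z o o.length (L.map (p1 z o)) = L := by
    clear hs h1
    induction L with
    | nil => simp [p2]
    | cons e L ih =>
      obtain ⟨b, w⟩ := e
      obtain ⟨⟨hb, rfl⟩, hL⟩ := leftFleet_cons.1 hL
      rw [h.p2_map_cons_o hb, ih hL]
      congr 3
      omega
  rw [e] at h1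
  have hL4 : ∀ {L l}, LeftFleet o L → Step4 c L l → l = L := by
    intro L
    induction L with
    | nil => exact fun _ hs => hs.nil_eq
    | cons e L ih =>
      intro l hL hs
      obtain ⟨b, w⟩ := e
      obtain ⟨⟨hb, rfl⟩, hL⟩ := leftFleet_cons.1 hL
      rcases hs.o_cons h rfl with ⟨t', h2, rfl⟩ | ⟨j, t1, t', -, -, -, rfl, -⟩
      · rw [ih hL h2]
      · have := (leftFleet_cons.1 hL).1.1
        dsimp only at this
        omega
  congr 1
  rcases h1.o_cons h rfl with ⟨t', h2, rfl⟩ | ⟨j, t1, t', -, -, -, rfl, -⟩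
  · rw [hL4 hL h2]
    congr 2
    omega
  · have := (leftFleet_cons.1 hL).1.1
    dsimp only at this
    omega

end IsMarkerPair
end Fleets

/-! ### Conserved number of gliders and the extent of a list -/

section Particles

variable {A : Type*} [TopologicalSpace A] {X : Subshift A ℤ} {z o : List A} {n : ℕ}

/-- The class to which a gap belongs. -/
def classIndex (z o w : List A) : ℕ :=
  -- For `m = |w|/K` this is the representative of `m - 1` modulo `p/K` in `1, …, p/K`; a double
  -- period is added to avoid a truncated subtraction of `2`.
  (w.length / Nat.gcd z.length o.length + (2 * numClasses z o - 2)) % numClasses z o + 1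

open Classical in
/-- The number of gliders into which a gap decomposes. -/
noncomputable def weight (z o w : List A) : ℕ :=
  if w = o ∨ w = wpow o (z.length + 1) then 1 else classIndex z o w + 1

theorem weight_pos {A : Type*} (z o w : List A) : 0 < weight z o w := by
  unfold weight
  split_ifs <;> omega

/-- The number of gliders into which a list decomposes. -/
noncomputable def weights (z o : List A) (l : List (ℕ × List A)) : ℕ :=
  (l.map fun e => weight z o e.2).sum

@[simp] theorem weights_cons {A : Type*} (z o : List A) (e : ℕ × List A) (l : List (ℕ × List A)) :
    weights z o (e :: l) = weight z o e.2 + weights z o l := by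
  simp [weights]

theorem weights_addHead {A : Type*} (z o : List A) (k : ℕ) (l : List (ℕ × List A)) :
    weights z o (addHead k l) = weights z o l := by
  rcases l with - | ⟨⟨a, w⟩, t⟩ <;> simp

/-- All words are shorter than `n`. -/
def Short (n : ℕ) (l : List (ℕ × List A)) : Prop := ∀ e ∈ l, e.2.length < n

@[simp] theorem short_nil {A : Type*} {n : ℕ} : Short n ([] : List (ℕ × List A)) := by simp [Short]

@[simp] theorem short_cons {A : Type*} {n : ℕ} {e : ℕ × List A} {l : List (ℕ × List A)} :
    Short n (e :: l) ↔ e.2.length < n ∧ Short n l := by simp [Short]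

theorem Short.addHead {A : Type*} {n : ℕ} {l : List (ℕ × List A)} (h : Short n l) (k : ℕ) :
    Short n (addHead k l) := by
  rcases l with - | ⟨⟨a, w⟩, t⟩
  · simp
  · simpa using h

namespace IsMarkerPair

theorem classIndex_le (h : IsMarkerPair X z o) (w : List A) :
    1 ≤ classIndex z o w ∧ classIndex z o w ≤ numClasses z o :=
  ⟨by simp [classIndex], Nat.mod_lt _ h.numClasses_pos⟩

/-- As `K` divides the length of every gap, the classes exhaust all short gaps other than the
gliders. -/
theorem mem_classIndex (h : IsMarkerPair X z o) {w : List A} (hw : IsGap X z w) (hn : w.length < n)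
    (h1 : w ≠ o) (h2 : w ≠ wpow o (z.length + 1)) : w ∈ classWords X z o n (classIndex z o w) := by
  have hJ := h.numClasses_pos
  have hd := h.dvd w (language_factor hw.2.2) hw.2.2
  obtain ⟨m, hm⟩ := hd
  refine ⟨hw.1, hn, language_factor hw.2.2, hw.2.1, hw.2.2, ?_, fun _ => ⟨h1, h2⟩⟩
  have e : z.length = Nat.gcd z.length o.length * numClasses z o := by
    rw [mul_comm, numClasses_mul]
  have key : m ≡ classIndex z o w + 1 [MOD numClasses z o] := by
    rw [classIndex, hm, Nat.mul_div_cancel_left _ h.gcd_pos]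
    have : (m + (2 * numClasses z o - 2)) % numClasses z o + 1 + 1 ≡
        m + (2 * numClasses z o - 2) + 1 + 1 [MOD numClasses z o] :=
      ((Nat.mod_modEq _ _).add_right 1).add_right 1
    refine Nat.ModEq.trans ?_ this.symm
    rw [show m + (2 * numClasses z o - 2) + 1 + 1 = m + 2 * numClasses z o by omega]
    simp [Nat.ModEq]
  have := Nat.ModEq.mul_left' (Nat.gcd z.length o.length) key
  rw [← e, ← hm, mul_comm _ (_ + 1)] at this
  exact this

theorem weight_class (h : IsMarkerPair X z o) {w : List A} {j : ℕ} (hj : 1 ≤ j)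
    (hj' : j ≤ numClasses z o) (hw : w ∈ classWords X z o n j) : weight z o w = j + 1 := by
  have h1 : ¬ (w = o ∨ w = wpow o (z.length + 1)) := fun e => h.o_notMem_class hj hj' e hw
  rw [weight, if_neg h1, h.class_unique (h.classIndex_le w).1 (h.classIndex_le w).2 hj hj'
    (h.mem_classIndex (isGap_of_class hw) hw.2.1 (fun e => h1 (Or.inl e))
      fun e => h1 (Or.inr e)) hw]

/-- For `j ≥ 2` the word `o^j` belongs to class `j - 1`, because its length is `jq`, hence `jK`,
modulo `p`. -/
theorem weight_wpow (h : IsMarkerPair X z o) {j : ℕ} (hj : 1 ≤ j)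
    (hj' : j ≤ numClasses z o) : weight z o (wpow o j) = j := by
  rcases hj.eq_or_lt with rfl | hj2
  · simp [weight]
  obtain ⟨i, rfl⟩ := Nat.exists_eq_add_of_le' hj
  have hJ := numClasses_le z o
  refine h.weight_class (n := (wpow o (i + 1)).length + 1) (by omega) (by omega) ?_
  have hg := h.isGap_wpow (n := i + 1) (by omega)
  refine ⟨hg.1, by omega, language_factor hg.2.2, hg.2.1, hg.2.2, ?_, fun e => by omega⟩
  rw [length_wpow]
  exact h.modEq.mul_left (i + 1)

theorem weight_o {A : Type*} (z o : List A) : weight z o o = 1 := by simp [weight]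

theorem weight_r {A : Type*} (z o : List A) : weight z o (wpow o (z.length + 1)) = 1 := by simp [weight]

theorem weights_p1 (h : IsMarkerPair X z o) (l : List (ℕ × List A)) :
    weights z o (l.map (p1 z o)) = weights z o l := by
  induction l with
  | nil => rfl
  | cons e t ih =>
    obtain ⟨a, w⟩ := e
    rw [List.map_cons, weights_cons, weights_cons, ih]
    rcases h.p1_cases a w with ⟨rfl, e⟩ | ⟨rfl, h1, e⟩ | ⟨h1, h2, e⟩ <;>
      simp only [e, weight_o, weight_r]

theorem weights_p2 (h : IsMarkerPair X z o) (l : List (ℕ × List A)) (k : ℤ) :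
    weights z o (p2 z o k l) = weights z o l := by
  induction l generalizing k with
  | nil => rfl
  | cons e t ih =>
    obtain ⟨a, w⟩ := e
    rw [p2, weights_cons, weights_cons, ih]
    rcases h.newWord_cases w (t.head?.map Prod.fst) with
      ⟨rfl, e, -⟩ | ⟨rfl, h1, e, -⟩ | ⟨h1, h2, e, -⟩ <;> simp only [e, weight_o, weight_r]

theorem length_wpow_lt {A : Type*} {z o : List A} {n : ℕ} (hn : gliderBound z o < n) {k : ℕ}
    (hk : k ≤ z.length + 1 + numClasses z o) : (wpow o k).length < n := by
  refine lt_of_le_of_lt ?_ hn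
  rw [gliderBound, length_wpow, length_wpow]
  exact Nat.mul_le_mul_right _ hk

theorem short_p1 (h : IsMarkerPair X z o) (hn : gliderBound z o < n) {l : List (ℕ × List A)}
    (hl : Short n l) : Short n (l.map (p1 z o)) := by
  have e1 := IsMarkerPair.length_wpow_lt hn (k := z.length + 1) (by omega)
  have e2 := IsMarkerPair.length_wpow_lt hn (k := 1) (by omega)
  rw [wpow_one] at e2
  induction l with
  | nil => simp
  | cons e t ih =>
    obtain ⟨a, w⟩ := e
    rw [short_cons] at hl
    rw [List.map_cons, short_cons]
    refine ⟨?_, ih hl.2⟩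
    rcases h.p1_cases a w with ⟨rfl, e⟩ | ⟨rfl, h1, e⟩ | ⟨h1, h2, e⟩ <;> rw [e]
    exacts [e2, e1, hl.1]

theorem short_p2 (h : IsMarkerPair X z o) (hn : gliderBound z o < n) {l : List (ℕ × List A)}
    (hl : Short n l) (k : ℤ) : Short n (p2 z o k l) := by
  have e1 := IsMarkerPair.length_wpow_lt hn (k := z.length + 1) (by omega)
  have e2 := IsMarkerPair.length_wpow_lt hn (k := 1) (by omega)
  rw [wpow_one] at e2
  induction l generalizing k with
  | nil => simp [p2]
  | cons e t ih =>
    obtain ⟨a, w⟩ := e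
    rw [short_cons] at hl
    rw [p2, short_cons]
    refine ⟨?_, ih hl.2 _⟩
    rcases h.newWord_cases w (t.head?.map Prod.fst) with
      ⟨rfl, e, -⟩ | ⟨rfl, h1, e, -⟩ | ⟨h1, h2, e, -⟩ <;> dsimp only <;> rw [e]
    exacts [e2, e1, hl.1]

end IsMarkerPair

namespace Step4

variable {c : GliderChoice X z o n} {l l' : List (ℕ × List A)}

/-- A word of class `j` counts `j + 1`, and so does the pair `o`, `o^j` into which it splits. -/
theorem weights_eq (h : IsMarkerPair X z o) (hs : Step4 c l l') :
    weights z o l' = weights z o l := by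
  induction hs with
  | nil => rfl
  | inert _ _ _ ih => simp [ih]
  | cycle hj hj' hi ha _ ih =>
    simp [ih, h.weight_class hj hj' ((c.mem_enum _ hj hj' _).1 (List.getElem_mem _))]
  | split hj hj' ha _ ih =>
    have := (c.mem_enum _ hj hj' _).1 (List.mem_of_getLast? (c.enum_last _ hj hj'))
    simp [ih, h.weight_class hj hj' this, IsMarkerPair.weight_o, h.weight_wpow hj hj']
    omega
  | merge hj hj' hi ha _ ih =>
    simp [ih, h.weight_class hj hj' ((c.mem_enum _ hj hj' _).1 (List.getElem_mem _)),
      IsMarkerPair.weight_o, h.weight_wpow hj hj']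
    omega

/-- New gaps are words of a class, short by definition, or the powers `o` and `o^j`, short by the
bound on `n`. -/
theorem short (hn : gliderBound z o < n) (hs : Step4 c l l')
    (hl : Short n l) : Short n l' := by
  have e2 := IsMarkerPair.length_wpow_lt hn (k := 1) (by omega)
  rw [wpow_one] at e2
  induction hs with
  | nil => simp
  | inert _ _ _ ih => exact short_cons.2 ⟨(short_cons.1 hl).1, ih (short_cons.1 hl).2⟩
  | cycle hj hj' hi ha _ ih =>
    exact short_cons.2 ⟨((c.mem_enum _ hj hj' _).1 (List.getElem_mem _)).2.1,
      ih (short_cons.1 hl).2⟩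
  | split hj hj' ha _ ih =>
    exact short_cons.2 ⟨e2, short_cons.2 ⟨IsMarkerPair.length_wpow_lt hn (by omega),
      ih (short_cons.1 hl).2⟩⟩
  | merge hj hj' hi ha _ ih =>
    exact short_cons.2 ⟨((c.mem_enum _ hj hj' _).1 (List.getElem_mem _)).2.1,
      ih (short_cons.1 (short_cons.1 hl).2).2⟩

end Step4

open Classical in
/-- The distance from the first `z` of a list to the end of its last word which is not a rightbound
glider. -/
noncomputable def extent (z o : List A) : List (ℕ × List A) → ℕ
  | [] => 0
  | (a, w) :: t => if RightFleet z o ((a, w) :: t) then 0 else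
      a * z.length + w.length + extent z o t

theorem extent_of_rightFleet {A : Type*} {z o : List A} {l : List (ℕ × List A)} (hl : RightFleet z o l) : extent z o l = 0 := by
  rcases l with - | ⟨⟨a, w⟩, t⟩
  · rfl
  · rw [extent, if_pos hl]

theorem extent_cons_le {A : Type*} (z o : List A) (a : ℕ) (w : List A) (t : List (ℕ × List A)) :
    extent z o ((a, w) :: t) ≤ a * z.length + w.length + extent z o t := by
  rw [extent]
  split_ifs <;> omega

theorem extent_cons_of_not {A : Type*} {z o : List A} {a : ℕ} {w : List A} {t : List (ℕ × List A)}
    (h : ¬ RightFleet z o ((a, w) :: t)) :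
    extent z o ((a, w) :: t) = a * z.length + w.length + extent z o t := by
  rw [extent, if_neg h]

/-- Rule words have equal length and none of their gaps is a rightbound glider, so no right end that
counts moves to the right. -/
theorem Step4.extent_le (h : IsMarkerPair X z o) {c : GliderChoice X z o n}
    {l l' : List (ℕ × List A)} (hs : Step4 c l l') : extent z o l' ≤ extent z o l := by
  have hnot : ∀ {a j w t}, 1 ≤ j → j ≤ numClasses z o → w ∈ c.enum j →
      ¬ RightFleet z o ((a, w) :: t) := fun hj hj' hw hR =>
    Step4.o_notMem h c hj hj' (Or.inr (rightFleet_cons.1 hR).1.2) hw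
  have hlen : ∀ {j w}, 1 ≤ j → j ≤ numClasses z o → w ∈ c.enum j →
      c.pad j w * z.length + w.length =
        c.pad₀ j * z.length + (o.length + o.length * z.length + (wpow o j).length) :=
    fun hj hj' hw => by
      have := c.length_eq _ hj hj' _ hw
      simp only [List.length_append, length_wpow] at this ⊢
      omega
  have hpad : ∀ {a b c : ℕ}, b ≤ a → (a - b + c) * z.length + b * z.length =
      a * z.length + c * z.length := fun {a b c} hba => by
    rw [← add_mul, ← add_mul]
    congr 1
    omega
  induction hs with
  | nil => exact le_rfl
  | @inert a w t t' h1 h2 hs ih =>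
    by_cases hR : RightFleet z o ((a, w) :: t)
    · obtain ⟨l', hl', e⟩ := Step4.rightFleet_append (t := []) h (rightFleet_cons.1 hR).2
        (by simpa using hs)
      rw [e, hl'.nil_eq, List.append_nil]
    · rw [extent_cons_of_not hR]
      exact (extent_cons_le _ _ _ _ _).trans (by omega)
  | @cycle j i a t t' hj hj' hi ha _ ih =>
    have hm : (c.enum j)[i] ∈ c.enum j := List.getElem_mem _
    rw [extent_cons_of_not (hnot (a := a) (t := t) hj hj' hm)]
    refine (extent_cons_le _ _ _ _ _).trans ?_
    have h1 := hlen hj hj' (List.getElem_mem hi)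
    have h2 := hlen hj hj' hm
    have h3 := hpad (c := c.pad j (c.enum j)[i + 1]) ha
    omega
  | @split j a t t' hj hj' ha _ ih =>
    have hm := List.mem_of_getLast? (c.enum_last _ hj hj')
    rw [extent_cons_of_not (hnot hj hj' hm)]
    refine (extent_cons_le _ _ _ _ _).trans ?_
    have := extent_cons_le z o o.length (wpow o j) t'
    have h1 := hlen hj hj' hm
    have h3 := hpad (c := c.pad₀ j) ha
    omega
  | @merge j a t t' hj hj' hi ha _ ih =>
    have hm := List.getElem_mem hi
    have hne : ∀ a t, ¬ RightFleet z o ((a, o) :: t) := fun a t hR =>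
      h.o_ne_r (rightFleet_cons.1 hR).1.2
    have hne2 : ¬ RightFleet z o ((o.length, wpow o j) :: t) := fun hR => by
      have := h.wpow_o_injective (rightFleet_cons.1 hR).1.2
      have := IsMarkerPair.numClasses_le z o
      omega
    rw [extent_cons_of_not (hne _ _), extent_cons_of_not hne2]
    refine (extent_cons_le _ _ _ _ _).trans ?_
    have h1 := hlen hj hj' hm
    have h3 := hpad (c := c.pad j (c.enum j)[0]) ha
    omega

/-- Under `P₂ ∘ P₁` only rightbound gliders advance; the right end of any other gap is not beyond
that of the gap it comes from. -/
theorem IsMarkerPair.extent_p2 (h : IsMarkerPair X z o) {l : List (ℕ × List A)}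
    (hl : Valid X z l) (k : ℤ) (hk : ∀ e ∈ (l.map (p1 z o)).head?, 0 < e.1 + k) :
    (extent z o (p2 z o k (l.map (p1 z o))) : ℤ) ≤ extent z o l + k * z.length ∨
      RightFleet z o (p2 z o k (l.map (p1 z o))) := by
  induction l generalizing k with
  | nil => simp [p2]
  | cons e t ih =>
    obtain ⟨a, w⟩ := e
    have hlt := (valid_cons.1 hl).2
    have ha := (valid_cons.1 hl).1.1
    dsimp only at ha
    by_cases hR : RightFleet z o ((a, w) :: t)
    · right
      have hR2 := (rightFleet_cons.1 hR).2
      obtain rfl : w = _ := (rightFleet_cons.1 hR).1.2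
      have e1 := le_head_map_p1_append (l := []) hR2 (by simp)
      rw [List.append_nil] at e1
      have e2 := h.p2_map_rightFleet_append (l := []) hR2 (by simp)
      rw [List.append_nil] at e2
      rw [h.p2_map_cons_r e1, e2, rightFleet_cons]
      have := hk _ rfl
      rw [p1_r] at this
      push_cast at this
      exact ⟨⟨by dsimp only; omega, rfl⟩, by simpa [p2] using hR2⟩
    rw [extent_cons_of_not hR]
    have hk := hk _ rfl
    rw [List.map_cons]
    have hnext : ∀ e ∈ (t.map (p1 z o)).head?, 0 < e.1 := fun e he =>
      ((h.valid_p1 hlt) e (List.mem_of_mem_head? he)).1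
    -- One entry at a time: the first inequality says that what follows is not pushed to the right.
    -- The second, about the new gap itself, is needed only when the rest has become a fleet.
    have key : ∀ (b : ℕ) (v : List A), p1 z o (a, w) = (b, v) → ∀ (d : ℤ) v',
        newWord z o v ((t.map (p1 z o)).head?.map Prod.fst) = v' →
        carry z o v ((t.map (p1 z o)).head?.map Prod.fst) = d →
        (∀ e ∈ (t.map (p1 z o)).head?, 0 < e.1 + d) →
        (b * z.length + v'.length + d * z.length : ℤ) ≤ a * z.length + w.length →
        (v' ≠ wpow o (z.length + 1) → (b * z.length + v'.length : ℤ) ≤ a * z.length + w.length) →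
        ((extent z o (p2 z o k (p1 z o (a, w) :: t.map (p1 z o))) : ℤ) ≤
          (a * z.length + w.length + extent z o t : ℕ) + k * z.length ∨
        RightFleet z o (p2 z o k (p1 z o (a, w) :: t.map (p1 z o)))) := by
      intro b v e1 d v' e2 e3 h1 h2 h3
      rw [e1] at hk ⊢
      dsimp only at hk
      rw [p2, e2, e3]
      have e5 : ((b + k : ℤ).toNat : ℤ) * z.length = b * z.length + k * z.length := by
        rw [Int.toNat_of_nonneg (by omega)]; ring
      have e4 := extent_cons_le z o (b + k : ℤ).toNat v' (p2 z o d (t.map (p1 z o)))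
      have e4 : (extent z o (((b + k : ℤ).toNat, v') :: p2 z o d (t.map (p1 z o))) : ℤ) ≤
        b * z.length + k * z.length + v'.length + extent z o (p2 z o d (t.map (p1 z o))) := by
          rw [← e5]; exact_mod_cast e4
      push_cast
      rcases ih hlt d h1 with h4 | h4
      · left; omega
      · rw [extent_of_rightFleet h4] at e4
        by_cases hv : v' = wpow o (z.length + 1)
        · exact Or.inr (rightFleet_cons.2 ⟨⟨by dsimp only; omega, hv⟩, h4⟩)
        · have := h3 hv
          left; push_cast at e4; omega
    have hq : ((wpow o (z.length + 1)).length : ℤ) = o.length * z.length + o.length := by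
      rw [length_wpow]; push_cast; ring
    have hzero : ∀ e ∈ (t.map (p1 z o)).head?, 0 < (e.1 : ℤ) + 0 := fun e he => by
      have := hnext e he
      omega
    have hpos : ∀ e ∈ (t.map (p1 z o)).head?, 0 < (e.1 : ℤ) + o.length := fun e he => by
      have := hnext e he
      omega
    have hneg : (∀ n ∈ (t.map (p1 z o)).head?.map Prod.fst, o.length + 1 ≤ n) →
        ∀ e ∈ (t.map (p1 z o)).head?, 0 < (e.1 : ℤ) + -o.length := fun hn e he => by
      rw [Option.mem_def] at he
      have := hn e.1 (by simp [he])
      omega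
    have hqp : 0 ≤ (o.length : ℤ) * z.length := by positivity
    rcases h.p1_cases a w with ⟨rfl, e⟩ | ⟨rfl, h1, e⟩ | ⟨h1, h2, e⟩
    · rcases h.newWord_cases o ((t.map (p1 z o)).head?.map Prod.fst) with
        ⟨e0, -⟩ | ⟨-, e1, e2, e3⟩ | ⟨-, -, e2, e3⟩
      · exact absurd e0 h.o_ne_r
      · exact key _ _ e _ _ e2 e3 (hneg e1) (by push_cast [add_mul]; linarith) (absurd rfl)
      · exact key _ _ e _ _ e2 e3 hzero (by push_cast [add_mul] at hq ⊢; linarith)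
          fun _ => by push_cast [add_mul] at hq ⊢; linarith
    · rcases h.newWord_cases (wpow w (z.length + 1)) ((t.map (p1 z w)).head?.map Prod.fst) with
        ⟨-, e2, e3⟩ | ⟨e0, -⟩ | ⟨e0, -⟩
      · have e4 : ((a - w.length : ℕ) : ℤ) = a - w.length := by omega
        exact key _ _ e _ _ e2 e3 hpos (by rw [e4, sub_mul]; linarith)
          fun _ => by rw [e4, sub_mul]; linarith
      · exact absurd e0.symm h.o_ne_r
      · exact absurd rfl e0
    · rcases h.newWord_cases w ((t.map (p1 z o)).head?.map Prod.fst) with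
        ⟨e0, -⟩ | ⟨rfl, e1, e2, e3⟩ | ⟨-, -, e2, e3⟩
      · exact absurd e0 h1
      · exact key _ _ e _ _ e2 e3 (hneg e1) (by linarith) (absurd rfl)
      · exact key _ _ e _ _ e2 e3 hzero (by linarith) fun _ => by linarith

end Particles

/-! ### Decomposition of every list into gliders -/

section Diffusion

variable {A : Type*} [TopologicalSpace A] {X : Subshift A ℤ} {z o : List A} {n : ℕ}

/-- Lists which evolve into a fleet of rightbound gliders, emitting leftbound gliders to the
left. -/
inductive Diffuses (c : GliderChoice X z o n) : List (ℕ × List A) → Prop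
  | fleet {l : List (ℕ × List A)} : RightFleet z o l → Diffuses c l
  | emit {a : ℕ} {l : List (ℕ × List A)} : o.length + 1 ≤ a → Diffuses c l →
      Diffuses c ((a, o) :: l)
  -- The padding `k` is arbitrary because a list may have to be padded before a step can be taken.
  | step {l : List (ℕ × List A)} : (∀ k l', Step c (addHead k l) l' → Diffuses c l') →
      Diffuses c l

namespace IsMarkerPair

variable {c : GliderChoice X z o n}

theorem weights_step (h : IsMarkerPair X z o) {l l' : List (ℕ × List A)} (hs : Step c l l') :
    weights z o l' = weights z o l := by
  rw [Step4.weights_eq h hs, h.weights_p2, h.weights_p1]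

theorem short_step (h : IsMarkerPair X z o) (hn : gliderBound z o < n) {l l' : List (ℕ × List A)}
    (hs : Step c l l') (hl : Short n l) : Short n l' :=
  Step4.short hn hs (h.short_p2 hn (h.short_p1 hn hl) _)

/-- Each step adds `q` copies of `z` before the gap in the moving frame, until its padding is
complete. Then the gap advances in its cycle; the last word of the cycle splits off a leftbound
glider and leaves a list of smaller weight. -/
theorem diffuses_of_class (h : IsMarkerPair X z o) (hn : gliderBound z o < n) {N : ℕ}
    (hN : ∀ l, Valid X z l → Short n l → weights z o l < N → Diffuses c l) {j i a : ℕ} (hj : 1 ≤ j)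
    (hj' : j ≤ numClasses z o) (hi : i < (c.enum j).length) {t : List (ℕ × List A)}
    (hl : Valid X z ((a, (c.enum j)[i]) :: t)) (hs : Short n ((a, (c.enum j)[i]) :: t))
    (hw : weights z o ((a, (c.enum j)[i]) :: t) = N) : Diffuses c ((a, (c.enum j)[i]) :: t) := by
  have h2 := h.two_le
  -- Outer induction on the words of the cycle still to come, inner induction on the missing copies
  -- of `z`.
  induction hm : (c.enum j).length - i using Nat.strong_induction_on generalizing i a t with
  | _ m ihm =>
  induction hd : c.pad j (c.enum j)[i] - a using Nat.strong_induction_on generalizing a t with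
  | _ d ihd =>
  refine .step fun k l' hst => ?_
  have hl' := h.valid_step (hl.addHead k) hst
  have hs' := h.short_step hn hst (hs.addHead k)
  have hw' := h.weights_step hst
  rw [weights_addHead, hw] at hw'
  have hme : (c.enum j)[i] ∈ c.enum j := List.getElem_mem hi
  have hno : ∀ (w : List A), w = o ∨ w = wpow o (z.length + 1) → (c.enum j)[i] ≠ w :=
    fun w hw e => Step4.o_notMem h c hj hj' hw (e ▸ hme)
  have huniq : ∀ j1, 1 ≤ j1 → j1 ≤ numClasses z o → (c.enum j)[i] ∈ c.enum j1 → j1 = j :=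
    fun j1 h1 h1' hm => h.class_unique h1 h1' hj hj' ((c.mem_enum _ h1 h1' _).1 hm)
      ((c.mem_enum _ hj hj' _).1 hme)
  have hp1 : p1 z o (a + k, (c.enum j)[i]) = (a + k, (c.enum j)[i]) :=
    p1_of_ne (hno _ (Or.inr rfl)) fun e => absurd e (hno _ (Or.inl rfl))
  rw [Step, addHead_cons, List.map_cons, hp1, p2] at hst
  rcases h.newWord_cases (c.enum j)[i] ((t.map (p1 z o)).head?.map Prod.fst) with
    ⟨e, -⟩ | ⟨e, -⟩ | ⟨-, -, e, -⟩
  · exact absurd e (hno _ (Or.inr rfl))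
  · exact absurd e (hno _ (Or.inl rfl))
  rw [e, show (((a + k : ℕ) : ℤ) + o.length).toNat = a + k + o.length by omega] at hst
  rcases hst.cons_cases with ⟨t', h3, rfl, h4⟩ | ⟨j1, i1, t', hj1, hj1', hi1, e, ha, h3, rfl⟩ |
    ⟨j1, t', hj1, hj1', -, e, ha, h3, rfl⟩ | ⟨j1, t1, t', hj1, hj1', hi1, e, -⟩
  · have := h4 j hj hj' hme
    exact ihd _ (by omega) hl' hs' hw' rfl
  · obtain rfl := huniq j1 hj1 hj1' (by rw [e]; exact List.getElem_mem _)
    obtain rfl := (c.enum_nodup j1 hj hj').getElem_inj_iff.1 e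
    exact ihm _ (by omega) hi1 hl' hs' hw' rfl
  · have := c.le_pad₀ j1 hj1 hj1'
    rw [weights_cons] at hw'
    have := weight_pos z o o
    exact .emit (by omega) (hN _ (valid_cons.1 hl').2 (short_cons.1 hs').2 (by dsimp only at hw'; omega))
  · exact absurd e (hno _ (Or.inl rfl))

/-- The leading `o` either escapes as a leftbound glider or is merged by `P₄` into a word of a
class. -/
theorem diffuses_of_o (h : IsMarkerPair X z o) (hn : gliderBound z o < n) {N : ℕ}
    (hN : ∀ l, Valid X z l → Short n l → weights z o l < N → Diffuses c l) {a : ℕ}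
    (ha : o.length + 1 ≤ a) {t l : List (ℕ × List A)}
    (hl : Valid X z l) (hs : Short n l) (hw : weights z o l = N) (hst : Step4 c ((a, o) :: t) l) :
    Diffuses c l := by
  rcases hst.o_cons h rfl with ⟨t', h3, rfl⟩ | ⟨j, t1, t', hj, hj', hi, -, -, -, rfl⟩
  · rw [weights_cons] at hw
    have := weight_pos z o o
    exact .emit ha (hN _ (valid_cons.1 hl).2 (short_cons.1 hs).2 (by dsimp only at hw; omega))
  · exact h.diffuses_of_class hn hN hj hj' hi hl hs hw

/-- As long as the leading glider keeps moving to the right, the extent of what lies ahead of it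
falls by at least `qp` per step. So eventually either all that is ahead is a rightbound fleet, or
the glider is stopped and becomes `o`. -/
theorem diffuses_of_r (h : IsMarkerPair X z o) (hn : gliderBound z o < n) {N : ℕ}
    (hN : ∀ l, Valid X z l → Short n l → weights z o l < N → Diffuses c l) {a : ℕ}
    {t : List (ℕ × List A)} (hl : Valid X z ((a, wpow o (z.length + 1)) :: t))
    (hs : Short n ((a, wpow o (z.length + 1)) :: t))
    (hw : weights z o ((a, wpow o (z.length + 1)) :: t) = N) :
    Diffuses c ((a, wpow o (z.length + 1)) :: t) := by
  have h2 := h.two_le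
  have hp := h.length_pos
  induction hm : extent z o t using Nat.strong_induction_on generalizing a t with
  | _ m ihm =>
  by_cases hR : RightFleet z o ((a, wpow o (z.length + 1)) :: t)
  · exact .fleet hR
  refine .step fun k l' hst => ?_
  have hl' := h.valid_step (hl.addHead k) hst
  have hs' := h.short_step hn hst (hs.addHead k)
  have hw' := h.weights_step hst
  rw [weights_addHead, hw] at hw'
  rw [Step, addHead_cons, List.map_cons, p1_r, p2] at hst
  have e0 : ((a + k + o.length : ℕ) + (o.length : ℤ)).toNat = a + k + o.length + o.length := by
    omega
  rw [e0] at hst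
  rcases h.newWord_cases o ((t.map (p1 z o)).head?.map Prod.fst) with
    ⟨e, -⟩ | ⟨-, e1, e, e'⟩ | ⟨-, -, e, e'⟩
  · exact absurd e h.o_ne_r
  · rw [e, e'] at hst
    obtain ⟨t', h3, rfl⟩ := hst.r_cons h rfl
    have h4 := h.extent_p2 (valid_cons.1 hl).2 (-o.length) fun e he => by
      rw [Option.mem_def] at he
      have := e1 e.1 (by simp [he])
      omega
    have h5 := h3.extent_le h
    by_cases hR' : RightFleet z o t'
    · exact .fleet (rightFleet_cons.2 ⟨⟨(valid_cons.1 hl').1.1, rfl⟩, hR'⟩)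
    refine ihm _ ?_ hl' hs' hw' rfl
    rcases h4 with h4 | h4
    · have : (0 : ℤ) < o.length * z.length := by positivity
      rw [neg_mul] at h4
      omega
    · exfalso
      obtain ⟨t'', h6, rfl⟩ := Step4.rightFleet_append (t := []) h h4 (by simpa using h3)
      rw [h6.nil_eq, List.append_nil] at hR'
      exact hR' h4
  · rw [e, e'] at hst
    exact h.diffuses_of_o hn hN (by omega) hl' hs' hw' hst

/-- Induction on the number of gliders, according to the type of the first gap. -/
theorem diffuses (h : IsMarkerPair X z o) (hn : gliderBound z o < n) (c : GliderChoice X z o n)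
    {l : List (ℕ × List A)} (hl : Valid X z l) (hs : Short n l) : Diffuses c l := by
  induction hN : weights z o l using Nat.strong_induction_on generalizing l with
  | _ N ih =>
  have hN' : ∀ l, Valid X z l → Short n l → weights z o l < N → Diffuses c l :=
    fun l h1 h2 h3 => ih _ h3 h1 h2 rfl
  rcases l with - | ⟨⟨a, w⟩, t⟩
  · exact .fleet (by simp)
  have ha := (valid_cons.1 hl).1.1
  dsimp only at ha
  by_cases hr : w = wpow o (z.length + 1)
  · subst hr
    exact h.diffuses_of_r hn hN' hl hs hN
  by_cases ho : w = o
  · subst ho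
    refine .step fun k l' hst => ?_
    have hl' := h.valid_step (hl.addHead k) hst
    have hs' := h.short_step hn hst (hs.addHead k)
    have hw' := h.weights_step hst
    rw [weights_addHead, hN] at hw'
    rw [Step, addHead_cons] at hst
    by_cases hak : w.length + 1 ≤ a + k
    · rw [h.p2_map_cons_o hak] at hst
      exact h.diffuses_of_o hn hN' (by omega) hl' hs' hw' hst
    -- Too few copies of `z` precede `o` for `P₁` to act. Then `P₂` turns it into a rightbound
    -- glider, or it remains and the motion of the frame supplies enough copies.
    · rw [List.map_cons, p1_of_ne h.o_ne_r (fun _ => by omega), p2] at hst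
      rw [show ((a + k : ℕ) + (w.length : ℤ)).toNat = a + k + w.length by omega] at hst
      rcases h.newWord_cases w ((t.map (p1 z w)).head?.map Prod.fst) with
        ⟨e, -⟩ | ⟨-, e1, e, e'⟩ | ⟨-, -, e, e'⟩
      · exact absurd e h.o_ne_r
      · rw [e, e'] at hst
        obtain ⟨t', h3, rfl⟩ := hst.r_cons h rfl
        exact h.diffuses_of_r hn hN' hl' hs' hw'
      · rw [e, e'] at hst
        exact h.diffuses_of_o hn hN' (by omega) hl' hs' hw' hst
  · have hj := h.classIndex_le w
    have hm := (c.mem_enum _ hj.1 hj.2 w).2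
      (h.mem_classIndex (valid_cons.1 hl).1.2 (short_cons.1 hs).1 ho hr)
    generalize classIndex z o w = j at hj hm
    obtain ⟨i, hi, rfl⟩ := List.mem_iff_getElem.1 hm
    exact h.diffuses_of_class hn hN' hj.1 hj.2 hi hl hs hN

/-- Under a glider automorphism, points with zero tails decompose into gliders. -/
theorem exists_fleets [DiscreteTopology A] [Finite A] (h : IsMarkerPair X z o)
    (hn : gliderBound z o < n) {G : Aut X} (hG : IsGliderCA c G) {x : X.carrier} {s : ℤ}
    {l : List (ℕ × List A)} (hl : Valid X z l) (hs : Short n l) (hf : Form z x.1 s l) :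
    ∃ (t : ℕ) (k : ℤ) (L R : List (ℕ × List A)), LeftFleet o L ∧ RightFleet z o R ∧
      Form z ((G ^ t).1 x).1 (s + k * z.length) (L ++ R) := by
  obtain ⟨C, hC⟩ := h.exists_form_step hG
  have key : ∀ l, Diffuses c l → Valid X z l → ∀ (L : List (ℕ × List A)), LeftFleet o L →
      ∀ (x : X.carrier) (s : ℤ), Form z x.1 s (L ++ l) →
      ∃ (t : ℕ) (k : ℤ) (L R : List (ℕ × List A)), LeftFleet o L ∧ RightFleet z o R ∧
        Form z ((G ^ t).1 x).1 (s + k * z.length) (L ++ R) := by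
    intro l hd
    induction hd with
    | fleet hR =>
      intro _ L hL x s hf
      exact ⟨0, 0, L, _, hL, hR, by simpa using hf⟩
    | @emit a l ha _ ih =>
      intro hl L hL x s hf
      exact ih (valid_cons.1 hl).2 (L ++ [(a, o)]) (by simp [hL]; omega) x s (by simpa using hf)
    | step hst ih =>
      intro hl L hL x s hf
      have hv : Valid X z (L ++ _) := valid_append.2 ⟨h.valid_leftFleet hL, hl⟩
      obtain ⟨l', h1, h2⟩ := hC x _ _ (hv.addHead C) (fun e he => by
        rcases hL : L ++ _ with - | ⟨⟨a, w⟩, t⟩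
        · rw [hL] at he; simp at he
        · rw [hL] at he
          simp only [addHead_cons, List.head?_cons, Option.mem_def, Option.some.injEq] at he
          subst he
          dsimp only
          omega) (hf.pad C)
      -- Gliders already emitted absorb the padding; if there are none, it goes to the head of the
      -- remaining list.
      obtain ⟨L', k, m, hL', h3, h4, rfl⟩ : ∃ L' k m, LeftFleet o L' ∧ Step c (addHead k _) m ∧
          Valid X z m ∧ l' = L' ++ m := by
        rcases eq_or_ne L [] with rfl | hne
        · exact ⟨[], C, l', by simp, h1, h.valid_step (hl.addHead C) h1, rfl⟩
        · rw [addHead_append _ hne] at h1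
          obtain ⟨m, h3, rfl⟩ := h.step_leftFleet_append (hL.addHead C) hl h1
          exact ⟨_, 0, m, hL.addHead C, by rwa [addHead_zero], h.valid_step hl h3, rfl⟩
      obtain ⟨t, k', L2, R2, h5, h6, h7⟩ := ih k m h3 h4 L' hL' _ _ h2
      refine ⟨t + 1, k' - o.length - C, L2, R2, h5, h6, ?_⟩
      rw [pow_succ]
      convert h7 using 1
      · rfl
      · ring
  exact key l (h.diffuses hn c hl hs) hl [] (by simp) x s (by simpa using hf)

end IsMarkerPair
end Diffusion

/-! ### Collisions of fleets -/

section Collision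

variable {A : Type*} [TopologicalSpace A] {X : Subshift A ℤ} {z o : List A} {n : ℕ}

theorem Form.of_pad {A : Type*} {z : List A} {x : ℤ → A} {s : ℤ} {k : ℕ} {l : List (ℕ × List A)}
    (h : Form z x (s - k * z.length) (addHead k l)) : Form z x s l := by
  rcases l with - | ⟨⟨a, w⟩, t⟩
  · have h2 := rForm_nil.1 h.2
    refine ⟨fun t => ?_, rForm_nil.2 ?_⟩
    · by_cases ht : t < k
      · refine h2.occursAt_of (k - 1 - t) ?_
        have : ((k - 1 - t : ℕ) : ℤ) = k - 1 - t := by omega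
        rw [this]; ring
      · refine h.1.occursAt_of (t - k) ?_
        have : ((t - k : ℕ) : ℤ) = t - k := by omega
        rw [this]; ring
    · have := h2.add k
      rwa [sub_add_cancel] at this
  · have := h.unpad
    rwa [sub_add_cancel] at this

theorem RForm.exists_split (hp : 0 < z.length) {x : ℤ → A} {s : ℤ} {l : List (ℕ × List A)}
    (hl : Valid X z l) (hf : RForm z x s l) {k : ℤ} {c : ℕ} {g : List A} (hg : GapAt z x k c g)
    (hk : s ≤ k + c * z.length) : ∃ l₁, ∃ a : ℕ, ∃ l₂, l = l₁ ++ (a, g) :: l₂ ∧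
      k + c * z.length = s + (flat z l₁).length + a * z.length := by
  induction l generalizing s with
  | nil => exact (hg.apply_notMem ((rForm_nil.1 hf).mem hp hk)).elim
  | cons e t ih =>
    obtain ⟨a, w⟩ := e
    have hw := hf.gapAt hl
    rcases hw.sep hp hg with ⟨e, rfl⟩ | h1 | h1
    · exact ⟨[], a, t, rfl, by simpa using e.symm⟩
    · obtain ⟨l1, b, l2, rfl, e⟩ := ih (valid_cons.1 hl).2 (rForm_cons.1 hf).2.2 (by
        have : 0 ≤ (c : ℤ) * z.length := by positivity
        omega)
      refine ⟨(a, w) :: l1, b, l2, rfl, ?_⟩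
      rw [e]
      simp
      ring
    · have := hg.length_pos
      omega

theorem Form.exists_split (hp : 0 < z.length) {x : ℤ → A} {s : ℤ} {l : List (ℕ × List A)}
    (hl : Valid X z l) (hf : Form z x s l) {k : ℤ} {c : ℕ} {g : List A} (hg : GapAt z x k c g) :
    ∃ l₁, ∃ a : ℕ, ∃ l₂, l = l₁ ++ (a, g) :: l₂ ∧
      k + c * z.length = s + (flat z l₁).length + a * z.length :=
  hf.2.exists_split hp hl hg (not_lt.1 fun hlt => hg.apply_notMem (hf.1.mem hp hlt))

theorem Form.exists_split_two (hp : 0 < z.length) {x : ℤ → A} {s : ℤ} {l : List (ℕ × List A)}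
    (hl : Valid X z l) (hf : Form z x s l) {k : ℤ} {c d : ℕ} {g v : List A} (hg : GapAt z x k c g)
    (hv : GapAt z x (k + c * z.length + g.length) d v) :
    ∃ l₁, ∃ a : ℕ, ∃ l₂, l = l₁ ++ (a, g) :: (d, v) :: l₂ ∧
      k + c * z.length = s + (flat z l₁).length + a * z.length := by
  obtain ⟨l1, a, l2, rfl, e⟩ := hf.exists_split hp hl hg
  rw [e] at hv
  have hf2 := (rForm_cons.1 (rForm_append.1 hf.2).2).2.2
  have hl2 := (valid_cons.1 (valid_append.1 hl).2).2
  rcases l2 with - | ⟨⟨b, w⟩, t⟩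
  · exact absurd hv ((rForm_nil.1 hf2).not_gapAt hp)
  · have hw := hf2.gapAt hl2
    have h1 := hw.length_pos
    have h2 := hv.length_pos
    have h3 : 0 ≤ (b : ℤ) * z.length := by positivity
    have h4 : 0 ≤ (d : ℤ) * z.length := by positivity
    obtain ⟨e1, rfl⟩ := hw.unique hp hv le_rfl (by omega) le_rfl (by omega)
    have : (b : ℤ) * z.length = d * z.length := by omega
    have := mul_right_cancel₀ (by omega : (z.length : ℤ) ≠ 0) this
    obtain rfl : b = d := by exact_mod_cast this
    exact ⟨l1, a, t, rfl, e⟩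

/-- The effect of a rule one of whose words occurs exactly once. -/
theorem Replaces.form_of_once {R : Set (List A × List A)} {F : X.carrier → X.carrier}
    (hF : Replaces R F) {x : X.carrier} {s : ℤ} {l l' : List (ℕ × List A)} (hf : Form z x.1 s l)
    {r : List A × List A} (hr : r ∈ R) (hlen : r.1.length = r.2.length) {u v : List A} {N N' : ℕ}
    (h1 : flat z l ++ wpow z N = u ++ r.1 ++ v) (h2 : flat z l' ++ wpow z N' = u ++ r.2 ++ v)
    (hone : ∀ r' ∈ R, ∀ k, OccursAt x.1 r'.1 k →
      k = s + u.length ∧ r'.1.length = r.1.length) : Form z (F x).1 s l' := by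
  have hout : ∀ m, m < s + u.length ∨ s + u.length + r.1.length ≤ m → (F x).1 m = x.1 m := by
    intro m hm
    refine (hF x).2 m fun r' hr' k hk hkm => ?_
    obtain ⟨rfl, e⟩ := hone r' hr' k hk
    rw [e] at hkm
    omega
  have hx : OccursAt x.1 (u ++ r.1 ++ v) s := by
    rw [← h1, occursAt_append, occursAt_wpow_iff]
    exact ⟨hf.2.1, fun t _ => hf.2.2 t⟩
  rw [occursAt_append, occursAt_append, List.length_append] at hx
  push_cast at hx
  have hy : OccursAt (F x).1 (u ++ r.2 ++ v) s := by
    rw [occursAt_append, occursAt_append, List.length_append, ← hlen]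
    push_cast
    exact ⟨⟨hx.1.1.congr fun m _ h => hout m (Or.inl h), (hF x).1 r hr _ hx.1.2⟩,
      hx.2.congr fun m h _ => hout m (Or.inr (by omega))⟩
  rw [← h2, occursAt_append] at hy
  have e1 := congrArg List.length h1
  have e2 := congrArg List.length h2
  simp only [List.length_append, length_wpow] at e1 e2
  have e3 : ((flat z l').length + N' * z.length : ℤ) = (flat z l).length + N * z.length := by
    exact_mod_cast (by omega : (flat z l').length + N' * z.length =
      (flat z l).length + N * z.length)
  have e4 : (u.length + r.1.length : ℤ) ≤ (flat z l).length + N * z.length := by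
    exact_mod_cast (by omega : u.length + r.1.length ≤ (flat z l).length + N * z.length)
  refine ⟨hf.1.congr fun m h => hout m (Or.inl (by omega)), hy.1, fun t => ?_⟩
  by_cases ht : t < N'
  · exact (occursAt_wpow_iff.1 hy.2) t ht
  · have h5 := hf.2.2 (t - N' + N)
    have e5 : ((t - N' + N : ℕ) : ℤ) = t - N' + N := by omega
    have e6 : s + (flat z l).length + ((t - N' + N : ℕ) : ℤ) * z.length =
        s + (flat z l').length + t * z.length := by
      rw [e5, add_mul, sub_mul]; omega
    rw [e6] at h5
    refine h5.congr fun m h _ => hout m (Or.inr ?_)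
    have : (N' : ℤ) * z.length ≤ t * z.length := by gcongr; omega
    omega

/-- A rightbound glider directly followed by a leftbound one exists only at the seam of the two
fleets; hence the rules of `F` apply at most there. -/
theorem split_fleets {A : Type*} {z o : List A} (hne : o ≠ wpow o (z.length + 1))
    {R L l₁ l₂ : List (ℕ × List A)} {m a d : ℕ} (hR : RightFleet z o R) (hL : LeftFleet o L)
    (e : R ++ (m, o) :: L = l₁ ++ (a, wpow o (z.length + 1)) :: (d, o) :: l₂) :
    R = l₁ ++ [(a, wpow o (z.length + 1))] ∧ m = d ∧ L = l₂ := by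
  rcases List.append_eq_append_iff.1 e with ⟨b, rfl, e2⟩ | ⟨b, rfl, e2⟩
  · have : (a, wpow o (z.length + 1)) ∈ (m, o) :: L := by rw [e2]; simp
    rcases List.mem_cons.1 this with h | h
    · simp only [Prod.mk.injEq] at h
      exact absurd h.2.symm hne
    · exact absurd (hL _ h).2.symm hne
  · rcases b with - | ⟨x, - | ⟨y, b⟩⟩
    · simp only [List.nil_append, List.cons.injEq, Prod.mk.injEq] at e2
      exact absurd e2.1.2.symm hne
    · simp only [List.cons_append, List.nil_append, List.cons.injEq, Prod.mk.injEq, and_true] at e2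
      obtain ⟨rfl, rfl, rfl⟩ := e2
      exact ⟨rfl, rfl, rfl⟩
    · simp only [List.cons_append, List.cons.injEq] at e2
      have := hR y (by simp)
      rw [← e2.2.1] at this
      exact absurd this.2 hne

namespace IsMarkerPair

theorem occursAt_doubleWord (h : IsMarkerPair X z o) {x : ℤ → A} {s : ℤ}
    {R L : List (ℕ × List A)} {m : ℕ} (hR : RightFleet z o R) (hL : LeftFleet o L) (hm : 0 < m)
    (hf : Form z x s (R ++ (m, o) :: L)) {c d e : ℕ} (hc : 0 < c) (hd : 0 < d) (he : 0 < e) {k : ℤ}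
    (hk : OccursAt x (doubleWord z o c d e) k) : m = d ∧
      k + c * z.length + (wpow o (z.length + 1)).length = s + (flat z R).length := by
  obtain ⟨g1, g2, -⟩ := h.gapAt_doubleWord hc hd he hk
  have hl : Valid X z (R ++ (m, o) :: L) := valid_append.2 ⟨h.valid_rightFleet hR,
    valid_cons.2 ⟨⟨hm, h.isGap_o⟩, h.valid_leftFleet hL⟩⟩
  obtain ⟨l1, a, l2, e, e2⟩ := hf.exists_split_two h.length_pos hl g1 g2
  obtain ⟨rfl, rfl, rfl⟩ := split_fleets h.o_ne_r hR hL e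
  refine ⟨rfl, ?_⟩
  rw [e2]
  simp
  ring

theorem double_eq_self (h : IsMarkerPair X z o) {F : X.carrier → X.carrier}
    {c d e c' d' e' : ℕ} (hc : 0 < c) (hd : 0 < d) (he : 0 < e) (hc' : 0 < c') (hd' : 0 < d')
    (he' : 0 < e') (hF : Replaces (swapRule (doubleWord z o c d e) (doubleWord z o c' d' e')) F)
    {x : X.carrier} {s : ℤ} {R L : List (ℕ × List A)} {m : ℕ} (hR : RightFleet z o R)
    (hL : LeftFleet o L) (hm : 0 < m) (hf : Form z x.1 s (R ++ (m, o) :: L)) (h1 : m ≠ d)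
    (h2 : m ≠ d') : F x = x := by
  ext i
  refine (hF x).2 i fun r hr k hk _ => ?_
  rcases mem_swapRule.1 hr with rfl | rfl
  · exact h1 (h.occursAt_doubleWord hR hL hm hf hc hd he hk).1
  · exact h2 (h.occursAt_doubleWord hR hL hm hf hc' hd' he' hk).1

theorem form_double (h : IsMarkerPair X z o) {F : X.carrier → X.carrier}
    {c d e c' d' e' : ℕ} (hc : 0 < c) (hd : 0 < d) (he : 0 < e) (hc' : 0 < c') (hd' : 0 < d')
    (he' : e ≤ e') (hsum : c + d + e = c' + d' + e') (hdd : d ≠ d')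
    (hF : Replaces (swapRule (doubleWord z o c d e) (doubleWord z o c' d' e')) F)
    {x : X.carrier} {s : ℤ} {R L : List (ℕ × List A)} {a : ℕ} (hR : RightFleet z o R)
    (ha : c ≤ a) (hL : LeftFleet o L) (hL' : ∀ b ∈ L.head?, e ≤ b.1)
    (hf : Form z x.1 s (R ++ (a, wpow o (z.length + 1)) :: (d, o) :: L)) :
    Form z (F x).1 s (R ++ (a - c + c', wpow o (z.length + 1)) :: (d', o) :: addHead (e' - e) L) := by
  have hR' : RightFleet z o (R ++ [(a, wpow o (z.length + 1))]) := by simp [hR]; omega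
  have hf' : Form z x.1 s ((R ++ [(a, wpow o (z.length + 1))]) ++ (d, o) :: L) := by simpa using hf
  obtain ⟨b, rfl⟩ := Nat.exists_eq_add_of_le' ha
  obtain ⟨e1, rfl⟩ := Nat.exists_eq_add_of_le he'
  have hlen : (doubleWord z o c d e).length = (doubleWord z o c' d' (e + e1)).length := by
    have : ((c + d + e : ℕ) : ℤ) * z.length = ((c' + d' + (e + e1) : ℕ) : ℤ) * z.length := by
      rw [hsum]
    have h1 := length_doubleWord z o c d e
    have h2 := length_doubleWord z o c' d' (e + e1)
    push_cast [add_mul] at this h2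
    omega
  have hone : ∀ r ∈ swapRule (doubleWord z o c d e) (doubleWord z o c' d' (e + e1)), ∀ k,
      OccursAt x.1 r.1 k → k = s + (flat z R ++ wpow z b).length ∧
        r.1.length = (doubleWord z o c d e).length := by
    intro r hr k hk
    rcases mem_swapRule.1 hr with rfl | rfl
    · refine ⟨?_, rfl⟩
      have := (h.occursAt_doubleWord hR' hL hd hf' hc hd he hk).2
      simp only [flat_append, flat_cons, flat_nil, List.length_append, length_wpow,
        List.length_nil] at this ⊢
      push_cast [add_mul] at this ⊢
      omega
    · exact absurd (h.occursAt_doubleWord hR' hL hd hf' hc' hd' (by omega) hk).1 hdd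
  rw [Nat.add_sub_cancel, Nat.add_sub_cancel_left]
  -- The copies of `z` behind the rule word belong to the first entry of `L`, or to the right tail
  -- if `L` is empty; `N` and `N'` count copies taken from the tail.
  have key : ∃ v N N', flat z L ++ wpow z N = wpow z e ++ v ∧
      flat z (addHead e1 L) ++ wpow z N' = wpow z (e + e1) ++ v := by
    rcases L with - | ⟨⟨f, w⟩, t⟩
    · exact ⟨[], e, e + e1, by simp, by simp⟩
    · have := hL' _ rfl
      obtain ⟨f, rfl⟩ := Nat.exists_eq_add_of_le this
      refine ⟨wpow z f ++ w ++ flat z t, 0, 0, by simp [wpow_add], ?_⟩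
      rw [addHead_cons, add_right_comm]
      simp [wpow_add]
  obtain ⟨v, N, N', k1, k2⟩ := key
  refine hF.form_of_once hf (mem_swapRule.2 (Or.inl rfl)) hlen (u := flat z R ++ wpow z b) (v := v)
    (N := N) (N' := N') ?_ ?_ hone
  · simp only [flat_append, flat_cons, doubleWord, wpow_add, List.append_assoc, k1]
  · simp only [flat_append, flat_cons, doubleWord, wpow_add, List.append_assoc, k2]

variable [DiscreteTopology A] [Finite A]

/-- The middle exponents in the rules of `F` are at most `q + 3`. -/
theorem collision_eq_self (h : IsMarkerPair X z o) {F : Aut X} (hF : IsCollisionCA z o F)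
    {x : X.carrier} {s : ℤ} {R L : List (ℕ × List A)} {m : ℕ} (hR : RightFleet z o R)
    (hL : LeftFleet o L) (hm : o.length + 4 ≤ m) (hf : Form z x.1 s (R ++ (m, o) :: L)) :
    F.1 x = x := by
  obtain ⟨F1, F2, h1, h2, rfl⟩ := hF
  rw [ruleF1_eq] at h1
  rw [ruleF2_eq] at h2
  have e1 : F1.1 x = x := h.double_eq_self (by omega) (by omega) (by omega) (by omega) (by omega)
    (by omega) h1 hR hL (by omega) hf (by omega) (by omega)
  have e2 : F2.1 x = x := h.double_eq_self (by omega) (by omega) (by omega) (by omega) (by omega)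
    (by omega) h2 hR hL (by omega) hf (by omega) (by omega)
  change F2.1 (F1.1 x) = x
  rw [e1, e2]

/-- `F₁` brings the leftbound glider one copy of `z` closer, from distance `q + 3` to `q + 2`, and
then `F₂` brings the rightbound one closer, to distance `q + 1`. The other gliders stay where they
are. -/
theorem form_collision (h : IsMarkerPair X z o) {F : Aut X} (hF : IsCollisionCA z o F)
    {x : X.carrier} {s : ℤ} {R L : List (ℕ × List A)} {a : ℕ} (hR : RightFleet z o R)
    (ha : 0 < a) (hL : LeftFleet o L)
    (hf : Form z x.1 s (R ++ (a, wpow o (z.length + 1)) :: (o.length + 3, o) :: L)) :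
    Form z (F.1 x).1 s
      (R ++ (a + 1, wpow o (z.length + 1)) :: (o.length + 1, o) :: addHead 1 L) := by
  obtain ⟨F1, F2, h1, h2, rfl⟩ := hF
  rw [ruleF1_eq] at h1
  rw [ruleF2_eq] at h2
  have hhead : ∀ {L : List (ℕ × List A)}, LeftFleet o L → ∀ b ∈ L.head?, 1 ≤ b.1 :=
    fun hL b hb => by
      have := (hL b (List.mem_of_mem_head? hb)).1
      omega
  have f1 := h.form_double (by omega) (by omega) (by omega) (by omega) (by omega) (by omega)
    (by omega) (by omega) h1 hR ha hL (hhead hL) hf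
  rw [Nat.sub_add_cancel ha] at f1
  have f2 := h.form_double (by omega) (by omega) (by omega) (by omega) (by omega) (by omega)
    (by omega) (by omega) h2 hR ha (hL.addHead 1) (hhead (hL.addHead 1)) f1
  rw [Nat.sub_self, addHead_zero] at f2
  rwa [show a - 1 + 2 = a + 1 by omega] at f2

/-- The list is padded by `C` copies to allow a step, and the padding is removed afterwards. -/
theorem form_fleets (h : IsMarkerPair X z o) {c : GliderChoice X z o n} {G : Aut X}
    (hG : IsGliderCA c G) {x : X.carrier} {s : ℤ} {R L : List (ℕ × List A)}
    (hL : LeftFleet o L) (hR : RightFleet z o R) (hf : Form z x.1 s (L ++ R)) :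
    Form z (G.1 x).1 (s - o.length * z.length) (L ++ addHead (2 * o.length) R) := by
  obtain ⟨C, hC⟩ := h.exists_form_step hG
  have hv : Valid X z (L ++ R) := valid_append.2 ⟨h.valid_leftFleet hL, h.valid_rightFleet hR⟩
  obtain ⟨l', h1, h2⟩ := hC x _ _ (hv.addHead C) (fun e he => by
    rcases hL : L ++ R with - | ⟨⟨a, w⟩, t⟩
    · rw [hL] at he; simp at he
    · rw [hL] at he
      simp only [addHead_cons, List.head?_cons, Option.mem_def, Option.some.injEq] at he
      subst he
      dsimp only
      omega) (hf.pad C)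
  have e : l' = addHead C (L ++ addHead (2 * o.length) R) := by
    rcases eq_or_ne L [] with rfl | hne
    · rw [h.step_rightFleet (hR.addHead C) h1, List.nil_append, addHead_addHead,
        addHead_addHead, add_comm]
    · rw [addHead_append _ hne] at h1
      obtain ⟨m, h3, rfl⟩ := h.step_leftFleet_append (hL.addHead C) (h.valid_rightFleet hR) h1
      rw [h.step_rightFleet hR h3, addHead_append _ hne]
  rw [e] at h2
  refine Form.of_pad (k := C) ?_
  convert h2 using 1
  ring

theorem form_approach (h : IsMarkerPair X z o) {c : GliderChoice X z o n} {G : Aut X}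
    (hG : IsGliderCA c G) {x : X.carrier} {s : ℤ} {R L : List (ℕ × List A)} {m : ℕ}
    (hR : RightFleet z o R) (hR' : R ≠ []) (hL : LeftFleet o L) (hm : 2 * o.length + 1 ≤ m)
    (hf : Form z x.1 s (R ++ (m, o) :: L)) :
    Form z (G.1 x).1 (s - o.length * z.length)
      (addHead (2 * o.length) R ++ (m - 2 * o.length, o) :: L) := by
  obtain ⟨C, hC⟩ := h.exists_form_step hG
  have hv : Valid X z (R ++ (m, o) :: L) := valid_append.2 ⟨h.valid_rightFleet hR,
    valid_cons.2 ⟨⟨by dsimp only; omega, h.isGap_o⟩, h.valid_leftFleet hL⟩⟩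
  obtain ⟨l', h1, h2⟩ := hC x _ _ (hv.addHead C) (fun e he => by
    rcases R with - | ⟨⟨a, w⟩, t⟩
    · exact absurd rfl hR'
    · simp only [List.cons_append, addHead_cons, List.head?_cons, Option.mem_def,
        Option.some.injEq] at he
      subst he
      dsimp only
      omega) (hf.pad C)
  rw [addHead_append _ hR'] at h1
  have hne : addHead C R ≠ [] := by
    rcases R with - | ⟨⟨a, w⟩, t⟩
    · exact absurd rfl hR'
    · simp
  have e := h.step_approach (hR.addHead C) hne hL hm h1
  rw [addHead_addHead, add_comm, ← addHead_addHead, ← addHead_append] at e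
  · rw [e] at h2
    refine Form.of_pad (k := C) ?_
    convert h2 using 1
    ring
  · rcases R with - | ⟨⟨a, w⟩, t⟩
    · exact absurd rfl hR'
    · simp

end IsMarkerPair
end Collision

/-! ### Shifts, radii, and points on which the glider maps act as shifts -/

section Commute

variable {A : Type*} [TopologicalSpace A] [DiscreteTopology A] [Finite A] {X : Subshift A ℤ}
  {z o : List A} {n : ℕ}

theorem coe_shiftPerm {A : Type*} [TopologicalSpace A] {X : Subshift A ℤ} (j : ℤ)
    (x : X.carrier) : (shiftPerm X j x).1 = shift j x.1 := rfl

theorem shiftPerm_shiftPerm {A : Type*} [TopologicalSpace A] {X : Subshift A ℤ} (i j : ℤ)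
    (x : X.carrier) : shiftPerm X i (shiftPerm X j x) = shiftPerm X (i + j) x := by
  ext k
  simp [coe_shiftPerm, add_comm, add_left_comm]

theorem shiftPerm_zero {A : Type*} [TopologicalSpace A] {X : Subshift A ℤ}
    (x : X.carrier) : shiftPerm X 0 x = x := by
  ext k
  simp [coe_shiftPerm]

theorem sigma_zpow_apply (k : ℤ) (x : X.carrier) : (sigma X ^ k).1 x = shiftPerm X k x := by
  induction k generalizing x with
  | zero => rw [zpow_zero, shiftPerm_zero]; rfl
  | succ k ih =>
    rw [zpow_add_one]
    change (sigma X ^ (k : ℤ)).1 (shiftPerm X 1 x) = _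
    rw [ih, shiftPerm_shiftPerm]
  | pred k ih =>
    rw [zpow_sub_one]
    have : (sigma X)⁻¹.1 x = shiftPerm X (-1) x := by
      change (shiftPerm X 1)⁻¹ x = _
      rw [Equiv.Perm.inv_eq_iff_eq, shiftPerm_shiftPerm, add_neg_cancel, shiftPerm_zero]
    change (sigma X ^ (-k : ℤ)).1 ((sigma X)⁻¹.1 x) = _
    rw [this, ih, shiftPerm_shiftPerm, sub_eq_add_neg]

theorem apply_shiftPerm (f : Aut X) (j : ℤ) (x : X.carrier) :
    f.1 (shiftPerm X j x) = shiftPerm X j (f.1 x) := by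
  obtain ⟨r, hr⟩ := IsMorphism.locality f.2
  ext k
  exact hr _ _ k (j + k) fun l _ => by simp [coe_shiftPerm, add_assoc]

theorem sigma_zpow_mul_comm (f : Aut X) (k : ℤ) : sigma X ^ k * f = f * sigma X ^ k := by
  ext x : 2
  change (sigma X ^ k).1 (f.1 x) = f.1 ((sigma X ^ k).1 x)
  rw [sigma_zpow_apply, sigma_zpow_apply, apply_shiftPerm]

theorem pow_apply_of_shift {G : Aut X} {j : ℤ} {x : X.carrier}
    (hx : G.1 x = shiftPerm X j x) (t : ℕ) : (G ^ t).1 x = shiftPerm X (t * j) x := by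
  induction t with
  | zero => simp [shiftPerm_zero]
  | succ t ih =>
    rw [pow_succ']
    change G.1 ((G ^ t).1 x) = _
    rw [ih, apply_shiftPerm, hx, shiftPerm_shiftPerm]
    congr 2
    push_cast; ring

/-- A bound for the range of the local rule. -/
def HasRadius (f : Aut X) (r : ℕ) : Prop := ∀ (x y : X.carrier) (i : ℤ),
  (∀ k, i - r ≤ k → k ≤ i + r → x.1 k = y.1 k) → (f.1 x).1 i = (f.1 y).1 i

theorem exists_hasRadius (f : Aut X) : ∃ r, HasRadius f r := by
  obtain ⟨r, hr⟩ := IsMorphism.locality f.2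
  refine ⟨r, fun x y i h => hr x y i i fun k hk => ?_⟩
  rw [abs_le] at hk
  exact h _ (by omega) (by omega)

/-- The beginning of a left-infinite stretch on which no `z` occurs is preserved. -/
theorem RuleOK.first_occurrence {A : Type*} [TopologicalSpace A] {X : Subshift A ℤ} {z : List A}
    {R : Set (List A × List A)} (hz : IsMarker X z)
    (h : RuleOK X z R) {F : X.carrier → X.carrier} (hF : Replaces R F) {x : X.carrier} {i : ℤ}
    (hi : OccursAt x.1 z i) (hlt : ∀ j < i, ¬ OccursAt x.1 z j) :
    OccursAt (F x).1 z i ∧ ∀ j < i, ¬ OccursAt (F x).1 z j := by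
  have hp := hz.length_pos
  have hle : ∀ r ∈ R, ∀ k, OccursAt x.1 r.1 k → i ≤ k := fun r hr k hk => by
    by_contra! hki
    exact hlt k hki (h.occursAt_ends hr hk).2.1
  have h1 : OccursAt (F x).1 z i := by
    by_cases hr : ∃ r ∈ R, OccursAt x.1 r.1 i
    · obtain ⟨r, hr, hk⟩ := hr
      exact (h.occursAt_ends_right hr ((hF x).1 r hr i hk)).1
    · push Not at hr
      refine hi.congr fun m h1 h2 => (hF x).2 m fun r hr' k hk hkm => ?_
      have h3 := hle r hr' k hk
      have h4 := (h.occursAt_ends hr' hk).2.1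
      rcases hz.occursAt_sep hi h4 with rfl | h5 | h5
      · exact hr r hr' hk
      · omega
      · omega
  refine ⟨h1, fun j hj hj' => ?_⟩
  rcases hz.occursAt_sep h1 hj' with e | h5 | h5
  · omega
  · omega
  · refine hlt j hj (hj'.congr fun m h3 h4 => ((hF x).2 m fun r hr k hk hkm => ?_).symm)
    have := hle r hr k hk
    omega

theorem RuleOK.eq_self_of_no_occurrence {A : Type*} [TopologicalSpace A] {X : Subshift A ℤ} {z : List A}
    {R : Set (List A × List A)}
    (h : RuleOK X z R) {F : X.carrier → X.carrier} (hF : Replaces R F) {x : X.carrier}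
    (hx : ∀ j, ¬ OccursAt x.1 z j) : F x = x := by
  ext i
  exact (hF x).2 i fun r hr k hk _ => hx k (h.occursAt_ends hr hk).2.1

theorem form_nil_iff {A : Type*} {z : List A} {x : ℤ → A} {s : ℤ} :
    Form z x s [] ↔ ∀ t : ℤ, OccursAt x z (s + t * z.length) := by
  constructor
  · rintro ⟨h1, h2⟩ t
    rcases le_total 0 t with ht | ht
    · exact (rForm_nil.1 h2).occursAt_of t.toNat (by rw [Int.toNat_of_nonneg ht])
    · rcases ht.eq_or_lt with rfl | ht
      · exact (rForm_nil.1 h2).occursAt_of 0 (by simp)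
      · refine h1.occursAt_of (-t - 1).toNat ?_
        rw [Int.toNat_of_nonneg (by omega)]
        ring
  · intro h
    refine ⟨fun t => ?_, rForm_nil.2 fun t => h t⟩
    convert h (-(t + 1)) using 1
    ring

theorem Form.nil_add {A : Type*} {z : List A} {x : ℤ → A} {s : ℤ} (h : Form z x s []) (k : ℤ) :
    Form z x (s + k * z.length) [] := by
  rw [form_nil_iff] at h ⊢
  intro t
  convert h (k + t) using 1
  ring

theorem RTail.phase {A : Type*} [TopologicalSpace A] {X : Subshift A ℤ} {z : List A}
    (hz : IsMarker X z) {x : ℤ → A} {s e : ℤ} (h1 : RTail z x s)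
    (h2 : RTail z x e) : ∃ j : ℤ, e = s + j * z.length := by
  have hp := hz.length_pos
  wlog hle : s ≤ e generalizing s e
  · obtain ⟨j, hj⟩ := this h2 h1 (by omega)
    exact ⟨-j, by rw [hj]; ring⟩
  have e1 := Int.emod_add_mul_ediv (e - s) z.length
  have e2 := Int.emod_nonneg (e - s) (b := z.length) (by omega)
  have e3 := Int.emod_lt_of_pos (e - s) (b := z.length) (by omega)
  have e4 : 0 ≤ (e - s) / z.length := Int.ediv_nonneg (by omega) (by omega)
  have h3 := h1 ((e - s) / z.length).toNat
  rw [Int.toNat_of_nonneg e4] at h3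
  have h4 := h2 0
  have := hz.occursAt_unique h3 h4 (m := e) (by rw [mul_comm]; omega) (by rw [mul_comm]; omega)
    (by simp) (by simp; omega)
  exact ⟨(e - s) / z.length, by rw [this]; simp⟩

namespace IsMarkerPair

variable {c : GliderChoice X z o n} {G : Aut X}

theorem glider_leftFleet (h : IsMarkerPair X z o) (hG : IsGliderCA c G) {x : X.carrier} {s : ℤ}
    {L : List (ℕ × List A)} (hL : LeftFleet o L) (hf : Form z x.1 s L) :
    G.1 x = shiftPerm X (o.length * z.length) x := by
  have := h.form_fleets hG hL (rightFleet_nil z o) (by simpa using hf)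
  refine Subtype.ext (Form.ext h.length_pos (l := L) (s := s - o.length * z.length)
    (by simpa using this) ?_)
  rw [coe_shiftPerm, form_shift]
  simpa using hf

theorem glider_rightFleet (h : IsMarkerPair X z o) (hG : IsGliderCA c G) {x : X.carrier} {s : ℤ}
    {R : List (ℕ × List A)} (hR : RightFleet z o R) (hf : Form z x.1 s R) :
    G.1 x = shiftPerm X (-(o.length * z.length)) x := by
  have := h.form_fleets hG (leftFleet_nil o) hR (by simpa using hf)
  rw [List.nil_append] at this
  refine Subtype.ext (Form.ext h.length_pos this ?_)
  rw [coe_shiftPerm, form_shift]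
  convert hf.pad (2 * o.length) using 1
  push_cast
  ring

/-- Take `n` larger than all gaps. Iterating `G n` merely shifts `x`, so the fleets that must arise
are present in `x` from the beginning. -/
theorem exists_fleets_of_shift (h : IsMarkerPair X z o) {G : ℕ → Aut X}
    (hG : ∀ n, gliderBound z o < n → ∃ c : GliderChoice X z o n, IsGliderCA c (G n))
    {x : X.carrier} {s : ℤ} {l : List (ℕ × List A)} (hl : Valid X z l) (hf : Form z x.1 s l)
    {j : ℤ} (hx : ∀ n, gliderBound z o < n → (G n).1 x = shiftPerm X (j * z.length) x) :
    ∃ (k : ℤ) (L R : List (ℕ × List A)), LeftFleet o L ∧ RightFleet z o R ∧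
      Form z x.1 (s + k * z.length) (L ++ R) := by
  obtain ⟨n, hn, hs⟩ : ∃ n, gliderBound z o < n ∧ Short n l := by
    refine ⟨gliderBound z o + (l.map fun e => e.2.length).sum + 1, by omega, fun e he => ?_⟩
    have := List.single_le_sum (l := l.map fun e => e.2.length) (by simp) e.2.length
      (List.mem_map_of_mem he)
    omega
  obtain ⟨c, hc⟩ := hG n hn
  obtain ⟨t, k, L, R, hL, hR, h1⟩ := h.exists_fleets hn hc hl hs hf
  rw [pow_apply_of_shift (hx n hn) t, coe_shiftPerm, form_shift] at h1
  refine ⟨k + t * j, L, R, hL, hR, ?_⟩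
  convert h1 using 1
  ring

/-- In the frame of the leftbound gliders `x` stands still, whereas the head of a rightbound fleet
would gain `2q` copies of `z`; so there is no rightbound fleet. -/
theorem leftFleet_of_shift (h : IsMarkerPair X z o) {G : ℕ → Aut X}
    (hG : ∀ n, gliderBound z o < n → ∃ c : GliderChoice X z o n, IsGliderCA c (G n))
    {x : X.carrier} {s : ℤ} {l : List (ℕ × List A)} (hl : Valid X z l) (hf : Form z x.1 s l)
    (hx : ∀ n, gliderBound z o < n → (G n).1 x = shiftPerm X (o.length * z.length) x) :
    ∃ (k : ℤ) (L : List (ℕ × List A)), LeftFleet o L ∧ Form z x.1 (s + k * z.length) L := by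
  obtain ⟨k, L, R, hL, hR, h1⟩ := h.exists_fleets_of_shift hG hl hf hx
  obtain ⟨c, hc⟩ := hG _ (Nat.lt_succ_self _)
  have h2 := h.form_fleets hc hL hR h1
  rw [hx _ (Nat.lt_succ_self _), coe_shiftPerm, form_shift, sub_add_cancel] at h2
  have e := h2.2.unique h.length_pos (valid_append.2 ⟨h.valid_leftFleet hL,
    h.valid_rightFleet (hR.addHead _)⟩) (valid_append.2 ⟨h.valid_leftFleet hL,
      h.valid_rightFleet hR⟩) h1.2
  have e := List.append_cancel_left e
  rcases R with - | ⟨⟨a, w⟩, t⟩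
  · exact ⟨k, L, hL, by simpa using h1⟩
  · have := h.two_le
    simp only [addHead_cons, List.cons.injEq, Prod.mk.injEq] at e
    omega

theorem rightFleet_of_shift (h : IsMarkerPair X z o) {G : ℕ → Aut X}
    (hG : ∀ n, gliderBound z o < n → ∃ c : GliderChoice X z o n, IsGliderCA c (G n))
    {x : X.carrier} {s : ℤ} {l : List (ℕ × List A)} (hl : Valid X z l) (hf : Form z x.1 s l)
    (hx : ∀ n, gliderBound z o < n → (G n).1 x = shiftPerm X (-(o.length * z.length)) x) :
    ∃ (k : ℤ) (R : List (ℕ × List A)), RightFleet z o R ∧ Form z x.1 (s + k * z.length) R := by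
  obtain ⟨k, L, R, hL, hR, h1⟩ := h.exists_fleets_of_shift hG hl hf (j := -o.length)
    (by simpa using hx)
  obtain ⟨c, hc⟩ := hG _ (Nat.lt_succ_self _)
  have h2 := h.form_fleets hc hL hR h1
  rw [hx _ (Nat.lt_succ_self _), coe_shiftPerm, form_shift] at h2
  have hv := valid_append.2 ⟨h.valid_leftFleet hL, h.valid_rightFleet hR⟩
  have h3 := h1.pad (2 * o.length)
  have e1 : s + k * z.length - o.length * z.length + -(o.length * z.length) =
    s + k * z.length - (2 * o.length : ℕ) * z.length := by push_cast; ring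
  rw [e1] at h2
  have e := h2.2.unique h.length_pos (valid_append.2 ⟨h.valid_leftFleet hL,
    h.valid_rightFleet (hR.addHead _)⟩) (hv.addHead _) h3.2
  rcases L with - | ⟨⟨a, w⟩, t⟩
  · exact ⟨k, R, hR, by simpa using h1⟩
  · have := h.two_le
    simp only [List.cons_append, addHead_cons, List.cons.injEq, Prod.mk.injEq] at e
    omega

end IsMarkerPair
end Commute

/-! ### Centralizing automorphisms and the point of period `z` -/

section Centralizer

variable {A : Type*} [TopologicalSpace A] [DiscreteTopology A] [Finite A] {X : Subshift A ℤ}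
  {z o : List A} {n : ℕ}

/-- `f` commutes with the glider automorphisms and with the collision automorphism. -/
structure Central (z o : List A) (G : ℕ → Aut X) (F f : Aut X) : Prop where
  isGlider : ∀ n, gliderBound z o < n → ∃ c : GliderChoice X z o n, IsGliderCA c (G n)
  isCollision : IsCollisionCA z o F
  glider_comm : ∀ n, gliderBound z o < n → f * G n = G n * f
  collision_comm : f * F = F * f

namespace Central

variable {G : ℕ → Aut X} {F f : Aut X}

theorem sigma_mul (hf : Central z o G F f) (k : ℤ) : Central z o G F (sigma X ^ k * f) where
  isGlider := hf.isGlider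
  isCollision := hf.isCollision
  glider_comm n hn := by
    rw [mul_assoc, hf.glider_comm n hn, ← mul_assoc, sigma_zpow_mul_comm, mul_assoc]
  collision_comm := by
    rw [mul_assoc, hf.collision_comm, ← mul_assoc, sigma_zpow_mul_comm, mul_assoc]

theorem glider_apply (hf : Central z o G F f) {n : ℕ} (hn : gliderBound z o < n) (x : X.carrier) :
    (G n).1 (f.1 x) = f.1 ((G n).1 x) :=
  (congrArg (fun g : Aut X => g.1 x) (hf.glider_comm n hn)).symm

theorem collision_apply (hf : Central z o G F f) (x : X.carrier) :
    F.1 (f.1 x) = f.1 (F.1 x) :=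
  (congrArg (fun g : Aut X => g.1 x) hf.collision_comm).symm

end Central

namespace IsMarkerPair

theorem exists_form {A : Type*} [TopologicalSpace A] {X : Subshift A ℤ}
    {z o : List A} (h : IsMarkerPair X z o) {l : List (ℕ × List A)} (hl : Valid X z l) (s : ℤ) :
    ∃ x : X.carrier, Form z x.1 s l := by
  obtain ⟨x, hx, hf⟩ := exists_rForm h.isMarker hl s
  exact ⟨⟨x, hx⟩, hf⟩

theorem eq_shiftPerm {A : Type*} [TopologicalSpace A] {X : Subshift A ℤ}
    {z o : List A} (h : IsMarkerPair X z o) {x y : X.carrier} {s j : ℤ} {l : List (ℕ × List A)}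
    (hx : Form z x.1 s l) (hy : Form z y.1 (s + j) l) : x = shiftPerm X j y :=
  Subtype.ext (Form.ext h.length_pos hx (by rwa [coe_shiftPerm, form_shift]))

/-- The image of the point of period `z` under a central automorphism. -/
theorem exists_occursAt_image (h : IsMarkerPair X z o) {G : ℕ → Aut X} {F f : Aut X}
    (hf : Central z o G F f) {u : X.carrier} (hu : Form z u.1 0 []) :
    ∃ i, OccursAt (f.1 u).1 z i := by
  have hp := h.length_pos
  have hq := h.two_le
  -- The test point `x` is a single leftbound glider: `G` acts on `f x` as a nontrivial shift, but
  -- far to the left `f x` looks like `f u` and contains no `z`.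
  by_contra! hno
  have hL : LeftFleet o [(o.length + 1, o)] := by simp
  obtain ⟨x, hx⟩ := h.exists_form (h.valid_leftFleet hL) 0
  obtain ⟨c, hc⟩ := hf.isGlider _ (Nat.lt_succ_self _)
  have hGx := h.glider_leftFleet hc hL hx
  have hqp : 0 < (o.length : ℤ) * z.length := by positivity
  have hne : shiftPerm X (o.length * z.length) x ≠ x := by
    intro e
    have h1 := hx.pad o.length
    rw [zero_sub] at h1
    have h2 : Form z (shiftPerm X (o.length * z.length) x).1 (-(o.length * z.length))
        [(o.length + 1, o)] := by
      rw [coe_shiftPerm, form_shift]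
      simpa using hx
    rw [e] at h2
    have := h2.2.unique hp (h.valid_leftFleet hL) (h.valid_leftFleet (hL.addHead _)) h1.2
    simp only [addHead_cons, List.cons.injEq, Prod.mk.injEq] at this
    omega
  have hGy : (G (gliderBound z o).succ).1 (f.1 x) = shiftPerm X (o.length * z.length) (f.1 x) := by
    rw [hf.glider_apply (Nat.lt_succ_self _), hGx, apply_shiftPerm]
  obtain ⟨r, hr⟩ := exists_hasRadius f
  have hleft : ∀ i : ℤ, i + r < 0 → (f.1 x).1 i = (f.1 u).1 i := fun i hi =>
    hr _ _ _ fun k _ hk => LTail.agree hp hx.1 hu.1 (by omega)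
  have hz := h.isMarker
  obtain ⟨P1, P2, P4, h1, h2, h4, hG⟩ := hc
  by_cases hex : ∃ i, OccursAt (f.1 x).1 z i
  -- The leftmost `z` of `f x` keeps its position under each factor of `G`, while the shift would
  -- move it.
  · have hbd : ∀ i, OccursAt (f.1 x).1 z i → -(r : ℤ) - z.length ≤ i := by
      intro i hi
      by_contra! hlt
      exact hno i (hi.congr fun m h1 h2 => (hleft m (by omega)).symm)
    obtain ⟨i, hi, hmin⟩ := Int.exists_least_of_bdd ⟨_, hbd⟩ hex
    have hmin : ∀ j < i, ¬ OccursAt (f.1 x).1 z j := fun j hj hj' => by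
      have := hmin j hj'
      omega
    obtain ⟨a1, a2⟩ := h.ruleOK_P1.first_occurrence hz h1 hi hmin
    obtain ⟨b1, b2⟩ := h.ruleOK_P2.first_occurrence hz h2 a1 a2
    obtain ⟨c1, c2⟩ := (c.ruleOK h).first_occurrence hz h4 b1 b2
    have e : (G (gliderBound z o).succ).1 (f.1 x) = P4.1 (P2.1 (P1.1 (f.1 x))) := by rw [hG]; rfl
    rw [← e, hGy, coe_shiftPerm] at c2
    refine c2 (i - o.length * z.length) (by omega) ?_
    rw [occursAt_shift]
    simpa using hi
  -- Without any `z`, the point `f x` is fixed by `G`, so `x` is fixed by the shift, against `hne`.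
  · push Not at hex
    have e1 := h.ruleOK_P1.eq_self_of_no_occurrence h1 hex
    have e2 := h.ruleOK_P2.eq_self_of_no_occurrence h2 hex
    have e4 := (c.ruleOK h).eq_self_of_no_occurrence h4 hex
    have e : (G (gliderBound z o).succ).1 (f.1 x) = P4.1 (P2.1 (P1.1 (f.1 x))) := by rw [hG]; rfl
    rw [e1, e2, e4, hGy, ← apply_shiftPerm] at e
    exact hne (f.1.injective e)

/-- The image inherits the period `|z|`, so one occurrence of `z` determines it up to a shift. -/
theorem exists_image_periodic (h : IsMarkerPair X z o) {G : ℕ → Aut X} {F f : Aut X}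
    (hf : Central z o G F f) : ∃ k : ℤ, ∀ u : X.carrier, Form z u.1 0 [] →
      (sigma X ^ k * f).1 u = u := by
  obtain ⟨u, hu⟩ := h.exists_form (valid_nil) 0
  obtain ⟨i, hi⟩ := h.exists_occursAt_image hf hu
  have hper : ∀ t : ℤ, shiftPerm X (t * z.length) u = u := fun t => by
    refine (h.eq_shiftPerm (j := t * z.length) hu ?_).symm
    exact hu.nil_add t
  refine ⟨i, fun v hv => ?_⟩
  obtain rfl : v = u := Subtype.ext (hv.ext h.length_pos hu)
  have h1 : Form z (f.1 v).1 i [] := by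
    rw [form_nil_iff]
    intro t
    rw [← hper (-t), apply_shiftPerm, coe_shiftPerm, occursAt_shift]
    convert hi using 1
    ring
  change (sigma X ^ i).1 (f.1 v) = v
  rw [sigma_zpow_apply]
  exact (h.eq_shiftPerm hv (by simpa using h1)).symm

end IsMarkerPair
end Centralizer

/-! ### Images of single gliders -/

section GliderImages

variable {A : Type*} [TopologicalSpace A] [DiscreteTopology A] [Finite A] {X : Subshift A ℤ}
  {z o : List A} {n : ℕ} {G : ℕ → Aut X} {F f : Aut X}

/-- `f` fixes the point of period `z`. -/
def FixesPeriodic (z : List A) (f : Aut X) : Prop := ∀ u : X.carrier, Form z u.1 0 [] → f.1 u = u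

theorem FixesPeriodic.apply (hu : FixesPeriodic z f) {u : X.carrier} {s : ℤ}
    (h1 : Form z u.1 s []) : f.1 u = u := by
  have h2 : Form z (shiftPerm X s u).1 0 [] := by
    rw [coe_shiftPerm, form_shift, zero_add]; exact h1
  have := hu _ h2
  rw [apply_shiftPerm] at this
  exact (shiftPerm X s).injective this

namespace IsMarkerPair

theorem form_approach_add (h : IsMarkerPair X z o) {c : GliderChoice X z o n} {G : Aut X}
    (hG : IsGliderCA c G) {x : X.carrier} {s : ℤ} {R L : List (ℕ × List A)} {m : ℕ}
    (hR : RightFleet z o R) (hR' : R ≠ []) (hL : LeftFleet o L) (hm : 0 < m)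
    (hf : Form z x.1 s (R ++ (m + 2 * o.length, o) :: L)) :
    Form z (G.1 x).1 (s + o.length * z.length) (R ++ (m, o) :: L) := by
  have := h.form_approach hG hR hR' hL (by omega) hf
  rw [Nat.add_sub_cancel, ← addHead_append _ hR'] at this
  refine Form.of_pad (k := 2 * o.length) ?_
  convert this using 1
  push_cast; ring

/-- Beyond the radius `r` the image is that of `z^ℤ`, which is fixed; `r` copies of `z` have at
least `r` symbols. -/
theorem image_tails (h : IsMarkerPair X z o) (hu : FixesPeriodic z f) : ∃ N : ℕ,
    ∀ (x : X.carrier) (s : ℤ) (l : List (ℕ × List A)), Form z x.1 s l →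
      LTail z (f.1 x).1 (s - N * z.length) ∧
      RTail z (f.1 x).1 (s + (flat z l).length + N * z.length) := by
  have hp := h.length_pos
  obtain ⟨r, hr⟩ := exists_hasRadius f
  have hrp : (r : ℤ) ≤ r * z.length := by
    have : (r : ℤ) * 1 ≤ r * z.length := by gcongr; omega
    omega
  refine ⟨r, fun x s l hf => ⟨?_, ?_⟩⟩
  · obtain ⟨u, h1⟩ := h.exists_form (valid_nil) s
    have h2 := hu.apply h1
    refine (h1.1.sub r).congr fun m hm => ?_
    rw [← h2, hr x u m fun k _ hk => hf.1.agree hp h1.1 (by omega), h2]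
  · obtain ⟨u, h1⟩ := h.exists_form (valid_nil) (s + (flat z l).length)
    have h2 := hu.apply h1
    refine rForm_nil.1 ((rForm_nil.2 ((rForm_nil.1 h1.2).add r)).congr fun m hm => ?_)
    rw [← h2, hr x u m fun k hk _ => hf.2.2.agree hp (rForm_nil.1 h1.2) (by omega), h2]

theorem exists_form_image (h : IsMarkerPair X z o) (hu : FixesPeriodic z f) {x : X.carrier}
    {s : ℤ} {l : List (ℕ × List A)} (hf : Form z x.1 s l) :
    ∃ (k : ℤ) (l' : List (ℕ × List A)), Valid X z l' ∧ Form z (f.1 x).1 (s + k * z.length) l' := by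
  obtain ⟨N, hN⟩ := h.image_tails hu
  obtain ⟨h1, h2⟩ := hN x s l hf
  have h3 := h1.sub 1
  obtain ⟨l', hl', h4⟩ := exists_rForm_of_rTail h.isMarker (f.1 x).2
    ((flat z l).length + (2 * N + 1) * z.length) (s - N * z.length - (1 : ℕ) * z.length)
    (h1.occursAt_of 0 (by push_cast; ring)) (by convert h2 using 1; push_cast; ring)
  refine ⟨-N - 1, l', hl', ?_⟩
  rw [show s + (-N - 1 : ℤ) * z.length = s - N * z.length - (1 : ℕ) * z.length by push_cast; ring]
  exact ⟨h3, h4⟩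

theorem eq_nil_of_image (h : IsMarkerPair X z o) (hu : FixesPeriodic z f) {x : X.carrier}
    {l : List (ℕ × List A)} (hl : Valid X z l) (hf : Form z x.1 0 l) {k : ℤ}
    (h1 : Form z (f.1 x).1 (k * z.length) []) : l = [] := by
  have h2 := f.1.injective (hu.apply h1)
  rw [h2] at h1
  have h3 := h1.nil_add (-k)
  rw [show k * (z.length : ℤ) + -k * z.length = 0 by ring] at h3
  exact hf.2.unique h.length_pos hl valid_nil h3.2

/-- The image of a rightbound glider is a fleet of rightbound gliders. -/
theorem image_r (h : IsMarkerPair X z o) (hf : Central z o G F f) (hu : FixesPeriodic z f) :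
    ∃ (k j : ℤ) (R : List (ℕ × List A)), RightFleet z o R ∧ R ≠ [] ∧
      k * z.length + (flat z R).length = z.length + (wpow o (z.length + 1)).length + j * z.length ∧
      ∀ x : X.carrier, Form z x.1 0 [(1, wpow o (z.length + 1))] →
        Form z (f.1 x).1 (k * z.length) R := by
  have hR : RightFleet z o [(1, wpow o (z.length + 1))] := by simp
  have hv := h.valid_rightFleet hR
  obtain ⟨x, hx⟩ := h.exists_form hv 0
  obtain ⟨k0, l, hl, h1⟩ := h.exists_form_image hu hx
  -- All `G n` act on a rightbound glider as the same shift, hence also on its image.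
  obtain ⟨k, R, hR', h2⟩ := h.rightFleet_of_shift hf.isGlider hl h1 fun n hn => by
    obtain ⟨c, hc⟩ := hf.isGlider n hn
    rw [hf.glider_apply hn, h.glider_rightFleet hc hR hx, apply_shiftPerm]
  have h2 : Form z (f.1 x).1 ((k0 + k) * z.length) R := by
    convert h2 using 1; ring
  obtain ⟨N, hN⟩ := h.image_tails hu
  obtain ⟨j, hj⟩ := RTail.phase h.isMarker (hN x _ _ hx).2 h2.2.2
  refine ⟨k0 + k, N + j, R, hR', ?_, ?_, fun y hy => ?_⟩
  · rintro rfl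
    exact absurd (h.eq_nil_of_image hu hv hx h2) (by simp)
  · rw [hj]
    simp
    ring
  · rwa [show y = x from Subtype.ext (hy.ext h.length_pos hx)]

/-- The image of a leftbound glider is a fleet of leftbound gliders. -/
theorem image_o (h : IsMarkerPair X z o) (hf : Central z o G F f) (hu : FixesPeriodic z f) :
    ∃ (k : ℤ) (b : ℕ) (L : List (ℕ × List A)), LeftFleet o ((b, o) :: L) ∧
      ∀ x : X.carrier, Form z x.1 0 [(o.length + 1, o)] →
        Form z (f.1 x).1 (k * z.length) ((b, o) :: L) := by
  have hL : LeftFleet o [(o.length + 1, o)] := by simp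
  have hv := h.valid_leftFleet hL
  obtain ⟨x, hx⟩ := h.exists_form hv 0
  obtain ⟨k0, l, hl, h1⟩ := h.exists_form_image hu hx
  obtain ⟨k, L, hL', h2⟩ := h.leftFleet_of_shift hf.isGlider hl h1 fun n hn => by
    obtain ⟨c, hc⟩ := hf.isGlider n hn
    rw [hf.glider_apply hn, h.glider_leftFleet hc hL hx, apply_shiftPerm]
  have h2 : Form z (f.1 x).1 ((k0 + k) * z.length) L := by
    convert h2 using 1; ring
  rcases L with - | ⟨⟨b, w⟩, L⟩
  · exact absurd (h.eq_nil_of_image hu hv hx h2) (by simp)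
  obtain ⟨⟨hb, rfl⟩, hL''⟩ := leftFleet_cons.1 hL'
  exact ⟨k0 + k, b, L, hL', fun y hy => by
    rwa [show y = x from Subtype.ext (hy.ext h.length_pos hx)]⟩

/-- The images of two approaching gliders. -/
theorem image_pair_of_le (h : IsMarkerPair X z o) {k₁ j₁ k₂ : ℤ} {R L : List (ℕ × List A)} {b : ℕ}
    (hj : k₁ * z.length + (flat z R).length =
      z.length + (wpow o (z.length + 1)).length + j₁ * z.length)
    (h1 : ∀ x : X.carrier, Form z x.1 0 [(1, wpow o (z.length + 1))] →
      Form z (f.1 x).1 (k₁ * z.length) R)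
    (h2 : ∀ x : X.carrier, Form z x.1 0 [(o.length + 1, o)] →
      Form z (f.1 x).1 (k₂ * z.length) ((b, o) :: L)) :
    ∃ M : ℕ, ∀ m, M ≤ m → ∀ x : X.carrier, Form z x.1 0 [(1, wpow o (z.length + 1)), (m, o)] →
      Form z (f.1 x).1 (k₁ * z.length)
        (R ++ ((m + (k₂ - o.length - 1 - j₁ + b : ℤ)).toNat, o) :: L) := by
  have hp := h.length_pos
  obtain ⟨r, hr⟩ := exists_hasRadius f
  have hrp : (r : ℤ) ≤ r * z.length := by
    have : (r : ℤ) * 1 ≤ r * z.length := by gcongr; omega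
    omega
  set E : ℤ := z.length + (wpow o (z.length + 1)).length with hE
  -- The distance exceeds the radius and all offsets, so the image can be read off from the
  -- rightbound glider alone on the left and from the leftbound glider alone on the right.
  refine ⟨o.length + 1 + r + j₁.natAbs + r + (k₂ - o.length - 1 - j₁).natAbs + k₂.natAbs, fun m hm x hx => ?_⟩
  have hx2 := (rForm_cons.1 hx.2).2.2
  have e1 : (0 : ℤ) + (1 : ℕ) * z.length + (wpow o (z.length + 1)).length = E := by
    push_cast; rw [hE]; ring
  rw [e1] at hx2
  obtain ⟨y, hy⟩ := h.exists_form (l := [(1, wpow o (z.length + 1))])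
    (by simp [h.isGap_r]) 0
  obtain ⟨v, hv⟩ := h.exists_form (l := [(o.length + 1, o)]) (by simp [h.isGap_o]) 0
  have hy2 := (rForm_cons.1 hy.2).2.2
  rw [e1] at hy2
  obtain ⟨m', rfl⟩ : ∃ m', m = o.length + 1 + m' := ⟨m - (o.length + 1), by omega⟩
  set w := shiftPerm X (-(E + m' * z.length)) v with hw
  have hw1 : Form z w.1 (E + m' * z.length) [(o.length + 1, o)] := by
    rw [hw, coe_shiftPerm, form_shift]; simpa using hv
  have hw2 := hw1.pad m'
  rw [add_sub_cancel_right, addHead_cons] at hw2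
  have hagr : ∀ i, E ≤ i → x.1 i = w.1 i := fun i hi => hx2.agree hp hw2.2 hi
  have hagl : ∀ i, i < E + (o.length + 1 + m' : ℕ) * z.length → x.1 i = y.1 i := by
    intro i hi
    rcases lt_or_ge i 0 with h0 | h0
    · exact hx.1.agree hp hy.1 h0
    rcases lt_or_ge i E with h3 | h3
    · have ex : OccursAt x.1 (flat z [(1, wpow o (z.length + 1))]) 0 :=
        (rForm_append (l := [(1, wpow o (z.length + 1))]).1 hx.2).1
      exact ex.agree hy.2.1 h0 (by simp [hE] at h3 ⊢; omega)
    · have ex := (rForm_cons.1 hx2).1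
      have ey : OccursAt y.1 (wpow z (o.length + 1 + m')) E :=
        occursAt_wpow_iff.2 fun t _ => (rForm_nil.1 hy2) t
      exact ex.agree ey h3 (by simpa using hi)
  have fx1 := h1 y hy
  have fx2 : Form z (f.1 w).1 (k₂ * z.length + (E + m' * z.length)) ((b, o) :: L) := by
    rw [hw, apply_shiftPerm, coe_shiftPerm, form_shift]
    convert h2 v hv using 1
    ring
  have fr : ∀ i, E + r ≤ i → (f.1 x).1 i = (f.1 w).1 i := fun i hi =>
    hr _ _ _ fun k hk _ => hagr k (by omega)
  have fl : ∀ i, i < E + (o.length + 1 + m' : ℕ) * z.length - r → (f.1 x).1 i = (f.1 y).1 i :=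
    fun i hi => hr _ _ _ fun k _ hk => hagl k (by omega)
  obtain ⟨K, hK⟩ : ∃ K : ℕ, (K : ℤ) = k₂ + m' - j₁ := ⟨(k₂ + m' - j₁).toNat, by omega⟩
  have fx3 := fx2.pad K
  rw [hK, show k₂ * z.length + (E + m' * z.length) - (k₂ + m' - j₁) * z.length =
    E + j₁ * z.length by ring, addHead_cons] at fx3
  have b1 : j₁ * z.length + r ≤ (o.length + 1 + m' : ℕ) * z.length := by
    refine (add_le_add_right hrp _).trans ?_
    rw [← add_mul]; gcongr; push_cast; omega
  have b2 : (r : ℤ) ≤ j₁ * z.length + K * z.length := by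
    refine hrp.trans ?_
    rw [← add_mul]; gcongr; omega
  have run : ∀ i, E + j₁ * z.length ≤ i → (f.1 x).1 i = (f.1 w).1 i := by
    intro i hi
    rcases lt_or_ge i (E + r) with h3 | h3
    · have b3 : (r : ℤ) + r ≤ (o.length + 1 + m' : ℕ) * z.length := by
        refine (add_le_add hrp hrp).trans ?_
        rw [← add_mul]; gcongr; push_cast; omega
      have ew : OccursAt (f.1 w).1 (wpow z (b + K)) (E + j₁ * z.length) := (rForm_cons.1 fx3.2).1
      have ey : OccursAt (f.1 y).1 (wpow z (b + K)) (E + j₁ * z.length) :=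
        occursAt_wpow_iff.2 fun t _ => hj ▸ fx1.2.2 t
      rw [fl i (by omega)]
      refine ey.agree ew hi ?_
      rw [length_wpow]
      push_cast [add_mul]
      have : 0 ≤ (b : ℤ) * z.length := by positivity
      omega
    · exact fr i h3
  have e5 : ((o.length + 1 + m' : ℕ) + (k₂ - o.length - 1 - j₁ + b : ℤ)).toNat = b + K := by
    omega
  rw [e5]
  refine ⟨fx1.1.congr fun i hi => fl i ?_, rForm_append.2 ⟨fx1.2.1.congr fun i _ hi => fl i ?_, ?_⟩⟩
  · omega
  · omega
  · rw [hj]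
    exact fx3.2.congr run

/-- Small distances are reached from large ones by running `G`, which diminishes the distances in
the pair and in its image alike by `2q`. -/
theorem image_pair (h : IsMarkerPair X z o) (hf : Central z o G F f) {k : ℤ}
    {R L : List (ℕ × List A)} {d : ℤ} (hR : RightFleet z o R) (hR' : R ≠ []) (hL : LeftFleet o L)
    {M : ℕ} (hM : ∀ m, M ≤ m → ∀ x : X.carrier,
      Form z x.1 0 [(1, wpow o (z.length + 1)), (m, o)] →
      Form z (f.1 x).1 (k * z.length) (R ++ ((m + d).toNat, o) :: L))
    {m : ℕ} (hm : 0 < m) (hmd : 0 < m + d) {x : X.carrier}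
    (hx : Form z x.1 0 [(1, wpow o (z.length + 1)), (m, o)]) :
    Form z (f.1 x).1 (k * z.length) (R ++ ((m + d).toNat, o) :: L) := by
  have hq := h.two_le
  obtain ⟨c, hc⟩ := hf.isGlider _ (Nat.lt_succ_self _)
  have key : ∀ t m : ℕ, M ≤ m + t → 0 < m → 0 < m + d → ∀ x : X.carrier,
      Form z x.1 0 [(1, wpow o (z.length + 1)), (m, o)] →
      Form z (f.1 x).1 (k * z.length) (R ++ ((m + d).toNat, o) :: L) := by
    intro t
    induction t using Nat.strong_induction_on with
    | _ t ih =>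
    intro m hmt hm hmd x hx
    rcases le_or_gt M m with hle | hlt
    · exact hM m hle x hx
    obtain ⟨y, hy⟩ := h.exists_form
      (l := [(1, wpow o (z.length + 1)), (m + 2 * o.length, o)]) (by simp [h.isGap_r, h.isGap_o]; omega) 0
    have h1 := ih (t - 2 * o.length) (by omega) (m + 2 * o.length) (by omega) (by omega)
      (by push_cast; omega) y hy
    have h2 := h.form_approach_add hc (R := [(1, wpow o (z.length + 1))]) (L := []) (by simp)
      (by simp) (by simp) hm hy
    rw [show (((m + 2 * o.length : ℕ) : ℤ) + d).toNat = (m + d).toNat + 2 * o.length by omega] at h1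
    have h3 := h.form_approach_add hc hR hR' hL (by omega) h1
    have h4 : (G (gliderBound z o).succ).1 y = shiftPerm X (-(o.length * z.length)) x :=
      h.eq_shiftPerm h2 (by simpa using hx)
    rw [hf.glider_apply (Nat.lt_succ_self _), h4, apply_shiftPerm, coe_shiftPerm, form_shift] at h3
    simpa using h3
  exact key M m (by omega) hm hmd x hx

/-- The distance in the image of a pair of gliders differs from that of the pair by a constant `d`.
At distance `q + 3` the map `F` moves a pair, and beyond it does not; commutation with `F` forces `d
= 0`, and then that the images of the gliders are single gliders. -/
theorem exists_shift_gliders (h : IsMarkerPair X z o) (hf : Central z o G F f)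
    (hu : FixesPeriodic z f) : ∃ k : ℤ,
      (∀ x : X.carrier, Form z x.1 0 [(1, wpow o (z.length + 1))] →
        Form z (f.1 x).1 (k * z.length) [(1, wpow o (z.length + 1))]) ∧
      (∀ x : X.carrier, Form z x.1 0 [(o.length + 1, o)] →
        Form z (f.1 x).1 (k * z.length) [(o.length + 1, o)]) := by
  have hp := h.length_pos
  have hq := h.two_le
  obtain ⟨k₁, j₁, R, hR, hR', hj, h1⟩ := h.image_r hf hu
  obtain ⟨k₂, b, L, hL, h2⟩ := h.image_o hf hu
  obtain ⟨M, hM⟩ := h.image_pair_of_le hj h1 h2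
  set d : ℤ := k₂ - o.length - 1 - j₁ + b with hd
  obtain ⟨⟨hb, -⟩, hL'⟩ := leftFleet_cons.1 hL
  dsimp only at hb
  have hpair := fun (m : ℕ) (hm : 0 < m) (hmd : 0 < m + d) (x : X.carrier) hx =>
    h.image_pair hf hR hR' hL' hM (m := m) hm hmd (x := x) hx
  obtain ⟨R', a, rfl⟩ : ∃ R' a, R = R' ++ [(a, wpow o (z.length + 1))] := by
    obtain ⟨R', ⟨a, w⟩, rfl⟩ := R.eq_nil_or_concat'.resolve_left hR'
    have := (rightFleet_append.1 hR).2
    simp only [rightFleet_cons] at this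
    exact ⟨R', a, by rw [this.1.2]⟩
  have hR2 := (rightFleet_append.1 hR).1
  have ha : 0 < a := by
    have := (rightFleet_append.1 hR).2
    simp only [rightFleet_cons] at this
    exact this.1.1
  have hv : ∀ m : ℕ, 0 < m → Valid X z [(1, wpow o (z.length + 1)), (m, o)] := fun m hm => by
    simp [h.isGap_r, h.isGap_o, hm]
  have hV : ∀ m : ℕ, 0 < m → Valid X z ((R' ++ [(a, wpow o (z.length + 1))]) ++ (m, o) :: L) :=
    fun m hm => valid_append.2 ⟨h.valid_rightFleet hR,
      valid_cons.2 ⟨⟨hm, h.isGap_o⟩, h.valid_leftFleet hL'⟩⟩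
  have hV' : ∀ m : ℕ, 0 < m → Valid X z (R' ++ (a + 1, wpow o (z.length + 1)) :: (m, o) ::
      addHead 1 L) := fun m hm => valid_append.2 ⟨h.valid_rightFleet hR2,
        valid_cons.2 ⟨⟨by dsimp only; omega, h.isGap_r⟩,
        valid_cons.2 ⟨⟨hm, h.isGap_o⟩, h.valid_leftFleet (hL'.addHead 1)⟩⟩⟩
  have hr1 : RightFleet z o [(1, wpow o (z.length + 1))] := by simp
  rcases lt_trichotomy d 0 with hd0 | hd0 | hd0
  -- The image is at the critical distance `q + 3` and is moved by `F`, the pair is at distance at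
  -- least `q + 4` and is not.
  · exfalso
    obtain ⟨m, hm⟩ : ∃ m : ℕ, (m : ℤ) = o.length + 3 - d := ⟨(o.length + 3 - d).toNat, by omega⟩
    obtain ⟨x, hx⟩ := h.exists_form (hv m (by omega)) 0
    have e1 := h.collision_eq_self hf.isCollision (R := [(1, wpow o (z.length + 1))]) (L := []) hr1
      (by simp) (by omega : o.length + 4 ≤ m) hx
    have f1 := hpair m (by omega) (by omega) x hx
    rw [show ((m : ℤ) + d).toNat = o.length + 3 by omega] at f1
    have f2 := h.form_collision hf.isCollision hR2 ha hL' (by simpa using f1)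
    rw [hf.collision_apply, e1] at f2
    have e := f1.2.unique hp (hV _ (by omega)) (hV' _ (by omega)) f2.2
    simp at e
  -- `F` takes the pair at distance `q + 3` to a shift by one `z` of the pair at distance `q + 1`.
  -- In the image the same shift would have to affect all gliders, but `F` leaves those of `R'` and
  -- `L` in place; so there are none.
  · obtain ⟨x, hx⟩ := h.exists_form (hv (o.length + 3) (by omega)) 0
    obtain ⟨y, hy⟩ := h.exists_form (hv (o.length + 1) (by omega)) 0
    have f1 := hpair _ (by omega) (by omega) x hx
    have g1 := hpair _ (by omega) (by omega) y hy
    rw [hd0, add_zero, Int.toNat_natCast] at f1 g1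
    have f2 := h.form_collision hf.isCollision hR2 ha hL' (by simpa using f1)
    have f3 := h.form_collision hf.isCollision (R := []) (L := []) (by simp) one_pos (by simp) hx
    have e1 : F.1 x = shiftPerm X (-z.length) y := by
      refine h.eq_shiftPerm f3 ?_
      convert hy.pad 1 using 1
      · push_cast; ring
      · simp
    rw [hf.collision_apply, e1, apply_shiftPerm, coe_shiftPerm, form_shift] at f2
    have g2 := g1.pad 1
    rw [show k₁ * (z.length : ℤ) - (1 : ℕ) * z.length = k₁ * z.length + -z.length by
      push_cast; ring] at g2
    have e := g2.2.unique hp ((hV _ (by omega)).addHead 1) (hV' _ (by omega)) f2.2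
    obtain ⟨rfl, rfl⟩ : R' = [] ∧ L = [] := by
      rcases R' with - | ⟨⟨b', w⟩, t⟩
      · rcases L with - | ⟨⟨b', w⟩, t⟩
        · simp
        · simp at e
      · simp at e
    have ha' : k₁ + a = 1 + j₁ := by
      refine mul_right_cancel₀ (b := (z.length : ℤ)) (by omega) ?_
      simp at hj
      linarith
    -- `d = 0` says that the two image gliders are displaced by the same number of copies of `z`;
    -- surplus copies at the head go into the tail.
    refine ⟨j₁, fun x hx => Form.of_pad (k := a - 1) ?_,
      fun x hx => Form.of_pad (k := b - (o.length + 1)) ?_⟩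
    · convert h1 x hx using 1
      · rw [Nat.cast_sub (by omega)]
        linear_combination (-z.length : ℤ) * ha'
      · simp; omega
    · convert h2 x hx using 1
      · rw [Nat.cast_sub hb]
        push_cast
        linear_combination (z.length : ℤ) * (hd - hd0)
      · simp; omega
  -- Conversely, the pair is at the critical distance and its image is too far apart.
  · exfalso
    obtain ⟨x, hx⟩ := h.exists_form (hv (o.length + 3) (by omega)) 0
    have f1 := hpair _ (by omega) (by omega) x hx
    have e1 := h.collision_eq_self hf.isCollision hR hL' (by omega) f1
    have f3 := h.form_collision hf.isCollision (R := []) (L := []) (by simp) one_pos (by simp) hx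
    rw [hf.collision_apply] at e1
    rw [f.1.injective e1] at f3
    have e := hx.2.unique hp (hv _ (by omega)) ?_ f3.2
    · simp at e
    · simp [h.isGap_r, h.isGap_o]

end IsMarkerPair
end GliderImages

/-! ### From single gliders to all points -/

section FixedPoints

variable {A : Type*} [TopologicalSpace A] [DiscreteTopology A] [Finite A] {X : Subshift A ℤ}
  {z o : List A} {n : ℕ} {F f : Aut X}

/-- `f` fixes the points with zero tails which are described by the list `l`. -/
def FixesList (z : List A) (f : Aut X) (l : List (ℕ × List A)) : Prop :=
  ∀ (s : ℤ) (x : X.carrier), Form z x.1 s l → f.1 x = x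

theorem FixesList.addHead_iff {l : List (ℕ × List A)} {k : ℕ} :
    FixesList z f (addHead k l) ↔ FixesList z f l :=
  ⟨fun h _ x hx => h _ x (hx.pad k), fun h s x hx => h (s + k * z.length) x
    (Form.of_pad (k := k) (by rwa [add_sub_cancel_right]))⟩

theorem FixesList.head {w : List A} {t : List (ℕ × List A)} {a : ℕ} (b : ℕ)
    (h : FixesList z f ((a, w) :: t)) : FixesList z f ((b, w) :: t) := by
  rw [← addHead_iff (k := b), addHead_cons] at h
  rwa [← addHead_iff (k := a), addHead_cons, add_comm]

/-- The regions where `x` agrees with `y` and with `v` overlap in `2r` symbols, so every window of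
radius `r` lies in one of them. -/
theorem HasRadius.apply_eq_of_glue {r : ℕ} (hr : HasRadius f r) {x y v : X.carrier} (c : ℤ)
    (hy : f.1 y = y) (hv : f.1 v = v) (h1 : ∀ i, i < c + r + r → x.1 i = y.1 i)
    (h2 : ∀ i, c ≤ i → x.1 i = v.1 i) : f.1 x = x := by
  ext i
  rcases lt_or_ge i (c + r) with hi | hi
  · rw [hr x y i fun k _ hk => h1 k (by omega), hy, h1 i (by omega)]
  · rw [hr x v i fun k hk _ => h2 k (by omega), hv, h2 i (by omega)]

theorem Form.agree_append {A : Type*} {z : List A} (hp : 0 < z.length) {x y : ℤ → A} {s : ℤ} {w : List A}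
    {a : ℕ} {l t : List (ℕ × List A)} (hx : Form z x s (l ++ (a, w) :: t)) (hy : Form z y s l)
    {i : ℤ} (hi : i < s + (flat z l).length + a * z.length) : x i = y i := by
  obtain ⟨h1, h2⟩ := rForm_append.1 hx.2
  rcases lt_or_ge i s with h0 | h0
  · exact hx.1.agree hp hy.1 h0
  rcases lt_or_ge i (s + (flat z l).length) with h3 | h3
  · exact h1.agree hy.2.1 h0 h3
  · have ey : OccursAt y (wpow z a) (s + (flat z l).length) :=
      occursAt_wpow_iff.2 fun t _ => hy.2.2 t
    exact (rForm_cons.1 h2).1.agree ey h3 (by simpa using hi)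

namespace IsMarkerPair

theorem fixesList_of_form (h : IsMarkerPair X z o) {l : List (ℕ × List A)} {s : ℤ} {x : X.carrier}
    (hx : Form z x.1 s l) (hf : f.1 x = x) : FixesList z f l := by
  intro s' y hy
  rw [h.eq_shiftPerm (j := s - s') hy (by simpa using hx), apply_shiftPerm, hf]

/-- At least `2r` copies of `z` between the two parts make them independent for `f`. -/
theorem fixesList_append (h : IsMarkerPair X z o) {r : ℕ} (hr : HasRadius f r)
    {l t : List (ℕ × List A)} {a : ℕ} {w : List A} (hv : Valid X z (l ++ (a, w) :: t))
    (ha : 2 * r ≤ a) (h1 : FixesList z f l) (h2 : FixesList z f ((a, w) :: t)) :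
    FixesList z f (l ++ (a, w) :: t) := by
  have hp := h.length_pos
  intro s x hx
  obtain ⟨y, hy⟩ := h.exists_form (valid_append.1 hv).1 s
  obtain ⟨v, hv⟩ := h.exists_form (valid_append.1 hv).2 (s + (flat z l).length)
  have hap : (r : ℤ) + r ≤ a * z.length := by
    have : ((2 * r : ℕ) : ℤ) * 1 ≤ a * z.length := by gcongr; omega
    push_cast at this; omega
  exact hr.apply_eq_of_glue (s + (flat z l).length) (h1 _ _ hy) (h2 _ _ hv)
    (fun i hi => hx.agree_append hp hy (by omega))
    fun i hi => (rForm_append.1 hx.2).2.agree hp hv.2 hi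

/-- Each part is compared on its own side with the whole and on the other side with `z^ℤ`, which `f`
fixes. -/
theorem fixesList_of_append (h : IsMarkerPair X z o) (hu : FixesPeriodic z f) {r : ℕ}
    (hr : HasRadius f r) {l t : List (ℕ × List A)} {a : ℕ} {w : List A}
    (hv : Valid X z (l ++ (a, w) :: t)) (ha : 2 * r ≤ a)
    (h1 : FixesList z f (l ++ (a, w) :: t)) :
    FixesList z f l ∧ FixesList z f ((a, w) :: t) := by
  have hp := h.length_pos
  have hap : (r : ℤ) + r ≤ a * z.length := by
    have : ((2 * r : ℕ) : ℤ) * 1 ≤ a * z.length := by gcongr; omega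
    push_cast at this; omega
  obtain ⟨x, hx⟩ := h.exists_form hv 0
  obtain ⟨y, hy⟩ := h.exists_form (valid_append.1 hv).1 0
  obtain ⟨v, hv⟩ := h.exists_form (valid_append.1 hv).2 (0 + (flat z l).length)
  obtain ⟨u, hU⟩ := h.exists_form valid_nil (0 + (flat z l).length)
  have hfu := hu.apply hU
  refine ⟨h.fixesList_of_form hy ?_, h.fixesList_of_form hv ?_⟩
  · exact hr.apply_eq_of_glue (0 + (flat z l).length) (h1 _ _ hx) hfu
      (fun i hi => (hx.agree_append hp hy (by omega)).symm)
      fun i hi => RTail.agree hp hy.2.2 (rForm_nil.1 hU.2) hi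
  · exact hr.apply_eq_of_glue (0 + (flat z l).length) hfu (h1 _ _ hx)
      (fun i hi => Form.agree_append hp (l := []) hv hU (by simp at hi ⊢; omega))
      fun i hi => (hv.2.agree hp (rForm_append.1 hx.2).2 hi)

theorem fixesList_iff_of_comm (h : IsMarkerPair X z o) {g : Aut X} (hg : ∀ x, g.1 (f.1 x) = f.1 (g.1 x))
    {l l' : List (ℕ × List A)} {s s' : ℤ} {x : X.carrier} (hx : Form z x.1 s l)
    (hx' : Form z (g.1 x).1 s' l') : FixesList z f l ↔ FixesList z f l' := by
  refine ⟨fun h1 => h.fixesList_of_form hx' ?_, fun h1 => h.fixesList_of_form hx ?_⟩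
  · rw [← hg, h1 _ _ hx]
  · refine g.1.injective ?_
    rw [hg, h1 _ _ hx']

variable {G : ℕ → Aut X}

/-- Running `G` shows that only the distance modulo `2q` of two approaching fleets matters. -/
theorem fixesList_approach (h : IsMarkerPair X z o) (hf : Central z o G F f)
    {R L : List (ℕ × List A)} (hR : RightFleet z o R) (hR' : R ≠ []) (hL : LeftFleet o L)
    {m : ℕ} (hm : 0 < m) (k : ℕ) :
    FixesList z f (R ++ (m + 2 * o.length * k, o) :: L) ↔ FixesList z f (R ++ (m, o) :: L) := by
  induction k with
  | zero => simp
  | succ k ih =>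
    rw [← ih]
    obtain ⟨c, hc⟩ := hf.isGlider _ (Nat.lt_succ_self _)
    obtain ⟨x, hx⟩ := h.exists_form (l := R ++ (m + 2 * o.length * (k + 1), o) :: L)
      (valid_append.2 ⟨h.valid_rightFleet hR,
        valid_cons.2 ⟨⟨by dsimp only; omega, h.isGap_o⟩, h.valid_leftFleet hL⟩⟩) 0
    refine h.fixesList_iff_of_comm (hf.glider_apply (Nat.lt_succ_self _)) hx
      (s' := 0 + o.length * z.length)
      (h.form_approach_add hc hR hR' hL (m := m + 2 * o.length * k) (by omega) ?_)
    rwa [add_assoc, ← mul_add_one]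

/-- The fleets are joined at a large distance, brought to distance `q + 1` by `G`, taken back to
distance `q + 3` by undoing `F`, and moved apart again by `G` so that they can be separated. Undoing
`F` shortens the gaps next to the two colliding gliders within their fleets by one copy of `z`. -/
theorem fixesList_collide (h : IsMarkerPair X z o) (hf : Central z o G F f)
    (hu : FixesPeriodic z f) {R L : List (ℕ × List A)} {a : ℕ} (hR : RightFleet z o R)
    (ha : 0 < a) (hL : LeftFleet o L)
    (h1 : FixesList z f (R ++ [(a + 1, wpow o (z.length + 1))]))
    (h2 : FixesList z f ((o.length + 1, o) :: addHead 1 L)) :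
    FixesList z f (R ++ [(a, wpow o (z.length + 1))]) ∧
      FixesList z f ((o.length + 3, o) :: L) := by
  have hq := h.two_le
  obtain ⟨r, hr⟩ := exists_hasRadius f
  have hr1 : ∀ b, 0 < b → RightFleet z o (R ++ [(b, wpow o (z.length + 1))]) := fun b hb => by
    simp [hR, hb]
  have hv : ∀ b m L', 0 < b → 0 < m → LeftFleet o L' →
      Valid X z ((R ++ [(b, wpow o (z.length + 1))]) ++ (m, o) :: L') := fun b m L' hb hm hL' =>
    valid_append.2 ⟨h.valid_rightFleet (hr1 b hb),
      valid_cons.2 ⟨⟨hm, h.isGap_o⟩, h.valid_leftFleet hL'⟩⟩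
  have hbig : ∀ m, 2 * r ≤ m + 2 * o.length * r := fun m => by
    have : 2 * 1 * r ≤ 2 * o.length * r := by gcongr; omega
    omega
  have h3 := h.fixesList_append hr (hv _ _ _ (by omega) (by omega) (hL.addHead 1))
    (hbig (o.length + 1)) h1 (h2.head _)
  rw [h.fixesList_approach hf (hr1 _ (by omega)) (by simp) (hL.addHead 1) (by omega)] at h3
  obtain ⟨x, hx⟩ := h.exists_form (hv a (o.length + 3) L ha (by omega) hL) 0
  have hFx := h.form_collision hf.isCollision hR ha hL (by simpa using hx)
  rw [List.append_assoc, List.singleton_append,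
    ← h.fixesList_iff_of_comm hf.collision_apply hx hFx,
    ← h.fixesList_approach hf (hr1 _ ha) (by simp) hL (by omega) r] at h3
  obtain ⟨h4, h5⟩ := h.fixesList_of_append hu hr (hv _ _ _ ha (by omega) hL) (hbig _) h3
  exact ⟨h4, h5.head _⟩

/-- Gliders with wide gaps between them are independent; a single auxiliary rightbound glider and
`fixesList_collide` then narrow the first inner gap copy by copy. -/
theorem fixesList_leftFleet (h : IsMarkerPair X z o) (hf : Central z o G F f)
    (hu : FixesPeriodic z f) (h1 : FixesList z f [(1, wpow o (z.length + 1))])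
    (h2 : FixesList z f [(o.length + 1, o)]) {L : List (ℕ × List A)} (hL : LeftFleet o L) :
    FixesList z f L := by
  obtain ⟨r, hr⟩ := exists_hasRadius f
  induction L with
  | nil => exact fun s x hx => hu.apply hx
  | cons e t ih =>
    obtain ⟨a, w⟩ := e
    obtain ⟨⟨ha, rfl⟩, ht⟩ := leftFleet_cons.1 hL
    rcases t with - | ⟨⟨b, v⟩, t⟩
    · exact h2.head _
    obtain ⟨⟨hb, hv⟩, ht'⟩ := leftFleet_cons.1 ht
    dsimp only at ha hb hv
    subst hv
    -- Induction on the number `d` of copies by which `b` may fall short of `2r`.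
    have key : ∀ d b : ℕ, v.length + 1 ≤ b → 2 * r ≤ b + d →
        FixesList z f ((v.length + 3, v) :: (b, v) :: t) := by
      intro d
      induction d with
      | zero =>
        intro b hb hbr
        exact h.fixesList_append (l := [(v.length + 3, v)]) hr
          (h.valid_leftFleet (by simp [ht', hb])) hbr (h2.head _) ((ih ht).head b)
      | succ d ihd =>
        intro b hb hbr
        refine (h.fixesList_collide hf hu (R := []) (a := 1) (by simp) one_pos
          (L := (b, v) :: t) (by simp [ht', hb]) (h1.head _) ?_).2
        exact (ihd (b + 1) (by omega) (by omega)).head _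
    exact (key (2 * r) b hb (by omega)).head a

theorem fixesList_rightFleet (h : IsMarkerPair X z o) (hf : Central z o G F f)
    (hu : FixesPeriodic z f) (h1 : FixesList z f [(1, wpow o (z.length + 1))])
    (h2 : FixesList z f [(o.length + 1, o)]) {R : List (ℕ × List A)} (hR : RightFleet z o R) :
    FixesList z f R := by
  obtain ⟨r, hr⟩ := exists_hasRadius f
  induction R using List.reverseRecOn with
  | nil => exact fun s x hx => hu.apply hx
  | append_singleton R e ih =>
    obtain ⟨b, w⟩ := e
    obtain ⟨hR1, hR2⟩ := rightFleet_append.1 hR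
    simp only [rightFleet_cons, rightFleet_nil, and_true] at hR2
    obtain ⟨hb, rfl⟩ := hR2
    have key : ∀ d b : ℕ, 0 < b → 2 * r ≤ b + d →
        FixesList z f (R ++ [(b, wpow o (z.length + 1))]) := by
      intro d
      induction d with
      | zero =>
        intro b hb hbr
        exact h.fixesList_append hr (h.valid_rightFleet (by simp [hR1, hb])) hbr (ih hR1)
          (h1.head b)
      | succ d ihd =>
        intro b hb hbr
        exact (h.fixesList_collide hf hu hR1 hb (L := []) (by simp)
          (ihd (b + 1) (by omega) (by omega)) h2).1
    exact key (2 * r) b hb (by omega)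

/-- The two fleets recede from each other under `G`, and once far apart they are independent. -/
theorem fixesList_fleets (h : IsMarkerPair X z o) (hf : Central z o G F f)
    (hu : FixesPeriodic z f) (h1 : FixesList z f [(1, wpow o (z.length + 1))])
    (h2 : FixesList z f [(o.length + 1, o)]) {L R : List (ℕ × List A)} (hL : LeftFleet o L)
    (hR : RightFleet z o R) : FixesList z f (L ++ R) := by
  have hq := h.two_le
  obtain ⟨r, hr⟩ := exists_hasRadius f
  have hLf := h.fixesList_leftFleet hf hu h1 h2 hL
  have hRf := h.fixesList_rightFleet hf hu h1 h2 hR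
  rcases R with - | ⟨⟨a, w⟩, t⟩
  · rwa [List.append_nil]
  have key : ∀ k, FixesList z f (L ++ addHead (2 * o.length * k) ((a, w) :: t)) →
      FixesList z f (L ++ (a, w) :: t) := by
    intro k
    induction k with
    | zero => simp
    | succ k ih =>
      refine fun h3 => ih ?_
      obtain ⟨c, hc⟩ := hf.isGlider _ (Nat.lt_succ_self _)
      have hR' := hR.addHead (2 * o.length * k)
      obtain ⟨x, hx⟩ := h.exists_form
        (valid_append.2 ⟨h.valid_leftFleet hL, h.valid_rightFleet hR'⟩) 0
      have hGx := h.form_fleets hc hL hR' hx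
      rw [addHead_addHead, ← mul_add_one] at hGx
      exact (h.fixesList_iff_of_comm (hf.glider_apply (Nat.lt_succ_self _)) hx hGx).2 h3
  refine key r ?_
  have hR' := hR.addHead (2 * o.length * r)
  rw [addHead_cons] at hR' ⊢
  refine h.fixesList_append hr
    (valid_append.2 ⟨h.valid_leftFleet hL, h.valid_rightFleet hR'⟩) ?_ hLf (hRf.head _)
  have : 2 * 1 * r ≤ 2 * o.length * r := by gcongr; omega
  omega

/-- A power of a suitable `G n`, which commutes with `f`, turns a given point with zero tails into
fleets; so `f` fixes it. Since `f` is local, density of these points suffices. -/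
theorem eq_one_of_fixes (h : IsMarkerPair X z o) (ht : IsTransitive X) (hf : Central z o G F f)
    (hu : FixesPeriodic z f) (h1 : FixesList z f [(1, wpow o (z.length + 1))])
    (h2 : FixesList z f [(o.length + 1, o)]) : f = 1 := by
  have hall : ∀ (y : X.carrier) (s : ℤ) (l : List (ℕ × List A)), Valid X z l → Form z y.1 s l →
      f.1 y = y := by
    intro y s l hl hy
    obtain ⟨n, hn, hs⟩ : ∃ n, gliderBound z o < n ∧ Short n l := by
      refine ⟨gliderBound z o + (l.map fun e => e.2.length).sum + 1, by omega, fun e he => ?_⟩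
      have := List.single_le_sum (l := l.map fun e => e.2.length) (by simp) e.2.length
        (List.mem_map_of_mem he)
      omega
    obtain ⟨c, hc⟩ := hf.isGlider n hn
    obtain ⟨t, k, L, R, hL, hR, h3⟩ := h.exists_fleets hn hc hl hs hy
    have h4 := h.fixesList_fleets hf hu h1 h2 hL hR _ _ h3
    have hcomm : f * G n ^ t = G n ^ t * f := (Commute.pow_right (hf.glider_comm n hn) t)
    have h5 : f.1 ((G n ^ t).1 y) = (G n ^ t).1 (f.1 y) :=
      congrArg (fun g : Aut X => g.1 y) hcomm
    rw [h4] at h5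
    exact ((G n ^ t).1.injective h5).symm
  obtain ⟨r, hr⟩ := exists_hasRadius f
  ext x i
  obtain ⟨y, hy, ⟨s, l, hl, hf⟩, hag⟩ :=
    exists_form_agree h.isMarker ht x.2 (i - r) (2 * r + 1)
  have h3 := hall ⟨y, hy⟩ s l hl hf
  have := hr x ⟨y, hy⟩ i fun k h1 h2 => (hag k h1 (by push_cast; omega)).symm
  rw [h3] at this
  exact this.trans (hag i (by omega) (by push_cast; omega))

/-- Two corrections by shifts: the first makes `f` fix `z^ℤ`, and the second, by a multiple of
`|z|`, puts the single gliders back in place. -/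
theorem mem_zpowers_of_central (h : IsMarkerPair X z o) (ht : IsTransitive X)
    (hf : Central z o G F f) : f ∈ Subgroup.zpowers (sigma X) := by
  have hp := h.length_pos
  obtain ⟨i, hi⟩ := h.exists_image_periodic hf
  have hf1 := hf.sigma_mul i
  obtain ⟨k, hk1, hk2⟩ := h.exists_shift_gliders hf1 hi
  have hf2 := hf1.sigma_mul (k * z.length)
  have happ : ∀ x, (sigma X ^ (k * z.length) * (sigma X ^ i * f)).1 x =
      shiftPerm X (k * z.length) ((sigma X ^ i * f).1 x) := fun x =>
    sigma_zpow_apply _ _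
  have hfix : ∀ l, (∀ x : X.carrier, Form z x.1 0 l →
      Form z ((sigma X ^ i * f).1 x).1 (k * z.length) l) → Valid X z l →
      FixesList z (sigma X ^ (k * z.length) * (sigma X ^ i * f)) l := by
    intro l hl hv
    obtain ⟨x, hx⟩ := h.exists_form hv 0
    refine h.fixesList_of_form hx ?_
    rw [happ]
    exact (h.eq_shiftPerm hx (by simpa using hl x hx)).symm
  have h1 := h.eq_one_of_fixes ht hf2 (fun u hu => by
      rw [happ, hi u hu]
      exact (h.eq_shiftPerm hu (hu.nil_add k)).symm)
    (hfix _ hk1 (by simp [h.isGap_r])) (hfix _ hk2 (by simp [h.isGap_o]))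
  rw [← mul_assoc, ← zpow_add] at h1
  rw [eq_inv_of_mul_eq_one_right h1]
  exact Subgroup.inv_mem _ (Subgroup.zpow_mem_zpowers _ _)

theorem centralizer_eq (h : IsMarkerPair X z o) (ht : IsTransitive X)
    (hG : ∀ n, gliderBound z o < n → ∃ c : GliderChoice X z o n, IsGliderCA c (G n))
    (hF : IsCollisionCA z o F) :
    Subgroup.centralizer ((Subgroup.closure (G '' {n | gliderBound z o < n} ∪ {F}) :
      Subgroup (Aut X)) : Set (Aut X)) = Subgroup.zpowers (sigma X) := by
  rw [Subgroup.centralizer_closure]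
  ext f
  constructor
  · intro hf
    rw [Subgroup.mem_centralizer_iff] at hf
    refine h.mem_zpowers_of_central ht (G := G) (F := F) ⟨hG, hF, fun n hn => ?_, ?_⟩
    · exact (hf _ (Or.inl ⟨n, hn, rfl⟩)).symm
    · exact (hf _ (Or.inr rfl)).symm
  · rintro ⟨k, rfl⟩
    rw [Subgroup.mem_centralizer_iff]
    exact fun g _ => (sigma_zpow_mul_comm g k).symm

end IsMarkerPair
end FixedPoints

/-! ### A periodic base point and its returns -/

section Base

variable {A : Type*}

/-- The first `n` symbols of `y` to the right of the origin occur in `x` at position `t`. -/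
def Reads (y : ℤ → A) (n : ℕ) (x : ℤ → A) (t : ℤ) : Prop :=
  ∀ k : ℤ, 0 ≤ k → k < n → x (t + k) = y k

theorem Reads.congr {y x x' : ℤ → A} {n : ℕ} {t : ℤ} (h : Reads y n x t)
    (hx : ∀ i, t ≤ i → i < t + n → x' i = x i) : Reads y n x' t := fun k h1 h2 => by
  rw [hx _ (by omega) (by omega), h k h1 h2]

theorem Reads.apply {y x : ℤ → A} {n : ℕ} {t : ℤ} (h : Reads y n x t) {i : ℤ} (h1 : t ≤ i)
    (h2 : i < t + n) : x i = y (i - t) := by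
  have := h (i - t) (by omega) (by omega)
  rwa [add_sub_cancel] at this

theorem reads_shift {y x : ℤ → A} {n : ℕ} {j t : ℤ} :
    Reads y n (shift j x) t ↔ Reads y n x (j + t) := by
  simp [Reads, add_assoc]

theorem Reads.glue_eq {y x x' : ℤ → A} {n : ℕ} {t i : ℤ} (h : Reads y n x t)
    (h' : Reads y n x' t) (hi : i < t + n) : glue t x x' i = x i := by
  rcases lt_or_ge i t with h1 | h1
  · exact glue_left h1
  · rw [glue_right h1, h.apply h1 hi, h'.apply h1 hi]

theorem Reads.glue_left {y x x' : ℤ → A} {n m : ℕ} {t s : ℤ} (h : Reads y n x t)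
    (h' : Reads y n x' t) (hs : s + m ≤ t + n) :
    Reads y m (glue t x x') s ↔ Reads y m x s :=
  ⟨fun h1 => h1.congr fun i _ hi => (h.glue_eq h' (by omega)).symm,
    fun h1 => h1.congr fun i _ hi => h.glue_eq h' (by omega)⟩

theorem reads_glue_right {y x x' : ℤ → A} {m : ℕ} {t s : ℤ} (hs : t ≤ s) :
    Reads y m (glue t x x') s ↔ Reads y m x' s :=
  ⟨fun h1 => h1.congr fun i hi _ => (glue_right (by omega)).symm,
    fun h1 => h1.congr fun i hi _ => glue_right (by omega)⟩

variable [TopologicalSpace A]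

/-- `y` is a point of least period `p`, and the points of `X` can be cut where the word formed by
the first `n` symbols of `y` occurs. -/
structure IsBase (X : Subshift A ℤ) (y : ℤ → A) (p n : ℕ) : Prop where
  mem : y ∈ X.carrier
  pos : 0 < p
  periodic : ∀ i, y (i + p) = y i
  least : ∀ d : ℕ, 0 < d → (∀ i, y (i + d) = y i) → p ≤ d
  two_mul_le : 2 * p ≤ n
  glue_mem : ∀ x ∈ X.carrier, ∀ x' ∈ X.carrier, ∀ t, Reads y n x t → Reads y n x' t →
    glue t x x' ∈ X.carrier

/-- Copies of `v T v` are glued at `v`; the periodic point is a limit of points with long powers of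
`v T`. -/
theorem exists_periodic {X : Subshift A ℤ} {v : List A} (hv : IsSynchronizingWord X v)
    {T : List A} (hT : v ++ T ++ v ∈ language X) (hne : v ++ T ≠ []) :
    ∃ y ∈ X.carrier, OccursAt y v 0 ∧ ∃ p : ℕ, 0 < p ∧ ∀ i, y (i + p) = y i := by
  set w := v ++ T with hw
  have hp : 0 < w.length := List.length_pos_iff.2 hne
  have key : ∀ n, ∃ x ∈ X.carrier, OccursAt x (wpow w n ++ v) 0 := by
    intro n
    induction n with
    | zero => simpa using exists_occursAt hv.1 0
    | succ n ih =>
      obtain ⟨x, hx, hx1⟩ := ih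
      obtain ⟨x', hx', hx2⟩ := exists_occursAt hT (n * w.length)
      rw [occursAt_append] at hx1
      have h2 : OccursAt x' (v ++ (T ++ v)) (n * w.length) := by
        rw [← List.append_assoc]; exact hx2
      have h3 := hx1.2
      rw [length_wpow] at h3
      push_cast at h3
      rw [zero_add] at h3
      have hg := SynchShift.glue_mem hv hx hx' h3 (occursAt_append.1 h2).1
      refine ⟨_, hg, ?_⟩
      rw [wpow_succ', List.append_assoc, occursAt_append]
      have hagr : ∀ m, m < (n : ℤ) * w.length + v.length →
          glue (n * w.length + v.length) x x' m = x m := fun m hm => glue_left hm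
      refine ⟨hx1.1.congr fun m _ hm => hagr m (by simp at hm; omega), ?_⟩
      rw [length_wpow]
      push_cast
      rw [zero_add]
      refine hx2.congr fun m h1 _ => ?_
      rcases lt_or_ge m (n * w.length + v.length) with h4 | h4
      · rw [hagr m h4]
        exact h3.agree (occursAt_append.1 h2).1 h1 (by omega)
      · exact glue_right h4
  set y : ℤ → A := fun i => w[(i % w.length).toNat]'(by
    have := Int.emod_lt_of_pos i (b := w.length) (by omega)
    have := Int.emod_nonneg i (b := w.length) (by omega)
    omega) with hy
  have hper : ∀ i t : ℤ, y (i + t * w.length) = y i := fun i t => by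
    simp [hy, Int.add_mul_emod_self_right]
  have hocc : ∀ t : ℤ, OccursAt y w (t * w.length) := by
    intro t k hk
    rw [add_comm, hper]
    simp only [hy]
    congr 1
    rw [Int.emod_eq_of_lt (by omega) (by omega)]
    simp
  refine ⟨y, ?_, ?_, w.length, hp, fun i => by simpa using hper i 1⟩
  · refine mem_carrier_of_approx fun N => ?_
    obtain ⟨x, hx, h1⟩ := key (N + N + 1)
    refine ⟨shift (N * w.length) x, shift_mem hx _, fun m hm => ?_⟩
    rw [abs_le] at hm
    have hN : (N : ℤ) ≤ N * w.length := by
      have : (N : ℤ) * 1 ≤ N * w.length := by gcongr; omega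
      omega
    have h2 : OccursAt (shift (-(N * w.length : ℤ)) y) (wpow w (N + N + 1)) 0 := by
      rw [occursAt_wpow_iff]
      intro t _
      rw [occursAt_shift]
      convert hocc (t - N) using 1
      ring
    have := (occursAt_append.1 h1).1.agree h2 (m := N * w.length + m) (by omega)
      (by rw [length_wpow]; push_cast [add_mul]; omega)
    simpa using this
  · exact (occursAt_append.1 (by simpa [hw] using hocc 0)).1

/-- A prefix of `2p + |v|` symbols shows the synchronizing word, which permits gluing, and two full
periods, which control overlaps. -/
theorem exists_isBase {X : Subshift A ℤ} (hX : IsSynchronizing X) :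
    ∃ y p n, IsBase X y p n := by
  classical
  obtain ⟨ht, v, hv⟩ := hX
  obtain ⟨x, hx, i, hi⟩ := hv.1
  have ha : [x 0] ∈ language X := ⟨x, hx, 0, fun k hk => by
    obtain rfl : k = 0 := by simpa using hk
    simp⟩
  obtain ⟨w1, -, h1⟩ := ht _ hv.1 _ ha
  obtain ⟨w2, -, h2⟩ := ht _ h1 _ hv.1
  obtain ⟨y, hy, hyv, hper⟩ := exists_periodic hv (T := w1 ++ [x 0] ++ w2)
    (by simpa using h2) (by simp)
  set p := Nat.find hper with hp
  obtain ⟨hp0, hpp⟩ := Nat.find_spec hper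
  refine ⟨y, p, 2 * p + v.length, hy, hp0, hpp, fun d h3 h4 => Nat.find_min' hper ⟨h3, h4⟩,
    by omega, fun x hx x' hx' t h3 h4 => ?_⟩
  have hrv : ∀ x, Reads y (2 * p + v.length) x t → OccursAt x v t := fun x h k hk => by
    rw [h k (by omega) (by push_cast; omega), ← hyv k hk, zero_add]
  have := SynchShift.glue_mem hv hx hx' (hrv x h3) (hrv x' h4)
  convert this using 1
  funext i
  rcases lt_or_ge i (t + v.length) with h5 | h5
  · rw [h3.glue_eq h4 (by push_cast; omega), SynchShift.glue_left h5]
  · rw [glue_right (by omega), glue_right h5]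

namespace IsBase

variable {X : Subshift A ℤ} {y : ℤ → A} {p n : ℕ}

theorem periodic_mul (h : IsBase X y p n) (i t : ℤ) : y (i + t * p) = y i := by
  induction t generalizing i with
  | zero => simp
  | succ t ih => rw [add_mul, ← add_assoc, one_mul, h.periodic, ih]
  | pred t ih =>
    rw [← h.periodic]
    convert ih i using 2
    ring

theorem periodic_emod (h : IsBase X y p n) (i : ℤ) : y (i % p) = y i := by
  conv_rhs => rw [← Int.emod_add_mul_ediv i p, mul_comm, h.periodic_mul]

/-- The base point is not equal to its translates by non-multiples of the period. -/
theorem dvd_of_agree (h : IsBase X y p n) {d : ℤ}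
    (hd : ∀ k : ℤ, 0 ≤ k → k < p → y (d + k) = y k) : (p : ℤ) ∣ d := by
  have hp := h.pos
  have e1 := Int.emod_nonneg d (b := p) (by omega)
  have e2 := Int.emod_lt_of_pos d (b := p) (by omega)
  obtain ⟨r, hr⟩ : ∃ r : ℕ, (r : ℤ) = d % p := ⟨(d % p).toNat, by omega⟩
  rcases Nat.eq_zero_or_pos r with h0 | h0
  · exact Int.dvd_of_emod_eq_zero (by omega)
  · have := h.least r h0 fun i => by
      have e3 := Int.emod_nonneg i (b := p) (by omega)
      have e4 := Int.emod_lt_of_pos i (b := p) (by omega)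
      rw [← h.periodic_emod i, ← hd _ e3 e4, hr, ← h.periodic_emod, ← h.periodic_emod (d + i % p)]
      congr 1
      simp [add_comm]
    omega

theorem reads_self (h : IsBase X y p n) (m : ℕ) (t : ℤ) : Reads y m y (t * p) := fun k _ _ => by
  rw [add_comm, h.periodic_mul]

theorem reads_add_iff (h : IsBase X y p n) {x : ℤ → A} {t : ℤ} :
    Reads y (n + p) x t ↔ Reads y n x t ∧ Reads y n x (t + p) := by
  have hp := h.pos
  have h2 := h.two_mul_le
  constructor
  · refine fun h1 => ⟨fun k h2 h3 => h1 k h2 (by push_cast; omega), fun k h2 h3 => ?_⟩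
    rw [add_assoc, h1 _ (by omega) (by push_cast; omega), add_comm, h.periodic]
  · rintro ⟨h1, h2⟩ k h3 h4
    push_cast at h4
    rcases lt_or_ge k n with h5 | h5
    · exact h1 k h3 h5
    · have := h2 (k - p) (by omega) (by omega)
      rw [show t + p + (k - p) = t + k by ring] at this
      rw [this, ← h.periodic]
      congr 1; ring

/-- Closer occurrences would agree on a full period and contradict the minimality of `p`. -/
theorem reads_sep (h : IsBase X y p n) {x : ℤ → A} {s t : ℤ} (hs : Reads y n x s)
    (ht : Reads y n x t) (hst : s < t) : s + p ≤ t := by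
  have h2 := h.two_mul_le
  by_contra! hlt
  have := h.dvd_of_agree (d := t - s) fun k h3 h4 => by
    rw [← ht k h3 (by omega), ← hs _ (by omega) (by omega)]
    congr 1; ring
  have := Int.le_of_dvd (by omega) this
  omega

/-- `m` is a distance between two occurrences of the word which is formed by the first `n` symbols
of `y`. -/
def IsReturn (X : Subshift A ℤ) (y : ℤ → A) (n m : ℕ) : Prop :=
  ∃ x ∈ X.carrier, Reads y n x 0 ∧ Reads y n x m

theorem glue_shift_mem (h : IsBase X y p n) {x x' : ℤ → A} (hx : x ∈ X.carrier)
    (hx' : x' ∈ X.carrier) {t s : ℤ} (h1 : Reads y n x t) (h2 : Reads y n x' s) :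
    glue t x (shift (s - t) x') ∈ X.carrier ∧ Reads y n (shift (s - t) x') t := by
  have : Reads y n (shift (s - t) x') t := by rw [reads_shift]; simpa using h2
  exact ⟨h.glue_mem _ hx _ (shift_mem hx' _) _ h1 this, this⟩

theorem isReturn_add (h : IsBase X y p n) {a b : ℕ} (ha : IsReturn X y n a)
    (hb : IsReturn X y n b) : IsReturn X y n (a + b) := by
  obtain ⟨x, hx, h1, h2⟩ := ha
  obtain ⟨x', hx', h3, h4⟩ := hb
  obtain ⟨h5, h6⟩ := h.glue_shift_mem hx hx' h2 h3
  refine ⟨_, h5, (h2.glue_left h6 (by omega)).2 h1, (reads_glue_right (by push_cast; omega)).2 ?_⟩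
  rw [reads_shift]
  push_cast
  convert h4 using 1
  ring

theorem isReturn_mul (h : IsBase X y p n) {a : ℕ} (ha : IsReturn X y n a) (k : ℕ) :
    IsReturn X y n (k * a) := by
  induction k with
  | zero =>
    obtain ⟨x, hx, h1, -⟩ := ha
    exact ⟨x, hx, h1, by simpa using h1⟩
  | succ k ih => rw [add_one_mul]; exact h.isReturn_add ih ha

theorem isReturn_period (h : IsBase X y p n) : IsReturn X y n p :=
  ⟨y, h.mem, by simpa using h.reads_self n 0, by simpa using h.reads_self n 1⟩

/-- Returns are closed under addition. So the least positive number congruent to a return modulo `p`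
divides all returns: remainders are again congruent to returns. -/
theorem exists_gcd_return (h : IsBase X y p n) : ∃ g : ℕ, g ∣ p ∧
    (∀ m, IsReturn X y n m → g ∣ m) ∧ ∃ m, IsReturn X y n m ∧ m ≡ g [MOD p] := by
  classical
  have hex : ∃ g : ℕ, 0 < g ∧ ∃ m, IsReturn X y n m ∧ m ≡ g [MOD p] :=
    ⟨p, h.pos, p, h.isReturn_period, rfl⟩
  obtain ⟨hg, m₀, hm₀, hmg⟩ := Nat.find_spec hex
  have hmin := fun k => Nat.find_min' hex (m := k)
  set g := Nat.find hex
  have key : ∀ m, IsReturn X y n m → g ∣ m := by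
    intro m hm
    by_contra hndvd
    have hr : 0 < m % g := Nat.pos_of_ne_zero fun e => hndvd (Nat.dvd_of_mod_eq_zero e)
    -- The factor `p - 1` serves as `-1` modulo `p`, so this return is congruent to `m - (m / g) g`.
    have := hmin (m % g) ⟨hr, m + (m / g * (p - 1)) * m₀,
      h.isReturn_add hm (h.isReturn_mul hm₀ _), ?_⟩
    · have := Nat.mod_lt m hg
      omega
    · refine ((hmg.mul_left _).add_left m).trans ?_
      have e : m + m / g * (p - 1) * g = m % g + p * (m / g * g) := by
        obtain ⟨p', hp'⟩ : ∃ p', p = p' + 1 := ⟨p - 1, by have := h.pos; omega⟩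
        have := Nat.mod_add_div m g
        rw [hp', Nat.add_sub_cancel]
        linarith
      rw [e]
      exact Nat.ModEq.symm (by simp [Nat.ModEq])
  exact ⟨g, key p h.isReturn_period, key, m₀, hm₀, hmg⟩

/-- A return which is not part of the base point. -/
def IsProperReturn (X : Subshift A ℤ) (y : ℤ → A) (p n m : ℕ) : Prop :=
  ∃ x ∈ X.carrier, Reads y n x 0 ∧ Reads y n x m ∧ ¬ Reads y (m + p) x 0

/-- Transitivity embeds every word between two copies of the prefix. If all returns belonged to `y`,
every point would have period `p`, and `X` would be finite. -/
theorem exists_isProperReturn [Finite A] (h : IsBase X y p n) (ht : IsTransitive X)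
    (hinf : X.carrier.Infinite) : ∃ m, IsProperReturn X y p n m := by
  by_contra! hno
  have hp := h.pos
  have hV : factor y 0 n ∈ language X := ⟨y, h.mem, 0, occursAt_factor _ _ _⟩
  have hper : ∀ x ∈ X.carrier, ∀ i, x (i + p) = x i := by
    intro x hx i
    obtain ⟨a, -, ha⟩ := ht _ hV _ ⟨x, hx, i, occursAt_factor x i (p + 1)⟩
    obtain ⟨b, -, hb⟩ := ht _ ha _ hV
    obtain ⟨x', hx', h1⟩ := exists_occursAt hb 0
    rw [occursAt_append, occursAt_append, occursAt_append, occursAt_append] at h1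
    obtain ⟨⟨⟨⟨h1, -⟩, h2⟩, -⟩, h3⟩ := h1
    simp only [zero_add, List.length_append, length_factor] at h2 h3
    rw [occursAt_factor_iff] at h1 h2 h3
    have r1 : Reads y n x' 0 := fun k h4 h5 => by
      have := h1 k.toNat (by omega)
      rw [Int.toNat_of_nonneg h4] at this
      simpa using this
    have r2 : Reads y n x' (n + a.length + (p + 1) + b.length : ℕ) := fun k h4 h5 => by
      have := h3 k.toNat (by omega)
      rwa [Int.toNat_of_nonneg h4, zero_add k] at this
    have r3 : Reads y (n + a.length + (p + 1) + b.length + p) x' 0 := by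
      by_contra hn
      exact hno _ ⟨x', hx', r1, r2, hn⟩
    have e1 := h2 p (by omega)
    have e2 := h2 0 (by omega)
    have e3 := r3 ((n + a.length : ℕ) + (p : ℤ)) (by omega) (by push_cast; omega)
    have e4 := r3 (n + a.length : ℕ) (by omega) (by push_cast; omega)
    rw [h.periodic] at e3
    simp only [Nat.cast_zero, add_zero, zero_add] at e1 e2 e3 e4
    rw [← e1, ← e2, e3, e4]
  refine hinf ?_
  refine Set.Finite.of_injOn (f := fun (x : ℤ → A) (k : Fin p) => x (k : ℕ)) (t := Set.univ)
    (fun _ _ => Set.mem_univ _) ?_ Set.finite_univ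
  intro x hx x' hx' e
  have hmod : ∀ x ∈ X.carrier, ∀ i : ℤ, x i = x (i % p) := by
    intro x hx i
    have hm : ∀ (t : ℤ) i, x (i + t * p) = x i := by
      intro t
      induction t with
      | zero => simp
      | succ t ih => intro i; rw [add_mul, ← add_assoc, one_mul, hper x hx, ih]
      | pred t ih =>
        intro i
        rw [← hper x hx]
        convert ih i using 2
        ring
    conv_lhs => rw [← Int.emod_add_mul_ediv i p, mul_comm, hm]
  funext i
  have e1 := Int.emod_nonneg i (b := p) (by omega)
  have e2 := Int.emod_lt_of_pos i (b := p) (by omega)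
  rw [hmod x hx, hmod x' hx']
  have := congrFun e ⟨(i % p).toNat, by omega⟩
  simpa [Int.toNat_of_nonneg e1] using this

theorem isProperReturn_add (h : IsBase X y p n) {a b : ℕ} (ha : IsProperReturn X y p n a)
    (hb : IsReturn X y n b) : IsProperReturn X y p n (a + b) := by
  obtain ⟨x, hx, h1, h2, h0⟩ := ha
  obtain ⟨x', hx', h3, h4⟩ := hb
  obtain ⟨h5, h6⟩ := h.glue_shift_mem hx hx' h2 h3
  have := h.two_mul_le
  refine ⟨_, h5, (h2.glue_left h6 (by omega)).2 h1, (reads_glue_right (by push_cast; omega)).2 ?_,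
    fun h7 => h0 ?_⟩
  · rw [reads_shift]
    push_cast
    convert h4 using 1
    ring
  · rw [← h2.glue_left h6 (by push_cast; omega)]
    exact fun k h8 h9 => h7 k h8 (by push_cast at h9 ⊢; omega)

/-- Two adjacent copies of the word can be merged in a proper return. -/
theorem isProperReturn_sub (h : IsBase X y p n) {m : ℕ} {x : ℤ → A} (hx : x ∈ X.carrier)
    (h1 : Reads y n x 0) (h2 : Reads y n x m) (h0 : ¬ Reads y (m + p) x 0) {t : ℤ} (ht : 0 ≤ t)
    (htm : t + p ≤ m) (h3 : Reads y n x t) (h4 : Reads y n x (t + p)) :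
    IsProperReturn X y p n (m - p) := by
  have hp2 := h.two_mul_le
  obtain ⟨h5, h6⟩ := h.glue_shift_mem hx hx h3 h4
  rw [add_sub_cancel_left] at h5 h6
  refine ⟨_, h5, (h3.glue_left h6 (by omega)).2 h1, (reads_glue_right (by omega)).2 ?_,
    fun h7 => h0 ?_⟩
  · rw [reads_shift, Nat.cast_sub (by omega)]
    simpa using h2
  · rw [Nat.sub_add_cancel (by omega)] at h7
    have hdvd : (p : ℤ) ∣ t := h.dvd_of_agree fun k h8 h9 => by
      have := h7 (t + k) (by omega) (by omega)
      rw [zero_add, h3.glue_eq h6 (by omega), h3 k h8 (by omega)] at this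
      exact this.symm
    obtain ⟨c, rfl⟩ := hdvd
    have hy : ∀ k, y (k - p * c) = y k := fun k => by
      rw [← h.periodic_mul _ c]; congr 1; ring
    intro k h8 h9
    push_cast at h9
    rw [zero_add]
    rcases lt_or_ge k (p * c + p) with h10 | h10
    · rcases lt_or_ge k (p * c) with h11 | h11
      · have := h7 k h8 (by omega)
        rwa [zero_add, SynchShift.glue_left h11] at this
      · rw [h3.apply h11 (by omega), hy]
    · have := h7 (k - p) (by omega) (by omega)
      rw [zero_add, glue_right (by omega)] at this
      simp only [shift_apply, add_sub_cancel] at this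
      rw [this, ← h.periodic, sub_add_cancel]

/-- `q` is the least proper return in the residue class of `g` modulo `p`. If the prefix occurred
twice at distance `p` inside, one period could be cut out, giving a smaller one. -/
theorem exists_minimal_return [Finite A] (h : IsBase X y p n) (ht : IsTransitive X)
    (hinf : X.carrier.Infinite) : ∃ q : ℕ, 2 ≤ q ∧ q ≡ p.gcd q [MOD p] ∧
      (∀ m, IsReturn X y n m → p.gcd q ∣ m) ∧
      ∃ x ∈ X.carrier, Reads y n x 0 ∧ Reads y n x q ∧
        ∀ t : ℤ, 0 ≤ t → t + p ≤ q → ¬ Reads y (n + p) x t := by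
  classical
  have hp := h.pos
  obtain ⟨g, hgp, hg, m, hm, hmg⟩ := h.exists_gcd_return
  have hex : ∃ q : ℕ, q ≡ g [MOD p] ∧ IsProperReturn X y p n q := by
    obtain ⟨m₁, h1⟩ := h.exists_isProperReturn ht hinf
    have h2 : IsReturn X y n m₁ := by
      obtain ⟨x, hx, h3, h4, -⟩ := h1
      exact ⟨x, hx, h3, h4⟩
    -- The proper return `m₁` is taken `p` times, so that it does not change the residue of `m`.
    refine ⟨_, ?_, h.isProperReturn_add (h.isProperReturn_add h1 (h.isReturn_mul h2 (p - 1))) hm⟩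
    have e : m₁ + (p - 1) * m₁ + m = m + p * m₁ := by
      obtain ⟨p', rfl⟩ : ∃ p', p = p' + 1 := ⟨p - 1, by omega⟩
      simp only [Nat.add_sub_cancel]
      ring
    rw [e]
    exact Nat.ModEq.trans (by simp [Nat.ModEq]) hmg
  obtain ⟨hqg, x, hx, h1, h2, h0⟩ := Nat.find_spec hex
  have hmin := fun k => Nat.find_min' hex (m := k)
  set q := Nat.find hex
  have hgcd : p.gcd q = g := by
    rw [Nat.gcd_comm, hqg.gcd_eq, Nat.gcd_eq_left hgp]
  have hnot : ∀ t : ℤ, 0 ≤ t → t + p ≤ q → ¬ Reads y (n + p) x t := by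
    intro t ht0 htq hr
    obtain ⟨h3, h4⟩ := h.reads_add_iff.1 hr
    have := hmin (q - p) ⟨?_, h.isProperReturn_sub hx h1 h2 h0 ht0 htq h3 h4⟩
    · omega
    · refine Nat.ModEq.trans ?_ hqg
      conv_rhs => rw [← Nat.sub_add_cancel (show p ≤ q by omega)]
      simp [Nat.ModEq]
  refine ⟨q, ?_, hgcd ▸ hqg, hgcd ▸ hg, x, hx, h1, h2, hnot⟩
  have hp2 := h.two_mul_le
  rcases Nat.eq_zero_or_pos q with hq | hq
  · exact absurd (fun k h3 h4 => h1 k h3 (by rw [hq] at h4; push_cast at h4; omega)) h0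
  have := h.reads_sep h1 h2 (by omega)
  -- Only `p = q = 1` is left, and then the two ends are prefixes at distance `p`.
  by_contra! hlt
  refine hnot 0 le_rfl (by omega) (h.reads_add_iff.2 ⟨h1, ?_⟩)
  convert h2 using 1
  omega

end IsBase
end Base

theorem map_wpow {A B : Type*} (β : A → B) (w : List A) (n : ℕ) :
    (wpow w n).map β = wpow (w.map β) n := by
  simp [wpow, List.map_flatten]

theorem isMorphism_of_locality {A B : Type*} [TopologicalSpace A] [TopologicalSpace B] [Nonempty B]
    {X : Subshift A ℤ} {Y : Subshift B ℤ} {F : X.carrier → Y.carrier} (r : ℕ)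
    (h : ∀ (x y : X.carrier) (i j : ℤ),
      (∀ k : ℤ, |k| ≤ r → x.1 (i + k) = y.1 (j + k)) → (F x).1 i = (F y).1 j) :
    IsMorphism X Y F := by
  classical
  refine ⟨-r, r, by omega, fun w => if hw : ∃ (x : X.carrier) (i : ℤ),
    w = fun k : Fin ((r : ℤ) - -(r : ℤ) + 1).toNat => x.1 (i + -r + ((k : ℕ) : ℤ)) then
      (F hw.choose).1 hw.choose_spec.choose
    else Classical.arbitrary B, fun x i => ?_⟩
  have hw : ∃ (y : X.carrier) (j : ℤ), (fun k : Fin ((r : ℤ) - -r + 1).toNat =>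
      x.1 (i + -r + ((k : ℕ) : ℤ))) =
      fun k : Fin ((r : ℤ) - -(r : ℤ) + 1).toNat => y.1 (j + -r + ((k : ℕ) : ℤ)) := ⟨x, i, rfl⟩
  beta_reduce
  rw [dif_pos hw]
  apply h
  intro k hk
  rw [abs_le] at hk
  have := congrFun hw.choose_spec.choose_spec ⟨(k + r).toNat, by omega⟩
  simp only [Int.toNat_of_nonneg (show 0 ≤ k + r by omega)] at this
  convert this using 2 <;> ring

/-! ### Marking the occurrences of the base word -/

section Code

variable {A B : Type*}

/-- The symbols `α 0, …, α (p - 1)` and `β a` are distinct. -/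
structure IsCoding (p : ℕ) (α : ℕ → B) (β : A → B) : Prop where
  mark_inj : ∀ k < p, ∀ l < p, α k = α l → k = l
  plain_inj : Function.Injective β
  mark_ne_plain : ∀ k < p, ∀ a, α k ≠ β a

open Classical in
/-- The configuration in which the first `p` symbols of every occurrence of the word formed by the
first `n` symbols of `y` are replaced by `α 0, …, α (p - 1)` and the other symbols are renamed
by `β`. -/
noncomputable def code (y : ℤ → A) (p n : ℕ) (α : ℕ → B) (β : A → B) (x : ℤ → A) : ℤ → B :=
  fun i => if h : ∃ k, k < p ∧ Reads y n x (i - (k : ℕ)) then α h.choose else β (x i)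

theorem code_plain {y : ℤ → A} {p n : ℕ} {α : ℕ → B} {β : A → B} {x : ℤ → A} {i : ℤ}
    (h : ∀ k < p, ¬ Reads y n x (i - (k : ℕ))) : code y p n α β x i = β (x i) :=
  dif_neg fun ⟨k, h1, h2⟩ => h k h1 h2

namespace IsBase

variable [TopologicalSpace A] {X : Subshift A ℤ} {y : ℤ → A} {p n : ℕ} {α : ℕ → B} {β : A → B}

/-- The coding will mark the prefix of length `n + p`: the minimal return has the shorter prefix at
its ends but avoids the longer one. -/
theorem add_period (h : IsBase X y p n) : IsBase X y p (n + p) where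
  mem := h.mem
  pos := h.pos
  periodic := h.periodic
  least := h.least
  two_mul_le := by have := h.two_mul_le; omega
  glue_mem x hx x' hx' t h1 h2 :=
    h.glue_mem x hx x' hx' t (h.reads_add_iff.1 h1).1 (h.reads_add_iff.1 h2).1

theorem code_mark (h : IsBase X y p n) {x : ℤ → A} {t : ℤ} (ht : Reads y n x t) {k : ℕ}
    (hk : k < p) : code y p n α β x (t + k) = α k := by
  have hex : ∃ l, l < p ∧ Reads y n x (t + k - (l : ℕ)) := ⟨k, hk, by simpa using ht⟩
  refine (dif_pos hex).trans ?_
  obtain ⟨h1, h2⟩ := hex.choose_spec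
  congr 1
  rcases lt_trichotomy t (t + k - (hex.choose : ℕ)) with h3 | h3 | h3
  · have := h.reads_sep ht h2 h3
    omega
  · omega
  · have := h.reads_sep h2 ht h3
    omega

theorem code_eq_mark_iff (h : IsBase X y p n) (hc : IsCoding p α β) {x : ℤ → A} {i : ℤ} {k : ℕ}
    (hk : k < p) : code y p n α β x i = α k ↔ Reads y n x (i - k) := by
  constructor
  · intro e
    by_cases hex : ∃ l, l < p ∧ Reads y n x (i - (l : ℕ))
    · obtain ⟨l, hl, h1⟩ := hex
      have := h.code_mark (α := α) (β := β) h1 hl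
      rw [sub_add_cancel, e] at this
      rwa [hc.mark_inj k hk l hl this]
    · push Not at hex
      rw [code_plain hex] at e
      exact absurd e.symm (hc.mark_ne_plain k hk _)
  · intro h1
    simpa using h.code_mark (α := α) (β := β) h1 hk

theorem code_congr (h : IsBase X y p n) {x x' : ℤ → A} {i j : ℤ} (hx : x i = x' j)
    (hr : ∀ k < p, Reads y n x (i - (k : ℕ)) ↔ Reads y n x' (j - (k : ℕ))) :
    code y p n α β x i = code y p n α β x' j := by
  by_cases hex : ∃ l, l < p ∧ Reads y n x (i - (l : ℕ))
  · obtain ⟨l, hl, h1⟩ := hex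
    have e1 := h.code_mark (α := α) (β := β) h1 hl
    have e2 := h.code_mark (α := α) (β := β) ((hr l hl).1 h1) hl
    rw [sub_add_cancel] at e1 e2
    rw [e1, e2]
  · push Not at hex
    rw [code_plain hex, code_plain fun k hk => (hr k hk).not.1 (hex k hk), hx]

theorem code_locality (h : IsBase X y p n) {x x' : ℤ → A} {i j : ℤ}
    (hx : ∀ k : ℤ, |k| ≤ (n + p : ℕ) → x (i + k) = x' (j + k)) :
    code y p n α β x i = code y p n α β x' j := by
  have hagr : ∀ k : ℤ, -(n + p : ℤ) ≤ k → k ≤ n + p → x (i + k) = x' (j + k) := fun k h1 h2 =>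
    hx k (abs_le.2 ⟨by push_cast; omega, by push_cast; omega⟩)
  refine h.code_congr (by simpa using hagr 0 (by omega) (by omega)) fun k hk => ?_
  refine forall_congr' fun m => forall_congr' fun h1 => forall_congr' fun h2 => ?_
  rw [show i - (k : ℕ) + m = i + (m - (k : ℕ)) by ring,
    show j - (k : ℕ) + m = j + (m - (k : ℕ)) by ring, hagr _ (by omega) (by omega)]

/-- A mark tells which symbol of `y` it stands for, so the coding is undone symbol by symbol. -/
theorem eq_of_code_eq (h : IsBase X y p n) (hc : IsCoding p α β) {x x' : ℤ → A} {i j : ℤ}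
    (e : code y p n α β x i = code y p n α β x' j) : x i = x' j := by
  have hp2 := h.two_mul_le
  by_cases hex : ∃ l, l < p ∧ Reads y n x (i - (l : ℕ))
  · obtain ⟨l, hl, h1⟩ := hex
    have e1 := h.code_mark (α := α) (β := β) h1 hl
    rw [sub_add_cancel, e, h.code_eq_mark_iff hc hl] at e1
    have e2 := h1 l (by omega) (by omega)
    have e3 := e1 l (by omega) (by omega)
    rw [sub_add_cancel] at e2 e3
    rw [e2, e3]
  · push Not at hex
    rw [code_plain hex] at e
    by_cases hex' : ∃ l, l < p ∧ Reads y n x' (j - (l : ℕ))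
    · obtain ⟨l, hl, h1⟩ := hex'
      rw [(h.code_eq_mark_iff hc hl).2 h1] at e
      exact absurd e.symm (hc.mark_ne_plain l hl _)
    · push Not at hex'
      rw [code_plain hex'] at e
      exact hc.plain_inj e

/-- The marker word of the coding. -/
def markWord (p : ℕ) (α : ℕ → B) : List B := (List.range p).map α

theorem occursAt_markWord_iff (h : IsBase X y p n) (hc : IsCoding p α β) {x : ℤ → A} {i : ℤ} :
    OccursAt (code y p n α β x) (markWord p α) i ↔ Reads y n x i := by
  constructor
  · intro h1
    have := h1 0 (by simpa [markWord] using h.pos)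
    simp only [markWord, List.getElem_map, List.getElem_range] at this
    rw [h.code_eq_mark_iff hc h.pos] at this
    simpa using this
  · intro h1 k hk
    simp only [markWord, List.length_map, List.length_range] at hk
    simp only [markWord, List.getElem_map, List.getElem_range]
    exact h.code_mark h1 hk

theorem code_shift (h : IsBase X y p n) (x : ℤ → A) (j : ℤ) :
    code y p n α β (shift j x) = shift j (code y p n α β x) := by
  funext i
  exact h.code_locality fun k _ => by simp [add_assoc]

theorem continuous_code (h : IsBase X y p n) [DiscreteTopology A] [TopologicalSpace B] :
    Continuous (code y p n α β) := by
  refine continuous_pi fun i => continuous_iff_continuousAt.2 fun x => ?_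
  refine Filter.Tendsto.congr' (f₁ := fun _ => code y p n α β x i) ?_ tendsto_const_nhds
  have : ∀ᶠ x' in nhds x, ∀ m ∈ Finset.Icc (i - (n + p : ℕ)) (i + (n + p : ℕ)), x' m = x m := by
    refine (Filter.eventually_all_finset _).2 fun m _ => ?_
    exact (continuous_apply m).continuousAt.eventually
      ((isOpen_discrete {x m}).eventually_mem (Set.mem_singleton _))
  filter_upwards [this] with x' hx'
  refine h.code_locality fun k hk => (hx' _ ?_).symm
  rw [abs_le] at hk
  rw [Finset.mem_Icc]
  omega

/-- The image of `X` under the coding. -/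
noncomputable def codeShift [DiscreteTopology A] [Finite A] [TopologicalSpace B]
    [DiscreteTopology B] (h : IsBase X y p n) (α : ℕ → B) (β : A → B) : Subshift B ℤ where
  carrier := code y p n α β '' X.carrier
  isClosed := (X.isClosed.isCompact.image h.continuous_code).isClosed
  mapsTo g := by
    rintro _ ⟨x, hx, rfl⟩
    exact ⟨shift g x, shift_mem hx g, h.code_shift x g⟩

variable [DiscreteTopology A] [Finite A] [TopologicalSpace B] [DiscreteTopology B]

/-- The coding is a bijection. -/
noncomputable def codeEquiv (h : IsBase X y p n) (hc : IsCoding p α β) :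
    X.carrier ≃ (h.codeShift α β).carrier :=
  Equiv.ofBijective (fun x => ⟨code y p n α β x.1, x.1, x.2, rfl⟩) ⟨fun x x' e =>
    Subtype.ext <| funext fun i => h.eq_of_code_eq hc (congrFun (congrArg Subtype.val e) i), by
    rintro ⟨_, x, hx, rfl⟩
    exact ⟨⟨x, hx⟩, rfl⟩⟩

theorem isMorphism_codeEquiv (h : IsBase X y p n) (hc : IsCoding p α β) :
    IsMorphism X (h.codeShift α β) (h.codeEquiv hc) := by
  have : Nonempty B := ⟨α 0⟩
  exact isMorphism_of_locality (n + p) fun x x' i j hx => h.code_locality hx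

theorem isMorphism_codeEquiv_symm (h : IsBase X y p n) (hc : IsCoding p α β) :
    IsMorphism (h.codeShift α β) X (h.codeEquiv hc).symm := by
  have : Nonempty A := ⟨y 0⟩
  refine isMorphism_of_locality 0 fun b b' i j hb => ?_
  obtain ⟨x, rfl⟩ := (h.codeEquiv hc).surjective b
  obtain ⟨x', rfl⟩ := (h.codeEquiv hc).surjective b'
  rw [Equiv.symm_apply_apply, Equiv.symm_apply_apply]
  have := hb 0 (by simp)
  rw [add_zero, add_zero] at this
  exact h.eq_of_code_eq hc this

theorem exists_of_mem_language (h : IsBase X y p n) {w : List B}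
    (hw : w ∈ language (h.codeShift α β)) (i : ℤ) :
    ∃ x ∈ X.carrier, OccursAt (code y p n α β x) w i := by
  obtain ⟨_, ⟨x, hx, rfl⟩, h1⟩ := exists_occursAt hw i
  exact ⟨x, hx, h1⟩

theorem mem_language_code (h : IsBase X y p n) {w : List B} {x : ℤ → A} (hx : x ∈ X.carrier)
    {i : ℤ} (hw : OccursAt (code y p n α β x) w i) : w ∈ language (h.codeShift α β) :=
  ⟨_, ⟨x, hx, rfl⟩, i, hw⟩

end IsBase
end Code

/-! ### Coding of glued points and powers of a return -/

section CodeGlue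

variable {A B : Type*} [TopologicalSpace A] {X : Subshift A ℤ} {y : ℤ → A} {p n : ℕ} {α : ℕ → B}
  {β : A → B}

namespace IsBase

theorem code_glue_left (h : IsBase X y p n) {x x' : ℤ → A} {t i : ℤ} (hx : Reads y n x t)
    (hx' : Reads y n x' t) (hi : i < t + p) :
    code y p n α β (glue t x x') i = code y p n α β x i := by
  have hp2 := h.two_mul_le
  rcases lt_or_ge i t with h1 | h1
  · exact h.code_congr (glue_left h1) fun k _ => hx.glue_left hx' (by omega)
  · obtain ⟨k, rfl⟩ : ∃ k : ℕ, i = t + k := ⟨(i - t).toNat, by omega⟩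
    rw [h.code_mark hx (by omega),
      h.code_mark ((hx.glue_left hx' le_rfl).2 hx) (by omega)]

theorem code_glue_right (h : IsBase X y p n) {x x' : ℤ → A} {t i : ℤ} (hx : Reads y n x t)
    (hx' : Reads y n x' t) (hi : t ≤ i) :
    code y p n α β (glue t x x') i = code y p n α β x' i := by
  rcases lt_or_ge i (t + p) with h1 | h1
  · obtain ⟨k, rfl⟩ : ∃ k : ℕ, i = t + k := ⟨(i - t).toNat, by omega⟩
    rw [h.code_mark hx' (by omega),
      h.code_mark ((hx.glue_left hx' le_rfl).2 hx) (by omega)]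
  · exact h.code_congr (glue_right hi) fun k _ => reads_glue_right (by omega)

/-- A point which contains a power of a minimal return and no occurrences in between. -/
theorem exists_power (h : IsBase X y p n) {x₀ : ℤ → A} {q : ℕ} (hx₀ : x₀ ∈ X.carrier)
    (h0 : Reads y n x₀ 0) (hq : Reads y n x₀ q)
    (hno : ∀ t : ℤ, 0 ≤ t → t + p ≤ q → ¬ Reads y (n + p) x₀ t) (N : ℕ) :
    ∃ x ∈ X.carrier, Reads y (n + p) x (-p) ∧ Reads y n x (N * q) ∧
      OccursAt x (wpow (factor x₀ 0 q) N) 0 ∧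
      ∀ t : ℤ, -p < t → t + p ≤ N * q → ¬ Reads y (n + p) x t := by
  induction N with
  | zero =>
    refine ⟨y, h.mem, by simpa using h.reads_self (n + p) (-1), by simpa using h.reads_self n 0,
      occursAt_nil _ _, fun t h1 h2 => ?_⟩
    simp at h2
    omega
  | succ N ih =>
    obtain ⟨x, hx, h1, h2, h3, h4⟩ := ih
    obtain ⟨h5, h6⟩ := h.glue_shift_mem hx hx₀ h2 h0
    have hNq : 0 ≤ (N : ℤ) * q := by positivity
    refine ⟨_, h5, (h2.glue_left h6 (by push_cast; omega)).2 h1,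
      (reads_glue_right (by push_cast; linarith)).2 ?_, ?_, fun t h7 h8 h9 => ?_⟩
    · rw [reads_shift]
      convert hq using 1
      push_cast; ring
    · rw [wpow_succ', occursAt_append, length_wpow, length_factor]
      refine ⟨h3.congr fun m _ hm => glue_left ?_, occursAt_factor_iff.2 fun k hk => ?_⟩
      · simpa using hm
      · push_cast
        rw [zero_add, glue_right (by omega), shift_apply]
        congr 1; ring
    · push_cast [add_mul] at h8
      rcases le_or_gt (t + p) (N * q) with h10 | h10
      · exact h4 t h7 h10 ((h2.glue_left h6 (by push_cast; omega)).1 h9)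
      -- An occurrence that starts less than `p` before the seam would be too close to the prefix at
      -- the seam.
      rcases lt_or_ge t (N * q) with h11 | h11
      · have := h.reads_sep (h.reads_add_iff.1 h9).1 ((reads_glue_right le_rfl).2 h6) h11
        omega
      · rw [reads_glue_right h11, reads_shift] at h9
        exact hno _ (by omega) (by omega) h9

end IsBase
end CodeGlue

/-! ### The marker pair of the coded subshift -/

section CodeMarker

variable {A B : Type*} [TopologicalSpace A] [DiscreteTopology A] [Finite A] [TopologicalSpace B]
  [DiscreteTopology B] {X : Subshift A ℤ} {y : ℤ → A} {p n : ℕ} {α : ℕ → B} {β : A → B}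

namespace IsBase

/-- The marks appear exactly where the base word is read; there points can be glued, and the code of
the glued point is determined on each side separately. -/
theorem isSynchronizingWord_markWord (h : IsBase X y p n) (hc : IsCoding p α β) :
    IsSynchronizingWord (h.codeShift α β) (markWord p α) := by
  refine ⟨h.mem_language_code h.mem ((h.occursAt_markWord_iff hc).2 (h.reads_self n 0)),
    fun u _ v _ hu hv => ?_⟩
  obtain ⟨x, hx, h1⟩ := h.exists_of_mem_language hu (-u.length)
  obtain ⟨x', hx', h2⟩ := h.exists_of_mem_language hv 0
  rw [occursAt_append, neg_add_cancel, h.occursAt_markWord_iff hc] at h1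
  rw [occursAt_append, h.occursAt_markWord_iff hc] at h2
  have hl : (markWord p α).length = p := by simp [markWord]
  refine h.mem_language_code (h.glue_mem _ hx _ hx' _ h1.2 h2.1) (i := -u.length) ?_
  rw [occursAt_append, occursAt_append, neg_add_cancel, h.occursAt_markWord_iff hc]
  refine ⟨⟨h1.1.congr fun m _ hm => ?_, (h1.2.glue_left h2.1 le_rfl).2 h1.2⟩, ?_⟩
  · exact h.code_glue_left h1.2 h2.1 (by omega)
  · rw [List.length_append, Nat.cast_add, neg_add_cancel_left]
    rw [zero_add] at h2
    refine h2.2.congr fun m hm _ => ?_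
    exact h.code_glue_right h1.2 h2.1 (by omega)

/-- A mark reveals an occurrence of the base word at a known position, which forces the adjacent
marks. -/
theorem isDeterministicWord_markWord (h : IsBase X y p n) (hc : IsCoding p α β) :
    IsDeterministicWord (h.codeShift α β) (markWord p α) := by
  have hl : (markWord p α).length = p := by simp [markWord]
  have hget : ∀ (i : ℕ) (hi : i < (markWord p α).length), (markWord p α)[i] = α i := fun i hi => by
    simp [markWord]
  have hpair : ∀ {a b : B}, [a, b] ∈ language (h.codeShift α β) → ∃ x ∈ X.carrier,
      code y p n α β x 0 = a ∧ code y p n α β x 1 = b := by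
    intro a b hab
    obtain ⟨x, hx, h1⟩ := h.exists_of_mem_language hab 0
    exact ⟨x, hx, by simpa using h1 0 (by simp), by simpa using h1 1 (by simp)⟩
  have hmem : ∀ i, i + 1 < p → [α i, α (i + 1)] ∈ language (h.codeShift α β) := by
    intro i hi
    refine h.mem_language_code h.mem (i := i) ?_
    have h0 : Reads y n y 0 := by simpa using h.reads_self n 0
    intro k hk
    have hk' : k < 2 := by simpa using hk
    have := h.code_mark (α := α) (β := β) h0 (k := i + k) (by omega)
    push_cast at this
    rw [zero_add] at this
    rw [this]
    interval_cases k <;> rfl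
  constructor
  · intro i hi
    rw [hl] at hi
    rw [hget]
    refine ⟨_, hmem i hi, fun a ha => ?_⟩
    obtain ⟨x, hx, h1, rfl⟩ := hpair ha
    rw [h.code_eq_mark_iff hc (by omega)] at h1
    have := h.code_mark (α := α) (β := β) h1 hi
    rw [← this]
    congr 1
    push_cast; ring
  · intro i hi
    rw [hl] at hi
    rw [hget]
    refine ⟨_, hmem i hi, fun a ha => ?_⟩
    obtain ⟨x, hx, rfl, h1⟩ := hpair ha
    rw [h.code_eq_mark_iff hc (by omega)] at h1
    have := h.code_mark (α := α) (β := β) h1 (k := i) (by omega)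
    rw [← this]
    congr 1
    push_cast; ring

/-- A power of the minimal return is bordered by pieces of `y` on both sides. No long prefix is read
inside, so the symbols there are only renamed. -/
theorem markWord_pow_mem (h : IsBase X y p n) (hc : IsCoding p α β) {x₀ : ℤ → A} {q : ℕ}
    (hx₀ : x₀ ∈ X.carrier) (h0 : Reads y n x₀ 0) (hq : Reads y n x₀ q)
    (hno : ∀ t : ℤ, 0 ≤ t → t + p ≤ q → ¬ Reads y (n + p) x₀ t) (N : ℕ) :
    markWord p α ++ wpow ((factor x₀ 0 q).map β) N ++ markWord p α ∈
      language (h.add_period.codeShift α β) := by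
  have hl : (markWord p α).length = p := by simp [markWord]
  have hy0 : Reads y n y 0 := by simpa using h.reads_self n 0
  obtain ⟨x, hx, h1, h2, h3, h4⟩ := h.exists_power hx₀ h0 hq hno N
  obtain ⟨h5, h6⟩ := h.glue_shift_mem hx h.mem h2 hy0
  set c := glue (N * q) x (shift (0 - N * q) y) with hc'
  have hNq : 0 ≤ (N : ℤ) * q := by positivity
  refine h.add_period.mem_language_code h5 (i := -p) ?_
  rw [occursAt_append, occursAt_append, h.add_period.occursAt_markWord_iff hc,
    h.add_period.occursAt_markWord_iff hc, hl, neg_add_cancel]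
  refine ⟨⟨(h2.glue_left h6 (by push_cast; omega)).2 h1, ?_⟩, ?_⟩
  · rw [← map_wpow]
    intro k hk
    have hk' : k < N * q := by simpa using hk
    have hkq : (k : ℤ) < N * q := by exact_mod_cast hk'
    rw [zero_add, code_plain, List.getElem_map]
    · have := h3 k (by simpa using hk')
      rw [zero_add] at this
      rw [hc', glue_left hkq, this]
    · intro l hl' h7
      rcases le_or_gt ((k - l : ℤ) + p) (N * q) with h10 | h10
      · exact h4 _ (by omega) h10 ((h2.glue_left h6 (by push_cast; omega)).1 h7)
      · have := h.reads_sep (h.reads_add_iff.1 h7).1 ((reads_glue_right le_rfl).2 h6) (by omega)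
        omega
  · rw [List.length_append, length_wpow, List.length_map, length_factor, hl]
    push_cast
    rw [neg_add_cancel_left, hc', reads_glue_right le_rfl, reads_shift]
    simpa using h.reads_self (n + p) 0

/-- For the divisibility condition, an occurrence of `z w z` in the code gives a return of length `p
+ |w|`, and the gcd divides `p`. -/
theorem isMarkerPair_code (h : IsBase X y p n) (hc : IsCoding p α β) {x₀ : ℤ → A} {q : ℕ}
    (hx₀ : x₀ ∈ X.carrier) (h0 : Reads y n x₀ 0) (hq : Reads y n x₀ q)
    (hno : ∀ t : ℤ, 0 ≤ t → t + p ≤ q → ¬ Reads y (n + p) x₀ t) (hq2 : 2 ≤ q)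
    (hmod : q ≡ p.gcd q [MOD p]) (hdvd : ∀ m, IsReturn X y n m → p.gcd q ∣ m) :
    IsMarkerPair (h.add_period.codeShift α β) (markWord p α) ((factor x₀ 0 q).map β) := by
  have hl : (markWord p α).length = p := by simp [markWord]
  have hp := h.pos
  have hpow := h.markWord_pow_mem hc hx₀ h0 hq hno
  refine ⟨fun e => ?_, ⟨_, ⟨y, h.mem, rfl⟩, fun i => ?_⟩, h.add_period.isDeterministicWord_markWord hc,
    h.add_period.isSynchronizingWord_markWord hc, ?_, ?_, by simpa using hq2, ?_, hpow, ?_, ?_⟩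
  · rw [e] at hl
    simp at hl
    omega
  · rw [hl, h.add_period.occursAt_markWord_iff hc]
    exact h.reads_self _ _
  · refine List.Nodup.map_on (fun a ha b hb e => ?_) List.nodup_range
    exact hc.mark_inj a (List.mem_range.1 ha) b (List.mem_range.1 hb) e
  · have := hpow 1
    rw [wpow_one] at this
    exact language_factor this
  · intro a ha ha'
    obtain ⟨k, hk, rfl⟩ := List.mem_map.1 ha
    obtain ⟨b, -, e⟩ := List.mem_map.1 ha'
    exact hc.mark_ne_plain k (List.mem_range.1 hk) b e.symm
  · rw [hl, List.length_map, length_factor]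
    exact hmod
  · intro w _ hw
    rw [hl, List.length_map, length_factor]
    obtain ⟨x, hx, h1⟩ := h.add_period.exists_of_mem_language hw 0
    rw [occursAt_append, occursAt_append, h.add_period.occursAt_markWord_iff hc,
      h.add_period.occursAt_markWord_iff hc, h.reads_add_iff, h.reads_add_iff] at h1
    have := hdvd (p + w.length) ⟨x, hx, h1.1.1.1, by simpa [hl] using h1.2.1⟩
    exact (Nat.dvd_add_right (Nat.gcd_dvd_left p q)).1 this

end IsBase

/-- An infinite synchronizing subshift is conjugate to a subshift with a marker pair, by a map which
is local in both directions. -/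
theorem exists_markerPair (hX : IsSynchronizing X) (hinf : X.carrier.Infinite) :
    ∃ (m : ℕ) (Y : Subshift (Fin m) ℤ) (z o : List (Fin m)) (F : X.carrier ≃ Y.carrier),
      IsMorphism X Y F ∧ IsMorphism Y X F.symm ∧ IsMarkerPair Y z o := by
  obtain ⟨y, p, n, h⟩ := exists_isBase hX
  obtain ⟨q, hq2, hmod, hdvd, x, hx, h0, hq, hno⟩ := h.exists_minimal_return hX.1 hinf
  have hp := h.pos
  let e := Finite.equivFin A
  -- The reduction modulo `p` only makes `α` total.
  let α : ℕ → Fin (p + Nat.card A) := fun k => Fin.castAdd _ ⟨k % p, Nat.mod_lt _ hp⟩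
  let β : A → Fin (p + Nat.card A) := fun a => Fin.natAdd _ (e a)
  have hc : IsCoding p α β := by
    refine ⟨fun k hk l hl h1 => ?_, fun a b h1 => ?_, fun k hk a h1 => ?_⟩
    · simpa [α, Fin.ext_iff, Nat.mod_eq_of_lt hk, Nat.mod_eq_of_lt hl] using h1
    · simpa [β] using h1
    · have h2 := Nat.mod_lt k hp
      simp only [α, β, Fin.ext_iff, Fin.val_castAdd, Fin.val_natAdd] at h1
      omega
  exact ⟨_, _, _, _, h.add_period.codeEquiv hc, h.add_period.isMorphism_codeEquiv hc,
    h.add_period.isMorphism_codeEquiv_symm hc, h.isMarkerPair_code hc hx h0 hq hno hq2 hmod hdvd⟩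

end CodeMarker

/-! ### Transport by morphisms; finite subshifts -/

section Conjugacy

variable {A B : Type*} [TopologicalSpace A] [TopologicalSpace B] {X : Subshift A ℤ}
  {Y : Subshift B ℤ}

theorem IsMorphism.comp {C : Type*} [TopologicalSpace C] [Nonempty C] {Z : Subshift C ℤ}
    {G : Y.carrier → Z.carrier} {F : X.carrier → Y.carrier} (hG : IsMorphism Y Z G)
    (hF : IsMorphism X Y F) : IsMorphism X Z (G ∘ F) := by
  obtain ⟨r, hr⟩ := hG.locality
  obtain ⟨s, hs⟩ := hF.locality
  refine isMorphism_of_locality (r + s) fun x y i j h => hr _ _ _ _ fun k hk => hs _ _ _ _ ?_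
  intro l hl
  have := h (k + l) (by push_cast; exact (abs_add_le k l).trans (add_le_add hk hl))
  simpa [add_assoc] using this

theorem IsMorphism.apply_shiftPerm {F : X.carrier → Y.carrier} (hF : IsMorphism X Y F) (j : ℤ)
    (x : X.carrier) : F (shiftPerm X j x) = shiftPerm Y j (F x) := by
  obtain ⟨r, hr⟩ := hF.locality
  ext k
  exact hr _ _ k (j + k) fun l _ => by simp [coe_shiftPerm, add_assoc]

/-- Words of `Y` are lifted to windows of `X` longer by the radius on either side; these are
connected in `X` and mapped back. -/
theorem IsTransitive.map (ht : IsTransitive X) {F : X.carrier → Y.carrier}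
    (hF : IsMorphism X Y F) (hs : Function.Surjective F) : IsTransitive Y := by
  obtain ⟨r, hr⟩ := hF.locality
  rintro u ⟨_, h1, i, hu⟩ v ⟨_, h2, j, hv⟩
  obtain ⟨x, hx⟩ := hs ⟨_, h1⟩
  obtain ⟨x', hx'⟩ := hs ⟨_, h2⟩
  obtain rfl := congrArg Subtype.val hx
  obtain rfl := congrArg Subtype.val hx'
  obtain ⟨w, -, y, hy, k, h3⟩ := ht _ ⟨x.1, x.2, i - r, occursAt_factor _ _ (r + u.length + r)⟩ _
    ⟨x'.1, x'.2, j - r, occursAt_factor _ _ (r + v.length + r)⟩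
  rw [occursAt_append, occursAt_append] at h3
  simp only [List.length_append, length_factor] at h3
  obtain ⟨⟨h4, -⟩, h5⟩ := h3
  have key : ∀ (x : X.carrier) (i l : ℤ) (w : List B), OccursAt (F x).1 w i →
      OccursAt y (factor x.1 (i - r) (r + w.length + r)) l →
      OccursAt (F ⟨y, hy⟩).1 w (l + r) := by
    intro x i l w h6 h7 m hm
    rw [← h6 m hm]
    refine hr _ _ _ _ fun s hs => ?_
    rw [abs_le] at hs
    have := occursAt_factor_iff.1 h7 (r + m + s).toNat (by omega)
    rw [Int.toNat_of_nonneg (by omega)] at this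
    convert this using 2 <;> ring
  have h6 := key x i k u hu h4
  have h7 := key x' j _ v hv h5
  refine ⟨factor (F ⟨y, hy⟩).1 (k + r + u.length) (r + w.length + r),
    ⟨_, (F ⟨y, hy⟩).2, _, occursAt_factor _ _ _⟩, _, (F ⟨y, hy⟩).2, k + r, ?_⟩
  rw [occursAt_append, occursAt_append]
  refine ⟨⟨h6, occursAt_factor _ _ _⟩, ?_⟩
  convert h7 using 1
  rw [List.length_append, length_factor]
  push_cast
  ring

/-- A finite transitive subshift is the orbit of a point. -/
theorem exists_shiftPerm_eq (ht : IsTransitive X) (hfin : X.carrier.Finite) (x x' : X.carrier) :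
    ∃ k, x' = shiftPerm X k x := by
  have hfin' : Finite X.carrier := hfin
  -- Finitely many points are told apart by one central window.
  have hdet : ∃ N : ℕ, ∀ x x' : X.carrier, OccursAt x'.1 (factor x.1 (-N) (2 * N + 1)) (-N) →
      x = x' := by
    have hne : ∀ e : X.carrier × X.carrier, e.1 ≠ e.2 → ∃ i : ℤ, e.1.1 i ≠ e.2.1 i := by
      intro e he
      by_contra! h
      exact he (Subtype.ext (funext h))
    choose! i hi using hne
    obtain ⟨N, hN⟩ := (Set.finite_range fun e => (i e).natAbs).bddAbove
    refine ⟨N, fun x x' h => ?_⟩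
    by_contra hxx
    have h1 : (i (x, x')).natAbs ≤ N := hN ⟨(x, x'), rfl⟩
    have h2 := occursAt_factor_iff.1 h (i (x, x') + N).toNat (by omega)
    rw [Int.toNat_of_nonneg (by omega), neg_add_cancel_comm_assoc] at h2
    exact hi (x, x') hxx h2.symm
  obtain ⟨N, hN⟩ := hdet
  obtain ⟨w, -, y, hy, j, h1⟩ := ht _ ⟨x.1, x.2, -N, occursAt_factor _ _ (2 * N + 1)⟩ _
    ⟨x'.1, x'.2, -N, occursAt_factor _ _ (2 * N + 1)⟩
  rw [occursAt_append, occursAt_append] at h1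
  obtain ⟨⟨h2, -⟩, h3⟩ := h1
  generalize j + ((factor x.1 (-N) (2 * N + 1) ++ w).length : ℤ) = l at h3
  have key : ∀ (x : X.carrier) (j : ℤ), OccursAt y (factor x.1 (-N) (2 * N + 1)) j →
      x = shiftPerm X (j + N) ⟨y, hy⟩ := fun x j h =>
    hN _ _ (by rw [coe_shiftPerm, occursAt_shift]; simpa using h)
  have e1 := key x _ h2
  have e2 := key x' _ h3
  refine ⟨l - j, ?_⟩
  rw [e2, e1, shiftPerm_shiftPerm]
  congr 2
  ring

end Conjugacy

/-! ### The center of the automorphism group -/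

section Center

variable {A : Type*} [TopologicalSpace A] [DiscreteTopology A] [Finite A] {X : Subshift A ℤ}

theorem zpowers_sigma_le_center : Subgroup.zpowers (sigma X) ≤ Subgroup.center (Aut X) := by
  rintro _ ⟨k, rfl⟩
  rw [Subgroup.mem_center_iff]
  exact fun g => (sigma_zpow_mul_comm g k).symm

/-- The center lies in the centralizer of the glider and collision automorphisms. -/
theorem IsMarkerPair.center_le {z o : List A} (h : IsMarkerPair X z o) (ht : IsTransitive X) :
    Subgroup.center (Aut X) ≤ Subgroup.zpowers (sigma X) := by
  have hex : ∀ n, gliderBound z o < n → ∃ (G : Aut X) (c : GliderChoice X z o n),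
      IsGliderCA c G := fun n hn => by
    obtain ⟨c⟩ := h.exists_gliderChoice hn
    obtain ⟨G, hG, -⟩ := c.existsUnique_gliderCA h
    exact ⟨G, c, hG⟩
  choose! G hG using hex
  obtain ⟨F, hF, -⟩ := h.existsUnique_collisionCA
  rw [← h.centralizer_eq ht hG hF]
  exact Subgroup.center_le_centralizer _

/-- Conjugation by `F` identifies the automorphism groups and takes one shift to the other, so
centers correspond. -/
theorem center_le_of_conjugate {B : Type*} [TopologicalSpace B] [DiscreteTopology B] [Finite B]
    [Nonempty A] [Nonempty B] {Y : Subshift B ℤ} (F : X.carrier ≃ Y.carrier) (hF : IsMorphism X Y F)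
    (hF' : IsMorphism Y X F.symm)
    (hY : Subgroup.center (Aut Y) ≤ Subgroup.zpowers (sigma Y)) :
    Subgroup.center (Aut X) ≤ Subgroup.zpowers (sigma X) := by
  intro f hf
  rw [Subgroup.mem_center_iff] at hf
  let f' : Aut Y := ⟨(F.symm.trans f.1).trans F, (hF.comp f.2).comp hF'⟩
  have hf' : f' ∈ Subgroup.center (Aut Y) := by
    rw [Subgroup.mem_center_iff]
    intro g
    let g' : Aut X := ⟨(F.trans g.1).trans F.symm, (hF'.comp g.2).comp hF⟩
    ext y : 2
    change g.1 (F (f.1 (F.symm y))) = F (f.1 (F.symm (g.1 y)))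
    have h1 : F.symm (g.1 (F (f.1 (F.symm y)))) = f.1 (F.symm (g.1 (F (F.symm y)))) :=
      congrArg (fun g : Aut X => g.1 (F.symm y)) (hf g')
    rw [F.apply_symm_apply, F.symm_apply_eq] at h1
    exact h1
  obtain ⟨k, hk⟩ := hY hf'
  refine ⟨k, ?_⟩
  ext x : 2
  have h1 : (sigma Y ^ k).1 (F x) = F (f.1 (F.symm (F x))) :=
    congrArg (fun g : Aut Y => g.1 (F x)) hk
  rw [sigma_zpow_apply, F.symm_apply_apply, ← hF.apply_shiftPerm, F.apply_eq_iff_eq,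
    ← sigma_zpow_apply] at h1
  exact h1

/-- In the finite case `X` is one orbit, so an automorphism is known from its value at one point; in
the infinite case the statement comes from a conjugate subshift with a marker pair. -/
theorem center_eq_zpowers (hX : IsSynchronizing X) :
    Subgroup.center (Aut X) = Subgroup.zpowers (sigma X) := by
  refine le_antisymm ?_ zpowers_sigma_le_center
  rcases X.carrier.finite_or_infinite with hfin | hinf
  · intro f _
    rcases isEmpty_or_nonempty X.carrier with he | ⟨⟨x⟩⟩
    · convert Subgroup.one_mem _
      ext x : 2
      exact he.elim x
    · obtain ⟨k, hk⟩ := exists_shiftPerm_eq hX.1 hfin x (f.1 x)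
      refine ⟨k, ?_⟩
      ext x' : 2
      obtain ⟨j, rfl⟩ := exists_shiftPerm_eq hX.1 hfin x x'
      change (sigma X ^ k).1 _ = f.1 _
      rw [sigma_zpow_apply, SynchShift.apply_shiftPerm, hk, shiftPerm_shiftPerm,
        shiftPerm_shiftPerm, add_comm]
  · obtain ⟨m, Y, z, o, F, hF, hF', h⟩ := exists_markerPair hX hinf
    obtain ⟨x, hx⟩ := hinf.nonempty
    have : Nonempty A := ⟨x 0⟩
    have : Nonempty (Fin m) := ⟨(F ⟨x, hx⟩).1 0⟩
    exact center_le_of_conjugate F hF hF' (h.center_le (hX.1.map hF F.surjective))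

/-- The whole group is an admissible set, since its centralizer is the center. -/
theorem kInv_ne_bot (hX : IsSynchronizing X) : kInv X ≠ ⊥ := by
  have : ∃ S : Set (Aut X), Subgroup.centralizer S = Subgroup.zpowers (sigma X) :=
    ⟨Set.univ, by rw [Subgroup.centralizer_univ, center_eq_zpowers hX]⟩
  rw [kInv, if_pos this]
  exact WithBot.coe_ne_bot

end Center

end SynchShift

theorem mainTheorem6 {A : Type*} [TopologicalSpace A] [DiscreteTopology A] [Finite A]
    (X : SymbolicDynamics.FullShift.Subshift A ℤ) (hX : SynchShift.IsSynchronizing X) :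
    -- the invariant
    SynchShift.kInv X ≠ ⊥ ∧
    -- the explicit sets of automorphisms
    (X.carrier.Infinite →
      -- up to conjugacy there is a marker pair
      (∃ (m : ℕ) (Y : SymbolicDynamics.FullShift.Subshift (Fin m) ℤ) (z o : List (Fin m)),
        SynchShift.Conjugate X Y ∧ SynchShift.IsMarkerPair Y z o) ∧
      -- for each marker pair the glider automorphisms and `F` exist, and the centralizer is `⟨σ⟩`
      ∀ z o : List A, SynchShift.IsMarkerPair X z o →
        (∃! F : SynchShift.Aut X, SynchShift.IsCollisionCA z o F) ∧
        (∀ n, SynchShift.gliderBound z o < n →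
          Nonempty (SynchShift.GliderChoice X z o n) ∧
          ∀ c : SynchShift.GliderChoice X z o n,
            ∃! G : SynchShift.Aut X, SynchShift.IsGliderCA c G) ∧
        ∀ (G : ℕ → SynchShift.Aut X) (F : SynchShift.Aut X),
          (∀ n, SynchShift.gliderBound z o < n →
            ∃ c : SynchShift.GliderChoice X z o n, SynchShift.IsGliderCA c (G n)) →
          SynchShift.IsCollisionCA z o F →
          Subgroup.centralizer
            ((Subgroup.closure (G '' {n | SynchShift.gliderBound z o < n} ∪ {F}) :
              Subgroup (SynchShift.Aut X)) : Set (SynchShift.Aut X)) =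
            Subgroup.zpowers (SynchShift.sigma X)) := by
  refine ⟨SynchShift.kInv_ne_bot hX, fun hinf => ⟨?_, fun z o h =>
    ⟨?_, fun n hn => ⟨?_, fun c => ?_⟩, ?_⟩⟩⟩
  · obtain ⟨m, Y, z, o, F, hF, -, h⟩ := SynchShift.exists_markerPair hX hinf
    exact ⟨m, Y, z, o, ⟨F, hF, F.bijective⟩, h⟩
  · exact h.existsUnique_collisionCA
  · exact h.exists_gliderChoice hn
  · exact c.existsUnique_gliderCA h
  · exact fun G F hG hF => h.centralizer_eq hX.1 hG hF
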